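/- **Setting.** Let $d\in\mathbb N$, $d\ge1$, and write points of $\mathbb R^{2d}$ as $z=(x,v)$. Put $a=(3,1)$, $|z|_a=|x|^{1/3}+|v|$ and $r^{a}z=(r^3x,rv)$ for $r>0$. Distributions are (complex-valued) tempered distributions on $\mathbb R^{2d}$. *Weights.* $\mathscr P_{\rm w}=\{\varrho^\kappa:\kappa\in\mathbb R\}$ with $\varrho(x,v)=((1+|x|^2)^{1/3}+1+|v|^2)^{-1/2}$, and $\|F\|_{L^\infty(\rho)}=\|\rho F\|_{L^\infty}$. *Blocks.* Fix a nonnegative $C^\infty$ function $\phi_{-1}$ with $\phi_{-1}(-\xi)=\phi_{-1}(\xi)$, $\phi_{-1}(\xi)=1$ for $|\xi|_a\le\frac12$ and $\phi_{-1}(\xi)=0$ for $|\xi|_a>\frac23$. Put $\phi_j(\xi)=\phi_{-1}(2^{-a(j+1)}\xi)-\phi_{-1}(2^{-aj}\xi)$ for $j\ge0$, let $\mathcal R_jF$ be the inverse Fourier transform of $\phi_j\hat F$ (the Fourier transform having the kernel $e^{-i\xi\cdot z}$), and let $S_kF=\sum_{j=-1}^{k-1}\mathcal R_jF$. *Spaces.*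 $\|F\|_{\mathbf C^s_a(\rho)}=\sup_{j\ge-1}2^{sj}\|\mathcal R_jF\|_{L^\infty(\rho)}$ for $s\in\mathbb R$. For $T>0$, $\mathbb C^s_{T,a}(\rho)$ is the space of weakly measurable $t\mapsto F(t)\in\mathscr S'(\mathbb R^{2d})$ on $[0,T]$ with $\|F\|_{\mathbb C^s_{T,a}(\rho)}=\sup_{0\le t\le T}\|F(t)\|_{\mathbf C^s_a(\rho)}<\infty$. With $\Gamma_tF(x,v)=F(x+tv,v)$, $t\in\mathbb R$, the kinetic Hölder norm is $$\|F\|_{\mathbb S^\alpha_{T,a}(\rho)}=\|F\|_{\mathbb C^\alpha_{T,a}(\rho)}+\sup_{0\le t\le T}\|F(t)\|_{L^\infty(\rho)}+\sup_{s\ne t\in[0,T]}\frac{\|F(t)-\Gamma_{t-s}F(s)\|_{L^\infty(\rho)}}{|t-s|^{\alpha/2}},$$ and $\mathbb S^\alpha_{T,a}(\rho)$ is the space of those $F$ for which it is finite. *Operators.* For $t>0$ let $P_tF=\Gamma_t(p_t*F)$, where $$p_t(x,v)=\Big(\frac{4\pi^2t^4}{3}\Big)^{-d/2}\exp\Big(-\frac{3|x|^2+|3x-2tv|^2}{4t^3}\Big)$$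 is the density of $(\sqrt2\int_0^tB_s\,ds,\sqrt2B_t)$ for a standard Brownian motion $B$ in $\mathbb R^d$. For $\lambda\ge0$ let $\mathscr I_\lambda F(t)=\int_0^te^{-\lambda(t-s)}P_{t-s}F(s)\,ds$, a weak integral in $\mathscr S'(\mathbb R^{2d})$. Let $F\prec G=\sum_{k\ge-1}S_{k-1}F\,\mathcal R_kG$ with convergence in $\mathscr S'(\mathbb R^{2d})$; for functions of time, $(f\prec g)(t)=f(t)\prec g(t)$. For $k\in\{0,1\}$ let $$[\nabla_v^k\mathscr I_\lambda,f\prec]g=\nabla_v^k\mathscr I_\lambda(f\prec g)-f\prec\nabla_v^k\mathscr I_\lambda g ,$$ where for $k=1$ the paraproduct acts on each component of the gradient, and norms of vectors of distributions are the maxima of the norms of the components. **Lemma.** Let $\rho_1,\rho_2\in\mathscr P_{\rm w}$, $\alpha\in(0,1)$, $\beta\in\mathbb R$, $k\in\{0,1\}$, $T>0$ and $\theta\in[0,2]$. There is a constant $C>0$ such that for all $\lambda\ge0$, all $f\in\mathbb S^\alpha_{T,a}(\rho_1)$ and all $g\in\mathbb C^\beta_{T,a}(\rho_2)$, the series and the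 integrals that define $[\nabla_v^k\mathscr I_\lambda,f\prec]g(t)$ converge for every $t\in[0,T]$, the commutator belongs to $\mathbb C^{\alpha+\beta+\theta-k}_{T,a}(\rho_1\rho_2)$, and $$\big\|[\nabla_v^k\mathscr I_\lambda,f\prec]g\big\|_{\mathbb C^{\alpha+\beta+\theta-k}_{T,a}(\rho_1\rho_2)}\le C\,(\lambda\vee1)^{\frac{\theta-2}{2}}\,\|f\|_{\mathbb S^\alpha_{T,a}(\rho_1)}\,\|g\|_{\mathbb C^\beta_{T,a}(\rho_2)}.$$ -/

import Mathlib

open MeasureTheory SchwartzMap Set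
open scoped ENNReal FourierTransform LineDeriv ContDiff

noncomputable section

namespace Kinetic

/-! ### Phase space, anisotropic scaling, transport and weights -/

/-- The phase space `ℝ^{2d} = ℝ^d × ℝ^d` of points `z = (x, v)`, with its Euclidean structure and
Lebesgue measure. -/
abbrev Phase (d : ℕ) : Type :=
  WithLp 2 (EuclideanSpace ℝ (Fin d) × EuclideanSpace ℝ (Fin d))

variable {d : ℕ}

/-- The anisotropic distance to the origin `|z|_a = |x|^{1/3} + |v|`, for `a = (3, 1)`. -/
def anisoNorm (z : Phase d) : ℝ := ‖z.fst‖ ^ (1 / 3 : ℝ) + ‖z.snd‖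

/-- The anisotropic dilation `r^a z = (r^3 x, r v)`. -/
def dilate (r : ℝ) (z : Phase d) : Phase d := WithLp.toLp 2 (r ^ 3 • z.fst, r • z.snd)

/-- The linear map `(x, v) ↦ (x + t v, v)`. -/
def transportL (t : ℝ) : Phase d →L[ℝ] Phase d :=
  (WithLp.prodContinuousLinearEquiv 2 ℝ _ _).symm.toContinuousLinearMap ∘L
    ContinuousLinearMap.prod (WithLp.fstL 2 ℝ _ _ + t • WithLp.sndL 2 ℝ _ _)
      (WithLp.sndL 2 ℝ _ _)

theorem transportL_apply (t : ℝ) (z : Phase d) :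
    transportL t z = WithLp.toLp 2 (z.fst + t • z.snd, z.snd) := rfl

theorem transportL_neg_transportL (t : ℝ) (z : Phase d) : transportL (-t) (transportL t z) = z := by
  rw [transportL_apply, transportL_apply]
  simp only [WithLp.toLp_fst, WithLp.toLp_snd, neg_smul, add_neg_cancel_right]
  rfl

/-- The transport `Γ_t z = (x + t v, v)`, a linear bijection of phase space, for `t ∈ ℝ`. -/
def transport (t : ℝ) : Phase d ≃L[ℝ] Phase d :=
  ContinuousLinearEquiv.equivOfInverse (transportL t) (transportL (-t))
    (transportL_neg_transportL t)
    (fun z => by simpa using transportL_neg_transportL (-t) z)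

theorem transport_apply (t : ℝ) (z : Phase d) :
    transport t z = WithLp.toLp 2 (z.fst + t • z.snd, z.snd) := rfl

/-- `ϱ(x, v) = ((1 + |x|²)^{1/3} + 1 + |v|²)^{-1/2}`. -/
def baseWeight (z : Phase d) : ℝ :=
  ((1 + ‖z.fst‖ ^ 2) ^ (1 / 3 : ℝ) + 1 + ‖z.snd‖ ^ 2) ^ (-(1 / 2) : ℝ)

variable (d) in
/-- The polynomial weights `ϱ^κ`, `κ ∈ ℝ`. -/
def polyWeights : Set (Phase d → ℝ) := {ρ | ∃ κ : ℝ, ρ = fun z => baseWeight z ^ κ}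

/-! ### Dyadic blocks -/

/-- The function `φ_{-1}` generating the dyadic partition of unity. -/
structure IsCutoff (φ : Phase d → ℝ) : Prop where
  smooth : ContDiff ℝ ∞ φ
  nonneg : ∀ ξ, 0 ≤ φ ξ
  symm : ∀ ξ, φ (-ξ) = φ ξ
  eq_one : ∀ ξ, anisoNorm ξ ≤ 1 / 2 → φ ξ = 1
  eq_zero : ∀ ξ, 2 / 3 < anisoNorm ξ → φ ξ = 0

/-- The functions `φ_j`, `j ≥ -1`, with `φ_j = 0` for `j ≤ -2`. -/
def dyadic (φ : Phase d → ℝ) (j : ℤ) (ξ : Phase d) : ℝ :=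
  if 0 ≤ j then φ (dilate (2 ^ (-(j + 1))) ξ) - φ (dilate (2 ^ (-j)) ξ)
  else if j = -1 then φ ξ else 0

theorem IsCutoff.hasCompactSupport {φ : Phase d → ℝ} (hφ : IsCutoff φ) : HasCompactSupport φ := by
  refine HasCompactSupport.intro (isCompact_closedBall (0 : Phase d) 2) fun ξ hξ => ?_
  refine hφ.eq_zero ξ ?_
  by_contra! h
  unfold anisoNorm at h
  have h1 : ‖ξ.fst‖ ^ (1 / 3 : ℝ) ≤ 1 := by linarith [norm_nonneg ξ.snd]
  have h2 : ‖ξ.snd‖ ≤ 1 := by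
    linarith [Real.rpow_nonneg (norm_nonneg ξ.fst) (1 / 3 : ℝ)]
  have h3 : ‖ξ.fst‖ ≤ 1 := by
    by_contra! h4
    exact absurd (Real.one_lt_rpow h4 (by norm_num : (0 : ℝ) < 1 / 3)) (not_lt.2 h1)
  have h5 : ‖ξ‖ ^ 2 ≤ 2 := by
    rw [WithLp.prod_norm_sq_eq_of_L2]
    nlinarith [norm_nonneg ξ.fst, norm_nonneg ξ.snd]
  have h6 : ‖ξ‖ ≤ 2 := by nlinarith [norm_nonneg ξ]
  exact hξ (by simpa using h6)

/-- The multipliers of the dyadic blocks have temperate growth. -/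
theorem IsCutoff.dyadic_temperate {φ : Phase d → ℝ} (hφ : IsCutoff φ) (j : ℤ) :
    Function.HasTemperateGrowth
      (fun ξ : Phase d => ((dyadic φ j ((2 * Real.pi) • ξ) : ℝ) : ℂ)) := by
  have h0 : φ.HasTemperateGrowth := hφ.hasCompactSupport.hasTemperateGrowth hφ.smooth
  have hd (r : ℝ) : Function.HasTemperateGrowth (fun ξ : Phase d => φ (dilate r ξ)) := by
    let L : Phase d →L[ℝ] Phase d :=
      (WithLp.prodContinuousLinearEquiv 2 ℝ _ _).symm.toContinuousLinearMap ∘L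
        ContinuousLinearMap.prod (r ^ 3 • WithLp.fstL 2 ℝ _ _) (r • WithLp.sndL 2 ℝ _ _)
    exact h0.comp (ContinuousLinearMap.hasTemperateGrowth L)
  have hj : Function.HasTemperateGrowth (dyadic φ j) := by
    unfold dyadic
    split_ifs
    · exact (hd _).sub (hd _)
    · exact h0
    · exact Function.HasTemperateGrowth.zero
  exact Function.HasTemperateGrowth.comp Complex.ofRealCLM.hasTemperateGrowth
    (hj.comp (ContinuousLinearMap.hasTemperateGrowth
      ((2 * Real.pi) • ContinuousLinearMap.id ℝ (Phase d))))

/-- The block `R_j F`, the inverse Fourier transform of `φ_j F̂`. The Fourier transform of Mathlib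
has the kernel `exp(-2πi ⟨x, ξ⟩)`, so that the frequency variable of the transform with kernel
`exp(-i ⟨x, ξ⟩)` is `2π ξ`. -/
def block (φ : Phase d → ℝ) (j : ℤ) : 𝓢'(Phase d, ℂ) →L[ℂ] 𝓢'(Phase d, ℂ) :=
  TemperedDistribution.fourierMultiplierCLM ℂ
    (fun ξ => ((dyadic φ j ((2 * Real.pi) • ξ) : ℝ) : ℂ))

/-- The low frequency cut-off `S_k F = ∑_{-1 ≤ j ≤ k - 1} R_j F`. -/
def lowFreq (φ : Phase d → ℝ) (k : ℤ) (F : 𝓢'(Phase d, ℂ)) : 𝓢'(Phase d, ℂ) :=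
  ∑ j ∈ Finset.Ico (-1) k, block φ j F

/-! ### Weighted norms -/

/-- The tempered distribution `F` is the function `u`. Such a `u` is unique up to null sets. -/
def IsRep (F : 𝓢'(Phase d, ℂ)) (u : Phase d → ℂ) : Prop :=
  AEStronglyMeasurable u volume ∧
    ∀ ψ : 𝓢(Phase d, ℂ), Integrable (fun z => ψ z * u z) volume ∧ F ψ = ∫ z, ψ z * u z

/-- The norm `‖F‖_{L^∞(ρ)} = ‖ρ F‖_∞`, which is `∞` if `F` is not a function. -/
def supNorm (ρ : Phase d → ℝ) (F : 𝓢'(Phase d, ℂ)) : ℝ≥0∞ :=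
  ⨅ (u : Phase d → ℂ) (_ : IsRep F u), eLpNorm (fun z => (ρ z : ℂ) * u z) ⊤ volume

/-- The norm of the weighted anisotropic Besov space `C^s_a(ρ) = B^{s,a}_{∞,∞}(ρ)`. -/
def besovNorm (φ : Phase d → ℝ) (s : ℝ) (ρ : Phase d → ℝ) (F : 𝓢'(Phase d, ℂ)) : ℝ≥0∞ :=
  ⨆ (j : ℤ) (_ : -1 ≤ j), (2 : ℝ≥0∞) ^ (s * (j : ℝ)) * supNorm ρ (block φ j F)

/-- The norm of `ℂ^s_{T,a}(ρ)`, the supremum over `t ∈ [0, T]` of the norms of `F(t)` in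
`C^s_a(ρ)`. -/
def besovNormT (φ : Phase d → ℝ) (T s : ℝ) (ρ : Phase d → ℝ) (F : ℝ → 𝓢'(Phase d, ℂ)) : ℝ≥0∞ :=
  ⨆ t ∈ Icc (0 : ℝ) T, besovNorm φ s ρ (F t)

/-- The space `ℂ^s_{T,a}(ρ)`: weakly measurable functions of time with values in tempered
distributions and with finite norm. -/
structure MemBesovT (φ : Phase d → ℝ) (T s : ℝ) (ρ : Phase d → ℝ)
    (F : ℝ → 𝓢'(Phase d, ℂ)) : Prop where
  meas : ∀ ψ : 𝓢(Phase d, ℂ), AEMeasurable (fun t => F t ψ) (volume.restrict (Icc 0 T))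
  finite : besovNormT φ T s ρ F < ⊤

/-- `Γ_t F`, the composition of `F` with `Γ_t`; by duality it acts on test functions by the
composition with `Γ_{-t}`, since `Γ_t` preserves Lebesgue measure. -/
def transportD (t : ℝ) : 𝓢'(Phase d, ℂ) →L[ℂ] 𝓢'(Phase d, ℂ) :=
  PointwiseConvergenceCLM.precomp ℂ (compCLMOfContinuousLinearEquiv ℂ (transport (-t)))

theorem transportD_apply (t : ℝ) (F : 𝓢'(Phase d, ℂ)) (ψ : 𝓢(Phase d, ℂ)) :
    transportD t F ψ = F (compCLMOfContinuousLinearEquiv ℂ (transport (-t)) ψ) := rfl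

/-- The norm of `C^γ_{T;Γ} L^∞(ρ)`, for `γ ∈ (0, 1)`. -/
def transportHolderNorm (T γ : ℝ) (ρ : Phase d → ℝ) (F : ℝ → 𝓢'(Phase d, ℂ)) : ℝ≥0∞ :=
  (⨆ t ∈ Icc (0 : ℝ) T, supNorm ρ (F t)) +
    ⨆ (s ∈ Icc (0 : ℝ) T) (t ∈ Icc (0 : ℝ) T) (_ : s ≠ t),
      supNorm ρ (F t - transportD (t - s) (F s)) / ENNReal.ofReal (|t - s| ^ γ)

/-- The norm of the kinetic Hölder space `𝕊^α_{T,a}(ρ)`. -/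
def kineticNorm (φ : Phase d → ℝ) (T α : ℝ) (ρ : Phase d → ℝ)
    (F : ℝ → 𝓢'(Phase d, ℂ)) : ℝ≥0∞ :=
  besovNormT φ T α ρ F + transportHolderNorm T (α / 2) ρ F

/-! ### The kinetic semigroup -/

/-- The exponent `(3|x|² + |3x - 2tv|²) / (4t³)` of the kinetic heat kernel. -/
def heatExponent (t : ℝ) (z : Phase d) : ℝ :=
  (3 * ‖z.fst‖ ^ 2 + ‖(3 : ℝ) • z.fst - (2 * t) • z.snd‖ ^ 2) / (4 * t ^ 3)

/-- The kinetic heat kernel `p_t(x, v)`, the density of the centred Gaussian vector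
`(√2 ∫_0^t B_s ds, √2 B_t)`, whose covariance in each coordinate has the entries `2t³/3`, `t²`,
`2t` and the determinant `t⁴/3`. -/
def heatKernel (t : ℝ) (z : Phase d) : ℝ :=
  (4 * Real.pi ^ 2 * t ^ 4 / 3) ^ (-(d : ℝ) / 2) * Real.exp (-heatExponent t z)

theorem heatExponent_temperate (t : ℝ) :
    (heatExponent (d := d) t).HasTemperateGrowth := by
  have h1 : (fun z : Phase d => ‖WithLp.fstL 2 ℝ (EuclideanSpace ℝ (Fin d)) (EuclideanSpace ℝ (Fin d)) z‖ ^ 2).HasTemperateGrowth :=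
    (Function.hasTemperateGrowth_norm_sq _).comp (ContinuousLinearMap.hasTemperateGrowth _)
  have h2 : (fun z : Phase d => ‖((3 : ℝ) • WithLp.fstL 2 ℝ (EuclideanSpace ℝ (Fin d)) (EuclideanSpace ℝ (Fin d)) - (2 * t) • WithLp.sndL 2 ℝ (EuclideanSpace ℝ (Fin d)) (EuclideanSpace ℝ (Fin d))) z‖ ^ 2).HasTemperateGrowth :=
    (Function.hasTemperateGrowth_norm_sq _).comp (ContinuousLinearMap.hasTemperateGrowth _)
  have := (((Function.HasTemperateGrowth.const (3:ℝ)).mul h1).add h2).mul (Function.HasTemperateGrowth.const (4 * t ^ 3)⁻¹)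
  exact this

theorem heatExponent_coercive {t : ℝ} (ht : 0 < t) :
    ∃ m : ℝ, 0 < m ∧ ∀ z : Phase d, m * ‖z‖ ^ 2 ≤ heatExponent t z := by
  refine ⟨(min (1/10) (t^2/10)) / (4 * t ^ 3), by positivity, fun z => ?_⟩
  unfold heatExponent
  rw [WithLp.prod_norm_sq_eq_of_L2, div_mul_eq_mul_div]
  apply div_le_div_of_nonneg_right _ (by positivity)
  have h : ‖(2 * t) • z.snd‖ ≤ ‖(3 : ℝ) • z.fst - (2 * t) • z.snd‖ + 3 * ‖z.fst‖ := by
    have := norm_sub_le ((3 : ℝ) • z.fst) ((3 : ℝ) • z.fst - (2 * t) • z.snd)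
    rw [sub_sub_cancel] at this
    rw [norm_smul (3 : ℝ)] at this
    simp at this ⊢
    linarith
  rw [norm_smul, Real.norm_of_nonneg (by positivity)] at h
  have h3 : (2 * t * ‖z.snd‖) ^ 2 ≤ (‖(3 : ℝ) • z.fst - (2 * t) • z.snd‖ + 3 * ‖z.fst‖) ^ 2 := by
    gcongr
  have a1 : min (1/10) (t^2/10) * ‖z.fst‖ ^ 2 ≤ 1/10 * ‖z.fst‖ ^ 2 := by gcongr; exact min_le_left _ _
  have a2 : min (1/10) (t^2/10) * ‖z.snd‖ ^ 2 ≤ t^2/10 * ‖z.snd‖ ^ 2 := by gcongr; exact min_le_right _ _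
  nlinarith [sq_nonneg (‖(3 : ℝ) • z.fst - (2 * t) • z.snd‖ - 3 * ‖z.fst‖), sq_nonneg ‖z.fst‖, sq_nonneg ‖z.snd‖, sq_nonneg ‖(3 : ℝ) • z.fst - (2 * t) • z.snd‖]

theorem exp_decay {m r : ℝ} (hm : 0 < m) (hr : 0 ≤ r) (N : ℕ) :
    (1 + r) ^ N * Real.exp (-(m * r ^ 2)) ≤ Real.exp m * N.factorial * (2 / m) ^ N := by
  have h1 : (1 + r) ^ N ≤ (2 * (1 + r ^ 2)) ^ N := by
    gcongr
    nlinarith [sq_nonneg (r - 1)]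
  have h2 : (m * (1 + r ^ 2)) ^ N / N.factorial ≤ Real.exp (m * (1 + r ^ 2)) :=
    Real.pow_div_factorial_le_exp _ (by positivity) N
  have h3 : Real.exp (m * (1 + r ^ 2)) * Real.exp (-(m * r ^ 2)) = Real.exp m := by
    rw [← Real.exp_add]; congr 1; ring
  have e : (0:ℝ) < Real.exp (-(m * r ^ 2)) := Real.exp_pos _
  have h4 : (2 * (1 + r ^ 2)) ^ N = (2 / m) ^ N * (m * (1 + r ^ 2)) ^ N := by
    rw [← mul_pow]; congr 1; field_simp
  calc (1 + r) ^ N * Real.exp (-(m * r ^ 2))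
      ≤ ((2 / m) ^ N * (m * (1 + r ^ 2)) ^ N) * Real.exp (-(m * r ^ 2)) := by
        rw [← h4]; gcongr
    _ ≤ ((2 / m) ^ N * (Real.exp (m * (1 + r ^ 2)) * N.factorial)) * Real.exp (-(m * r ^ 2)) := by
        gcongr
        rwa [div_le_iff₀ (by positivity)] at h2
    _ = _ := by rw [← h3]; ring

theorem heatKernel_smooth (t : ℝ) :
    ContDiff ℝ ∞ (fun z : Phase d => ((heatKernel t z : ℝ) : ℂ)) := by
  have h := (heatExponent_temperate (d := d) t).1
  unfold heatKernel
  exact Complex.ofRealCLM.contDiff.comp (contDiff_const.mul h.neg.exp)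

theorem heatKernel_decay {t : ℝ} (ht : 0 < t) (k n : ℕ) :
    ∃ C, ∀ z : Phase d,
      ‖z‖ ^ k * ‖iteratedFDeriv ℝ n (fun z => ((heatKernel t z : ℝ) : ℂ)) z‖ ≤ C := by
  obtain ⟨m, hm, hQ⟩ := heatExponent_coercive (d := d) ht
  have hT := heatExponent_temperate (d := d) t
  obtain ⟨l, K, hK, hbd⟩ := hT.norm_iteratedFDeriv_le_uniform n
  set c : ℝ := (4 * Real.pi ^ 2 * t ^ 4 / 3) ^ (-(d : ℝ) / 2) with hc
  set g : ℝ → ℝ := fun y => Real.exp (-y)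
  have hg : ContDiff ℝ ∞ g := Real.contDiff_exp.comp contDiff_neg
  refine ⟨|c| * (n.factorial * (1 + K) ^ n) * (Real.exp m * (k + l * n).factorial * (2 / m) ^ (k + l * n)), fun z => ?_⟩
  have e1 : (fun z : Phase d => ((heatKernel t z : ℝ) : ℂ)) =
      Complex.ofRealLI ∘ (c • (g ∘ heatExponent t)) := by
    ext z; simp [heatKernel, g, hc]
  have hs : ContDiff ℝ ∞ (g ∘ heatExponent (d := d) t) := hg.comp hT.1
  have hcs : ContDiff ℝ ∞ (c • (g ∘ heatExponent (d := d) t)) := hs.const_smul c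
  rw [e1, Complex.ofRealLI.norm_iteratedFDeriv_comp_left (n := ∞) hcs.contDiffAt (mod_cast le_top),
    iteratedFDeriv_const_smul_apply (hs.of_le (mod_cast le_top)).contDiffAt, norm_smul, Real.norm_eq_abs]
  have hb : ‖iteratedFDeriv ℝ n (g ∘ heatExponent t) z‖ ≤
      n.factorial * Real.exp (-(m * ‖z‖ ^ 2)) * ((1 + K) * (1 + ‖z‖) ^ l) ^ n := by
    refine norm_iteratedFDeriv_comp_le hg hT.1 (mod_cast le_top) z (fun i _ => ?_) (fun i hi hin => ?_)
    · rw [norm_iteratedFDeriv_eq_norm_iteratedDeriv]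
      have : iteratedDeriv i g = fun y => (-1) ^ i * Real.exp (-y) := by
        have := iteratedDeriv_comp_neg i Real.exp
        ext y
        have h0 := this y
        rw [iteratedDeriv_eq_iterate (f := Real.exp), Real.iter_deriv_exp, smul_eq_mul] at h0
        exact h0
      rw [this]
      simp only [norm_mul, norm_pow, norm_neg, norm_one, one_pow, one_mul, Real.norm_eq_abs, Real.abs_exp]
      exact Real.exp_le_exp.2 (neg_le_neg (hQ z))
    · have h1 : (1:ℝ) ≤ (1 + K) * (1 + ‖z‖) ^ l :=
        one_le_mul_of_one_le_of_one_le (by linarith) (one_le_pow₀ (by linarith [norm_nonneg z]))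
      calc _ ≤ K * (1 + ‖z‖) ^ l := hbd i hin z
        _ ≤ (1 + K) * (1 + ‖z‖) ^ l := by gcongr; linarith
        _ ≤ _ := le_self_pow₀ h1 (by omega)
  have hz : ‖z‖ ^ k ≤ (1 + ‖z‖) ^ k := by gcongr; linarith
  calc _ ≤ (1 + ‖z‖) ^ k * (|c| * (n.factorial * Real.exp (-(m * ‖z‖ ^ 2)) * ((1 + K) * (1 + ‖z‖) ^ l) ^ n)) := by
        gcongr
    _ = |c| * (n.factorial * (1 + K) ^ n) * ((1 + ‖z‖) ^ (k + l * n) * Real.exp (-(m * ‖z‖ ^ 2))) := by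
        rw [mul_pow, pow_add, pow_mul]; ring
    _ ≤ _ := mul_le_mul_of_nonneg_left (exp_decay hm (norm_nonneg z) _) (by positivity)

/-- The kinetic heat kernel as a Schwartz function. -/
def heatKernelS (t : ℝ) (ht : 0 < t) : 𝓢(Phase d, ℂ) where
  toFun z := ((heatKernel t z : ℝ) : ℂ)
  smooth' := heatKernel_smooth t
  decay' := heatKernel_decay ht

/-- The convolution `K * F` of a Schwartz function and a tempered distribution, which is the
inverse Fourier transform of `K̂ F̂`. -/
def convolve (K : 𝓢(Phase d, ℂ)) : 𝓢'(Phase d, ℂ) →L[ℂ] 𝓢'(Phase d, ℂ) :=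
  TemperedDistribution.fourierMultiplierCLM ℂ (𝓕 K : 𝓢(Phase d, ℂ))

/-- The kinetic semigroup `P_t F = Γ_t (p_t * F)` for `t > 0`, and `P_0 F = F`. Negative times are
not used. -/
def kineticSemigroup (t : ℝ) : 𝓢'(Phase d, ℂ) →L[ℂ] 𝓢'(Phase d, ℂ) :=
  if ht : 0 < t then transportD t ∘L convolve (heatKernelS t ht)
  else ContinuousLinearMap.id ℂ _

/-! ### Paraproduct, Duhamel operator and commutator -/

/-- The distribution `H` is the pointwise product of the functions `F` and `G`. -/
def IsProduct (F G H : 𝓢'(Phase d, ℂ)) : Prop :=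
  ∃ u v : Phase d → ℂ, IsRep F u ∧ IsRep G v ∧ IsRep H (fun z => u z * v z)

/-- The series `∑_{k ≥ -1} S_{k-1} F R_k G` converges to `H` in the space of tempered
distributions. Its terms with `k ≤ -2` vanish. -/
def HasParaproduct (φ : Phase d → ℝ) (F G H : 𝓢'(Phase d, ℂ)) : Prop :=
  ∃ p : ℤ → 𝓢'(Phase d, ℂ),
    (∀ k, IsProduct (lowFreq φ (k - 1) F) (block φ k G) (p k)) ∧ HasSum p H

open Classical in
/-- The paraproduct `F ≺ G = ∑_{k ≥ -1} S_{k-1} F R_k G` (`0` if the series does not converge). -/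
def paraproduct (φ : Phase d → ℝ) (F G : 𝓢'(Phase d, ℂ)) : 𝓢'(Phase d, ℂ) :=
  if h : ∃ H, HasParaproduct φ F G H then h.choose else 0

/-- The weak integral `∫_0^t e^{-λ(t-s)} P_{t-s} G(s) ds` exists in the space of tempered
distributions and equals `H`. -/
def HasDuhamel (lam : ℝ) (G : ℝ → 𝓢'(Phase d, ℂ)) (t : ℝ) (H : 𝓢'(Phase d, ℂ)) : Prop :=
  ∀ ψ : 𝓢(Phase d, ℂ),
    IntervalIntegrable
      (fun s => (Real.exp (-lam * (t - s)) : ℂ) * kineticSemigroup (t - s) (G s) ψ) volume 0 t ∧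
    H ψ = ∫ s in (0 : ℝ)..t,
      (Real.exp (-lam * (t - s)) : ℂ) * kineticSemigroup (t - s) (G s) ψ

open Classical in
/-- The Duhamel operator `(I_λ G)(t) = ∫_0^t e^{-λ(t-s)} P_{t-s} G(s) ds` (`0` if the integral does
not exist). -/
def duhamel (lam : ℝ) (G : ℝ → 𝓢'(Phase d, ℂ)) (t : ℝ) : 𝓢'(Phase d, ℂ) :=
  if h : ∃ H, HasDuhamel lam G t H then h.choose else 0

/-- The component `∂_{v_{m 1}} ⋯ ∂_{v_{m k}} F` of `∇_v^k F`. -/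
def gradV {k : ℕ} (m : Fin k → Fin d) (F : 𝓢'(Phase d, ℂ)) : 𝓢'(Phase d, ℂ) :=
  ∂^{fun i => (WithLp.toLp 2 (0, EuclideanSpace.single (m i) (1 : ℝ)) : Phase d)} F

/-- The component with the indices `m` of the commutator
`[∇_v^k I_λ, f ≺] g = ∇_v^k I_λ (f ≺ g) - f ≺ ∇_v^k I_λ g`, at time `t`. -/
def commutator (φ : Phase d → ℝ) (lam : ℝ) (f g : ℝ → 𝓢'(Phase d, ℂ)) {k : ℕ}
    (m : Fin k → Fin d) (t : ℝ) : 𝓢'(Phase d, ℂ) :=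
  gradV m (duhamel lam (fun s => paraproduct φ (f s) (g s)) t) -
    paraproduct φ (f t) (gradV m (duhamel lam g t))

/-- All series and integrals in the definition of `commutator` exist, for `t ∈ [0, T]`. -/
structure CommutatorDefined (φ : Phase d → ℝ) (T lam : ℝ) (f g : ℝ → 𝓢'(Phase d, ℂ)) {k : ℕ}
    (m : Fin k → Fin d) : Prop where
  para_left : ∀ t ∈ Icc (0 : ℝ) T, ∃ H, HasParaproduct φ (f t) (g t) H
  duhamel_left : ∀ t ∈ Icc (0 : ℝ) T,
    ∃ H, HasDuhamel lam (fun s => paraproduct φ (f s) (g s)) t H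
  duhamel_right : ∀ t ∈ Icc (0 : ℝ) T, ∃ H, HasDuhamel lam g t H
  para_right : ∀ t ∈ Icc (0 : ℝ) T,
    ∃ H, HasParaproduct φ (f t) (gradV m (duhamel lam g t)) H

end Kinetic

end

noncomputable section

namespace Kinetic

variable {d : ℕ}

/-! ### Moderate weights -/

/-! Every weighted sup bound is read by duality. `Bd w M F` states `|F ψ| ≤ M ∫ |ψ| w` for test
functions, and by Riesz representation in `L²` this means that `F` is a function bounded by `M w`
(`Bd.exists_rep`); the weight used is `w = ρ⁻¹`. Series of blocks and integrals over time thereby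
become series and integrals of scalars, and multiplier bounds become weighted Young inequalities for
the dual operators on test functions.

Fix `s < t` and `u = t - s`. Moving a derivative through `Γ_u` shears its symbol, so `∇_v^k P_u` is
`Γ_u` applied after a multiplier `e_u(D)` (`esym`). Since the heat kernel is self-similar, on
frequencies of size `2^i` this multiplier is a combination of products of dilated Schwartz symbols
with coefficients of size `2^{ik} (1 + u 2^{2i})^{-n}`, for any `n`
(`IsHomSymbol.exists_esym_mul_fatS`). The transport shears frequencies too and does not preserve
annuli: block `j` of the result sees block `i` of the argument only if `2^{|j-i|} ≤ C (1 + u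
2^{2i})` (`two_zpow_abs_le_of_ne_zero`). The free power `n` pays for this mismatch
(`exists_wt_bound`).

Put `a = S_{i-1} f(s)`, `g_i = R_i g(s)` and `Y = ∇_v^k P_u g_i`. The contribution of `g_i` to
`∇_v^k P_u (f(s) ≺ g(s)) - f(t) ≺ ∇_v^k P_u g(s)` is `Γ_u ([e_u(D), a] g_i) + ∑_q (Γ_u a - S_{q-1}
f(t)) R_q Y`. In the first term, `a` varies at scale `2^{-i}` by at most `2^{-αi}`, because `α < 1`
(`exists_isSlow_lowFn`), and the commutator of a convolution with `a` only sees increments of `a`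
(`exists_bd_commutator`). In the second, low frequency cut-offs are `2^{-αi}` or `2^{-αq}` close to
the functions themselves, `Γ_u f(s)` is `u^{α/2}` close to `f(t)`, and `u^{α/2} ≤ (1 + u 2^{2i})
2^{-αi}`. Both terms therefore gain `α` derivatives (`IsHomSymbol.exists_bd_commTerm`), and
summation over `i` bounds block `j` at fixed times by a multiple of `2^{-(α+β-k)j} (1 + u
2^{2j})^{-2}` (`IsHomSymbol.exists_bd_comm`).

The integral of `e^{-λu} (1 + u 2^{2j})^{-2}` over `u` is at most `2^{-2j}` and at most `(1 + T) /
(λ ∨ 1)`; a geometric mean of the two bounds gives `(λ ∨ 1)^{(θ-2)/2} 2^{-θj}`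
(`integral_exp_mul_wt_le`).

The series converge because the symbols of annuli are divisible by powers of a homogeneous symbol,
which can be moved to the test function (`exists_decomp_hasSum`). The integrands are measurable
because they are diagonals of functions of two times, measurable in one and continuous in the other
(`aemeasurable_diag`). -/

/-- Positive continuous weights which vary at most polynomially under translations and boundedly
under the transport over bounded times. -/
structure IsWeight (w : Phase d → ℝ) : Prop where
  pos : ∀ z, 0 < w z
  cont : Continuous w
  moderate : ∃ C : ℝ, ∃ N : ℕ, 0 ≤ C ∧ ∀ z y, w (z + y) ≤ C * (1 + ‖y‖) ^ N * w z
  transp : ∀ T : ℝ, ∃ C : ℝ, 0 ≤ C ∧ ∀ u, |u| ≤ T → ∀ z, w (transport u z) ≤ C * w z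

theorem IsWeight.mul {w v : Phase d → ℝ} (hw : IsWeight w) (hv : IsWeight v) :
    IsWeight (fun z => w z * v z) where
  pos z := mul_pos (hw.pos z) (hv.pos z)
  cont := hw.cont.mul hv.cont
  moderate := by
    obtain ⟨C, N, hC, h⟩ := hw.moderate
    obtain ⟨C', N', hC', h'⟩ := hv.moderate
    refine ⟨C * C', N + N', by positivity, fun z y => ?_⟩
    calc _ ≤ (C * (1 + ‖y‖) ^ N * w z) * (C' * (1 + ‖y‖) ^ N' * v z) :=
          mul_le_mul (h z y) (h' z y) (hv.pos _).le ((hw.pos _).le.trans (h z y))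
      _ = _ := by rw [pow_add]; ring
  transp T := by
    obtain ⟨C, hC, h⟩ := hw.transp T
    obtain ⟨C', hC', h'⟩ := hv.transp T
    refine ⟨C * C', by positivity, fun u hu z => ?_⟩
    calc _ ≤ (C * w z) * (C' * v z) :=
          mul_le_mul (h u hu z) (h' u hu z) (hv.pos _).le ((hw.pos _).le.trans (h u hu z))
      _ = _ := by ring

theorem transport_neg_transport (u : ℝ) (z : Phase d) : transport (-u) (transport u z) = z :=
  transportL_neg_transportL u z

theorem transport_transport_neg (u : ℝ) (z : Phase d) : transport u (transport (-u) z) = z := by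
  simpa using transport_neg_transport (-u) z

/-- Both conditions are symmetric under exchanging the two points: moderateness is applied at `z +
y` with the increment `-y`, and the transport bound at `Γ_u z` with the time `-u`. This is why
weights of growth and of decay can be treated alike. -/
theorem IsWeight.inv {w : Phase d → ℝ} (hw : IsWeight w) : IsWeight (fun z => (w z)⁻¹) where
  pos z := inv_pos.2 (hw.pos z)
  cont := hw.cont.inv₀ fun z => (hw.pos z).ne'
  moderate := by
    obtain ⟨C, N, hC, h⟩ := hw.moderate
    refine ⟨C, N, hC, fun z y => ?_⟩
    have h1 := h (z + y) (-y)
    rw [add_neg_cancel_right, norm_neg] at h1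
    rw [inv_eq_one_div, ← div_eq_mul_inv, div_le_div_iff₀ (hw.pos _) (hw.pos _), one_mul]
    exact h1
  transp T := by
    obtain ⟨C, hC, h⟩ := hw.transp T
    refine ⟨C, hC, fun u hu z => ?_⟩
    have h1 := h (-u) (by rwa [abs_neg]) (transport u z)
    rw [transport_neg_transport] at h1
    rw [inv_eq_one_div, ← div_eq_mul_inv, div_le_div_iff₀ (hw.pos _) (hw.pos _), one_mul]
    exact h1

theorem IsWeight.rpow_of_nonneg {w : Phase d → ℝ} (hw : IsWeight w) {κ : ℝ} (hκ : 0 ≤ κ) :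
    IsWeight (fun z => w z ^ κ) where
  pos z := Real.rpow_pos_of_pos (hw.pos z) _
  cont := hw.cont.rpow_const fun z => Or.inl (hw.pos z).ne'
  moderate := by
    obtain ⟨C, N, hC, h⟩ := hw.moderate
    refine ⟨C ^ κ, ⌈N * κ⌉₊, by positivity, fun z y => ?_⟩
    have h0 : (0 : ℝ) ≤ 1 + ‖y‖ := by positivity
    calc _ ≤ (C * (1 + ‖y‖) ^ N * w z) ^ κ := Real.rpow_le_rpow (hw.pos _).le (h z y) hκ
      _ = C ^ κ * (1 + ‖y‖) ^ (N * κ) * w z ^ κ := by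
        rw [Real.mul_rpow (by positivity) (hw.pos _).le, Real.mul_rpow hC (by positivity),
          ← Real.rpow_natCast_mul h0]
      _ ≤ _ := by
        have := (hw.pos z).le
        gcongr
        rw [← Real.rpow_natCast]
        exact Real.rpow_le_rpow_of_exponent_le (by linarith [norm_nonneg y]) (Nat.le_ceil _)
  transp T := by
    obtain ⟨C, hC, h⟩ := hw.transp T
    refine ⟨C ^ κ, by positivity, fun u hu z => ?_⟩
    rw [← Real.mul_rpow hC (hw.pos _).le]
    exact Real.rpow_le_rpow (hw.pos _).le (h u hu z) hκ

theorem IsWeight.rpow {w : Phase d → ℝ} (hw : IsWeight w) (κ : ℝ) :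
    IsWeight (fun z => w z ^ κ) := by
  rcases le_total 0 κ with h | h
  · exact hw.rpow_of_nonneg h
  · have := (hw.rpow_of_nonneg (neg_nonneg.2 h)).inv
    convert this using 2 with z
    rw [Real.rpow_neg (hw.pos z).le, inv_inv]

/-- The delicate point is the transport, which adds `u v` to `x`. The cube root is subadditive, so
the change costs `|v|^{2/3}`, which the summand `1 + |v|²` absorbs. -/
theorem isWeight_baseWeight_aux :
    IsWeight (fun z : Phase d => (1 + ‖z.fst‖ ^ 2) ^ (1 / 3 : ℝ) + 1 + ‖z.snd‖ ^ 2) where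
  pos z := by positivity
  cont := by
    have h1 : Continuous fun z : Phase d => z.fst := by fun_prop
    have h2 : Continuous fun z : Phase d => z.snd := by fun_prop
    refine ((Continuous.rpow_const (by fun_prop) fun z => Or.inr (by norm_num)).add
      continuous_const).add (h2.norm.pow 2)
  moderate := by
    refine ⟨2, 2, by norm_num, fun z y => ?_⟩
    have hy : ‖y‖ ^ 2 = ‖y.fst‖ ^ 2 + ‖y.snd‖ ^ 2 := WithLp.prod_norm_sq_eq_of_L2 y
    have e1 : ‖y.fst‖ ^ 2 ≤ ‖y‖ ^ 2 := by nlinarith [sq_nonneg ‖y.snd‖]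
    have e2 : ‖y.snd‖ ^ 2 ≤ ‖y‖ ^ 2 := by nlinarith [sq_nonneg ‖y.fst‖]
    have hn := norm_nonneg y
    have key (a b : EuclideanSpace ℝ (Fin d)) (hb : ‖b‖ ^ 2 ≤ ‖y‖ ^ 2) :
        1 + ‖a + b‖ ^ 2 ≤ 2 * (1 + ‖y‖) ^ 2 * (1 + ‖a‖ ^ 2) := by
      have hb' : ‖b‖ ≤ ‖y‖ := by
        exact (sq_le_sq₀ (norm_nonneg _) (norm_nonneg _)).1 hb
      have h1 : ‖a + b‖ ^ 2 ≤ (‖a‖ + ‖y‖) ^ 2 := by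
        gcongr
        exact (norm_add_le a b).trans (by linarith)
      have := norm_nonneg a
      have h4 : 0 ≤ ‖y‖ ^ 2 * ‖a‖ ^ 2 := by positivity
      have h5 : 0 ≤ ‖y‖ * ‖a‖ ^ 2 := by positivity
      nlinarith [sq_nonneg (‖a‖ - ‖y‖)]
    have k1 := key z.fst y.fst e1
    have k2 := key z.snd y.snd e2
    have h3 : (1 + ‖z.fst + y.fst‖ ^ 2) ^ (1 / 3 : ℝ)
        ≤ 2 * (1 + ‖y‖) ^ 2 * (1 + ‖z.fst‖ ^ 2) ^ (1 / 3 : ℝ) := by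
      calc _ ≤ (2 * (1 + ‖y‖) ^ 2 * (1 + ‖z.fst‖ ^ 2)) ^ (1 / 3 : ℝ) :=
            Real.rpow_le_rpow (by positivity) k1 (by norm_num)
        _ = (2 * (1 + ‖y‖) ^ 2) ^ (1 / 3 : ℝ) * (1 + ‖z.fst‖ ^ 2) ^ (1 / 3 : ℝ) :=
            Real.mul_rpow (by positivity) (by positivity)
        _ ≤ _ := by
            gcongr
            have : (1 : ℝ) ≤ 2 * (1 + ‖y‖) ^ 2 := by nlinarith
            calc _ ≤ (2 * (1 + ‖y‖) ^ 2) ^ (1 : ℝ) :=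
                  Real.rpow_le_rpow_of_exponent_le this (by norm_num)
              _ = _ := Real.rpow_one _
    simp only [WithLp.add_fst, WithLp.add_snd]
    nlinarith
  transp T := by
    refine ⟨4 * (1 + T ^ 2), by positivity, fun u hu z => ?_⟩
    rw [transport_apply]
    simp only [WithLp.toLp_fst, WithLp.toLp_snd]
    have hu2 : u ^ 2 ≤ T ^ 2 := by rw [← sq_abs]; gcongr
    set D := 2 * (1 + T ^ 2) with hD
    have hD1 : 1 ≤ D := by nlinarith [sq_nonneg T]
    have h1 : 1 + ‖z.fst + u • z.snd‖ ^ 2 ≤ D * ((1 + ‖z.fst‖ ^ 2) + ‖z.snd‖ ^ 2) := by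
      have : ‖z.fst + u • z.snd‖ ≤ ‖z.fst‖ + |u| * ‖z.snd‖ := by
        simpa [norm_smul] using norm_add_le z.fst (u • z.snd)
      have h2 : ‖z.fst + u • z.snd‖ ^ 2 ≤ (‖z.fst‖ + |u| * ‖z.snd‖) ^ 2 := by gcongr
      have h3 : (|u| * ‖z.snd‖) ^ 2 ≤ T ^ 2 * ‖z.snd‖ ^ 2 := by
        rw [mul_pow, sq_abs]; gcongr
      have : 0 ≤ T ^ 2 * ‖z.fst‖ ^ 2 := by positivity
      nlinarith [sq_nonneg (‖z.fst‖ - |u| * ‖z.snd‖), sq_nonneg T, sq_nonneg ‖z.snd‖]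
    have h4 : (1 + ‖z.fst + u • z.snd‖ ^ 2) ^ (1 / 3 : ℝ) ≤
        D * ((1 + ‖z.fst‖ ^ 2) ^ (1 / 3 : ℝ) + (1 + ‖z.snd‖ ^ 2)) := by
      calc _ ≤ (D * ((1 + ‖z.fst‖ ^ 2) + ‖z.snd‖ ^ 2)) ^ (1 / 3 : ℝ) :=
            Real.rpow_le_rpow (by positivity) h1 (by norm_num)
        _ = D ^ (1 / 3 : ℝ) * ((1 + ‖z.fst‖ ^ 2) + ‖z.snd‖ ^ 2) ^ (1 / 3 : ℝ) :=
            Real.mul_rpow (by positivity) (by positivity)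
        _ ≤ D * ((1 + ‖z.fst‖ ^ 2) ^ (1 / 3 : ℝ) + (‖z.snd‖ ^ 2) ^ (1 / 3 : ℝ)) := by
            gcongr
            · exact (Real.rpow_le_rpow_of_exponent_le hD1 (by norm_num)).trans_eq
                (Real.rpow_one D)
            · exact Real.rpow_add_le_add_rpow (by positivity) (by positivity) (by norm_num)
                (by norm_num)
        _ ≤ _ := by
            gcongr
            calc (‖z.snd‖ ^ 2) ^ (1 / 3 : ℝ) ≤ (1 + ‖z.snd‖ ^ 2) ^ (1 / 3 : ℝ) :=
                  Real.rpow_le_rpow (by positivity) (by linarith) (by norm_num)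
              _ ≤ (1 + ‖z.snd‖ ^ 2) ^ (1 : ℝ) :=
                  Real.rpow_le_rpow_of_exponent_le (by nlinarith [sq_nonneg ‖z.snd‖])
                    (by norm_num)
              _ = _ := Real.rpow_one _
    have h5 : (0 : ℝ) ≤ (1 + ‖z.fst‖ ^ 2) ^ (1 / 3 : ℝ) := by positivity
    have h6 : 4 * (1 + T ^ 2) = 2 * D := by rw [hD]; ring
    rw [h6]
    have h7 : 1 + ‖z.snd‖ ^ 2 ≤ D * (1 + ‖z.snd‖ ^ 2) :=
      le_mul_of_one_le_left (by positivity) hD1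
    nlinarith

theorem isWeight_baseWeight : IsWeight (baseWeight (d := d)) :=
  isWeight_baseWeight_aux.rpow _

theorem isWeight_of_mem_polyWeights {ρ : Phase d → ℝ} (h : ρ ∈ polyWeights d) : IsWeight ρ := by
  obtain ⟨κ, rfl⟩ := h
  exact isWeight_baseWeight.rpow κ

theorem IsWeight.le_pow {w : Phase d → ℝ} (hw : IsWeight w) :
    ∃ C : ℝ, ∃ N : ℕ, 0 ≤ C ∧ ∀ z, w z ≤ C * (1 + ‖z‖) ^ N := by
  obtain ⟨C, N, hC, h⟩ := hw.moderate
  refine ⟨C * w 0, N, mul_nonneg hC (hw.pos 0).le, fun z => ?_⟩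
  have := h 0 z
  rw [zero_add] at this
  linarith

/-! ### Weighted integral norms of test functions -/

/-- The norm of `L¹(w dz)`. -/
def wnorm (w : Phase d → ℝ) (ψ : Phase d → ℂ) : ℝ := ∫ z, ‖ψ z‖ * w z

theorem wnorm_nonneg {w : Phase d → ℝ} (hw : IsWeight w) (ψ : Phase d → ℂ) : 0 ≤ wnorm w ψ :=
  integral_nonneg fun z => mul_nonneg (norm_nonneg _) (hw.pos z).le

theorem integrable_pow_mul_schwartz (ψ : 𝓢(Phase d, ℂ)) (N : ℕ) :
    Integrable (fun z => (1 + ‖z‖) ^ N * ‖ψ z‖) volume := by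
  have h : (fun z => (1 + ‖z‖) ^ N * ‖ψ z‖) =
      fun z => ∑ m ∈ Finset.range (N + 1), ‖z‖ ^ m * ‖ψ z‖ * (N.choose m) := by
    ext z
    rw [add_comm, add_pow, Finset.sum_mul]
    refine Finset.sum_congr rfl fun m _ => ?_
    rw [one_pow]; ring
  rw [h]
  exact integrable_finsetSum _ fun m _ => (ψ.integrable_pow_mul volume m).mul_const _

theorem IsWeight.integrable {w : Phase d → ℝ} (hw : IsWeight w) (ψ : 𝓢(Phase d, ℂ)) :
    Integrable (fun z => ‖ψ z‖ * w z) volume := by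
  obtain ⟨C, N, hC, h⟩ := hw.le_pow
  refine ((integrable_pow_mul_schwartz ψ N).const_mul C).mono'
    (ψ.continuous.norm.mul hw.cont).aestronglyMeasurable (.of_forall fun z => ?_)
  rw [Real.norm_of_nonneg (mul_nonneg (norm_nonneg _) (hw.pos z).le)]
  calc _ ≤ ‖ψ z‖ * (C * (1 + ‖z‖) ^ N) := by gcongr; exact h z
    _ = _ := by ring

theorem wnorm_smul (w : Phase d → ℝ) (c : ℂ) (ψ : 𝓢(Phase d, ℂ)) :
    wnorm w (c • ψ : 𝓢(Phase d, ℂ)) = ‖c‖ * wnorm w ψ := by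
  unfold wnorm
  rw [← integral_const_mul]
  refine integral_congr_ae (.of_forall fun z => ?_)
  change ‖c • ψ z‖ * w z = _
  rw [norm_smul, mul_assoc]

/-- The norm of `L¹(w dz)` is a continuous seminorm on test functions. -/
theorem wnorm_le_seminorm {w : Phase d → ℝ} (hw : IsWeight w) :
    ∃ C : ℝ, ∃ N : ℕ, 0 ≤ C ∧ ∀ ψ : 𝓢(Phase d, ℂ),
      wnorm w ψ ≤ C * (Finset.Iic (N, 0)).sup (fun m => SchwartzMap.seminorm ℝ m.1 m.2) ψ := by
  obtain ⟨C, N, hC, h⟩ := hw.le_pow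
  obtain ⟨n, hn⟩ : ∃ n : ℕ, Integrable (fun z : Phase d => (1 + ‖z‖) ^ (-(n : ℝ))) volume :=
    ⟨_, Measure.integrable_pow_neg_integrablePower volume⟩
  refine ⟨C * 2 ^ (N + n) * ∫ z : Phase d, (1 + ‖z‖) ^ (-(n : ℝ)), N + n, by positivity,
    fun ψ => ?_⟩
  unfold wnorm
  set S := (Finset.Iic (N + n, 0)).sup (fun m => SchwartzMap.seminorm ℝ (E := Phase d) (F := ℂ) m.1 m.2) ψ
  have hb (z : Phase d) : (1 + ‖z‖) ^ (N + n) * ‖ψ z‖ ≤ 2 ^ (N + n) * S := by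
    have := SchwartzMap.one_add_le_sup_seminorm_apply (𝕜 := ℝ) (m := (N + n, 0)) le_rfl le_rfl ψ z
    simpa using this
  calc _ ≤ ∫ z : Phase d, C * 2 ^ (N + n) * S * (1 + ‖z‖) ^ (-(n : ℝ)) := by
        refine integral_mono (hw.integrable ψ) (hn.const_mul _) fun z => ?_
        have h0 : 0 < 1 + ‖z‖ := by positivity
        simp only
        rw [Real.rpow_neg h0.le, Real.rpow_natCast, ← div_eq_mul_inv, le_div_iff₀ (by positivity)]
        calc _ ≤ ‖ψ z‖ * (C * (1 + ‖z‖) ^ N) * (1 + ‖z‖) ^ n := by gcongr; exact h z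
          _ = C * ((1 + ‖z‖) ^ (N + n) * ‖ψ z‖) := by rw [pow_add]; ring
          _ ≤ C * (2 ^ (N + n) * S) := mul_le_mul_of_nonneg_left (hb z) hC
          _ = _ := by ring
    _ = _ := by rw [integral_const_mul]; ring

theorem tendsto_wnorm {w : Phase d → ℝ} (hw : IsWeight w) {ι : Type*} {l : Filter ι}
    {χ : ι → 𝓢(Phase d, ℂ)} (h : Filter.Tendsto χ l (nhds 0)) :
    Filter.Tendsto (fun i => wnorm w (χ i)) l (nhds 0) := by
  obtain ⟨C, N, hC, hb⟩ := wnorm_le_seminorm hw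
  have hc : Continuous (fun ψ : 𝓢(Phase d, ℂ) =>
      (Finset.Iic (N, 0)).sup (fun m => SchwartzMap.seminorm ℝ (E := Phase d) (F := ℂ) m.1 m.2) ψ) := by
    have hs : ∀ s : Finset (ℕ × ℕ), Continuous
        ⇑(s.sup (fun m => SchwartzMap.seminorm ℝ m.1 m.2) : Seminorm ℝ 𝓢(Phase d, ℂ)) := by
      intro s
      induction s using Finset.induction_on with
      | empty => exact (continuous_const : Continuous fun _ : 𝓢(Phase d, ℂ) => (0 : ℝ))
      | insert a s ha ih =>
        rw [Finset.sup_insert]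
        have h1 : Continuous (SchwartzMap.seminorm ℝ (E := Phase d) (F := ℂ) a.1 a.2) :=
          (schwartz_withSeminorms ℝ (Phase d) ℂ).continuous_seminorm a
        exact h1.max ih
    exact hs _
  have h0 : Filter.Tendsto (fun i => C * (Finset.Iic (N, 0)).sup
      (fun m => SchwartzMap.seminorm ℝ (E := Phase d) (F := ℂ) m.1 m.2) (χ i)) l (nhds 0) := by
    have := (((hc.tendsto 0).comp h).const_mul C)
    simpa using this
  exact squeeze_zero (fun i => wnorm_nonneg hw _) (fun i => hb _) h0

/-! ### Bounds of distributions by weights -/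

/-- The distribution `F` is bounded by `M w`, in the sense of duality. -/
def Bd (w : Phase d → ℝ) (M : ℝ) (F : 𝓢'(Phase d, ℂ)) : Prop :=
  ∀ ψ : 𝓢(Phase d, ℂ), ‖F ψ‖ ≤ M * wnorm w ψ

theorem Bd.mono {w : Phase d → ℝ} (hw : IsWeight w) {M M' : ℝ} {F : 𝓢'(Phase d, ℂ)}
    (h : Bd w M F) (hM : M ≤ M') : Bd w M' F := fun ψ =>
  (h ψ).trans (mul_le_mul_of_nonneg_right hM (wnorm_nonneg hw _))

theorem Bd.add {w : Phase d → ℝ} {M M' : ℝ} {F F' : 𝓢'(Phase d, ℂ)}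
    (h : Bd w M F) (h' : Bd w M' F') : Bd w (M + M') (F + F') := fun ψ => by
  rw [add_mul]
  exact (norm_add_le _ _).trans (add_le_add (h ψ) (h' ψ))

theorem Bd.neg {w : Phase d → ℝ} {M : ℝ} {F : 𝓢'(Phase d, ℂ)} (h : Bd w M F) :
    Bd w M (-F) := fun ψ => by
  change ‖-(F ψ)‖ ≤ _
  rw [norm_neg]; exact h ψ

theorem Bd.smul {w : Phase d → ℝ} {M : ℝ} {F : 𝓢'(Phase d, ℂ)} (h : Bd w M F) (c : ℂ) :
    Bd w (‖c‖ * M) (c • F) := fun ψ => by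
  change ‖c • F ψ‖ ≤ _
  rw [norm_smul, mul_assoc]
  exact mul_le_mul_of_nonneg_left (h ψ) (norm_nonneg c)

theorem bd_zero (w : Phase d → ℝ) : Bd w 0 (0 : 𝓢'(Phase d, ℂ)) := fun ψ => by
  change ‖(0 : ℂ)‖ ≤ _
  simp

theorem Bd.sum {w : Phase d → ℝ} {ι : Type*} {s : Finset ι} {M : ι → ℝ} {F : ι → 𝓢'(Phase d, ℂ)}
    (h : ∀ i ∈ s, Bd w (M i) (F i)) : Bd w (∑ i ∈ s, M i) (∑ i ∈ s, F i) := by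
  classical
  induction s using Finset.induction_on with
  | empty => simpa using bd_zero w
  | insert a s ha ih =>
    rw [Finset.sum_insert ha, Finset.sum_insert ha]
    exact (h a (Finset.mem_insert_self a s)).add
      (ih fun i hi => h i (Finset.mem_insert_of_mem hi))

/-! ### Representation of bounded distributions by functions -/

theorem hasTemperateGrowth_one_add_sq (n : ℝ) :
    Function.HasTemperateGrowth (fun z : Phase d => (((1 + ‖z‖ ^ 2) ^ n : ℝ) : ℂ)) :=
  Function.Complex.hasTemperateGrowth_ofReal.comp (Function.hasTemperateGrowth_one_add_norm_sq_rpow _ n)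

/-- Division by a high power of `1 + |z|²` makes the weight square integrable, so that duality in
`L²` can replace duality between `L¹(w)` and `L^∞`. -/
theorem IsWeight.exists_memLp {w : Phase d → ℝ} (hw : IsWeight w) :
    ∃ n : ℕ, MemLp (fun z : Phase d => (1 + ‖z‖ ^ 2) ^ (-(n : ℝ)) * w z) 2 volume := by
  obtain ⟨C, N, hC, h⟩ := hw.le_pow
  set I := Measure.integrablePower (volume : Measure (Phase d))
  have hI : Integrable (fun z : Phase d => (1 + ‖z‖) ^ (-(I : ℝ))) volume :=
    Measure.integrable_pow_neg_integrablePower volume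
  refine ⟨N + I, ?_⟩
  have hc : Continuous (fun z : Phase d => (1 + ‖z‖ ^ 2) ^ (-((N + I : ℕ) : ℝ)) * w z) := by
    refine Continuous.mul (Continuous.rpow_const (by fun_prop) fun z => Or.inl ?_) hw.cont
    positivity
  rw [memLp_two_iff_integrable_sq hc.aestronglyMeasurable]
  refine (hI.const_mul ((C * 2 ^ (N + I)) ^ 2)).mono' (hc.pow 2).aestronglyMeasurable
    (.of_forall fun z => ?_)
  have hz := hw.pos z
  have hn := norm_nonneg z
  rw [Real.norm_of_nonneg (by positivity), Real.rpow_neg (by positivity), Real.rpow_natCast,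
    Real.rpow_neg (by positivity), Real.rpow_natCast]
  have h1 : ((1 + ‖z‖ ^ 2) ^ (N + I))⁻¹ ≤ 2 ^ (N + I) * ((1 + ‖z‖) ^ (2 * (N + I)))⁻¹ := by
    rw [inv_eq_one_div, ← div_eq_mul_inv, div_le_div_iff₀ (by positivity) (by positivity), one_mul,
      ← mul_pow, pow_mul]
    gcongr
    nlinarith [sq_nonneg (1 - ‖z‖)]
  calc _ ≤ ((2 ^ (N + I) * ((1 + ‖z‖) ^ (2 * (N + I)))⁻¹) * (C * (1 + ‖z‖) ^ N)) ^ 2 := by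
        gcongr
        exact h z
    _ = (C * 2 ^ (N + I)) ^ 2 * (((1 + ‖z‖) ^ (2 * (N + I)))⁻¹ * (1 + ‖z‖) ^ N) ^ 2 := by ring
    _ ≤ _ := by
        gcongr
        have e : (1 + ‖z‖) ^ (2 * (N + I)) = (1 + ‖z‖) ^ N * (1 + ‖z‖) ^ (N + 2 * I) := by
          rw [← pow_add]; ring_nf
        rw [e, mul_inv, mul_comm _ ((1 + ‖z‖) ^ N), ← mul_assoc,
          mul_inv_cancel₀ (by positivity), one_mul, inv_pow, ← pow_mul]
        gcongr
        · linarith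
        · omega

/-- The modulus of a square integrable function. -/
def normLp (x : Lp ℂ 2 (volume : Measure (Phase d))) : Lp ℝ 2 (volume : Measure (Phase d)) :=
  (lipschitzWith_one_norm (E := ℂ)).compLp norm_zero x

theorem normLp_ae (x : Lp ℂ 2 (volume : Measure (Phase d))) :
    normLp x =ᵐ[volume] fun z => ‖x z‖ :=
  (lipschitzWith_one_norm (E := ℂ)).coeFn_compLp norm_zero x

theorem continuous_normLp : Continuous (normLp (d := d)) :=
  (lipschitzWith_one_norm (E := ℂ)).continuous_compLp norm_zero

theorem norm_normLp (x : Lp ℂ 2 (volume : Measure (Phase d))) : ‖normLp x‖ = ‖x‖ := by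
  rw [Lp.norm_def, Lp.norm_def]
  congr 1
  refine (eLpNorm_congr_ae (normLp_ae x)).trans ?_
  exact eLpNorm_norm _

/-- Written as an inner product, the weighted `L¹` norm is continuous on `L²`, so bounds by it
extend from test functions to all of `L²` by density. -/
theorem inner_normLp {W : Phase d → ℝ} (hW : MemLp W 2 volume)
    (x : Lp ℂ 2 (volume : Measure (Phase d))) :
    inner ℝ (hW.toLp W) (normLp x) = ∫ z, ‖x z‖ * W z := by
  rw [L2.inner_def]
  refine integral_congr_ae ?_
  filter_upwards [hW.coeFn_toLp, normLp_ae x] with z h1 h2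
  rw [h1, h2]
  simp

/-- A square integrable function whose pairings are bounded by those of `M W` is bounded
by `M W`. -/
theorem ae_le_of_forall_inner_le {W : Phase d → ℝ} (hW : MemLp W 2 volume) (hWm : Measurable W)
    (hW0 : ∀ z, 0 ≤ W z) {M : ℝ} (hM : 0 ≤ M) (v : Lp ℂ 2 (volume : Measure (Phase d)))
    (h : ∀ x : Lp ℂ 2 (volume : Measure (Phase d)),
      ‖∫ z, (starRingEnd ℂ) (v z) * x z‖ ≤ M * ∫ z, ‖x z‖ * W z) :
    ∀ᵐ z, ‖v z‖ ≤ M * W z := by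
  have hvm : StronglyMeasurable v := Lp.stronglyMeasurable v
  -- Test with `v 1_A`, where `A` is the set on which the claimed bound fails. The hypothesis gives
  -- `∫_A |v|² ≤ M ∫_A |v| W`, while on `A` the left integrand strictly exceeds the right one; hence
  -- `A` is a null set.
  set A : Set (Phase d) := {z | M * W z < ‖v z‖} with hA
  have hAm : MeasurableSet A := measurableSet_lt (hWm.const_mul M) hvm.norm.measurable
  have hx : MemLp (A.indicator v) 2 volume := (Lp.memLp v).indicator hAm
  have h1 := h (hx.toLp _)
  have hxz := hx.coeFn_toLp
  have i1 : Integrable (fun z => A.indicator (fun z => ‖v z‖ ^ 2) z) volume :=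
    ((memLp_two_iff_integrable_sq_norm (Lp.aestronglyMeasurable v)).1 (Lp.memLp v)).indicator hAm
  have i2 : Integrable (fun z => A.indicator (fun z => ‖v z‖ * W z) z) volume :=
    Integrable.indicator ((Lp.memLp v).norm.integrable_mul hW) hAm
  have e1 : ∫ z, (starRingEnd ℂ) (v z) * (hx.toLp _ : Phase d → ℂ) z =
      ((∫ z, A.indicator (fun z => ‖v z‖ ^ 2) z : ℝ) : ℂ) := by
    rw [← integral_complex_ofReal]
    refine integral_congr_ae ?_
    filter_upwards [hxz] with z hz
    rw [hz]
    by_cases h : z ∈ A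
    · simp [h, Complex.conj_mul']
    · simp [h]
  have e2 : ∫ z, ‖(hx.toLp _ : Phase d → ℂ) z‖ * W z =
      ∫ z, A.indicator (fun z => ‖v z‖ * W z) z := by
    refine integral_congr_ae ?_
    filter_upwards [hxz] with z hz
    rw [hz]
    by_cases h : z ∈ A
    · simp [h]
    · simp [h]
  rw [e1, e2, Complex.norm_real] at h1
  have h2 := (le_abs_self _).trans h1
  have i3 := i1.sub (i2.const_mul M)
  have hnn : 0 ≤ fun z => A.indicator (fun z => ‖v z‖ ^ 2) z -
      M * A.indicator (fun z => ‖v z‖ * W z) z := by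
    intro z
    by_cases h : z ∈ A
    · have h' : M * W z < ‖v z‖ := h
      simp only [h, indicator_of_mem, Pi.zero_apply]
      nlinarith [norm_nonneg (v z)]
    · simp [h]
  have h3 : ∫ z, (A.indicator (fun z => ‖v z‖ ^ 2) z -
      M * A.indicator (fun z => ‖v z‖ * W z) z) = 0 := by
    refine le_antisymm ?_ (integral_nonneg hnn)
    rw [integral_sub i1 (i2.const_mul M), integral_const_mul]
    linarith
  rw [integral_eq_zero_iff_of_nonneg hnn i3] at h3
  filter_upwards [h3] with z hz
  by_contra! hlt
  have hzA : z ∈ A := hlt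
  simp only [hzA, indicator_of_mem, Pi.zero_apply] at hz
  have hp : 0 ≤ M * W z := mul_nonneg hM (hW0 z)
  have : 0 < ‖v z‖ * (‖v z‖ - M * W z) := mul_pos (hp.trans_lt hlt) (sub_pos.2 hlt)
  nlinarith

/-- A functional on test functions which is bounded by a square integrable function `M W` is
represented by a function with the bound `M W`. -/
theorem exists_rep_of_le_inner {W : Phase d → ℝ} (hW : MemLp W 2 volume) (hWm : Measurable W)
    (hW0 : ∀ z, 0 ≤ W z) {M : ℝ} (hM : 0 ≤ M) (f : 𝓢(Phase d, ℂ) →ₗ[ℂ] ℂ)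
    (hf : ∀ ψ, ‖f ψ‖ ≤ M * ∫ z, ‖ψ z‖ * W z) :
    ∃ v : Phase d → ℂ, AEStronglyMeasurable v volume ∧ (∀ᵐ z, ‖v z‖ ≤ M * W z) ∧
      ∀ ψ, f ψ = ∫ z, v z * ψ z := by
  set e : 𝓢(Phase d, ℂ) →L[ℂ] Lp ℂ 2 (volume : Measure (Phase d)) :=
    SchwartzMap.toLpCLM ℂ ℂ 2 volume with he
  have hez (ψ : 𝓢(Phase d, ℂ)) : e ψ =ᵐ[volume] ψ := ψ.coeFn_toLp 2 volume
  have hde : DenseRange e := SchwartzMap.denseRange_toLpCLM (F := ℂ) (p := 2) (by norm_num)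
  have hf' (ψ : 𝓢(Phase d, ℂ)) : ‖f ψ‖ ≤ M * inner ℝ (hW.toLp W) (normLp (e ψ)) := by
    rw [inner_normLp]
    refine (hf ψ).trans_eq ?_
    congr 1
    refine integral_congr_ae ?_
    filter_upwards [hez ψ] with z hz
    rw [hz]
  have hf2 : ∃ C, ∀ ψ : 𝓢(Phase d, ℂ), ‖f ψ‖ ≤ C * ‖e.toLinearMap ψ‖ := by
    refine ⟨M * ‖hW.toLp W‖, fun ψ => (hf' ψ).trans ?_⟩
    rw [mul_assoc]
    refine mul_le_mul_of_nonneg_left ?_ hM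
    have := real_inner_le_norm (hW.toLp W) (normLp (e ψ))
    rwa [norm_normLp] at this
  set Λ : Lp ℂ 2 (volume : Measure (Phase d)) →L[ℂ] ℂ := f.extendOfNorm e.toLinearMap
  have hΛ (ψ : 𝓢(Phase d, ℂ)) : Λ (e ψ) = f ψ := LinearMap.extendOfNorm_eq hde hf2 ψ
  have hΛb (x : Lp ℂ 2 (volume : Measure (Phase d))) :
      ‖Λ x‖ ≤ M * inner ℝ (hW.toLp W) (normLp x) := by
    -- Both sides of the bound are continuous in `x`, so it passes from the dense range of test
    -- functions to `L²`.
    refine hde.induction_on (p := fun x => ‖Λ x‖ ≤ M * inner ℝ (hW.toLp W) (normLp x)) x ?_ ?_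
    · exact isClosed_le Λ.continuous.norm
        (continuous_const.mul (continuous_const.inner continuous_normLp))
    · intro ψ
      rw [hΛ ψ]
      exact hf' ψ
  set v : Lp ℂ 2 (volume : Measure (Phase d)) := (InnerProductSpace.toDual ℂ _).symm Λ with hv
  have hΛv (x : Lp ℂ 2 (volume : Measure (Phase d))) : Λ x = ∫ z, (starRingEnd ℂ) (v z) * x z := by
    rw [← InnerProductSpace.toDual_symm_apply (𝕜 := ℂ) (y := Λ), L2.inner_def]
    refine integral_congr_ae (.of_forall fun z => ?_)
    simp only [RCLike.inner_apply]
    rw [mul_comm]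
  have hvb := ae_le_of_forall_inner_le hW hWm hW0 hM v fun x => by
    rw [← hΛv, ← inner_normLp hW]; exact hΛb x
  refine ⟨fun z => (starRingEnd ℂ) (v z), Complex.continuous_conj.comp_aestronglyMeasurable
    (Lp.aestronglyMeasurable v), ?_, fun ψ => ?_⟩
  · filter_upwards [hvb] with z hz
    rwa [RCLike.norm_conj]
  · rw [← hΛ, hΛv]
    refine integral_congr_ae ?_
    filter_upwards [hez ψ] with z hz
    rw [hz]

/-- A distribution which is bounded by a weight is a function with that bound. -/
theorem Bd.exists_rep {w : Phase d → ℝ} (hw : IsWeight w) {M : ℝ} (hM : 0 ≤ M)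
    {F : 𝓢'(Phase d, ℂ)} (hF : Bd w M F) :
    ∃ u, IsRep F u ∧ ∀ᵐ z, ‖u z‖ ≤ M * w z := by
  obtain ⟨n, hn⟩ := hw.exists_memLp
  set g : Phase d → ℝ := fun z => (1 + ‖z‖ ^ 2) ^ (-(n : ℝ)) with hg
  set gi : Phase d → ℝ := fun z => (1 + ‖z‖ ^ 2) ^ (n : ℝ) with hgi
  have hgpos (z) : 0 < g z := by positivity
  have hgipos (z) : 0 < gi z := by positivity
  have hgg (z) : g z * gi z = 1 := by
    simp only [hg, hgi]
    rw [← Real.rpow_add (by positivity), neg_add_cancel, Real.rpow_zero]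
  have tg := hasTemperateGrowth_one_add_sq (d := d) (-(n : ℝ))
  have tgi := hasTemperateGrowth_one_add_sq (d := d) (n : ℝ)
  set mg : 𝓢(Phase d, ℂ) →L[ℂ] 𝓢(Phase d, ℂ) := SchwartzMap.smulLeftCLM ℂ (fun z => (g z : ℂ))
  set mgi : 𝓢(Phase d, ℂ) →L[ℂ] 𝓢(Phase d, ℂ) := SchwartzMap.smulLeftCLM ℂ (fun z => (gi z : ℂ))
  have mg_apply (ψ : 𝓢(Phase d, ℂ)) (z) : mg ψ z = g z * ψ z :=
    SchwartzMap.smulLeftCLM_apply_apply tg ψ z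
  have mgi_apply (ψ : 𝓢(Phase d, ℂ)) (z) : mgi ψ z = gi z * ψ z :=
    SchwartzMap.smulLeftCLM_apply_apply tgi ψ z
  have hgwc : Continuous (fun z => g z * w z) :=
    (Continuous.rpow_const (by fun_prop) fun z => Or.inl (by positivity)).mul hw.cont
  -- The functional `ψ ↦ F (g ψ)` is bounded by `g w`, which is in `L²`. Its representative `v` is
  -- divided by `g` afterwards, and every test function is of the form `g χ` with `χ` a test
  -- function.
  obtain ⟨v, hvm, hvb, hv⟩ := exists_rep_of_le_inner hn hgwc.measurable
    (fun z => mul_nonneg (hgpos z).le (hw.pos z).le) hM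
    { toFun := fun ψ => F (mg ψ)
      map_add' := fun ψ χ => by simp
      map_smul' := fun c ψ => by simp } (fun ψ => by
        refine (hF (mg ψ)).trans_eq ?_
        congr 1
        refine integral_congr_ae (.of_forall fun z => ?_)
        simp only [mg_apply, norm_mul, Complex.norm_real, Real.norm_of_nonneg (hgpos z).le]
        ring)
  have hub : ∀ᵐ z, ‖(gi z : ℂ) * v z‖ ≤ M * w z := by
    filter_upwards [hvb] with z hz
    rw [norm_mul, Complex.norm_real, Real.norm_of_nonneg (hgipos z).le]
    calc _ ≤ gi z * (M * (g z * w z)) := by have := (hgipos z).le; gcongr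
      _ = M * w z * (g z * gi z) := by ring
      _ = _ := by rw [hgg, mul_one]
  have hgic : Continuous gi := Continuous.rpow_const (by fun_prop) fun z => Or.inl (by positivity)
  have hum : AEStronglyMeasurable (fun z => (gi z : ℂ) * v z) volume :=
    (Complex.continuous_ofReal.comp hgic).aestronglyMeasurable.mul hvm
  refine ⟨fun z => gi z * v z, ⟨hum, fun ψ => ⟨?_, ?_⟩⟩, hub⟩
  · refine ((hw.integrable ψ).const_mul M).mono' (ψ.continuous.aestronglyMeasurable.mul hum) ?_
    filter_upwards [hub] with z hz
    rw [norm_mul]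
    calc _ ≤ ‖ψ z‖ * (M * w z) := by gcongr
      _ = _ := by ring
  · have : ψ = mg (mgi ψ) := by
      ext z
      rw [mg_apply, mgi_apply, ← mul_assoc, ← Complex.ofReal_mul, hgg, Complex.ofReal_one, one_mul]
    conv_lhs => rw [this]
    refine (hv (mgi ψ)).trans (integral_congr_ae (.of_forall fun z => ?_))
    simp only [mgi_apply]
    ring

/-- Multiplication by a nowhere vanishing Gaussian turns both representatives into integrable
functions; testing with compactly supported smooth functions times the Gaussian then identifies
them. -/
theorem IsRep.ae_eq {F : 𝓢'(Phase d, ℂ)} {u v : Phase d → ℂ} (hu : IsRep F u) (hv : IsRep F v) :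
    u =ᵐ[volume] v := by
  set ψ₀ : 𝓢(Phase d, ℂ) := heatKernelS 1 one_pos
  have h₀ (z) : ψ₀ z ≠ 0 := by
    change ((heatKernel 1 z : ℝ) : ℂ) ≠ 0
    rw [Complex.ofReal_ne_zero]
    unfold heatKernel
    positivity
  have h : ∀ᵐ z, ψ₀ z * u z = ψ₀ z * v z := by
    refine ae_eq_of_integral_contDiff_smul_eq (hu.2 ψ₀).1.locallyIntegrable
      (hv.2 ψ₀).1.locallyIntegrable fun g hg hgc => ?_
    have hg₁ : HasCompactSupport (fun z => (g z : ℂ) * ψ₀ z) :=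
      (hgc.comp_left (g := Complex.ofReal) rfl).mul_right
    have hg₂ : ContDiff ℝ ∞ (fun z => (g z : ℂ) * ψ₀ z) :=
      (Complex.ofRealCLM.contDiff.comp hg).mul (ψ₀.smooth ⊤)
    have h1 := (hu.2 (hg₁.toSchwartzMap hg₂)).2.symm.trans (hv.2 (hg₁.toSchwartzMap hg₂)).2
    simpa [mul_assoc] using h1
  filter_upwards [h] with z hz
  exact mul_left_cancel₀ (h₀ z) hz

/-! ### The norms `L^∞(ρ)` -/

theorem Bd.of_rep {w : Phase d → ℝ} (hw : IsWeight w) {M : ℝ} {F : 𝓢'(Phase d, ℂ)}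
    {u : Phase d → ℂ} (hu : IsRep F u) (h : ∀ᵐ z, ‖u z‖ ≤ M * w z) : Bd w M F := fun ψ => by
  rw [(hu.2 ψ).2, wnorm, ← integral_const_mul]
  refine norm_integral_le_of_norm_le ((hw.integrable ψ).const_mul M) ?_
  filter_upwards [h] with z hz
  rw [norm_mul]
  calc _ ≤ ‖ψ z‖ * (M * w z) := by gcongr
    _ = _ := by ring

theorem Bd.supNorm_le {ρ : Phase d → ℝ} (hρ : IsWeight ρ) {M : ℝ} (hM : 0 ≤ M)
    {F : 𝓢'(Phase d, ℂ)} (h : Bd (fun z => (ρ z)⁻¹) M F) : supNorm ρ F ≤ ENNReal.ofReal M := by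
  obtain ⟨u, hu, hb⟩ := h.exists_rep hρ.inv hM
  refine (iInf₂_le u hu).trans ?_
  rw [eLpNorm_exponent_top]
  refine eLpNormEssSup_le_of_ae_bound ?_
  filter_upwards [hb] with z hz
  rw [norm_mul, Complex.norm_real, Real.norm_of_nonneg (hρ.pos z).le]
  calc _ ≤ ρ z * (M * (ρ z)⁻¹) := by have := (hρ.pos z).le; gcongr
    _ = M := by rw [mul_left_comm, mul_inv_cancel₀ (hρ.pos z).ne', mul_one]

/-- The infimum over representatives is approached with a margin `δ`, which avoids asking whether it
is attained. The choice `δ = ε / (Q + 1)` also covers the case `Q = 0`. -/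
theorem Bd.of_supNorm_le {ρ : Phase d → ℝ} (hρ : IsWeight ρ) {M : ℝ} (hM : 0 ≤ M)
    {F : 𝓢'(Phase d, ℂ)} (h : supNorm ρ F ≤ ENNReal.ofReal M) : Bd (fun z => (ρ z)⁻¹) M F := by
  intro ψ
  refine le_of_forall_pos_le_add fun ε hε => ?_
  set Q := wnorm (fun z => (ρ z)⁻¹) ψ
  have hQ : 0 ≤ Q := wnorm_nonneg hρ.inv ψ
  set δ := ε / (Q + 1)
  have hδ : 0 < δ := by positivity
  have h1 : supNorm ρ F < ENNReal.ofReal (M + δ) :=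
    h.trans_lt ((ENNReal.ofReal_lt_ofReal_iff (by linarith)).2 (by linarith))
  obtain ⟨u, hu⟩ := iInf_lt_iff.1 h1
  obtain ⟨hu, h2⟩ := iInf_lt_iff.1 hu
  have h3 : ∀ᵐ z, ‖u z‖ ≤ (M + δ) * (ρ z)⁻¹ := by
    rw [eLpNorm_exponent_top] at h2
    filter_upwards [enorm_ae_le_eLpNormEssSup (fun z => (ρ z : ℂ) * u z) volume] with z hz
    have h4 := hz.trans h2.le
    rw [← ofReal_norm, ENNReal.ofReal_le_ofReal_iff (by positivity), norm_mul, Complex.norm_real,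
      Real.norm_of_nonneg (hρ.pos z).le] at h4
    rw [← div_eq_mul_inv, le_div_iff₀ (hρ.pos z)]
    linarith
  have h5 := Bd.of_rep hρ.inv hu h3 ψ
  have h6 : δ * Q ≤ ε := by
    rw [div_mul_eq_mul_div, div_le_iff₀ (by positivity)]
    nlinarith
  nlinarith

theorem IsRep.ae_le_of_bd {w : Phase d → ℝ} (hw : IsWeight w) {M : ℝ} (hM : 0 ≤ M)
    {F : 𝓢'(Phase d, ℂ)} {u : Phase d → ℂ} (hu : IsRep F u) (h : Bd w M F) :
    ∀ᵐ z, ‖u z‖ ≤ M * w z := by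
  obtain ⟨v, hv, hb⟩ := h.exists_rep hw hM
  filter_upwards [hb, hu.ae_eq hv] with z h1 h2
  rwa [h2]

/-- A distribution which is the function `a` times a bounded distribution. -/
theorem Bd.smulLeft {w v : Phase d → ℝ} (hw : IsWeight w) (hv : IsWeight v) {M M' : ℝ}
    {a : Phase d → ℂ} (ha : a.HasTemperateGrowth)
    (hab : ∀ᵐ z, ‖a z‖ ≤ M * w z) (hM' : 0 ≤ M') {G : 𝓢'(Phase d, ℂ)} (hG : Bd v M' G) :
    Bd (fun z => w z * v z) (M * M') (TemperedDistribution.smulLeftCLM ℂ a G) := by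
  intro ψ
  rw [TemperedDistribution.smulLeftCLM_apply_apply]
  refine (hG _).trans ?_
  rw [mul_comm M, mul_assoc]
  refine mul_le_mul_of_nonneg_left ?_ hM'
  unfold wnorm
  rw [← integral_const_mul]
  refine integral_mono_ae (hv.integrable _) (((hw.mul hv).integrable ψ).const_mul M) ?_
  filter_upwards [hab] with z hz
  rw [SchwartzMap.smulLeftCLM_apply_apply ha, norm_smul]
  have := (hv.pos z).le
  calc _ ≤ M * w z * ‖ψ z‖ * v z := by gcongr
    _ = _ := by ring

theorem isWeight_one : IsWeight (fun _ : Phase d => (1 : ℝ)) where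
  pos _ := one_pos
  cont := continuous_const
  moderate := ⟨1, 0, zero_le_one, fun _ _ => by simp⟩
  transp _ := ⟨1, zero_le_one, fun _ _ _ => by simp⟩

/-! ### Linear changes of variables -/

/-- The factor by which the integral changes under a linear change of variables. -/
def jac (A : Phase d ≃L[ℝ] Phase d) : ℝ := |(LinearMap.det (A : Phase d →ₗ[ℝ] Phase d))⁻¹|

theorem jac_pos (A : Phase d ≃L[ℝ] Phase d) : 0 < jac A :=
  abs_pos.2 (inv_ne_zero A.toLinearEquiv.isUnit_det'.ne_zero)

theorem integral_comp_linearEquiv {E : Type*} [NormedAddCommGroup E] [NormedSpace ℝ E]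
    (A : Phase d ≃L[ℝ] Phase d) (G : Phase d → E) :
    ∫ z, G (A z) = jac A • ∫ z, G z := by
  have h := Measure.map_linearMap_addHaar_eq_smul_addHaar (volume : Measure (Phase d))
    (f := (A : Phase d →ₗ[ℝ] Phase d)) A.toLinearEquiv.isUnit_det'.ne_zero
  have h2 : ∫ z, G (A z) = ∫ z, G z ∂(Measure.map A volume) :=
    (A.toHomeomorph.measurableEmbedding.integral_map G).symm
  have h3 : Measure.map A (volume : Measure (Phase d)) =
    ENNReal.ofReal (jac A) • volume := h
  rw [h2, h3, integral_smul_measure, ENNReal.toReal_ofReal (jac_pos A).le]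

/-- `A` and `B` are adjoint to each other. -/
def IsAdj (A B : Phase d ≃L[ℝ] Phase d) : Prop := ∀ x y, inner ℝ (A x) y = inner ℝ x (B y)

/-- The composition of a test function with a linear bijection. -/
def compE (A : Phase d ≃L[ℝ] Phase d) : 𝓢(Phase d, ℂ) →L[ℂ] 𝓢(Phase d, ℂ) :=
  compCLMOfContinuousLinearEquiv ℂ A

@[simp]
theorem compE_apply (A : Phase d ≃L[ℝ] Phase d) (ψ : 𝓢(Phase d, ℂ)) (z : Phase d) :
    compE A ψ z = ψ (A z) := rfl

/-- The change of variables `v ↦ A v`, evaluated at `B η` rather than at `η` so that no inverse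
transpose appears. -/
theorem fourier_compE {A B : Phase d ≃L[ℝ] Phase d} (h : IsAdj A B) (g : 𝓢(Phase d, ℂ))
    (η : Phase d) : 𝓕 (compE A g) (B η) = jac A * 𝓕 g η := by
  rw [SchwartzMap.fourier_coe, SchwartzMap.fourier_coe, Real.fourier_eq', Real.fourier_eq']
  have := integral_comp_linearEquiv A
    (fun v => Complex.exp (((-2 * Real.pi * inner ℝ v η : ℝ) : ℂ) * Complex.I) • g v)
  simp only [h _ η] at this
  simpa using this

theorem fourierInv_compE {A B : Phase d ≃L[ℝ] Phase d} (h : IsAdj A B) (g : 𝓢(Phase d, ℂ))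
    (η : Phase d) : 𝓕⁻ (compE A g) (B η) = jac A * 𝓕⁻ g η := by
  rw [SchwartzMap.fourierInv_coe, SchwartzMap.fourierInv_coe, Real.fourierInv_eq',
    Real.fourierInv_eq']
  have := integral_comp_linearEquiv A
    (fun v => Complex.exp (((2 * Real.pi * inner ℝ v η : ℝ) : ℂ) * Complex.I) • g v)
  simp only [h _ η] at this
  simpa using this

/-! ### Fourier multipliers on test functions and on distributions -/

/-- The Fourier multiplier with the symbol `σ` on distributions. -/
abbrev fm (σ : Phase d → ℂ) : 𝓢'(Phase d, ℂ) →L[ℂ] 𝓢'(Phase d, ℂ) :=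
  TemperedDistribution.fourierMultiplierCLM ℂ σ

/-- The operator on test functions which is dual to the Fourier multiplier with the symbol `σ`. -/
def dm (σ : Phase d → ℂ) : 𝓢(Phase d, ℂ) →L[ℂ] 𝓢(Phase d, ℂ) :=
  FourierTransform.fourierCLM ℂ 𝓢(Phase d, ℂ) ∘L SchwartzMap.smulLeftCLM ℂ σ ∘L
    FourierTransform.fourierInvCLM ℂ 𝓢(Phase d, ℂ)

theorem fm_apply (σ : Phase d → ℂ) (F : 𝓢'(Phase d, ℂ)) (ψ : 𝓢(Phase d, ℂ)) :
    fm σ F ψ = F (dm σ ψ) := rfl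

theorem dm_eq (σ : Phase d → ℂ) (ψ : 𝓢(Phase d, ℂ)) :
    dm σ ψ = 𝓕 (SchwartzMap.smulLeftCLM ℂ σ (𝓕⁻ ψ)) := rfl

theorem fourierInv_dm {σ : Phase d → ℂ} (hσ : σ.HasTemperateGrowth) (ψ : 𝓢(Phase d, ℂ))
    (ξ : Phase d) : 𝓕⁻ (dm σ ψ) ξ = σ ξ * 𝓕⁻ ψ ξ := by
  rw [dm_eq, FourierTransform.fourierInv_fourier_eq, SchwartzMap.smulLeftCLM_apply_apply hσ,
    smul_eq_mul]

theorem ext_fourierInv {ψ χ : 𝓢(Phase d, ℂ)} (h : ∀ ξ, 𝓕⁻ ψ ξ = 𝓕⁻ χ ξ) : ψ = χ := by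
  have : 𝓕⁻ ψ = 𝓕⁻ χ := SchwartzMap.ext h
  have h2 := congrArg (fun f : 𝓢(Phase d, ℂ) => 𝓕 f) this
  simpa only [FourierTransform.fourier_fourierInv_eq] using h2

theorem dm_dm {σ τ : Phase d → ℂ} (hσ : σ.HasTemperateGrowth) (hτ : τ.HasTemperateGrowth)
    (ψ : 𝓢(Phase d, ℂ)) : dm σ (dm τ ψ) = dm (fun ξ => σ ξ * τ ξ) ψ :=
  ext_fourierInv fun ξ => by
    rw [fourierInv_dm hσ, fourierInv_dm hτ]
    exact (mul_assoc _ _ _).symm.trans (fourierInv_dm (hσ.mul hτ) ψ ξ).symm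

theorem fm_fm {σ τ : Phase d → ℂ} (hσ : σ.HasTemperateGrowth) (hτ : τ.HasTemperateGrowth)
    (F : 𝓢'(Phase d, ℂ)) : fm σ (fm τ F) = fm (fun ξ => σ ξ * τ ξ) F := by
  ext ψ
  rw [fm_apply, fm_apply, fm_apply, dm_dm hτ hσ]
  simp_rw [mul_comm]

theorem fm_zero (F : 𝓢'(Phase d, ℂ)) : fm (fun _ => 0) F = 0 := by
  ext ψ
  simp

theorem dm_one (ψ : 𝓢(Phase d, ℂ)) : dm (fun _ => 1) ψ = ψ :=
  ext_fourierInv fun ξ => by rw [fourierInv_dm (Function.HasTemperateGrowth.const _), one_mul]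

/-- On the Fourier side, composition with `A` is composition with the inverse of its adjoint up to a
constant, and a constant commutes with every symbol. -/
theorem compE_dm {A B : Phase d ≃L[ℝ] Phase d} (h : IsAdj A B) {σ : Phase d → ℂ}
    (hσ : σ.HasTemperateGrowth) (ψ : 𝓢(Phase d, ℂ)) :
    compE A (dm (fun ξ => σ (B ξ)) ψ) = dm σ (compE A ψ) := by
  have hσB : (fun ξ => σ (B ξ)).HasTemperateGrowth := hσ.comp B.hasTemperateGrowth
  refine ext_fourierInv fun ξ => ?_
  obtain ⟨η, rfl⟩ := B.surjective ξ
  rw [fourierInv_compE h, fourierInv_dm hσB, fourierInv_dm hσ, fourierInv_compE h]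
  ring

/-! ### Multipliers with Schwartz symbols -/

theorem fourierInv_translate (ψ : 𝓢(Phase d, ℂ)) (z ξ : Phase d) :
    𝓕⁻ (compSubConstCLM ℂ (-z) ψ) ξ =
      Complex.exp (((-2 * Real.pi * inner ℝ ξ z : ℝ) : ℂ) * Complex.I) * 𝓕⁻ ψ ξ := by
  rw [SchwartzMap.fourierInv_coe, SchwartzMap.fourierInv_coe, Real.fourierInv_eq',
    Real.fourierInv_eq', ← integral_const_mul, ← integral_add_right_eq_self _ (-z)]
  refine integral_congr_ae (.of_forall fun y => ?_)
  simp only [compSubConstCLM_apply, smul_eq_mul, sub_neg_eq_add, neg_add_cancel_right]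
  rw [← mul_assoc, ← Complex.exp_add, ← add_mul, ← Complex.ofReal_add, inner_add_left,
    inner_neg_left, real_inner_comm z ξ]
  congr 5
  ring

/-- Parseval's identity with a translate of `ψ`. The argument is `z + y` and not `z - y` because the
operator is dual to convolution. -/
theorem dm_schwartz_apply (σ ψ : 𝓢(Phase d, ℂ)) (z : Phase d) :
    dm σ ψ z = ∫ y, 𝓕⁻ σ y * ψ (z + y) := by
  have h1 : ∫ y, 𝓕⁻ σ y * ψ (z + y) = ∫ y, 𝓕⁻ σ y * compSubConstCLM ℂ (-z) ψ y := by
    refine integral_congr_ae (.of_forall fun y => ?_)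
    simp [add_comm]
  rw [h1, SchwartzMap.integral_fourierInv_mul_eq, dm_eq, SchwartzMap.fourier_coe, Real.fourier_eq']
  refine integral_congr_ae (.of_forall fun ξ => ?_)
  simp only [fourierInv_translate, SchwartzMap.smulLeftCLM_apply_apply σ.hasTemperateGrowth,
    smul_eq_mul]
  ring

/-- A weighted form of Young's inequality. -/
theorem young {w v : Phase d → ℝ} (hw : IsWeight w) (hv : IsWeight v) :
    ∃ C : ℝ, ∃ N : ℕ, 0 ≤ C ∧ ∀ (k : Phase d → ℝ), Measurable k → (∀ y, 0 ≤ k y) →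
      Integrable (fun y => (1 + ‖y‖) ^ N * k y) volume → ∀ (ψ : 𝓢(Phase d, ℂ)) (g : Phase d → ℂ),
      Continuous g → (∀ z, ‖g z‖ ≤ ∫ y, k y * (‖ψ (z + y)‖ * v (z + y))) →
      wnorm w g ≤ C * (∫ y, (1 + ‖y‖) ^ N * k y) * wnorm (fun z => v z * w z) ψ := by
  obtain ⟨C, N, hC, h⟩ := hw.moderate
  refine ⟨C, N, hC, fun k hkm hk hki ψ g hg hgk => ?_⟩
  have hwpos := hw.pos
  have hvpos := hv.pos
  -- The weight is moved from `z` to the point `z + y` at which `ψ` is evaluated; the cost is a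
  -- power of `1 + |y|`, charged to the kernel.
  have hw1 (z y : Phase d) : w z ≤ C * (1 + ‖y‖) ^ N * w (z + y) := by
    have := h (z + y) (-y)
    rwa [add_neg_cancel_right, norm_neg] at this
  have hvw := hv.mul hw
  set φ : Phase d → ℝ≥0∞ := fun x => ENNReal.ofReal (‖ψ x‖ * (v x * w x)) with hφ
  have hφm : Measurable φ :=
    (ψ.continuous.norm.mul hvw.cont).measurable.ennreal_ofReal
  set κ : Phase d → ℝ≥0∞ := fun y => ENNReal.ofReal (C * ((1 + ‖y‖) ^ N * k y)) with hκ
  have hκm : Measurable κ := by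
    refine Measurable.ennreal_ofReal (Measurable.const_mul (Measurable.mul ?_ hkm) C)
    exact (by fun_prop : Continuous fun y : Phase d => (1 + ‖y‖) ^ N).measurable
  have e1 : ∫⁻ y, κ y = ENNReal.ofReal (C * ∫ y, (1 + ‖y‖) ^ N * k y) := by
    rw [← integral_const_mul, ofReal_integral_eq_lintegral_ofReal (hki.const_mul C)]
    exact .of_forall fun y => by have := hk y; simp only [Pi.zero_apply]; positivity
  have e2 : ∫⁻ y, φ y = ENNReal.ofReal (wnorm (fun z => v z * w z) ψ) := by
    rw [wnorm, ofReal_integral_eq_lintegral_ofReal (hvw.integrable ψ)]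
    exact .of_forall fun y => mul_nonneg (norm_nonneg _) (hvw.pos y).le
  -- Extended nonnegative integrals are used because the integrability of `g` is not assumed;
  -- Tonelli's theorem then needs measurability only.
  have hmain : ∫⁻ z, ENNReal.ofReal (‖g z‖ * w z) ≤
      ENNReal.ofReal (C * (∫ y, (1 + ‖y‖) ^ N * k y) * wnorm (fun z => v z * w z) ψ) := by
    calc ∫⁻ z, ENNReal.ofReal (‖g z‖ * w z) ≤ ∫⁻ z, ∫⁻ y, κ y * φ (z + y) := by
          refine lintegral_mono fun z => ?_
          calc ENNReal.ofReal (‖g z‖ * w z)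
              ≤ ENNReal.ofReal (∫ y, k y * (‖ψ (z + y)‖ * v (z + y)) * w z) := by
                rw [integral_mul_const]
                refine ENNReal.ofReal_le_ofReal ?_
                exact mul_le_mul_of_nonneg_right (hgk z) (hwpos z).le
            _ ≤ ∫⁻ y, ‖k y * (‖ψ (z + y)‖ * v (z + y)) * w z‖ₑ := by
                refine (Real.ofReal_le_enorm _).trans ?_
                exact enorm_integral_le_lintegral_enorm _
            _ ≤ _ := by
                refine lintegral_mono fun y => ?_
                have h1 := hk y
                have h2 := (hvpos (z + y)).le
                have h3 := (hwpos (z + y)).le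
                have h4 := (hwpos z).le
                simp only [hκ, hφ]
                rw [Real.enorm_eq_ofReal (by positivity), ← ENNReal.ofReal_mul (by positivity)]
                refine ENNReal.ofReal_le_ofReal ?_
                calc _ ≤ k y * (‖ψ (z + y)‖ * v (z + y)) * (C * (1 + ‖y‖) ^ N * w (z + y)) := by
                      gcongr
                      exact hw1 z y
                  _ = _ := by ring
      _ = ∫⁻ y, ∫⁻ z, κ y * φ (z + y) := by
          refine lintegral_lintegral_swap (Measurable.aemeasurable ?_)
          exact (hκm.comp measurable_snd).mul (hφm.comp (measurable_fst.add measurable_snd))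
      _ = ∫⁻ y, κ y * ∫⁻ z, φ z := by
          refine lintegral_congr fun y => ?_
          rw [lintegral_const_mul (κ y) (f := fun z => φ (z + y)) (hφm.comp (measurable_add_const y)),
            lintegral_add_right_eq_self φ y]
      _ = _ := by
          rw [lintegral_mul_const _ hκm, e1, e2, ← ENNReal.ofReal_mul]
          refine mul_nonneg hC (integral_nonneg fun y => ?_)
          have := hk y
          simp only [Pi.zero_apply]
          positivity
  have hnn : 0 ≤ C * (∫ y, (1 + ‖y‖) ^ N * k y) * wnorm (fun z => v z * w z) ψ := by
    refine mul_nonneg (mul_nonneg hC (integral_nonneg fun y => ?_)) (wnorm_nonneg hvw _)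
    have := hk y
    simp only [Pi.zero_apply]
    positivity
  rw [wnorm, integral_eq_lintegral_of_nonneg_ae
    (.of_forall fun z => mul_nonneg (norm_nonneg _) (hwpos z).le)
    (hg.norm.mul hw.cont).aestronglyMeasurable]
  exact ENNReal.toReal_le_of_le_ofReal hnn hmain

/-- The integral of the convolution kernel of a multiplier against a power. -/
def kernelNorm (N : ℕ) (σ : 𝓢(Phase d, ℂ)) : ℝ := ∫ y, (1 + ‖y‖) ^ N * ‖𝓕⁻ σ y‖

theorem kernelNorm_nonneg (N : ℕ) (σ : 𝓢(Phase d, ℂ)) : 0 ≤ kernelNorm N σ :=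
  integral_nonneg fun _ => by simp only [Pi.zero_apply]; positivity

theorem wnorm_dm_le {w : Phase d → ℝ} (hw : IsWeight w) :
    ∃ C : ℝ, ∃ N : ℕ, 0 ≤ C ∧ ∀ σ ψ : 𝓢(Phase d, ℂ),
      wnorm w (dm σ ψ) ≤ C * kernelNorm N σ * wnorm w ψ := by
  obtain ⟨C, N, hC, h⟩ := young hw isWeight_one
  refine ⟨C, N, hC, fun σ ψ => ?_⟩
  have := h (fun y => ‖𝓕⁻ σ y‖) (𝓕⁻ σ).continuous.norm.measurable (fun y => norm_nonneg _)
    (integrable_pow_mul_schwartz _ N) ψ (dm σ ψ) (dm σ ψ).continuous (fun z => ?_)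
  · simpa [kernelNorm] using this
  · rw [dm_schwartz_apply]
    refine (norm_integral_le_integral_norm _).trans_eq ?_
    simp

/-! ### Dilations -/

/-- The anisotropic dilation as a linear map. -/
def dilateL (r : ℝ) : Phase d →L[ℝ] Phase d :=
  (WithLp.prodContinuousLinearEquiv 2 ℝ _ _).symm.toContinuousLinearMap ∘L
    ContinuousLinearMap.prod (r ^ 3 • WithLp.fstL 2 ℝ _ _) (r • WithLp.sndL 2 ℝ _ _)

theorem dilateL_apply (r : ℝ) (z : Phase d) : dilateL r z = dilate r z := rfl

theorem dilate_dilate (r s : ℝ) (z : Phase d) : dilate r (dilate s z) = dilate (r * s) z := by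
  simp only [dilate, WithLp.toLp_fst, WithLp.toLp_snd, smul_smul, mul_pow]

theorem dilate_one (z : Phase d) : dilate 1 z = z := by
  simp only [dilate, one_pow, one_smul]; rfl

/-- The anisotropic dilation as a linear bijection. -/
def dilateE (r : ℝ) (hr : r ≠ 0) : Phase d ≃L[ℝ] Phase d :=
  ContinuousLinearEquiv.equivOfInverse (dilateL r) (dilateL r⁻¹)
    (fun z => by
      rw [dilateL_apply, dilateL_apply, dilate_dilate, inv_mul_cancel₀ hr, dilate_one])
    (fun z => by
      rw [dilateL_apply, dilateL_apply, dilate_dilate, mul_inv_cancel₀ hr, dilate_one])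

theorem dilateE_apply (r : ℝ) (hr : r ≠ 0) (z : Phase d) : dilateE r hr z = dilate r z := rfl

theorem isAdj_dilateE (r : ℝ) (hr : r ≠ 0) :
    IsAdj (dilateE r hr) (dilateE (d := d) r hr) := fun x y => by
  simp [dilateE_apply, dilate, WithLp.prod_inner_apply, inner_smul_left, inner_smul_right]

theorem norm_dilate_le {r : ℝ} (hr : 0 ≤ r) (z : Phase d) : ‖dilate r z‖ ≤ (1 + r) ^ 3 * ‖z‖ := by
  have h1 : ‖dilate r z‖ ^ 2 ≤ ((1 + r) ^ 3 * ‖z‖) ^ 2 := by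
    rw [mul_pow, WithLp.prod_norm_sq_eq_of_L2, WithLp.prod_norm_sq_eq_of_L2]
    simp only [dilate, WithLp.toLp_fst, WithLp.toLp_snd, norm_smul, mul_pow, Real.norm_eq_abs,
      sq_abs]
    rw [mul_add]
    have a1 : (r ^ 3) ^ 2 ≤ ((1 + r) ^ 3) ^ 2 := by gcongr; linarith
    have a2 : r ^ 2 ≤ ((1 + r) ^ 3) ^ 2 := by
      gcongr
      nlinarith [sq_nonneg r, pow_nonneg hr 3]
    gcongr
  exact (sq_le_sq₀ (norm_nonneg _) (by positivity)).1 h1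

theorem norm_dilate_le_of_le_one {r : ℝ} (hr : 0 ≤ r) (hr1 : r ≤ 1) (z : Phase d) :
    ‖dilate r z‖ ≤ r * ‖z‖ := by
  have h1 : ‖dilate r z‖ ^ 2 ≤ (r * ‖z‖) ^ 2 := by
    rw [mul_pow, WithLp.prod_norm_sq_eq_of_L2, WithLp.prod_norm_sq_eq_of_L2]
    simp only [dilate, WithLp.toLp_fst, WithLp.toLp_snd, norm_smul, mul_pow, Real.norm_eq_abs,
      sq_abs]
    rw [mul_add]
    have a1 : (r ^ 3) ^ 2 ≤ r ^ 2 := by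
      gcongr
      exact pow_le_of_le_one hr hr1 (by norm_num)
    gcongr
  exact (sq_le_sq₀ (norm_nonneg _) (by positivity)).1 h1

/-- The dilated symbol `ξ ↦ σ (r^a ξ)`. -/
def sc (σ : 𝓢(Phase d, ℂ)) (r : ℝ) : 𝓢(Phase d, ℂ) :=
  if h : r ≠ 0 then compE (dilateE r h) σ else 0

theorem sc_apply (σ : 𝓢(Phase d, ℂ)) {r : ℝ} (hr : 0 < r) (ξ : Phase d) :
    sc σ r ξ = σ (dilate r ξ) := by
  rw [sc, dif_pos hr.ne']; rfl

theorem sc_one (σ : 𝓢(Phase d, ℂ)) : sc σ 1 = σ := by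
  ext ξ
  rw [sc_apply σ one_pos, dilate_one]

/-- The Jacobian of the substitution `y ↦ r^a y` cancels the one in the dilated kernel, so its value
is irrelevant here. -/
theorem integral_fourierInv_sc {E : Type*} [NormedAddCommGroup E] [NormedSpace ℝ E]
    (σ : 𝓢(Phase d, ℂ)) {r : ℝ} (hr : 0 < r) (G : Phase d → ℝ) :
    ∫ y, G y * ‖𝓕⁻ (sc σ r) y‖ = ∫ y, G (dilate r y) * ‖𝓕⁻ σ y‖ := by
  have h := integral_comp_linearEquiv (dilateE r hr.ne') fun y => G y * ‖𝓕⁻ (sc σ r) y‖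
  have hj := jac_pos (dilateE (d := d) r hr.ne')
  have h2 (y : Phase d) : ‖𝓕⁻ (sc σ r) (dilateE r hr.ne' y)‖ = jac (dilateE (d := d) r hr.ne') * ‖𝓕⁻ σ y‖ := by
    rw [sc, dif_pos hr.ne', fourierInv_compE (isAdj_dilateE r hr.ne'), norm_mul, Complex.norm_real,
      Real.norm_of_nonneg hj.le]
  simp only [h2] at h
  simp_rw [mul_left_comm _ (jac _)] at h
  rw [integral_const_mul, smul_eq_mul] at h
  exact (mul_left_cancel₀ hj.ne' h).symm

/-- The kernel of `σ(r^a ξ)` lives at the scale `r`, so small `r` only concentrates it and an upper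
bound on `r` controls the weighted integral. -/
theorem kernelNorm_sc_le (N : ℕ) (σ : 𝓢(Phase d, ℂ)) {r R : ℝ} (hr : 0 < r) (hR : r ≤ R) :
    kernelNorm N (sc σ r) ≤ (1 + R) ^ (3 * N) * kernelNorm N σ := by
  unfold kernelNorm
  rw [integral_fourierInv_sc (E := ℝ) σ hr, ← integral_const_mul]
  refine integral_mono_of_nonneg (.of_forall fun y => ?_)
    ((integrable_pow_mul_schwartz _ N).const_mul _) (.of_forall fun y => ?_)
  · simp only [Pi.zero_apply]; positivity
  · simp only
    rw [← mul_assoc, pow_mul, ← mul_pow]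
    gcongr
    have h1 : (1 : ℝ) ≤ (1 + R) ^ 3 := one_le_pow₀ (by linarith)
    have h2 : ‖dilate r y‖ ≤ (1 + R) ^ 3 * ‖y‖ := by
      refine (norm_dilate_le hr.le y).trans ?_
      gcongr
    linarith

/-- Multipliers with dilated Schwartz symbols are bounded uniformly in the dilation. -/
theorem exists_bd_fm_sc {w : Phase d → ℝ} (hw : IsWeight w) (σ : 𝓢(Phase d, ℂ)) (R : ℝ) :
    ∃ C : ℝ, 0 ≤ C ∧ ∀ r, 0 < r → r ≤ R → (∀ ψ : 𝓢(Phase d, ℂ),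
      wnorm w (dm (sc σ r) ψ) ≤ C * wnorm w ψ) ∧
      ∀ M F, 0 ≤ M → Bd w M F → Bd w (C * M) (fm (sc σ r) F) := by
  obtain ⟨C, N, hC, h⟩ := wnorm_dm_le hw
  have h0 : 0 ≤ C * ((1 + |R|) ^ (3 * N) * kernelNorm N σ) :=
    mul_nonneg hC (mul_nonneg (by positivity) (kernelNorm_nonneg _ _))
  refine ⟨C * ((1 + |R|) ^ (3 * N) * kernelNorm N σ), h0, fun r hr hrR => ?_⟩
  have h1 (ψ : 𝓢(Phase d, ℂ)) : wnorm w (dm (sc σ r) ψ) ≤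
      C * ((1 + |R|) ^ (3 * N) * kernelNorm N σ) * wnorm w ψ := by
    refine (h _ ψ).trans ?_
    refine mul_le_mul_of_nonneg_right ?_ (wnorm_nonneg hw _)
    exact mul_le_mul_of_nonneg_left (kernelNorm_sc_le N σ hr (hrR.trans (le_abs_self R))) hC
  refine ⟨h1, fun M F hM hF ψ => ?_⟩
  rw [fm_apply]
  refine (hF _).trans ?_
  calc _ ≤ M * (C * ((1 + |R|) ^ (3 * N) * kernelNorm N σ) * wnorm w ψ) := by
        gcongr; exact h1 ψ
    _ = _ := by ring

/-! ### Transport -/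

/-- The adjoint of the transport, `(ξ_x, ξ_v) ↦ (ξ_x, ξ_v + u ξ_x)`. -/
def cotransportL (u : ℝ) : Phase d →L[ℝ] Phase d :=
  (WithLp.prodContinuousLinearEquiv 2 ℝ _ _).symm.toContinuousLinearMap ∘L
    ContinuousLinearMap.prod (WithLp.fstL 2 ℝ _ _)
      (WithLp.sndL 2 ℝ _ _ + u • WithLp.fstL 2 ℝ _ _)

theorem cotransportL_apply (u : ℝ) (z : Phase d) :
    cotransportL u z = WithLp.toLp 2 (z.fst, z.snd + u • z.fst) := rfl

theorem cotransportL_neg (u : ℝ) (z : Phase d) : cotransportL (-u) (cotransportL u z) = z := by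
  rw [cotransportL_apply, cotransportL_apply]
  simp only [WithLp.toLp_fst, WithLp.toLp_snd, neg_smul, add_neg_cancel_right]
  rfl

/-- The adjoint of the transport as a linear bijection. -/
def cotransport (u : ℝ) : Phase d ≃L[ℝ] Phase d :=
  ContinuousLinearEquiv.equivOfInverse (cotransportL u) (cotransportL (-u))
    (cotransportL_neg u) (fun z => by simpa using cotransportL_neg (-u) z)

theorem cotransport_apply (u : ℝ) (z : Phase d) :
    cotransport u z = WithLp.toLp 2 (z.fst, z.snd + u • z.fst) := rfl

theorem cotransport_neg_cotransport (u : ℝ) (z : Phase d) :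
    cotransport (-u) (cotransport u z) = z := cotransportL_neg u z

theorem isAdj_transport (u : ℝ) : IsAdj (transport u) (cotransport (d := d) u) := fun x y => by
  simp only [transport_apply, cotransport_apply, WithLp.prod_inner_apply, inner_add_left,
    inner_add_right, inner_smul_left, inner_smul_right]
  simp
  ring

theorem transport_add (u u' : ℝ) (z : Phase d) :
    transport u (transport u' z) = transport (u + u') z := by
  simp only [transport_apply, WithLp.toLp_fst, WithLp.toLp_snd, add_smul]
  rw [add_assoc, add_comm (u' • z.snd)]

/-- The determinant `D(u)` is multiplicative in `u` by the group law, and conjugation by the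
dilation with factor `2` turns `u` into `4u`. Hence `D(u)^4 = D(u)`, and a nonzero real number with
`D³ = 1` equals `1`. -/
theorem jac_transport (u : ℝ) : jac (transport (d := d) u) = 1 := by
  set D : ℝ → ℝ := fun u => LinearMap.det ((transport (d := d) u : Phase d →L[ℝ] Phase d) :
    Phase d →ₗ[ℝ] Phase d)
  have h1 (u u' : ℝ) : D (u + u') = D u * D u' := by
    simp only [D]
    rw [← LinearMap.det_comp]
    congr 1
    ext1 z
    exact (transport_add u u' z).symm
  have h2 : D (u + u + (u + u)) = D u := by
    have := LinearMap.det_conj ((transport (d := d) u : Phase d →L[ℝ] Phase d) :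
      Phase d →ₗ[ℝ] Phase d) (dilateE (d := d) 2 two_ne_zero).toLinearEquiv
    refine Eq.trans ?_ this
    simp only [D]
    congr 1
    ext1 z
    change transport (u + u + (u + u)) z = dilate 2 (transport u (dilate 2⁻¹ z))
    simp only [transport_apply, dilate, WithLp.toLp_fst, WithLp.toLp_snd, smul_smul, smul_add]
    congr 3
    · norm_num
    · congr 1; ring
    · norm_num
  have h3 : D u ≠ 0 := (transport (d := d) u).toLinearEquiv.isUnit_det'.ne_zero
  rw [h1, h1] at h2
  have h4 : D u ^ 3 = 1 := by
    have : D u * (D u ^ 3 - 1) = 0 := by linear_combination h2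
    rcases mul_eq_zero.1 this with h | h
    · exact absurd h h3
    · linarith
  have h5 : D u = 1 := by
    nlinarith [sq_nonneg (D u + 1), sq_nonneg (D u), sq_nonneg (D u - 1)]
  change |(D u)⁻¹| = 1
  rw [h5]; norm_num

theorem transportD_apply' (u : ℝ) (F : 𝓢'(Phase d, ℂ)) (ψ : 𝓢(Phase d, ℂ)) :
    transportD u F ψ = F (compE (transport (-u)) ψ) := rfl

/-- Multipliers are conjugated by the transport. -/
theorem fm_transportD (u : ℝ) {σ : Phase d → ℂ} (hσ : σ.HasTemperateGrowth)
    (F : 𝓢'(Phase d, ℂ)) :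
    fm σ (transportD u F) = transportD u (fm (fun ξ => σ (cotransport u ξ)) F) := by
  ext ψ
  have h := compE_dm (isAdj_transport (-u)) (hσ.comp (cotransport u).hasTemperateGrowth) ψ
  have h2 (ξ : Phase d) : cotransport u (cotransport (-u) ξ) = ξ := by
    simpa using cotransport_neg_cotransport (-u) ξ
  simp only [Function.comp_apply, h2] at h
  exact congrArg F h

theorem transportD_smulLeft (u : ℝ) {a : Phase d → ℂ} (ha : a.HasTemperateGrowth)
    (F : 𝓢'(Phase d, ℂ)) :
    transportD u (TemperedDistribution.smulLeftCLM ℂ a F) =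
      TemperedDistribution.smulLeftCLM ℂ (fun z => a (transport u z)) (transportD u F) := by
  ext ψ
  rw [transportD_apply', TemperedDistribution.smulLeftCLM_apply_apply,
    TemperedDistribution.smulLeftCLM_apply_apply, transportD_apply']
  congr 1
  ext z
  have h := SchwartzMap.smulLeftCLM_apply_apply (ha.comp (transport u).hasTemperateGrowth) ψ
    (transport (-u) z)
  rw [Function.comp_apply, transport_transport_neg] at h
  rw [SchwartzMap.smulLeftCLM_apply_apply ha, compE_apply]
  exact h.symm

theorem exists_bd_transportD {w : Phase d → ℝ} (hw : IsWeight w) (T : ℝ) :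
    ∃ C : ℝ, 0 ≤ C ∧ ∀ u, |u| ≤ T → ∀ M F, 0 ≤ M → Bd w M F → Bd w (C * M) (transportD u F) := by
  obtain ⟨C, hC, h⟩ := hw.transp T
  refine ⟨C, hC, fun u hu M F hM hF ψ => ?_⟩
  rw [transportD_apply']
  refine (hF _).trans ?_
  rw [mul_comm C, mul_assoc]
  refine mul_le_mul_of_nonneg_left ?_ hM
  have h1 := integral_comp_linearEquiv (transport u)
    fun z => ‖compE (transport (-u)) ψ z‖ * w z
  rw [jac_transport, one_smul] at h1
  unfold wnorm
  rw [← h1, ← integral_const_mul]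
  refine integral_mono_of_nonneg (.of_forall fun z => ?_) ((hw.integrable ψ).const_mul _)
    (.of_forall fun z => ?_)
  · exact mul_nonneg (norm_nonneg _) (hw.pos _).le
  · simp only [compE_apply, transport_neg_transport]
    rw [mul_left_comm]
    exact mul_le_mul_of_nonneg_left (h u hu z) (norm_nonneg _)

/-! ### Geometry of the frequency space -/

theorem anisoNorm_nonneg (z : Phase d) : 0 ≤ anisoNorm z := by unfold anisoNorm; positivity

theorem anisoNorm_dilate {r : ℝ} (hr : 0 ≤ r) (z : Phase d) :
    anisoNorm (dilate r z) = r * anisoNorm z := by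
  unfold anisoNorm dilate
  simp only [WithLp.toLp_fst, WithLp.toLp_snd, norm_smul, norm_pow, Real.norm_of_nonneg hr]
  rw [Real.mul_rpow (by positivity) (norm_nonneg _), ← Real.rpow_natCast r 3, ← Real.rpow_mul hr]
  norm_num
  ring

theorem anisoNorm_add_le (z y : Phase d) : anisoNorm (z + y) ≤ anisoNorm z + anisoNorm y := by
  unfold anisoNorm
  have h1 : ‖(z + y).fst‖ ^ (1 / 3 : ℝ) ≤ ‖z.fst‖ ^ (1 / 3 : ℝ) + ‖y.fst‖ ^ (1 / 3 : ℝ) := by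
    refine (Real.rpow_le_rpow (norm_nonneg _) (norm_add_le _ _) (by norm_num)).trans ?_
    exact Real.rpow_add_le_add_rpow (norm_nonneg _) (norm_nonneg _) (by norm_num) (by norm_num)
  have h2 : ‖(z + y).snd‖ ≤ ‖z.snd‖ + ‖y.snd‖ := norm_add_le _ _
  linarith

theorem anisoNorm_neg (z : Phase d) : anisoNorm (-z) = anisoNorm z := by
  simp [anisoNorm]

theorem norm_fst_le_anisoNorm (z : Phase d) : ‖z.fst‖ ≤ anisoNorm z ^ 3 := by
  have h : ‖z.fst‖ = (‖z.fst‖ ^ (1 / 3 : ℝ)) ^ 3 := by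
    rw [← Real.rpow_natCast, ← Real.rpow_mul (norm_nonneg _)]; norm_num
  rw [h]
  unfold anisoNorm
  gcongr
  linarith [norm_nonneg z.snd]

/-- The shear adds `u ξ_x` to `ξ_v`, and `|ξ_x|` is at most the cube of the anisotropic size.
Relative to the size itself the change is `|u|` times its square, which is the origin of the weight
`1 + u 2^{2i}`. -/
theorem anisoNorm_cotransport_le (u : ℝ) (z : Phase d) :
    anisoNorm (cotransport u z) ≤ anisoNorm z + |u| * anisoNorm z ^ 3 := by
  have h1 : ‖z.snd + u • z.fst‖ ≤ ‖z.snd‖ + |u| * anisoNorm z ^ 3 := by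
    refine (norm_add_le _ _).trans ?_
    rw [norm_smul, Real.norm_eq_abs]
    gcongr
    exact norm_fst_le_anisoNorm z
  unfold anisoNorm at h1 ⊢
  rw [cotransport_apply]
  simp only [WithLp.toLp_fst, WithLp.toLp_snd]
  linarith

/-- The anisotropic size of a frequency, in the normalization of the transform with the kernel
`exp (-i ⟨x, ξ⟩)`. -/
def freq (ξ : Phase d) : ℝ := anisoNorm ((2 * Real.pi) • ξ)

theorem freq_nonneg (ξ : Phase d) : 0 ≤ freq ξ := anisoNorm_nonneg _

theorem freq_dilate {r : ℝ} (hr : 0 ≤ r) (ξ : Phase d) : freq (dilate r ξ) = r * freq ξ := by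
  unfold freq
  rw [← anisoNorm_dilate hr, ← dilateL_apply, ← dilateL_apply, map_smul]

theorem freq_add_le (ξ η : Phase d) : freq (ξ + η) ≤ freq ξ + freq η := by
  unfold freq
  rw [smul_add]
  exact anisoNorm_add_le _ _

theorem freq_neg (ξ : Phase d) : freq (-ξ) = freq ξ := by
  unfold freq
  rw [smul_neg, anisoNorm_neg]

theorem freq_sub_le (ξ η : Phase d) : freq η - freq ξ ≤ freq (ξ + η) := by
  have h := freq_add_le (-ξ) (ξ + η)
  rw [neg_add_cancel_left, freq_neg] at h
  linarith

theorem freq_cotransport_le (u : ℝ) (ξ : Phase d) :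
    freq (cotransport u ξ) ≤ freq ξ + |u| * freq ξ ^ 3 := by
  unfold freq
  rw [← map_smul]
  exact anisoNorm_cotransport_le u _

theorem freq_le_cotransport (u : ℝ) (ξ : Phase d) :
    freq ξ ≤ freq (cotransport u ξ) + |u| * freq (cotransport u ξ) ^ 3 := by
  have := freq_cotransport_le (-u) (cotransport u ξ)
  rwa [cotransport_neg_cotransport, abs_neg] at this

theorem freq_zero : freq (0 : Phase d) = 0 := by
  simp [freq, anisoNorm]

theorem continuous_freq : Continuous (freq (d := d)) := by
  unfold freq anisoNorm
  have h1 : Continuous fun ξ : Phase d => ((2 * Real.pi) • ξ).fst := by fun_prop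
  have h2 : Continuous fun ξ : Phase d => ((2 * Real.pi) • ξ).snd := by fun_prop
  exact (h1.norm.rpow_const fun _ => Or.inr (by norm_num)).add h2.norm

/-! ### The symbols of the blocks as test functions -/

section symbols

variable {φ : Phase d → ℝ}

/-- The generating function of the dyadic blocks as a symbol. -/
def cutS (hφ : IsCutoff φ) : 𝓢(Phase d, ℂ) :=
  HasCompactSupport.toSchwartzMap (f := fun ξ => ((φ ((2 * Real.pi) • ξ) : ℝ) : ℂ))
    ((hφ.hasCompactSupport.comp_smul (by positivity)).comp_left (g := Complex.ofReal) rfl)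
    (Complex.ofRealCLM.contDiff.comp (hφ.smooth.comp (contDiff_const_smul _)))

theorem cutS_apply (hφ : IsCutoff φ) (ξ : Phase d) :
    cutS hφ ξ = ((φ ((2 * Real.pi) • ξ) : ℝ) : ℂ) := rfl

theorem cutS_eq_one (hφ : IsCutoff φ) {ξ : Phase d} (h : freq ξ ≤ 1 / 2) : cutS hφ ξ = 1 := by
  rw [cutS_apply, hφ.eq_one _ h, Complex.ofReal_one]

theorem cutS_eq_zero (hφ : IsCutoff φ) {ξ : Phase d} (h : 2 / 3 < freq ξ) : cutS hφ ξ = 0 := by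
  rw [cutS_apply, hφ.eq_zero _ h, Complex.ofReal_zero]

theorem sc_cutS_eq_one (hφ : IsCutoff φ) {r : ℝ} (hr : 0 < r) {ξ : Phase d}
    (h : r * freq ξ ≤ 1 / 2) : sc (cutS hφ) r ξ = 1 := by
  rw [sc_apply _ hr]
  exact cutS_eq_one hφ (by rwa [freq_dilate hr.le])

theorem sc_cutS_eq_zero (hφ : IsCutoff φ) {r : ℝ} (hr : 0 < r) {ξ : Phase d}
    (h : 2 / 3 < r * freq ξ) : sc (cutS hφ) r ξ = 0 := by
  rw [sc_apply _ hr]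
  exact cutS_eq_zero hφ (by rwa [freq_dilate hr.le])

/-- The symbol of the block `R_0`. -/
def annS (hφ : IsCutoff φ) : 𝓢(Phase d, ℂ) := sc (cutS hφ) 2⁻¹ - cutS hφ

theorem sc_sc (σ : 𝓢(Phase d, ℂ)) {r s : ℝ} (hr : 0 < r) (hs : 0 < s) :
    sc (sc σ r) s = sc σ (r * s) := by
  ext ξ
  rw [sc_apply _ hs, sc_apply _ hr, sc_apply _ (mul_pos hr hs), dilate_dilate]

theorem sc_sub (σ τ : 𝓢(Phase d, ℂ)) (r : ℝ) : sc (σ - τ) r = sc σ r - sc τ r := by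
  unfold sc
  split_ifs
  · exact map_sub _ _ _
  · simp

/-- The symbol of the block `R_j`. -/
def blockS (hφ : IsCutoff φ) (j : ℤ) : 𝓢(Phase d, ℂ) :=
  if 0 ≤ j then sc (annS hφ) (2 ^ (-j)) else if j = -1 then cutS hφ else 0

theorem blockS_apply (hφ : IsCutoff φ) (j : ℤ) (ξ : Phase d) :
    blockS hφ j ξ = ((dyadic φ j ((2 * Real.pi) • ξ) : ℝ) : ℂ) := by
  unfold blockS dyadic
  have hd (r : ℝ) : dilate r ((2 * Real.pi) • ξ) = (2 * Real.pi) • dilate r ξ := by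
    rw [← dilateL_apply, map_smul, dilateL_apply]
  split_ifs with h h'
  · rw [annS, sc_sub, sc_sc _ (by positivity) (by positivity)]
    change sc (cutS hφ) _ ξ - sc (cutS hφ) _ ξ = _
    rw [sc_apply _ (by positivity), sc_apply _ (by positivity), cutS_apply, cutS_apply, hd, hd,
      Complex.ofReal_sub, neg_add, zpow_add₀ two_ne_zero, mul_comm (2 ^ (-j))]
    simp
  · rfl
  · simp

theorem block_eq_fm (hφ : IsCutoff φ) (j : ℤ) : block φ j = fm (blockS hφ j) := by
  unfold block fm
  congr 1
  ext ξ
  exact (blockS_apply hφ j ξ).symm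

/-- The symbol of `S_k`. -/
def lowS (hφ : IsCutoff φ) (k : ℤ) : 𝓢(Phase d, ℂ) :=
  if 0 ≤ k then sc (cutS hφ) (2 ^ (-k)) else 0

/-- The differences that define the blocks telescope. -/
theorem sum_blockS (hφ : IsCutoff φ) (k : ℤ) :
    ∑ j ∈ Finset.Ico (-1) k, blockS hφ j = lowS hφ k := by
  rcases lt_or_ge k 0 with h | h
  · rw [Finset.Ico_eq_empty (by omega), Finset.sum_empty, lowS, if_neg (by omega)]
  · induction k, h using Int.leInduction with
    | base =>
      rw [show Finset.Ico (-1) (0 : ℤ) = {-1} from rfl, Finset.sum_singleton]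
      simp [lowS, sc_one, blockS]
    | succ k hk ih =>
      have : Finset.Ico (-1) (k + 1) = insert k (Finset.Ico (-1) k) := by
        ext x; simp only [Finset.mem_Ico, Finset.mem_insert]; omega
      rw [this, Finset.sum_insert (by simp), ih, lowS, lowS, if_pos hk, if_pos (by omega), blockS,
        if_pos hk, annS, sc_sub, sc_sc _ (by positivity) (by positivity), sub_add_cancel, neg_add,
        zpow_add₀ two_ne_zero, mul_comm (2 ^ (-k))]
      norm_num

theorem fm_add {σ τ : Phase d → ℂ} (hσ : σ.HasTemperateGrowth) (hτ : τ.HasTemperateGrowth)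
    (F : 𝓢'(Phase d, ℂ)) : fm (fun ξ => σ ξ + τ ξ) F = fm σ F + fm τ F := by
  ext ψ
  change F (𝓕 (SchwartzMap.smulLeftCLM ℂ (σ + τ) (𝓕⁻ ψ))) =
    F (𝓕 (SchwartzMap.smulLeftCLM ℂ σ (𝓕⁻ ψ))) + F (𝓕 (SchwartzMap.smulLeftCLM ℂ τ (𝓕⁻ ψ)))
  rw [SchwartzMap.smulLeftCLM_add hσ hτ, add_apply,
    FourierTransform.fourier_add, map_add]

theorem fm_schwartz_sum {ι : Type*} (s : Finset ι) (σ : ι → 𝓢(Phase d, ℂ)) (F : 𝓢'(Phase d, ℂ)) :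
    fm (∑ i ∈ s, σ i : 𝓢(Phase d, ℂ)) F = ∑ i ∈ s, fm (σ i) F := by
  classical
  induction s using Finset.induction_on with
  | empty =>
    rw [Finset.sum_empty, Finset.sum_empty]
    exact fm_zero F
  | insert a s ha ih =>
    rw [Finset.sum_insert ha, Finset.sum_insert ha, ← ih]
    exact fm_add (σ a).hasTemperateGrowth (∑ i ∈ s, σ i : 𝓢(Phase d, ℂ)).hasTemperateGrowth F

theorem lowFreq_eq_fm (hφ : IsCutoff φ) (k : ℤ) (F : 𝓢'(Phase d, ℂ)) :
    lowFreq φ k F = fm (lowS hφ k) F := by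
  rw [← sum_blockS hφ, fm_schwartz_sum]
  exact Finset.sum_congr rfl fun j _ => by rw [block_eq_fm hφ]

theorem block_of_lt {j : ℤ} (hφ : IsCutoff φ) (hj : j < -1) (F : 𝓢'(Phase d, ℂ)) :
    block φ j F = 0 := by
  rw [block_eq_fm hφ, blockS, if_neg (by omega), if_neg (by omega)]
  exact fm_zero F

/-- Outside the stated range the two cut-offs whose difference is the symbol are both `0` or both
`1`. The block `-1` is a ball, hence the lower bound only for `0 ≤ j`. -/
theorem freq_of_blockS_ne_zero (hφ : IsCutoff φ) {j : ℤ} {ξ : Phase d} (h : blockS hφ j ξ ≠ 0) :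
    freq ξ ≤ 2 ^ (j + 1) * (2 / 3) ∧ (0 ≤ j → 2 ^ (j - 1) < freq ξ) := by
  unfold blockS at h
  split_ifs at h with h0 h1
  · have hj : (0 : ℝ) < 2 ^ j := by positivity
    have e1 : (2 : ℝ) ^ (j + 1) = 2 ^ j * 2 := zpow_add_one₀ two_ne_zero j
    have e2 : (2 : ℝ) ^ (j - 1) = 2 ^ j * 2⁻¹ := zpow_sub_one₀ two_ne_zero j
    have e3 : (2 : ℝ) ^ (-j) = (2 ^ j)⁻¹ := zpow_neg 2 j
    rw [annS, sc_sub, sc_sc _ (by positivity) (by positivity)] at h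
    change sc (cutS hφ) _ ξ - sc (cutS hφ) _ ξ ≠ 0 at h
    rw [e1, e2]
    refine ⟨?_, fun _ => ?_⟩
    · by_contra! hc
      apply h
      rw [sc_cutS_eq_zero hφ (by positivity), sc_cutS_eq_zero hφ (by positivity), sub_zero]
      · rw [e3, inv_mul_eq_div, lt_div_iff₀ hj]; nlinarith
      · rw [e3, mul_assoc, inv_mul_eq_div (2 ^ j), inv_mul_eq_div, lt_div_iff₀ two_pos,
          lt_div_iff₀ hj]
        nlinarith
    · by_contra! hc
      apply h
      rw [sc_cutS_eq_one hφ (by positivity), sc_cutS_eq_one hφ (by positivity), sub_self]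
      · rw [e3, inv_mul_eq_div, div_le_iff₀ hj]; nlinarith
      · rw [e3, mul_assoc, inv_mul_eq_div (2 ^ j), inv_mul_eq_div, div_le_iff₀ two_pos,
          div_le_iff₀ hj]
        nlinarith
  · subst h1
    refine ⟨?_, fun h => absurd h (by norm_num)⟩
    by_contra! hc
    exact h (cutS_eq_zero hφ (by norm_num at hc; linarith))
  · exact absurd rfl h

theorem freq_of_lowS_ne_zero (hφ : IsCutoff φ) {k : ℤ} {ξ : Phase d} (h : lowS hφ k ξ ≠ 0) :
    0 ≤ k ∧ freq ξ ≤ 2 ^ k * (2 / 3) := by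
  unfold lowS at h
  split_ifs at h with h0
  · refine ⟨h0, ?_⟩
    by_contra! hc
    apply h
    refine sc_cutS_eq_zero hφ (by positivity) ?_
    rw [zpow_neg, inv_mul_eq_div, lt_div_iff₀ (by positivity)]
    linarith
  · exact absurd rfl h

/-- The profile of the enlarged annuli. -/
def fatAnn (hφ : IsCutoff φ) : 𝓢(Phase d, ℂ) := sc (cutS hφ) 4⁻¹ - sc (cutS hφ) 16

/-- The profiles of the enlarged blocks. -/
def fatP (hφ : IsCutoff φ) (i : ℤ) : 𝓢(Phase d, ℂ) :=
  if 0 ≤ i then fatAnn hφ else sc (cutS hφ) 4⁻¹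

/-- The symbols of the enlarged blocks. -/
def fatS (hφ : IsCutoff φ) (i : ℤ) : 𝓢(Phase d, ℂ) := sc (fatP hφ i) (2 ^ (-i))

/-- The constants come from the dilation factors of the profile: the outer cut-off is `1` up to `4 ·
2^i / 2`, and the inner one vanishes beyond `(2/3) · 2^i / 16 = 2^i / 24`. This leaves room both for
the blocks and for the products `S_{k-1} F R_k G`, whose frequencies exceed `2^k / 6`. -/
theorem fatS_eq_one (hφ : IsCutoff φ) {i : ℤ} {ξ : Phase d} (h1 : freq ξ ≤ 2 ^ (i + 1))
    (h2 : 0 ≤ i → 2 ^ i / 24 < freq ξ) : fatS hφ i ξ = 1 := by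
  have hi : (0 : ℝ) < 2 ^ i := by positivity
  have e1 : (2 : ℝ) ^ (i + 1) = 2 ^ i * 2 := zpow_add_one₀ two_ne_zero i
  have e3 : (2 : ℝ) ^ (-i) = (2 ^ i)⁻¹ := zpow_neg 2 i
  have key : sc (cutS hφ) (4⁻¹ * 2 ^ (-i)) ξ = 1 := by
    refine sc_cutS_eq_one hφ (by positivity) ?_
    rw [e3, mul_assoc, inv_mul_eq_div, inv_mul_eq_div, div_le_iff₀ (by norm_num), div_le_iff₀ hi]
    linarith
  unfold fatS fatP
  split_ifs with h0
  · rw [fatAnn, sc_sub, sc_sc _ (by positivity) (by positivity),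
      sc_sc _ (by positivity) (by positivity)]
    change sc (cutS hφ) _ ξ - sc (cutS hφ) _ ξ = 1
    rw [key, sc_cutS_eq_zero hφ (by positivity), sub_zero]
    rw [e3, mul_assoc, inv_mul_eq_div, mul_div_assoc', lt_div_iff₀ hi]
    linarith [h2 h0]
  · rw [sc_sc _ (by positivity) (by positivity), key]

theorem freq_of_fatS_ne_zero (hφ : IsCutoff φ) {i : ℤ} {ξ : Phase d} (h : fatS hφ i ξ ≠ 0) :
    freq ξ ≤ 2 ^ (i + 2) ∧ (0 ≤ i → 2 ^ (i - 5) < freq ξ) := by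
  have hi : (0 : ℝ) < 2 ^ i := by positivity
  have e1 : (2 : ℝ) ^ (i + 2) = 2 ^ i * 4 := by rw [zpow_add₀ two_ne_zero]; norm_num
  have e2 : (2 : ℝ) ^ (i - 5) = 2 ^ i / 32 := by rw [zpow_sub₀ two_ne_zero]; norm_num
  have e3 : (2 : ℝ) ^ (-i) = (2 ^ i)⁻¹ := zpow_neg 2 i
  have key : 2 ^ i * 4 < freq ξ → sc (cutS hφ) (4⁻¹ * 2 ^ (-i)) ξ = 0 := fun hc => by
    refine sc_cutS_eq_zero hφ (by positivity) ?_
    rw [e3, mul_assoc, inv_mul_eq_div, inv_mul_eq_div, lt_div_iff₀ (by norm_num), lt_div_iff₀ hi]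
    linarith
  unfold fatS fatP at h
  rw [e1, e2]
  split_ifs at h with h0
  · rw [fatAnn, sc_sub, sc_sc _ (by positivity) (by positivity),
      sc_sc _ (by positivity) (by positivity)] at h
    change sc (cutS hφ) _ ξ - sc (cutS hφ) _ ξ ≠ 0 at h
    refine ⟨?_, fun _ => ?_⟩
    · by_contra! hc
      apply h
      rw [key hc, sc_cutS_eq_zero hφ (by positivity), sub_zero]
      rw [e3, mul_assoc, inv_mul_eq_div, mul_div_assoc', lt_div_iff₀ hi]
      linarith
    · by_contra! hc
      apply h
      rw [sc_cutS_eq_one hφ (by positivity), sc_cutS_eq_one hφ (by positivity), sub_self]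
      · rw [e3, mul_assoc, inv_mul_eq_div, mul_div_assoc', div_le_iff₀ hi]
        linarith
      · rw [e3, mul_assoc, inv_mul_eq_div, inv_mul_eq_div, div_le_iff₀ (by norm_num),
          div_le_iff₀ hi]
        linarith
  · rw [sc_sc _ (by positivity) (by positivity)] at h
    refine ⟨?_, fun h => absurd h h0⟩
    by_contra! hc
    exact h (key hc)

theorem fatS_mul_blockS (hφ : IsCutoff φ) (j : ℤ) (ξ : Phase d) :
    fatS hφ j ξ * blockS hφ j ξ = blockS hφ j ξ := by
  by_cases h : blockS hφ j ξ = 0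
  · rw [h, mul_zero]
  · obtain ⟨h1, h2⟩ := freq_of_blockS_ne_zero hφ h
    have hj : (0 : ℝ) < 2 ^ j := by positivity
    have e1 : (2 : ℝ) ^ (j + 1) = 2 ^ j * 2 := zpow_add_one₀ two_ne_zero j
    have e2 : (2 : ℝ) ^ (j - 1) = 2 ^ j * 2⁻¹ := zpow_sub_one₀ two_ne_zero j
    rw [fatS_eq_one hφ, one_mul]
    · linarith
    · intro h0
      have := h2 h0
      linarith

/-- The parabolic weight `1 + u 2^{2i}`. -/
def wt (u : ℝ) (i : ℤ) : ℝ := 1 + u * 2 ^ (2 * i)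

theorem one_le_wt {u : ℝ} (hu : 0 ≤ u) (i : ℤ) : 1 ≤ wt u i := by
  unfold wt
  have : 0 ≤ u * (2 : ℝ) ^ (2 * i) := by positivity
  linarith

/-- The enlarged block `i` and the transported block `j` meet only if `2^{|j - i|}` is bounded in
terms of `1 + u 2^{2i}`. -/
theorem two_zpow_abs_le_of_ne_zero (hφ : IsCutoff φ) {i j : ℤ} (hi : -1 ≤ i) (hj : -1 ≤ j) {u : ℝ}
    (hu : 0 ≤ u) {ξ : Phase d} (h1 : fatS hφ i ξ ≠ 0)
    (h2 : blockS hφ j (cotransport u ξ) ≠ 0) : (2 : ℝ) ^ |j - i| ≤ 2 ^ 10 * wt u i := by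
  obtain ⟨a1, a2⟩ := freq_of_fatS_ne_zero hφ h1
  obtain ⟨b1, b2⟩ := freq_of_blockS_ne_zero hφ h2
  have c1 := freq_cotransport_le u ξ
  have c2 := freq_le_cotransport u ξ
  rw [abs_of_nonneg hu] at c1 c2
  set a := freq ξ
  set b := freq (cotransport u ξ)
  have ha : 0 ≤ a := freq_nonneg _
  have hb : 0 ≤ b := freq_nonneg _
  have hI : (0 : ℝ) < 2 ^ i := by positivity
  have hJ : (0 : ℝ) < 2 ^ j := by positivity
  have e1 : (2 : ℝ) ^ (i + 2) = 2 ^ i * 4 := by rw [zpow_add₀ two_ne_zero]; norm_num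
  have e2 : (2 : ℝ) ^ (i - 5) = 2 ^ i / 32 := by rw [zpow_sub₀ two_ne_zero]; norm_num
  have e3 : (2 : ℝ) ^ (j + 1) = 2 ^ j * 2 := zpow_add_one₀ two_ne_zero j
  have e4 : (2 : ℝ) ^ (j - 1) = 2 ^ j * 2⁻¹ := zpow_sub_one₀ two_ne_zero j
  have e5 : (2 : ℝ) ^ (2 * i) = 2 ^ i * 2 ^ i := by rw [two_mul, zpow_add₀ two_ne_zero]
  rw [e1] at a1
  rw [e2] at a2
  rw [e3] at b1
  rw [e4] at b2
  unfold wt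
  rw [e5]
  set I : ℝ := 2 ^ i
  set J : ℝ := 2 ^ j
  -- For `i < j` the size `b` exceeds `J / 2`, while `b ≤ a + u a³` with `a ≤ 4 I`; this gives the
  -- bound on `J / I`. If `j = -1` there is no lower bound on `b`, but then `i = j`.
  rcases le_total i j with hij | hij
  · rw [abs_of_nonneg (by omega), zpow_sub₀ two_ne_zero, div_le_iff₀ hI]
    rcases lt_or_ge j 0 with hj0 | hj0
    · have : j = i := by omega
      have hJI : J = I := by simp only [J, I, this]
      have h0 : 0 ≤ u * (I * I) := by positivity
      change J ≤ _
      rw [hJI]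
      nlinarith
    · have h3 := b2 hj0
      have h4 : u * a ^ 3 ≤ u * (I * 4) ^ 3 := by gcongr
      nlinarith
  · rcases eq_or_lt_of_le hij with hij' | hij'
    · have hJI : J = I := by simp only [J, I, hij']
      rw [hij', sub_self, abs_zero, zpow_zero]
      have h0 : 0 ≤ u * (I * I) := by positivity
      linarith
    -- Here `0 ≤ i`, so `a > I / 32`; the inverse shear gives `a ≤ b + u b³` with `b ≤ 2 J`.
    · rw [abs_of_nonpos (by omega), neg_sub, zpow_sub₀ two_ne_zero, div_le_iff₀ hJ]
      have h3 := a2 (by omega)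
      have hb3 : b ≤ 2 * J := by linarith
      have h4 : u * b ^ 3 ≤ u * (2 * J) ^ 3 := by gcongr
      have hJI : J ≤ I := zpow_le_zpow_right₀ (by norm_num) hij
      have h5 : u * (J * J) * J ≤ u * (I * I) * J := by gcongr
      nlinarith

/-- The frequencies of the product `S_{k-1} F R_k G` meet the block `j` only if `|j - k| ≤ 2`. -/
theorem abs_sub_le_two_of_ne_zero (hφ : IsCutoff φ) {j k : ℤ} (hj : -1 ≤ j) {ξ η : Phase d}
    (h1 : lowS hφ (k - 1) ξ ≠ 0) (h2 : blockS hφ k η ≠ 0) (h3 : blockS hφ j (ξ + η) ≠ 0) :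
    |j - k| ≤ 2 := by
  obtain ⟨a0, a1⟩ := freq_of_lowS_ne_zero hφ h1
  obtain ⟨b1, b2⟩ := freq_of_blockS_ne_zero hφ h2
  obtain ⟨c1, c2⟩ := freq_of_blockS_ne_zero hφ h3
  have f1 := freq_add_le ξ η
  have f2 := freq_sub_le ξ η
  have b3 := b2 (by omega)
  have e1 : (2 : ℝ) ^ (k + 1) = 2 ^ k * 2 := zpow_add_one₀ two_ne_zero k
  have e2 : (2 : ℝ) ^ (k - 1) = 2 ^ k * 2⁻¹ := zpow_sub_one₀ two_ne_zero k
  have e3 : (2 : ℝ) ^ (j + 1) = 2 ^ j * 2 := zpow_add_one₀ two_ne_zero j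
  have e4 : (2 : ℝ) ^ (j - 1) = 2 ^ j * 2⁻¹ := zpow_sub_one₀ two_ne_zero j
  have hK : (0 : ℝ) < 2 ^ k := by positivity
  have hJ : (0 : ℝ) < 2 ^ j := by positivity
  rw [e2] at a1 b3
  rw [e1] at b1
  rw [e3] at c1
  rw [abs_le]
  constructor
  · have h : (2 : ℝ) ^ k < 2 ^ (j + 3) := by
      have : (2 : ℝ) ^ (j + 3) = 2 ^ j * 8 := by rw [zpow_add₀ two_ne_zero]; norm_num
      rw [this]; linarith
    have := (zpow_lt_zpow_iff_right₀ (by norm_num : (1 : ℝ) < 2)).1 h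
    omega
  · rcases lt_or_ge j 0 with hj0 | hj0
    · omega
    · have c3 := c2 hj0
      rw [e4] at c3
      have h : (2 : ℝ) ^ j < 2 ^ (k + 2) := by
        have : (2 : ℝ) ^ (k + 2) = 2 ^ k * 4 := by rw [zpow_add₀ two_ne_zero]; norm_num
        rw [this]; linarith
      have := (zpow_lt_zpow_iff_right₀ (by norm_num : (1 : ℝ) < 2)).1 h
      omega

/-- The enlarged block contains the frequencies of `S_{k-1} F R_k G`. -/
theorem fatS_add_eq_one (hφ : IsCutoff φ) {k : ℤ} {ξ η : Phase d}
    (h1 : lowS hφ (k - 1) ξ ≠ 0) (h2 : blockS hφ k η ≠ 0) : fatS hφ k (ξ + η) = 1 := by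
  obtain ⟨a0, a1⟩ := freq_of_lowS_ne_zero hφ h1
  obtain ⟨b1, b2⟩ := freq_of_blockS_ne_zero hφ h2
  have f1 := freq_add_le ξ η
  have f2 := freq_sub_le ξ η
  have b3 := b2 (by omega)
  have e1 : (2 : ℝ) ^ (k + 1) = 2 ^ k * 2 := zpow_add_one₀ two_ne_zero k
  have e2 : (2 : ℝ) ^ (k - 1) = 2 ^ k * 2⁻¹ := zpow_sub_one₀ two_ne_zero k
  have hK : (0 : ℝ) < 2 ^ k := by positivity
  rw [e2] at a1 b3
  rw [e1] at b1
  refine fatS_eq_one hφ (by rw [e1]; linarith) fun _ => by linarith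

/-! ### Division by a homogeneous symbol -/

/-- A symbol which is homogeneous of degree six and vanishes only at the origin. -/
def hom (ξ : Phase d) : ℂ := ((‖ξ.snd‖ ^ 2) ^ 3 + ‖ξ.fst‖ ^ 2 : ℝ)

theorem hom_dilate (r : ℝ) (ξ : Phase d) : hom (dilate r ξ) = ((r ^ 6 : ℝ) : ℂ) * hom ξ := by
  unfold hom dilate
  rw [← Complex.ofReal_mul]
  congr 1
  simp only [WithLp.toLp_fst, WithLp.toLp_snd, norm_smul, mul_pow, Real.norm_eq_abs, sq_abs]
  ring

theorem hasTemperateGrowth_hom : Function.HasTemperateGrowth (hom (d := d)) := by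
  have h1 : (fun z : Phase d => ‖WithLp.fstL 2 ℝ (EuclideanSpace ℝ (Fin d))
      (EuclideanSpace ℝ (Fin d)) z‖ ^ 2).HasTemperateGrowth :=
    (Function.hasTemperateGrowth_norm_sq _).comp (ContinuousLinearMap.hasTemperateGrowth _)
  have h2 : (fun z : Phase d => ‖WithLp.sndL 2 ℝ (EuclideanSpace ℝ (Fin d))
      (EuclideanSpace ℝ (Fin d)) z‖ ^ 2).HasTemperateGrowth :=
    (Function.hasTemperateGrowth_norm_sq _).comp (ContinuousLinearMap.hasTemperateGrowth _)
  exact Function.Complex.hasTemperateGrowth_ofReal.comp ((h2.pow 3).add h1)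

theorem hom_ne_zero {ξ : Phase d} (h : ξ ≠ 0) : hom ξ ≠ 0 := by
  unfold hom
  rw [Complex.ofReal_ne_zero]
  intro h0
  have h1 : ‖ξ.fst‖ ^ 2 = 0 := by nlinarith [sq_nonneg ‖ξ.fst‖, pow_nonneg (sq_nonneg ‖ξ.snd‖) 3]
  have h2 : (‖ξ.snd‖ ^ 2) ^ 3 = 0 := by linarith
  have h3 : ‖ξ.snd‖ ^ 2 = 0 := by simpa using h2
  apply h
  rw [← norm_eq_zero, ← sq_eq_zero_iff, WithLp.prod_norm_sq_eq_of_L2]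
  linarith

theorem hasCompactSupport_sc_cutS (hφ : IsCutoff φ) {r : ℝ} (hr : 0 < r) :
    HasCompactSupport (sc (cutS hφ) r : Phase d → ℂ) := by
  have h : HasCompactSupport (cutS hφ : Phase d → ℂ) :=
    (hφ.hasCompactSupport.comp_smul (by positivity)).comp_left (g := Complex.ofReal) rfl
  have h2 := h.comp_isClosedEmbedding (dilateE r hr.ne').toHomeomorph.isClosedEmbedding
  have h3 : (sc (cutS hφ) r : Phase d → ℂ) =
      cutS hφ ∘ (dilateE (d := d) r hr.ne').toHomeomorph := by
    funext ξ
    rw [sc_apply _ hr]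
    rfl
  rw [h3]
  exact h2

/-- The profile of the annuli is divisible by powers of the homogeneous symbol. -/
theorem exists_fatAnn_eq (hφ : IsCutoff φ) (m : ℕ) :
    ∃ τ : 𝓢(Phase d, ℂ), ∀ ξ, fatAnn hφ ξ = hom ξ ^ m * τ ξ := by
  have hs : ContDiff ℝ ∞ (fun ξ : Phase d => fatAnn hφ ξ / hom ξ ^ m) := by
    have hm : ContDiff ℝ ∞ (fun ξ : Phase d => hom ξ ^ m) :=
      ContDiff.pow hasTemperateGrowth_hom.1 m
    rw [contDiff_iff_contDiffAt]
    intro ξ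
    -- The quotient is smooth at the origin because the profile vanishes nearby: for sizes below
    -- `1/32` both cut-offs, even the one dilated by `16`, equal `1`.
    by_cases h : ξ = 0
    · have hz : (fun ξ : Phase d => fatAnn hφ ξ / hom ξ ^ m) =ᶠ[nhds ξ] fun _ => 0 := by
        have : ∀ᶠ η in nhds ξ, freq η < 1 / 32 := by
          refine continuous_freq.continuousAt.eventually_lt continuousAt_const ?_
          rw [h, freq_zero]; norm_num
        filter_upwards [this] with η hη
        rw [fatAnn]
        change (sc (cutS hφ) _ η - sc (cutS hφ) _ η) / _ = 0
        rw [sc_cutS_eq_one hφ (by norm_num) (by linarith),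
          sc_cutS_eq_one hφ (by norm_num) (by linarith), sub_self, zero_div]
      exact contDiffAt_const.congr_of_eventuallyEq hz
    · simp_rw [div_eq_mul_inv]
      exact ((fatAnn hφ).smooth ⊤).contDiffAt.mul
        (hm.contDiffAt.inv (pow_ne_zero m (hom_ne_zero h)))
  have hc : HasCompactSupport (fun ξ : Phase d => fatAnn hφ ξ / hom ξ ^ m) := by
    have h1 : HasCompactSupport (fatAnn hφ : Phase d → ℂ) :=
      (hasCompactSupport_sc_cutS hφ (by norm_num : (0 : ℝ) < 4⁻¹)).sub
        (hasCompactSupport_sc_cutS hφ (by norm_num : (0 : ℝ) < 16))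
    simp_rw [div_eq_mul_inv]
    exact h1.mul_right
  refine ⟨hc.toSchwartzMap hs, fun ξ => ?_⟩
  change _ = hom ξ ^ m * (fatAnn hφ ξ / hom ξ ^ m)
  by_cases h : ξ = 0
  · have : fatAnn hφ ξ = 0 := by
      rw [fatAnn]
      change sc (cutS hφ) _ ξ - sc (cutS hφ) _ ξ = 0
      rw [h, sc_cutS_eq_one hφ (by norm_num) (by rw [freq_zero]; norm_num),
        sc_cutS_eq_one hφ (by norm_num) (by rw [freq_zero]; norm_num), sub_self]
    rw [this, zero_div, mul_zero]
  · rw [mul_div_cancel₀ _ (pow_ne_zero m (hom_ne_zero h))]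

end symbols

/-! ### Convergence of the Littlewood-Paley decomposition -/

theorem norm_schwartz_sub_le (σ : 𝓢(Phase d, ℂ)) :
    ∃ L : ℝ, 0 ≤ L ∧ ∀ x y, ‖σ y - σ x‖ ≤ L * ‖y - x‖ := by
  refine ⟨SchwartzMap.seminorm ℝ 0 1 σ, apply_nonneg _ _, fun x y => ?_⟩
  refine Convex.norm_image_sub_le_of_norm_fderiv_le (𝕜 := ℝ) (s := univ)
    (fun z _ => σ.differentiableAt) (fun z _ => ?_) convex_univ (mem_univ x) (mem_univ y)
  have := SchwartzMap.norm_iteratedFDeriv_le_seminorm ℝ σ 1 z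
  rwa [norm_iteratedFDeriv_one] at this

theorem norm_dilateL_le {r : ℝ} (hr : 0 ≤ r) (hr1 : r ≤ 1) : ‖dilateL (d := d) r‖ ≤ r :=
  ContinuousLinearMap.opNorm_le_bound _ hr fun z => norm_dilate_le_of_le_one hr hr1 z

/-- Order zero gains the factor `r` from the mean value inequality, at the price of `|x|`; order `n
≥ 1` gains `r^n ≤ r` from the chain rule, since the dilation has norm at most `r`. The growth `1 +
|x|` is later absorbed by Schwartz decay. -/
theorem norm_iteratedFDeriv_sc_sub_one_le {σ : 𝓢(Phase d, ℂ)} (hσ : σ 0 = 1) (n : ℕ) :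
    ∃ B : ℝ, 0 ≤ B ∧ ∀ r, 0 < r → r ≤ 1 → ∀ x,
      ‖iteratedFDeriv ℝ n (fun x => sc σ r x - 1) x‖ ≤ B * r * (1 + ‖x‖) := by
  have hfun (r : ℝ) (hr : 0 < r) : (fun x => sc σ r x - 1) = fun x => σ (dilateL r x) - 1 := by
    funext x
    rw [sc_apply _ hr, dilateL_apply]
  rcases Nat.eq_zero_or_pos n with rfl | hn
  · obtain ⟨L, hL, h⟩ := norm_schwartz_sub_le σ
    refine ⟨L, hL, fun r hr hr1 x => ?_⟩
    rw [norm_iteratedFDeriv_zero, sc_apply _ hr, ← hσ]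
    refine (h 0 _).trans ?_
    rw [sub_zero, mul_assoc]
    gcongr
    refine (norm_dilate_le_of_le_one hr.le hr1 x).trans ?_
    gcongr
    linarith
  · refine ⟨SchwartzMap.seminorm ℝ 0 n σ, apply_nonneg _ _, fun r hr hr1 x => ?_⟩
    have hs : ContDiff ℝ n σ := σ.smooth n
    have hs' : ContDiff ℝ n (σ ∘ dilateL r) := hs.comp (dilateL r).contDiff
    rw [hfun r hr, show (fun x => σ (dilateL r x) - 1) = (σ ∘ dilateL r) - fun _ => (1 : ℂ) from rfl,
      iteratedFDeriv_sub_apply hs'.contDiffAt contDiffAt_const, iteratedFDeriv_const_of_ne hn.ne',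
      Pi.zero_apply, sub_zero, ContinuousLinearMap.iteratedFDeriv_comp_right _ hs _ le_rfl]
    refine (ContinuousMultilinearMap.norm_compContinuousLinearMap_le _ _).trans ?_
    rw [Finset.prod_const, Finset.card_univ, Fintype.card_fin, mul_assoc]
    refine mul_le_mul (SchwartzMap.norm_iteratedFDeriv_le_seminorm ℝ σ n _) ?_ (by positivity)
      (apply_nonneg _ _)
    calc ‖dilateL (d := d) r‖ ^ n ≤ r ^ n := by gcongr; exact norm_dilateL_le hr.le hr1
      _ ≤ r := pow_le_of_le_one hr.le hr1 hn.ne'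
      _ ≤ r * (1 + ‖x‖) := le_mul_of_one_le_right hr.le (by linarith [norm_nonneg x])

/-- By the Leibniz rule every Schwartz seminorm of the difference is of order `r`. This is
convergence of the low frequency cut-offs on test functions, seen on the Fourier side. -/
theorem tendsto_smulLeftCLM_sc {σ : 𝓢(Phase d, ℂ)} (hσ : σ 0 = 1) {r : ℕ → ℝ}
    (hr : ∀ n, 0 < r n) (hr1 : ∀ n, r n ≤ 1) (hr0 : Filter.Tendsto r Filter.atTop (nhds 0))
    (χ : 𝓢(Phase d, ℂ)) :
    Filter.Tendsto (fun n => SchwartzMap.smulLeftCLM ℂ (sc σ (r n)) χ) Filter.atTop (nhds χ) := by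
  rw [(schwartz_withSeminorms ℝ (Phase d) ℂ).tendsto_nhds]
  rintro ⟨k, n⟩ ε hε
  choose B hB0 hB using norm_iteratedFDeriv_sc_sub_one_le hσ
  set K : ℝ := ∑ i ∈ Finset.range (n + 1), (n.choose i : ℝ) * B i *
    (2 ^ (k + 1) * (Finset.Iic (k + 1, n - i)).sup
      (fun m => SchwartzMap.seminorm ℝ (E := Phase d) (F := ℂ) m.1 m.2) χ) with hK
  have hK0 : 0 ≤ K := Finset.sum_nonneg fun i _ => mul_nonneg (mul_nonneg (by positivity) (hB0 i))
    (mul_nonneg (by positivity) (apply_nonneg _ _))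
  have hb (j : ℕ) : SchwartzMap.seminorm ℝ k n (SchwartzMap.smulLeftCLM ℂ (sc σ (r j)) χ - χ) ≤
      r j * K := by
    refine SchwartzMap.seminorm_le_bound ℝ k n _ (mul_nonneg (hr j).le hK0) fun x => ?_
    have e : ⇑(SchwartzMap.smulLeftCLM ℂ (sc σ (r j)) χ - χ) =
        fun x => (sc σ (r j) x - 1) * χ x := by
      funext y
      change SchwartzMap.smulLeftCLM ℂ (sc σ (r j)) χ y - χ y = _
      rw [SchwartzMap.smulLeftCLM_apply_apply (sc σ (r j)).hasTemperateGrowth, smul_eq_mul]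
      ring
    have h1 : ContDiff ℝ n (fun x => sc σ (r j) x - 1) := ((sc σ (r j)).smooth n).sub contDiff_const
    rw [e]
    refine (mul_le_mul_of_nonneg_left (norm_iteratedFDeriv_mul_le h1 (χ.smooth n) x le_rfl)
      (by positivity)).trans ?_
    rw [Finset.mul_sum, hK, Finset.mul_sum]
    refine Finset.sum_le_sum fun i hi => ?_
    have h2 := hB i (r j) (hr j) (hr1 j) x
    have h3 := SchwartzMap.one_add_le_sup_seminorm_apply (𝕜 := ℝ) (m := (k + 1, n - i)) le_rfl
      le_rfl χ x
    have h4 : ‖x‖ ^ k ≤ (1 + ‖x‖) ^ k := by gcongr; linarith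
    have hrj := (hr j).le
    have hBi := hB0 i
    calc _ ≤ (1 + ‖x‖) ^ k * ((n.choose i : ℝ) * (B i * r j * (1 + ‖x‖)) *
          ‖iteratedFDeriv ℝ (n - i) χ x‖) := by gcongr
      _ = r j * ((n.choose i : ℝ) * B i *
          ((1 + ‖x‖) ^ (k + 1) * ‖iteratedFDeriv ℝ (n - i) χ x‖)) := by rw [pow_succ]; ring
      _ ≤ _ := by gcongr
  have h0 : Filter.Tendsto (fun j => r j * K) Filter.atTop (nhds 0) := by
    simpa using hr0.mul_const K
  filter_upwards [h0.eventually_lt_const hε] with j hj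
  exact (hb j).trans_lt hj

section littlewoodPaley

variable {φ : Phase d → ℝ}

theorem tendsto_dm_lowS (hφ : IsCutoff φ) (ψ : 𝓢(Phase d, ℂ)) :
    Filter.Tendsto (fun n : ℕ => dm (lowS hφ n) ψ) Filter.atTop (nhds ψ) := by
  have h1 : cutS hφ 0 = 1 := cutS_eq_one hφ (by rw [freq_zero]; norm_num)
  have hr : Filter.Tendsto (fun n : ℕ => ((1 : ℝ) / 2) ^ n) Filter.atTop (nhds 0) :=
    tendsto_pow_atTop_nhds_zero_of_lt_one (by norm_num) (by norm_num)
  have h := tendsto_smulLeftCLM_sc h1 (fun n => by positivity)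
    (fun n => pow_le_one₀ (by norm_num) (by norm_num)) hr (𝓕⁻ ψ)
  have h2 := ((FourierTransform.fourierCLE ℂ 𝓢(Phase d, ℂ)).continuous.tendsto (𝓕⁻ ψ)).comp h
  have e : (FourierTransform.fourierCLE ℂ 𝓢(Phase d, ℂ)) (𝓕⁻ ψ) = ψ := by
    rw [FourierTransform.fourierCLE_apply, FourierTransform.fourier_fourierInv_eq]
  rw [e] at h2
  refine h2.congr fun n => ?_
  have e2 : (2 : ℝ) ^ (-(n : ℤ)) = (1 / 2) ^ n := by
    rw [zpow_neg, zpow_natCast, one_div, inv_pow]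
  rw [dm_eq, lowS, if_pos (by positivity), e2]
  rfl

theorem tendsto_fm_lowS (hφ : IsCutoff φ) (F : 𝓢'(Phase d, ℂ)) (ψ : 𝓢(Phase d, ℂ)) :
    Filter.Tendsto (fun n : ℕ => fm (lowS hφ n) F ψ) Filter.atTop (nhds (F ψ)) :=
  (F.continuous.tendsto ψ).comp (tendsto_dm_lowS hφ ψ)

theorem fm_fatS_blockS (hφ : IsCutoff φ) (j : ℤ) (F : 𝓢'(Phase d, ℂ)) :
    fm (fatS hφ j) (fm (blockS hφ j) F) = fm (blockS hφ j) F := by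
  rw [fm_fm (fatS hφ j).hasTemperateGrowth (blockS hφ j).hasTemperateGrowth]
  congr 2
  funext ξ
  exact fatS_mul_blockS hφ j ξ

/-- The quantity that controls the action of distributions of finite regularity. -/
def testNorm (m : ℕ) (w : Phase d → ℝ) (ψ : 𝓢(Phase d, ℂ)) : ℝ :=
  wnorm w (dm (fun ξ => hom ξ ^ m) ψ) + wnorm w ψ

theorem testNorm_nonneg (m : ℕ) {w : Phase d → ℝ} (hw : IsWeight w) (ψ : 𝓢(Phase d, ℂ)) :
    0 ≤ testNorm m w ψ := add_nonneg (wnorm_nonneg hw _) (wnorm_nonneg hw _)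

theorem tendsto_testNorm (m : ℕ) {w : Phase d → ℝ} (hw : IsWeight w) {ι : Type*} {l : Filter ι}
    {χ : ι → 𝓢(Phase d, ℂ)} (h : Filter.Tendsto χ l (nhds 0)) :
    Filter.Tendsto (fun i => testNorm m w (χ i)) l (nhds 0) := by
  have h1 := ((dm (d := d) (fun ξ => hom ξ ^ m)).continuous.tendsto 0).comp h
  rw [map_zero] at h1
  simpa [testNorm] using (tendsto_wnorm hw h1).add (tendsto_wnorm hw h)

theorem hasTemperateGrowth_hom_pow (m : ℕ) :
    Function.HasTemperateGrowth (fun ξ : Phase d => hom ξ ^ m) :=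
  hasTemperateGrowth_hom.pow m

/-- For `0 ≤ j` the symbol is `2^{-6mj} τ(2^{-j} ξ) hom(ξ)^m` with a Schwartz function `τ`, and the
power of `hom` is moved to the test function. For `j = -1` there is nothing to divide by, but the
power of two is at least `1`, so boundedness suffices. -/
theorem exists_wnorm_dm_fatS_le (hφ : IsCutoff φ) {w : Phase d → ℝ} (hw : IsWeight w) (m : ℕ) :
    ∃ C : ℝ, 0 ≤ C ∧ ∀ j : ℤ, -1 ≤ j → ∀ ψ : 𝓢(Phase d, ℂ),
      wnorm w (dm (fatS hφ j) ψ) ≤ C * (2 ^ (-(6 * m : ℝ) * j)) * testNorm m w ψ := by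
  obtain ⟨τ, hτ⟩ := exists_fatAnn_eq hφ m
  obtain ⟨C, hC, h⟩ := exists_bd_fm_sc hw τ 1
  obtain ⟨C', hC', h'⟩ := exists_bd_fm_sc hw (fatP hφ (-1)) 2
  refine ⟨max C C', le_max_of_le_left hC, fun j hj ψ => ?_⟩
  have h0 : 0 ≤ testNorm m w ψ := testNorm_nonneg m hw ψ
  rcases lt_or_ge j 0 with hj0 | hj0
  · obtain rfl : j = -1 := by omega
    have h1 := (h' 2 two_pos le_rfl).1 ψ
    have h2 : (1 : ℝ) ≤ 2 ^ (-(6 * m : ℝ) * ((-1 : ℤ) : ℝ)) :=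
      Real.one_le_rpow (by norm_num) (by push_cast; linarith [(Nat.cast_nonneg m : (0 : ℝ) ≤ m)])
    rw [fatS, neg_neg, zpow_one]
    refine h1.trans ?_
    refine mul_le_mul ?_ ?_ (wnorm_nonneg hw _) (by positivity)
    · exact (le_max_right C C').trans (le_mul_of_one_le_right (le_max_of_le_left hC) h2)
    · exact le_add_of_nonneg_left (wnorm_nonneg hw _)
  · have hr : (0 : ℝ) < 2 ^ (-j) := by positivity
    have hr1 : (2 : ℝ) ^ (-j) ≤ 1 := zpow_le_one_of_nonpos₀ (by norm_num) (by omega)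
    have e : dm (fatS hφ j) ψ = (((2 : ℝ) ^ (-(6 * m : ℝ) * j) : ℝ) : ℂ) •
        dm (sc τ (2 ^ (-j))) (dm (fun ξ => hom ξ ^ m) ψ) := by
      apply ext_fourierInv
      intro ξ
      rw [FourierTransform.fourierInv_smul]
      change _ = (((2 : ℝ) ^ (-(6 * m : ℝ) * j) : ℝ) : ℂ) • 𝓕⁻ (dm (sc τ (2 ^ (-j))) (dm (fun ξ => hom ξ ^ m) ψ)) ξ
      rw [fourierInv_dm (fatS hφ j).hasTemperateGrowth,
        fourierInv_dm (sc τ (2 ^ (-j))).hasTemperateGrowth,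
        fourierInv_dm (hasTemperateGrowth_hom_pow m), fatS, fatP, if_pos hj0, sc_apply _ hr,
        sc_apply _ hr, hτ, hom_dilate, smul_eq_mul, mul_pow, ← Complex.ofReal_pow, ← pow_mul,
        ← zpow_natCast, ← zpow_mul, ← Real.rpow_intCast]
      push_cast
      ring_nf
    rw [e, wnorm_smul, Complex.norm_real, Real.norm_of_nonneg (by positivity), mul_comm (max C C'),
      mul_assoc]
    refine mul_le_mul_of_nonneg_left ?_ (by positivity)
    refine ((h _ hr hr1).1 _).trans ?_
    refine mul_le_mul (le_max_left _ _) ?_ (wnorm_nonneg hw _) (le_max_of_le_left hC)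
    exact le_add_of_nonneg_right (wnorm_nonneg hw _)

/-! ### Summation of distributions with frequencies in the enlarged blocks -/

/-- A summable majorant on `ℤ`. -/
def geo (j : ℤ) : ℝ := (1 / 2) ^ j.natAbs

theorem geo_nonneg (j : ℤ) : 0 ≤ geo j := by unfold geo; positivity

theorem geo_neg (j : ℤ) : geo (-j) = geo j := by rw [geo, geo, Int.natAbs_neg]

theorem hasSum_geo : HasSum geo 3 := by
  have h1 : HasSum (fun n : ℕ => geo n) 2 := by
    simpa [geo] using hasSum_geometric_two
  have h2 : HasSum (fun n : ℕ => geo (-(n + 1 : ℤ))) 1 := by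
    have h : HasSum (fun n : ℕ => (1 / 2 : ℝ) * (1 / 2) ^ n) (1 / 2 * 2) :=
      hasSum_geometric_two.mul_left _
    rw [show (1 / 2 * 2 : ℝ) = 1 by norm_num] at h
    refine h.congr_fun fun n => ?_
    rw [geo_neg, ← pow_succ', geo]
    norm_cast
  have := HasSum.of_nat_of_neg_add_one h1 h2
  norm_num at this
  exact this

theorem hasSum_geo_sub (i : ℤ) : HasSum (fun j => geo (j - i)) 3 :=
  ((Equiv.subRight i).hasSum_iff (f := geo) (a := 3)).2 hasSum_geo

theorem hasSum_distribution_iff {ι : Type*} {G : ι → 𝓢'(Phase d, ℂ)} {H : 𝓢'(Phase d, ℂ)} :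
    HasSum G H ↔ ∀ ψ : 𝓢(Phase d, ℂ), HasSum (fun i => G i ψ) (H ψ) := by
  unfold HasSum
  rw [PointwiseConvergenceCLM.tendsto_iff_forall_tendsto]
  refine forall_congr' fun ψ => ?_
  refine Filter.tendsto_congr fun s => ?_
  change (PointwiseConvergenceCLM.coeLMₛₗ (RingHom.id ℂ) 𝓢(Phase d, ℂ) ℂ (∑ i ∈ s, G i)) ψ = _
  rw [map_sum, LinearMap.sum_apply]
  rfl

/-- A linear functional which is bounded by `testNorm` is a tempered distribution. -/
theorem exists_distribution_of_le {w : Phase d → ℝ} (hw : IsWeight w) {m : ℕ} {C : ℝ}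
    (f : 𝓢(Phase d, ℂ) →ₗ[ℂ] ℂ) (h : ∀ ψ, ‖f ψ‖ ≤ C * testNorm m w ψ) :
    ∃ G : 𝓢'(Phase d, ℂ), ∀ ψ, G ψ = f ψ := by
  have hc : Continuous f := by
    refine continuous_of_continuousAt_zero f ?_
    rw [ContinuousAt, map_zero]
    refine squeeze_zero_norm h ?_
    simpa using (tendsto_testNorm m hw (Filter.tendsto_id (x := nhds 0))).const_mul C
  exact ⟨ContinuousLinearMap.toPointwiseConvergenceCLM ℂ (RingHom.id ℂ) _ _ ⟨f, hc⟩, fun ψ => rfl⟩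

/-- A sequence of distributions of the size `M 2^{-bi}` with frequencies in the enlarged
blocks. -/
structure IsDecomp (hφ : IsCutoff φ) (w : Phase d → ℝ) (M b : ℝ)
    (G : ℤ → 𝓢'(Phase d, ℂ)) : Prop where
  fat : ∀ i, fm (fatS hφ i) (G i) = G i
  bd : ∀ i : ℤ, Bd w (M * 2 ^ (-b * i)) (G i)
  zero : ∀ i : ℤ, i < -1 → G i = 0

/-- The regularity `b` may be very negative, so `m` is taken so large that `b + 6m ≥ 1`; the decay
gained on the test function then beats the growth of the pieces. The additional factor `2` in the
constant accounts for `i = -1`. -/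
theorem exists_decomp_apply_le (hφ : IsCutoff φ) {w : Phase d → ℝ} (hw : IsWeight w) (b : ℝ) :
    ∃ m : ℕ, ∃ C : ℝ, 0 ≤ C ∧ ∀ M G, 0 ≤ M → IsDecomp hφ w M b G →
      ∀ (i : ℤ) (ψ : 𝓢(Phase d, ℂ)), ‖G i ψ‖ ≤ C * M * testNorm m w ψ * geo i := by
  obtain ⟨m, hm⟩ := exists_nat_ge (1 - b)
  obtain ⟨C, hC, h⟩ := exists_wnorm_dm_fatS_le hφ hw m
  refine ⟨m, 2 ^ (b + 6 * m + 1) * C, by positivity, fun M G hM hG i ψ => ?_⟩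
  have h0 := testNorm_nonneg m hw ψ
  rcases lt_or_ge i (-1) with hi | hi
  · rw [hG.zero i hi]
    change ‖(0 : ℂ)‖ ≤ _
    have := geo_nonneg i
    rw [norm_zero]
    positivity
  · have h1 : G i ψ = G i (dm (fatS hφ i) ψ) := by
      conv_lhs => rw [← hG.fat i, fm_apply]
    have key : (2 : ℝ) ^ (-b * i) * 2 ^ (-(6 * m : ℝ) * i) ≤ 2 ^ (b + 6 * m + 1) * geo i := by
      have hgeo : geo i = 2 ^ (-(|i| : ℤ) : ℝ) := by
        rw [geo, one_div, inv_pow, ← Real.rpow_natCast, Real.rpow_neg (by norm_num)]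
        congr 2
        rw [Nat.cast_natAbs]
      rw [hgeo, ← Real.rpow_add two_pos, ← Real.rpow_add two_pos]
      refine Real.rpow_le_rpow_of_exponent_le (by norm_num) ?_
      have hm' : 1 ≤ b + 6 * m := by nlinarith [(Nat.cast_nonneg m : (0 : ℝ) ≤ m)]
      have hi' : (-1 : ℝ) ≤ i := by exact_mod_cast hi
      have h3 : ((|i| : ℤ) : ℝ) ≤ i + 2 := by
        exact_mod_cast (by rw [abs_le]; omega : |i| ≤ i + 2)
      nlinarith
    rw [h1]
    calc _ ≤ M * 2 ^ (-b * i) * wnorm w (dm (fatS hφ i) ψ) := hG.bd i _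
      _ ≤ M * 2 ^ (-b * i) * (C * (2 ^ (-(6 * m : ℝ) * i)) * testNorm m w ψ) := by
          gcongr; exact h i hi ψ
      _ = C * M * testNorm m w ψ * (2 ^ (-b * i) * 2 ^ (-(6 * m : ℝ) * i)) := by ring
      _ ≤ C * M * testNorm m w ψ * (2 ^ (b + 6 * m + 1) * geo i) := by gcongr
      _ = _ := by ring

theorem exists_decomp_hasSum (hφ : IsCutoff φ) {w : Phase d → ℝ} (hw : IsWeight w) (b : ℝ) :
    ∃ m : ℕ, ∃ C : ℝ, 0 ≤ C ∧ ∀ M G, 0 ≤ M → IsDecomp hφ w M b G →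
      (∀ (i : ℤ) (ψ : 𝓢(Phase d, ℂ)), ‖G i ψ‖ ≤ C * M * testNorm m w ψ * geo i) ∧
      (∀ H, HasSum G H → ∀ ψ, ‖H ψ‖ ≤ 3 * (C * M * testNorm m w ψ)) ∧ ∃ H, HasSum G H := by
  obtain ⟨m, C, hC, h⟩ := exists_decomp_apply_le hφ hw b
  refine ⟨m, C, hC, fun M G hM hG => ⟨h M G hM hG, ?_, ?_⟩⟩
  · intro H hH ψ
    rw [mul_comm 3]
    exact (hasSum_distribution_iff.1 hH ψ).norm_le_of_bounded (hasSum_geo.mul_left _)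
      (h M G hM hG · ψ)
  · have hs (ψ : 𝓢(Phase d, ℂ)) : Summable fun i => G i ψ :=
      .of_norm_bounded (hasSum_geo.mul_left (C * M * testNorm m w ψ)).summable (h M G hM hG · ψ)
    let f : 𝓢(Phase d, ℂ) →ₗ[ℂ] ℂ :=
      { toFun := fun ψ => ∑' i, G i ψ
        map_add' := fun ψ χ => by
          simp_rw [map_add]
          exact (hs ψ).tsum_add (hs χ)
        map_smul' := fun c ψ => by
          simp_rw [map_smul]
          exact tsum_const_smul'' c }
    obtain ⟨H, hH⟩ := exists_distribution_of_le hw (C := 3 * (C * M)) (m := m) f fun ψ => by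
      have := (hs ψ).hasSum.norm_le_of_bounded
        (hasSum_geo.mul_left (C * M * testNorm m w ψ)) (h M G hM hG · ψ)
      calc _ ≤ _ := this
        _ = _ := by ring
    exact ⟨H, hasSum_distribution_iff.2 fun ψ => by rw [hH]; exact (hs ψ).hasSum⟩

/-- The blocks of `F` have the size `M 2^{-bj}`. -/
def BlockBd (hφ : IsCutoff φ) (w : Phase d → ℝ) (M b : ℝ) (F : 𝓢'(Phase d, ℂ)) : Prop :=
  ∀ j : ℤ, Bd w (M * 2 ^ (-b * j)) (fm (blockS hφ j) F)

theorem fm_blockS_of_lt (hφ : IsCutoff φ) {j : ℤ} (hj : j < -1) (F : 𝓢'(Phase d, ℂ)) :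
    fm (blockS hφ j) F = 0 := by
  rw [← block_eq_fm]
  exact block_of_lt hφ hj F

theorem BlockBd.isDecomp {hφ : IsCutoff φ} {w : Phase d → ℝ} {M b : ℝ} {F : 𝓢'(Phase d, ℂ)}
    (h : BlockBd hφ w M b F) : IsDecomp hφ w M b (fun j => fm (blockS hφ j) F) where
  fat i := fm_fatS_blockS hφ i F
  bd := h
  zero _ hi := fm_blockS_of_lt hφ hi F

theorem sum_fm_blockS (hφ : IsCutoff φ) (k : ℤ) (F : 𝓢'(Phase d, ℂ)) :
    ∑ j ∈ Finset.Ico (-1) k, fm (blockS hφ j) F = fm (lowS hφ k) F := by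
  rw [← sum_blockS hφ, fm_schwartz_sum]

/-- The bounds give unconditional convergence to some distribution. Its identity is decided along
integer intervals, where the partial sums are `S_n F` and tend to `F`. -/
theorem BlockBd.hasSum {hφ : IsCutoff φ} {w : Phase d → ℝ} (hw : IsWeight w) {M b : ℝ}
    (hM : 0 ≤ M) {F : 𝓢'(Phase d, ℂ)} (h : BlockBd hφ w M b F) :
    HasSum (fun j => fm (blockS hφ j) F) F := by
  obtain ⟨m, C, hC, hd⟩ := exists_decomp_hasSum hφ hw b
  obtain ⟨-, -, H, hH⟩ := hd M _ hM h.isDecomp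
  convert hH
  ext ψ
  refine tendsto_nhds_unique (tendsto_fm_lowS hφ F ψ) ?_
  have h1 : Filter.Tendsto (fun n : ℕ => Finset.Ico (-(n : ℤ) - 1) n) Filter.atTop
      Filter.atTop := by
    refine Filter.tendsto_atTop_finset_of_monotone (fun a b hab => ?_) fun x => ?_
    · refine Finset.Ico_subset_Ico ?_ ?_ <;> omega
    · exact ⟨x.natAbs + 1, by simp only [Finset.mem_Ico]; omega⟩
  have h2 := (hasSum_distribution_iff.1 hH ψ).comp h1
  refine h2.congr fun n => ?_
  rw [← sum_fm_blockS hφ]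
  change _ = (PointwiseConvergenceCLM.coeLMₛₗ (RingHom.id ℂ) 𝓢(Phase d, ℂ) ℂ
    (∑ i ∈ Finset.Ico (-1) (n : ℤ), fm (blockS hφ i) F)) ψ
  rw [map_sum, LinearMap.sum_apply]
  symm
  refine Finset.sum_subset (Finset.Ico_subset_Ico (by omega) le_rfl) fun j hj hj' => ?_
  simp only [Finset.mem_Ico] at hj hj'
  change fm (blockS hφ j) F ψ = 0
  rw [fm_blockS_of_lt hφ (by omega)]
  rfl

/-- The remainder of the Littlewood-Paley decomposition. -/
theorem BlockBd.sub_lowS {hφ : IsCutoff φ} {w : Phase d → ℝ} (hw : IsWeight w) {M b : ℝ}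
    (hM : 0 ≤ M) (hb : 0 < b) {F : 𝓢'(Phase d, ℂ)} (h : BlockBd hφ w M b F) {k : ℤ}
    (hk : -1 ≤ k) :
    Bd w ((1 - 2 ^ (-b))⁻¹ * M * 2 ^ (-b * k)) (F - fm (lowS hφ k) F) := by
  have hq : (2 : ℝ) ^ (-b) < 1 := Real.rpow_lt_one_of_one_lt_of_neg (by norm_num) (by linarith)
  have hq0 : (0 : ℝ) < 2 ^ (-b) := by positivity
  -- The estimate is a geometric sum for `S_n F - S_k F`, uniform in `n`; it survives the limit `n →
  -- ∞` on each test function.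
  have key (n : ℕ) (hn : k ≤ n) : Bd w ((1 - 2 ^ (-b))⁻¹ * M * 2 ^ (-b * k))
      (fm (lowS hφ n) F - fm (lowS hφ k) F) := by
    have e : fm (lowS hφ n) F - fm (lowS hφ k) F =
        ∑ j ∈ Finset.range (n - k).toNat, fm (blockS hφ (k + j)) F := by
      obtain ⟨l, hl⟩ : ∃ l : ℕ, (n : ℤ) = k + l := ⟨(n - k).toNat, by omega⟩
      have hl' : ((n : ℤ) - k).toNat = l := by omega
      rw [hl', hl]
      clear hl hl' hn n
      induction l with
      | zero => simp
      | succ l ih =>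
        rw [Finset.sum_range_succ, ← ih, ← sum_fm_blockS hφ (k + (l + 1 : ℕ)),
          ← sum_fm_blockS hφ (k + l)]
        have : Finset.Ico (-1) (k + (l + 1 : ℕ)) =
            insert (k + (l : ℤ)) (Finset.Ico (-1) (k + (l : ℤ))) := by
          ext x; simp only [Finset.mem_Ico, Finset.mem_insert]; push_cast; omega
        rw [this, Finset.sum_insert (by simp)]
        abel
    rw [e]
    refine (Bd.sum fun (j : ℕ) _ => h (k + (j : ℤ))).mono hw ?_
    have e2 (j : ℕ) : M * (2 : ℝ) ^ (-b * ((k + j : ℤ) : ℝ)) =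
        M * 2 ^ (-b * k) * ((2 : ℝ) ^ (-b)) ^ j := by
      rw [← Real.rpow_natCast, ← Real.rpow_mul two_pos.le, mul_assoc, ← Real.rpow_add two_pos]
      push_cast
      ring_nf
    simp_rw [e2]
    have hs : ∑ j ∈ Finset.range (n - k).toNat, ((2 : ℝ) ^ (-b)) ^ j ≤ (1 - 2 ^ (-b))⁻¹ :=
      sum_le_hasSum _ (fun _ _ => by positivity) (hasSum_geometric_of_lt_one hq0.le hq)
    rw [← Finset.mul_sum]
    calc _ ≤ M * 2 ^ (-b * (k : ℝ)) * (1 - 2 ^ (-b))⁻¹ := by gcongr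
      _ = _ := by ring
  intro ψ
  have hlim : Filter.Tendsto (fun n : ℕ => ‖fm (lowS hφ n) F ψ - fm (lowS hφ k) F ψ‖)
      Filter.atTop (nhds ‖F ψ - fm (lowS hφ k) F ψ‖) :=
    ((tendsto_fm_lowS hφ F ψ).sub_const _).norm
  refine le_of_tendsto hlim ?_
  filter_upwards [Filter.eventually_ge_atTop k.toNat] with n hn
  exact key n (by omega) ψ

end littlewoodPaley

/-! ### Mollification -/

instance properSpace_phase : ProperSpace (Phase d) := FiniteDimensional.proper ℝ _

theorem one_add_norm_le_mul {V : Type} [NormedAddCommGroup V] (x y : V) :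
    1 + ‖x‖ ≤ (1 + ‖x + y‖) * (1 + ‖y‖) := by
  have h : ‖x‖ ≤ ‖x + y‖ + ‖y‖ := by simpa using norm_sub_le (x + y) y
  nlinarith [norm_nonneg (x + y), norm_nonneg y, mul_nonneg (norm_nonneg (x + y)) (norm_nonneg y)]

theorem exists_schwartz_decay {V : Type} [NormedAddCommGroup V] [NormedSpace ℝ V] {E : Type}
    [NormedAddCommGroup E] [NormedSpace ℝ E] (K : 𝓢(V, E)) (L : ℕ) :
    ∃ B : ℝ, 0 ≤ B ∧ ∀ x, (1 + ‖x‖) ^ L * ‖K x‖ ≤ B := by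
  refine ⟨2 ^ L * (Finset.Iic (L, 0)).sup (fun m => SchwartzMap.seminorm ℝ m.1 m.2) K,
    mul_nonneg (by positivity) (apply_nonneg _ _), fun x => ?_⟩
  have := SchwartzMap.one_add_le_sup_seminorm_apply (𝕜 := ℝ) (m := (L, 0)) le_rfl le_rfl K x
  simpa using this

/-! ### Convolutions of Schwartz functions with functions of polynomial growth -/

section convFn

variable {V : Type} [NormedAddCommGroup V] [InnerProductSpace ℝ V] [FiniteDimensional ℝ V]
  [MeasurableSpace V] [BorelSpace V] {E : Type} [NormedAddCommGroup E] [NormedSpace ℝ E]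

variable (V) in
theorem exists_integrable_pow :
    ∃ n : ℕ, Integrable (fun z : V => ((1 + ‖z‖) ^ n)⁻¹) volume := by
  refine ⟨(volume : Measure V).integrablePower,
    (Measure.integrable_pow_neg_integrablePower (volume : Measure V)).congr
    (.of_forall fun z => ?_)⟩
  simp only
  rw [Real.rpow_neg (by positivity), Real.rpow_natCast]

/-- A bound for the integrand of a convolution which is locally uniform in the parameter. -/
theorem exists_integrand_bound (K : 𝓢(V, E)) {C : ℝ} (hC : 0 ≤ C) (N : ℕ) :
    ∃ L : ℕ, ∃ g : V → ℝ, Integrable g volume ∧ (∀ y, 0 ≤ g y) ∧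
      ∀ z y, C * (1 + ‖y‖) ^ N * ‖K (z - y)‖ ≤ (1 + ‖z‖) ^ L * g y := by
  obtain ⟨n, hn⟩ := exists_integrable_pow V
  obtain ⟨B, hB, h⟩ := exists_schwartz_decay K (N + n)
  refine ⟨N + n, fun y => C * B * ((1 + ‖y‖) ^ n)⁻¹, hn.const_mul _, fun y => by positivity,
    fun z y => ?_⟩
  have h1 : (1 + ‖y‖) ^ (N + n) ≤ ((1 + ‖z - y‖) * (1 + ‖z‖)) ^ (N + n) := by
    gcongr
    have := one_add_norm_le_mul (-y) z
    rwa [norm_neg, neg_add_eq_sub] at this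
  have h2 : (1 + ‖y‖) ^ N = (1 + ‖y‖) ^ (N + n) * ((1 + ‖y‖) ^ n)⁻¹ := by
    rw [pow_add]; field_simp
  calc _ = C * ((1 + ‖y‖) ^ (N + n) * ((1 + ‖y‖) ^ n)⁻¹) * ‖K (z - y)‖ := by rw [h2]
    _ ≤ C * (((1 + ‖z - y‖) * (1 + ‖z‖)) ^ (N + n) * ((1 + ‖y‖) ^ n)⁻¹) * ‖K (z - y)‖ := by gcongr
    _ = C * ((1 + ‖z‖) ^ (N + n)) * ((1 + ‖y‖) ^ n)⁻¹ *
        ((1 + ‖z - y‖) ^ (N + n) * ‖K (z - y)‖) := by rw [mul_pow]; ring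
    _ ≤ C * ((1 + ‖z‖) ^ (N + n)) * ((1 + ‖y‖) ^ n)⁻¹ * B := by gcongr; exact h _
    _ = _ := by ring

/-- The convolution of a Schwartz function and a function of polynomial growth. -/
def convFn (K : 𝓢(V, E)) (u : V → ℝ) (z : V) : E := ∫ y, u y • K (z - y)

theorem aestronglyMeasurable_conv (K : 𝓢(V, E)) {u : V → ℝ}
    (hu : AEStronglyMeasurable u volume) (z : V) :
    AEStronglyMeasurable (fun y => u y • K (z - y)) volume :=
  hu.smul (K.continuous.comp (continuous_const.sub continuous_id)).aestronglyMeasurable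

theorem norm_convFn_le (K : 𝓢(V, E)) {u : V → ℝ} {C : ℝ} (hC : 0 ≤ C) {N : ℕ}
    (hb : ∀ᵐ y, ‖u y‖ ≤ C * (1 + ‖y‖) ^ N) :
    ∃ L : ℕ, ∃ B : ℝ, ∀ z, ‖convFn K u z‖ ≤ B * (1 + ‖z‖) ^ L := by
  obtain ⟨L, g, hg, hg0, h⟩ := exists_integrand_bound K hC N
  refine ⟨L, ∫ y, g y, fun z => ?_⟩
  rw [mul_comm, ← integral_const_mul]
  refine norm_integral_le_of_norm_le (hg.const_mul _) ?_
  filter_upwards [hb] with y hy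
  rw [norm_smul]
  refine le_trans ?_ (h z y)
  gcongr

theorem hasFDerivAt_convFn (K : 𝓢(V, E)) {u : V → ℝ}
    (hu : AEStronglyMeasurable u volume) {C : ℝ} (hC : 0 ≤ C) {N : ℕ}
    (hb : ∀ᵐ y, ‖u y‖ ≤ C * (1 + ‖y‖) ^ N) (z₀ : V) :
    HasFDerivAt (convFn K u) (convFn (SchwartzMap.fderivCLM ℝ (V) E K) u z₀) z₀ := by
  obtain ⟨L, g, hg, hg0, h⟩ := exists_integrand_bound (SchwartzMap.fderivCLM ℝ (V) E K) hC N
  obtain ⟨L', g', hg', hg0', h'⟩ := exists_integrand_bound K hC N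
  refine hasFDerivAt_integral_of_dominated_of_fderiv_le (𝕜 := ℝ)
    (bound := fun y => (1 + (‖z₀‖ + 1)) ^ L * g y) (s := Metric.ball z₀ 1)
    (F' := fun z y => u y • SchwartzMap.fderivCLM ℝ (V) E K (z - y))
    (Metric.ball_mem_nhds z₀ one_pos) (.of_forall fun z => aestronglyMeasurable_conv K hu z) ?_
    (aestronglyMeasurable_conv _ hu z₀) ?_ (hg.const_mul _) (.of_forall fun y z _ => ?_)
  · refine (hg'.const_mul ((1 + ‖z₀‖) ^ L')).mono' (aestronglyMeasurable_conv K hu z₀) ?_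
    filter_upwards [hb] with y hy
    rw [norm_smul]
    refine le_trans ?_ (h' z₀ y)
    gcongr
  · filter_upwards [hb] with y hy z hz
    rw [norm_smul]
    have h1 : ‖z‖ ≤ ‖z₀‖ + 1 := by
      have := norm_le_norm_add_norm_sub' z z₀
      rw [Metric.mem_ball, dist_eq_norm] at hz
      linarith
    have h2 := hg0 y
    calc _ ≤ C * (1 + ‖y‖) ^ N * ‖SchwartzMap.fderivCLM ℝ (V) E K (z - y)‖ := by gcongr
      _ ≤ (1 + ‖z‖) ^ L * g y := h z y
      _ ≤ _ := by gcongr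
  · have h1 : HasFDerivAt (fun z => K (z - y)) (fderiv ℝ K (z - y)) z :=
      (hasFDerivAt_comp_sub y).2 (K.hasFDerivAt (z - y))
    exact h1.const_smul (u y)

/-- The derivative of a convolution is the convolution with the derivative of `K`, whose values are
linear maps. The induction on the order therefore has to quantify over all target spaces. -/
theorem convFn_contDiff_aux {u : V → ℝ} (hu : AEStronglyMeasurable u volume) {C : ℝ}
    (hC : 0 ≤ C) {N : ℕ} (hb : ∀ᵐ y, ‖u y‖ ≤ C * (1 + ‖y‖) ^ N) (n : ℕ) :
    ∀ (E : Type) [NormedAddCommGroup E] [NormedSpace ℝ E]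
      (K : 𝓢(V, E)), ContDiff ℝ n (convFn K u) ∧
        ∃ L : ℕ, ∃ B : ℝ, ∀ z, ‖iteratedFDeriv ℝ n (convFn K u) z‖ ≤ B * (1 + ‖z‖) ^ L := by
  induction n with
  | zero =>
    intro E _ _ K
    have h0 : Continuous (convFn K u) := continuous_iff_continuousAt.2 fun z =>
      (hasFDerivAt_convFn K hu hC hb z).continuousAt
    obtain ⟨L, B, h1⟩ := norm_convFn_le K hC hb
    refine ⟨by rw [Nat.cast_zero]; exact contDiff_zero.2 h0, L, B, fun z => ?_⟩
    rw [norm_iteratedFDeriv_zero]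
    exact h1 z
  | succ n ih =>
    intro E _ _ K
    have hf : fderiv ℝ (convFn K u) = convFn (SchwartzMap.fderivCLM ℝ (V) E K) u :=
      funext fun z => (hasFDerivAt_convFn K hu hC hb z).fderiv
    obtain ⟨h1, h2⟩ := ih _ (SchwartzMap.fderivCLM ℝ (V) E K)
    constructor
    · rw [Nat.cast_add, Nat.cast_one, contDiff_succ_iff_fderiv]
      refine ⟨fun z => (hasFDerivAt_convFn K hu hC hb z).differentiableAt, by simp, ?_⟩
      rw [hf]; exact h1
    · simp_rw [← norm_iteratedFDeriv_fderiv, hf]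
      exact h2

theorem hasTemperateGrowth_convFn (K : 𝓢(V, ℂ)) {u : V → ℝ}
    (hu : AEStronglyMeasurable u volume) {C : ℝ} (hC : 0 ≤ C) {N : ℕ}
    (hb : ∀ᵐ y, ‖u y‖ ≤ C * (1 + ‖y‖) ^ N) : (convFn K u).HasTemperateGrowth := by
  refine ⟨contDiff_infty.2 fun n => (convFn_contDiff_aux hu hC hb n ℂ K).1, fun n => ?_⟩
  obtain ⟨L, B, h⟩ := (convFn_contDiff_aux hu hC hb n ℂ K).2
  exact ⟨L, B, h⟩

theorem integrable_conv (K : 𝓢(V, E))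
    {u : V → ℝ} (hu : AEStronglyMeasurable u volume) {C : ℝ} (hC : 0 ≤ C) {N : ℕ}
    (hb : ∀ᵐ y, ‖u y‖ ≤ C * (1 + ‖y‖) ^ N) (z : V) :
    Integrable (fun y => u y • K (z - y)) volume := by
  obtain ⟨L, g, hg, hg0, h⟩ := exists_integrand_bound K hC N
  refine (hg.const_mul ((1 + ‖z‖) ^ L)).mono' (aestronglyMeasurable_conv K hu z) ?_
  filter_upwards [hb] with y hy
  rw [norm_smul]
  refine le_trans ?_ (h z y)
  gcongr

/-- Real and imaginary parts of `u` are treated separately, because the induction for `convFn` lets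
a real function act by scalars on arbitrary real normed spaces. -/
theorem hasTemperateGrowth_conv (K : 𝓢(V, ℂ)) {u : V → ℂ}
    (hu : AEStronglyMeasurable u volume) {C : ℝ} (hC : 0 ≤ C) {N : ℕ}
    (hb : ∀ᵐ y, ‖u y‖ ≤ C * (1 + ‖y‖) ^ N) :
    Function.HasTemperateGrowth fun z => ∫ y, u y * K (z - y) := by
  have hre : AEStronglyMeasurable (fun y => (u y).re) volume :=
    Complex.continuous_re.comp_aestronglyMeasurable hu
  have him : AEStronglyMeasurable (fun y => (u y).im) volume :=
    Complex.continuous_im.comp_aestronglyMeasurable hu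
  have hbre : ∀ᵐ y, ‖(u y).re‖ ≤ C * (1 + ‖y‖) ^ N := by
    filter_upwards [hb] with y hy using (Complex.abs_re_le_norm _).trans hy
  have hbim : ∀ᵐ y, ‖(u y).im‖ ≤ C * (1 + ‖y‖) ^ N := by
    filter_upwards [hb] with y hy using (Complex.abs_im_le_norm _).trans hy
  have e : (fun z => ∫ y, u y * K (z - y)) =
      convFn K (fun y => (u y).re) + (fun _ => Complex.I) * convFn K (fun y => (u y).im) := by
    funext z
    change _ = (∫ y, (u y).re • K (z - y)) + Complex.I * ∫ y, (u y).im • K (z - y)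
    rw [← integral_const_mul, ← integral_add (integrable_conv K hre hC hbre z)
      ((integrable_conv K him hC hbim z).const_mul _)]
    refine integral_congr_ae (.of_forall fun y => ?_)
    simp only [Complex.real_smul]
    conv_lhs => rw [← Complex.re_add_im (u y)]
    ring
  rw [e]
  exact (hasTemperateGrowth_convFn K hre hC hbre).add
    ((Function.HasTemperateGrowth.const _).mul (hasTemperateGrowth_convFn K him hC hbim))

end convFn

/-- The kernel `y ↦ 𝓕⁻ τ (z - y)`. -/
def kern (τ : 𝓢(Phase d, ℂ)) (z : Phase d) : 𝓢(Phase d, ℂ) := compSubConstCLM ℂ z (𝓕 τ)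

theorem fourier_eq_fourierInv_neg (τ : 𝓢(Phase d, ℂ)) (x : Phase d) : 𝓕 τ x = 𝓕⁻ τ (-x) := by
  rw [SchwartzMap.fourier_coe, SchwartzMap.fourierInv_coe, Real.fourierInv_eq_fourier_neg, neg_neg]

theorem kern_apply (τ : 𝓢(Phase d, ℂ)) (z y : Phase d) : kern τ z y = 𝓕⁻ τ (z - y) := by
  rw [kern, compSubConstCLM_apply, fourier_eq_fourierInv_neg, neg_sub]

theorem fourierInv_kern (τ : 𝓢(Phase d, ℂ)) (z ξ : Phase d) :
    𝓕⁻ (kern τ z) ξ = Complex.exp (((2 * Real.pi * inner ℝ ξ z : ℝ) : ℂ) * Complex.I) * τ ξ := by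
  have := fourierInv_translate (𝓕 τ) (-z) ξ
  rw [neg_neg] at this
  rw [kern, this, FourierTransform.fourierInv_fourier_eq, inner_neg_right]
  congr 4
  ring

theorem kern_add (τ τ' : 𝓢(Phase d, ℂ)) (z : Phase d) : kern (τ + τ') z = kern τ z + kern τ' z := by
  unfold kern
  rw [FourierTransform.fourier_add, map_add]

theorem dm_kern (σ τ ρ : 𝓢(Phase d, ℂ)) (h : ∀ ξ, σ ξ * τ ξ = ρ ξ) (z : Phase d) :
    dm σ (kern τ z) = kern ρ z := by
  apply ext_fourierInv
  intro ξ
  rw [fourierInv_dm σ.hasTemperateGrowth, fourierInv_kern, fourierInv_kern, ← h]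
  ring

/-- The function which represents `fm τ F`. -/
def mollify (τ : 𝓢(Phase d, ℂ)) (F : 𝓢'(Phase d, ℂ)) (z : Phase d) : ℂ := F (kern τ z)

theorem mollify_add (τ τ' : 𝓢(Phase d, ℂ)) (F : 𝓢'(Phase d, ℂ)) (z : Phase d) :
    mollify (τ + τ') F z = mollify τ F z + mollify τ' F z := by
  rw [mollify, kern_add, map_add]; rfl

theorem mollify_zero (F : 𝓢'(Phase d, ℂ)) (z : Phase d) : mollify 0 F z = 0 := by
  have := mollify_add 0 0 F z
  simpa using this

theorem mollify_sum {ι : Type*} (s : Finset ι) (τ : ι → 𝓢(Phase d, ℂ)) (F : 𝓢'(Phase d, ℂ))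
    (z : Phase d) : mollify (∑ i ∈ s, τ i) F z = ∑ i ∈ s, mollify (τ i) F z := by
  classical
  induction s using Finset.induction_on with
  | empty => simp [mollify_zero]
  | insert a s ha ih => rw [Finset.sum_insert ha, Finset.sum_insert ha, mollify_add, ih]

theorem mollify_fm (σ τ ρ : 𝓢(Phase d, ℂ)) (h : ∀ ξ, σ ξ * τ ξ = ρ ξ) (F : 𝓢'(Phase d, ℂ))
    (z : Phase d) : mollify τ (fm σ F) z = mollify ρ F z := by
  rw [mollify, mollify, fm_apply, dm_kern σ τ ρ h]

theorem mollify_eq_conv (τ : 𝓢(Phase d, ℂ)) {F : 𝓢'(Phase d, ℂ)} {u : Phase d → ℂ}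
    (hu : IsRep F u) : mollify τ F = fun z => ∫ y, u y * 𝓕⁻ τ (z - y) := by
  funext z
  rw [mollify, (hu.2 _).2]
  refine integral_congr_ae (.of_forall fun y => ?_)
  simp only [kern_apply, mul_comm]

/-- This is what makes the functions `S_{k-1} F` multipliers of test functions, so that their
products with arbitrary distributions are defined by duality. -/
theorem Bd.hasTemperateGrowth_mollify {w : Phase d → ℝ} (hw : IsWeight w) {M : ℝ} (hM : 0 ≤ M)
    {F : 𝓢'(Phase d, ℂ)} (h : Bd w M F) (τ : 𝓢(Phase d, ℂ)) :
    (mollify τ F).HasTemperateGrowth := by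
  obtain ⟨u, hu, hb⟩ := h.exists_rep hw hM
  obtain ⟨C, N, hC, hN⟩ := hw.le_pow
  rw [mollify_eq_conv τ hu]
  refine hasTemperateGrowth_conv _ hu.1 (mul_nonneg hM hC) (N := N) ?_
  filter_upwards [hb] with y hy
  refine hy.trans ?_
  rw [mul_assoc]
  gcongr
  exact hN y

theorem exists_wnorm_kern_le {w : Phase d → ℝ} (hw : IsWeight w) :
    ∃ C : ℝ, ∃ N : ℕ, 0 ≤ C ∧ ∀ (g : Phase d → ℂ) (z : Phase d),
      Integrable (fun y => (1 + ‖y‖) ^ N * ‖g y‖) volume →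
      wnorm w (fun y => g (z - y)) ≤ C * (∫ y, (1 + ‖y‖) ^ N * ‖g y‖) * w z := by
  obtain ⟨C, N, hC, h⟩ := hw.moderate
  refine ⟨C, N, hC, fun g z hg => ?_⟩
  have e : wnorm w (fun y => g (z - y)) = ∫ y, ‖g y‖ * w (z - y) := by
    rw [wnorm, ← integral_sub_left_eq_self (fun y => ‖g y‖ * w (z - y)) volume z]
    simp only [sub_sub_cancel]
  rw [e, ← integral_const_mul, ← integral_mul_const]
  refine integral_mono_of_nonneg (.of_forall fun y => ?_) ((hg.const_mul C).mul_const _)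
    (.of_forall fun y => ?_)
  · exact mul_nonneg (norm_nonneg _) (hw.pos _).le
  · have := h z (-y)
    rw [norm_neg, ← sub_eq_add_neg] at this
    simp only
    calc _ ≤ ‖g y‖ * (C * (1 + ‖y‖) ^ N * w z) := by gcongr
      _ = _ := by ring

theorem exists_norm_mollify_le {w : Phase d → ℝ} (hw : IsWeight w) :
    ∃ C : ℝ, ∃ N : ℕ, 0 ≤ C ∧ ∀ (τ : 𝓢(Phase d, ℂ)) M F, 0 ≤ M → Bd w M F →
      ∀ z, ‖mollify τ F z‖ ≤ C * kernelNorm N τ * M * w z := by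
  obtain ⟨C, N, hC, h⟩ := exists_wnorm_kern_le hw
  refine ⟨C, N, hC, fun τ M F hM hF z => ?_⟩
  have h1 := h (𝓕⁻ τ : 𝓢(Phase d, ℂ)) z (integrable_pow_mul_schwartz _ N)
  have e : (kern τ z : Phase d → ℂ) = fun y => 𝓕⁻ τ (z - y) := funext fun y => kern_apply τ z y
  rw [← e] at h1
  calc _ ≤ M * wnorm w (kern τ z) := hF _
    _ ≤ M * (C * kernelNorm N τ * w z) := by gcongr; exact h1
    _ = _ := by ring

/-- Fubini's theorem. Joint integrability follows from `w(y) ≤ C (1 + |y - z|)^N w(z)`, which leaves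
an integrable function of `z` times an integrable function of `y - z`. -/
theorem Bd.isRep_mollify {w : Phase d → ℝ} (hw : IsWeight w) {M : ℝ} (hM : 0 ≤ M)
    {F : 𝓢'(Phase d, ℂ)} (h : Bd w M F) (τ : 𝓢(Phase d, ℂ)) :
    IsRep (fm τ F) (mollify τ F) := by
  have ht := h.hasTemperateGrowth_mollify hw hM τ
  obtain ⟨u, hu, hb⟩ := h.exists_rep hw hM
  obtain ⟨C, N, hC, hN⟩ := hw.moderate
  refine ⟨ht.1.continuous.aestronglyMeasurable, fun ψ => ?_⟩
  constructor
  · have := (SchwartzMap.smulLeftCLM ℂ (mollify τ F) ψ).integrable (μ := volume)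
    refine this.congr (.of_forall fun z => ?_)
    rw [SchwartzMap.smulLeftCLM_apply_apply ht, smul_eq_mul, mul_comm]
  · have hint : Integrable (fun p : Phase d × Phase d => ψ p.1 * (u p.2 * 𝓕⁻ τ (p.1 - p.2)))
        (volume.prod volume) := by
      have h1 : Integrable (fun y => (1 + ‖y‖) ^ N * ‖𝓕⁻ τ y‖) volume :=
        integrable_pow_mul_schwartz _ N
      have h1' : Integrable (fun y => (1 + ‖-y‖) ^ N * ‖𝓕⁻ τ (-y)‖) volume := h1.comp_neg
      have h2 := (hw.integrable ψ).const_mul (M * C)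
      have h3 := (h2.convolution_integrand (ContinuousLinearMap.mul ℝ ℝ) h1').swap
      refine h3.mono' ?_ ?_
      · refine (ψ.continuous.comp continuous_fst).aestronglyMeasurable.mul ?_
        refine hu.1.comp_snd.mul ?_
        exact ((𝓕⁻ τ).continuous.comp (continuous_fst.sub continuous_snd)).aestronglyMeasurable
      · have hb2 : ∀ᵐ p : Phase d × Phase d ∂(volume.prod volume), ‖u p.2‖ ≤ M * w p.2 :=
          Measure.quasiMeasurePreserving_snd.ae hb
        filter_upwards [hb2] with p hp
        have h4 := hN p.1 (p.2 - p.1)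
        rw [add_sub_cancel] at h4
        simp only [Function.comp_apply, Prod.fst_swap, Prod.snd_swap, ContinuousLinearMap.mul_apply',
          norm_mul, neg_sub]
        rw [norm_sub_rev p.1 p.2]
        calc _ ≤ ‖ψ p.1‖ * (M * (C * (1 + ‖p.2 - p.1‖) ^ N * w p.1) * ‖𝓕⁻ τ (p.1 - p.2)‖) := by
              gcongr
              exact hp.trans (by gcongr)
          _ = _ := by ring
    calc fm τ F ψ = ∫ y, dm τ ψ y * u y := (hu.2 _).2
      _ = ∫ y, ∫ z, ψ z * (u y * 𝓕⁻ τ (z - y)) := by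
          refine integral_congr_ae (.of_forall fun y => ?_)
          simp only
          rw [dm_schwartz_apply, ← integral_mul_const,
            ← integral_sub_right_eq_self _ y]
          refine integral_congr_ae (.of_forall fun z => ?_)
          simp only [add_sub_cancel]
          ring
      _ = ∫ z, ∫ y, ψ z * (u y * 𝓕⁻ τ (z - y)) := (integral_integral_swap hint).symm
      _ = _ := by
          refine integral_congr_ae (.of_forall fun z => ?_)
          simp only
          rw [integral_const_mul, mollify_eq_conv τ hu]

/-! ### Regularity of mollified functions -/

/-- The mean value inequality on the segment from `y` to `y + a`, where `1 + |y|` is comparable with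
its value at intermediate points up to the factor `1 + |a|`. -/
theorem exists_schwartz_sub_le {V : Type} [NormedAddCommGroup V] [NormedSpace ℝ V] {E : Type}
    [NormedAddCommGroup E] [NormedSpace ℝ E] (K : 𝓢(V, E)) (L : ℕ) :
    ∃ B : ℝ, 0 ≤ B ∧ ∀ a y, (1 + ‖y‖) ^ L * ‖K (y + a) - K y‖ ≤ B * (‖a‖ * (1 + ‖a‖) ^ L) := by
  obtain ⟨B, hB, h⟩ := exists_schwartz_decay (SchwartzMap.fderivCLM ℝ V E K) L
  refine ⟨B, hB, fun a y => ?_⟩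
  have h1 : ‖K (y + a) - K y‖ ≤ B * (1 + ‖a‖) ^ L / (1 + ‖y‖) ^ L * ‖y + a - y‖ := by
    refine Convex.norm_image_sub_le_of_norm_fderiv_le (𝕜 := ℝ) (s := segment ℝ y (y + a))
      (fun z _ => K.differentiableAt) (fun x hx => ?_) (convex_segment _ _)
      (left_mem_segment ℝ y (y + a)) (right_mem_segment ℝ y (y + a))
    rw [segment_eq_image'] at hx
    obtain ⟨t, ⟨ht0, ht1⟩, rfl⟩ := hx
    rw [add_sub_cancel_left, le_div_iff₀ (by positivity)]
    have h2 : 1 + ‖y‖ ≤ (1 + ‖y + t • a‖) * (1 + ‖a‖) := by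
      refine (one_add_norm_le_mul y (t • a)).trans ?_
      gcongr
      rw [norm_smul, Real.norm_of_nonneg ht0]
      exact mul_le_of_le_one_left (norm_nonneg a) ht1
    have h3 := h (y + t • a)
    rw [SchwartzMap.fderivCLM_apply] at h3
    calc _ ≤ ‖fderiv ℝ K (y + t • a)‖ * ((1 + ‖y + t • a‖) * (1 + ‖a‖)) ^ L := by gcongr
      _ = (1 + ‖y + t • a‖) ^ L * ‖fderiv ℝ K (y + t • a)‖ * (1 + ‖a‖) ^ L := by
        rw [mul_pow]; ring
      _ ≤ _ := by gcongr
  rw [add_sub_cancel_left] at h1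
  calc _ ≤ (1 + ‖y‖) ^ L * (B * (1 + ‖a‖) ^ L / (1 + ‖y‖) ^ L * ‖a‖) := by gcongr
    _ = _ := by field_simp

theorem exists_integral_fourierInv_sub_le (σ : 𝓢(Phase d, ℂ)) (N : ℕ) :
    ∃ C : ℝ, ∃ L : ℕ, 0 ≤ C ∧ ∀ a, ∫ y, (1 + ‖y‖) ^ N * ‖𝓕⁻ σ (y + a) - 𝓕⁻ σ y‖ ≤
      C * (‖a‖ * (1 + ‖a‖) ^ L) := by
  obtain ⟨n, hn⟩ := exists_integrable_pow (Phase d)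
  obtain ⟨B, hB, h⟩ := exists_schwartz_sub_le (𝓕⁻ σ : 𝓢(Phase d, ℂ)) (N + n)
  refine ⟨B * ∫ z : Phase d, ((1 + ‖z‖) ^ n)⁻¹, N + n,
    mul_nonneg hB (integral_nonneg fun z => by simp only [Pi.zero_apply]; positivity), fun a => ?_⟩
  calc _ ≤ ∫ y : Phase d, B * (‖a‖ * (1 + ‖a‖) ^ (N + n)) * ((1 + ‖y‖) ^ n)⁻¹ := by
        refine integral_mono_of_nonneg (.of_forall fun y => ?_) (hn.const_mul _)
          (.of_forall fun y => ?_)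
        · simp only [Pi.zero_apply]; positivity
        · simp only
          rw [← div_eq_mul_inv, le_div_iff₀ (by positivity)]
          refine le_trans (le_of_eq ?_) (h a y)
          rw [pow_add]; ring
    _ = _ := by rw [integral_const_mul]; ring

theorem integral_fourierInv_sc_sub (σ : 𝓢(Phase d, ℂ)) {r : ℝ} (hr : 0 < r) (G : Phase d → ℝ)
    (a : Phase d) :
    ∫ y, G y * ‖𝓕⁻ (sc σ r) (y + a) - 𝓕⁻ (sc σ r) y‖ =
      ∫ y, G (dilate r y) * ‖𝓕⁻ σ (y + dilate r⁻¹ a) - 𝓕⁻ σ y‖ := by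
  have h := integral_comp_linearEquiv (dilateE r hr.ne')
    fun y => G y * ‖𝓕⁻ (sc σ r) (y + a) - 𝓕⁻ (sc σ r) y‖
  have hj := jac_pos (dilateE (d := d) r hr.ne')
  have h1 (y : Phase d) : 𝓕⁻ (sc σ r) (dilateE r hr.ne' y) =
      jac (dilateE (d := d) r hr.ne') * 𝓕⁻ σ y := by
    rw [sc, dif_pos hr.ne', fourierInv_compE (isAdj_dilateE r hr.ne')]
  have h2 (y : Phase d) : ‖𝓕⁻ (sc σ r) (dilateE r hr.ne' y + a) - 𝓕⁻ (sc σ r) (dilateE r hr.ne' y)‖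
      = jac (dilateE (d := d) r hr.ne') * ‖𝓕⁻ σ (y + dilate r⁻¹ a) - 𝓕⁻ σ y‖ := by
    have e : dilateE r hr.ne' y + a = dilateE r hr.ne' (y + dilate r⁻¹ a) := by
      rw [map_add, dilateE_apply r hr.ne' (dilate _ _), dilate_dilate, mul_inv_cancel₀ hr.ne',
        dilate_one]
    rw [e, h1, h1, ← mul_sub, norm_mul, Complex.norm_real, Real.norm_of_nonneg hj.le]
  simp only [h2] at h
  simp_rw [mul_left_comm _ (jac _)] at h
  rw [integral_const_mul, smul_eq_mul] at h
  exact (mul_left_cancel₀ hj.ne' h).symm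

/-- Bernstein's inequality in terms of increments. The difference of two translates of the kernel is
integrated, and rescaling by `r` turns the increment `y` into `r^{-a} y`. -/
theorem exists_norm_mollify_sub_le {w : Phase d → ℝ} (hw : IsWeight w) (σ : 𝓢(Phase d, ℂ)) (R : ℝ) :
    ∃ C : ℝ, ∃ L : ℕ, 0 ≤ C ∧ ∀ r, 0 < r → r ≤ R → ∀ M F, 0 ≤ M → Bd w M F → ∀ z y,
      ‖mollify (sc σ r) F (z + y) - mollify (sc σ r) F z‖ ≤
        C * M * (‖dilate r⁻¹ y‖ * (1 + ‖dilate r⁻¹ y‖) ^ L) * w z := by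
  obtain ⟨C, N, hC, h⟩ := exists_wnorm_kern_le hw
  obtain ⟨C', L, hC', h'⟩ := exists_integral_fourierInv_sub_le σ N
  refine ⟨C * ((1 + |R|) ^ (3 * N) * C'), L, by positivity, fun r hr hrR M F hM hF z y => ?_⟩
  have hwz := (hw.pos z).le
  set K : 𝓢(Phase d, ℂ) := 𝓕⁻ (sc σ r)
  set g : 𝓢(Phase d, ℂ) := compSubConstCLM ℂ (-y) K - K with hg
  have hgx (x : Phase d) : g x = K (x + y) - K x := by
    change compSubConstCLM ℂ (-y) K x - K x = _
    rw [compSubConstCLM_apply, sub_neg_eq_add]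
  have e1 : mollify (sc σ r) F (z + y) - mollify (sc σ r) F z =
      F (kern (sc σ r) (z + y) - kern (sc σ r) z) := by
    rw [map_sub]; rfl
  have e2 : (kern (sc σ r) (z + y) - kern (sc σ r) z : 𝓢(Phase d, ℂ)) =
      fun x => g (z - x) := by
    funext x
    change kern (sc σ r) (z + y) x - kern (sc σ r) z x = _
    rw [hgx, kern_apply, kern_apply, sub_add_eq_add_sub]
  have h1 := h g z (integrable_pow_mul_schwartz _ N)
  rw [← e2] at h1
  have h2 : ∫ x, (1 + ‖x‖) ^ N * ‖g x‖ ≤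
      (1 + |R|) ^ (3 * N) * C' * (‖dilate r⁻¹ y‖ * (1 + ‖dilate r⁻¹ y‖) ^ L) := by
    simp_rw [hgx]
    rw [integral_fourierInv_sc_sub σ hr (fun x => (1 + ‖x‖) ^ N) y, mul_assoc]
    have hi : Integrable (fun x => (1 + ‖x‖) ^ N * ‖𝓕⁻ σ (x + dilate r⁻¹ y) - 𝓕⁻ σ x‖) volume := by
      have := integrable_pow_mul_schwartz
        (compSubConstCLM ℂ (-dilate r⁻¹ y) (𝓕⁻ σ : 𝓢(Phase d, ℂ)) - 𝓕⁻ σ) N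
      refine this.congr (.of_forall fun x => ?_)
      change _ * ‖compSubConstCLM ℂ (-dilate r⁻¹ y) (𝓕⁻ σ : 𝓢(Phase d, ℂ)) x - 𝓕⁻ σ x‖ = _
      rw [compSubConstCLM_apply, sub_neg_eq_add]
    refine le_trans ?_ (mul_le_mul_of_nonneg_left (h' (dilate r⁻¹ y)) (by positivity))
    rw [← integral_const_mul]
    refine integral_mono_of_nonneg (.of_forall fun x => ?_) (hi.const_mul _)
      (.of_forall fun x => ?_)
    · simp only [Pi.zero_apply]; positivity
    · simp only
      rw [← mul_assoc, pow_mul, ← mul_pow]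
      gcongr
      have h3 : (1 : ℝ) ≤ (1 + |R|) ^ 3 := one_le_pow₀ (by linarith [abs_nonneg R])
      have h4 : ‖dilate r x‖ ≤ (1 + |R|) ^ 3 * ‖x‖ := by
        refine (norm_dilate_le hr.le x).trans ?_
        gcongr
        exact hrR.trans (le_abs_self R)
      linarith
  rw [e1]
  calc _ ≤ M * wnorm w (kern (sc σ r) (z + y) - kern (sc σ r) z : 𝓢(Phase d, ℂ)) := hF _
    _ ≤ M * (C * ((1 + |R|) ^ (3 * N) * C' * (‖dilate r⁻¹ y‖ * (1 + ‖dilate r⁻¹ y‖) ^ L)) * w z) := by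
        refine mul_le_mul_of_nonneg_left (h1.trans ?_) hM
        gcongr
    _ = _ := by ring

theorem sum_rpow_le {c : ℝ} (hc : 0 < c) (a b : ℤ) :
    ∑ j ∈ Finset.Ico a b, (2 : ℝ) ^ (c * j) ≤ (2 ^ c - 1)⁻¹ * 2 ^ (c * b) := by
  have h1 : 0 < (2 : ℝ) ^ c - 1 := by
    have := Real.one_lt_rpow (one_lt_two (α := ℝ)) hc
    linarith
  rcases lt_or_ge b a with h | h
  · rw [Finset.Ico_eq_empty (by omega), Finset.sum_empty]; positivity
  · induction b, h using Int.leInduction with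
    | base => rw [Finset.Ico_self, Finset.sum_empty]; positivity
    | succ k hk ih =>
      have : Finset.Ico a (k + 1) = insert k (Finset.Ico a k) := by
        ext x; simp only [Finset.mem_Ico, Finset.mem_insert]; omega
      rw [this, Finset.sum_insert (by simp)]
      have e : (2 : ℝ) ^ (c * ((k + 1 : ℤ) : ℝ)) = 2 ^ (c * k) * 2 ^ c := by
        rw [← Real.rpow_add two_pos]; push_cast; ring_nf
      rw [e]
      calc _ ≤ (2 : ℝ) ^ (c * k) + (2 ^ c - 1)⁻¹ * 2 ^ (c * k) := by gcongr
        _ = _ := by field_simp; ring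

section lowFunctions

variable {φ : Phase d → ℝ}

/-- The function `S_{i-1} F`. -/
def lowFn (hφ : IsCutoff φ) (i : ℤ) (F : 𝓢'(Phase d, ℂ)) : Phase d → ℂ :=
  mollify (lowS hφ (i - 1)) F

/-- Functions which vary slowly at the scale `2^{-i}`. -/
def IsSlow (w : Phase d → ℝ) (A : ℝ) (i : ℤ) (L : ℕ) (a : Phase d → ℂ) : Prop :=
  ∀ z y, ‖a (z + y) - a z‖ ≤ A * (1 + ‖dilate (2 ^ i) y‖) ^ L * w z

/-- Inserting the enlarged symbol writes each summand as a mollification of a block, whose size is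
known, rather than of `F`. -/
theorem lowFn_eq_sum (hφ : IsCutoff φ) (i : ℤ) (F : 𝓢'(Phase d, ℂ)) (z : Phase d) :
    lowFn hφ i F z = ∑ j ∈ Finset.Ico (-1) (i - 1), mollify (fatS hφ j) (fm (blockS hφ j) F) z := by
  rw [lowFn, ← sum_blockS, mollify_sum]
  refine Finset.sum_congr rfl fun j _ => ?_
  rw [mollify_fm (blockS hφ j) (fatS hφ j) (blockS hφ j)]
  intro ξ
  rw [mul_comm]
  exact fatS_mul_blockS hφ j ξ

/-- Block `j` contributes its size `2^{-αj}` times the increment measured at its own scale, which is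
at most `2^{j-i}` times the increment at scale `i`. As `α < 1`, the geometric sum over `j < i - 1`
is dominated by its last terms and yields `2^{-αi}`. -/
theorem exists_isSlow_lowFn (hφ : IsCutoff φ) {w : Phase d → ℝ} (hw : IsWeight w) {α : ℝ}
    (hα : α < 1) :
    ∃ C : ℝ, ∃ L : ℕ, 0 ≤ C ∧ ∀ M F, 0 ≤ M → BlockBd hφ w M α F → ∀ i : ℤ,
      IsSlow w (C * M * 2 ^ (-α * i)) i L (lowFn hφ i F) := by
  obtain ⟨C₁, L₁, hC₁, h₁⟩ := exists_norm_mollify_sub_le hw (fatAnn hφ) 2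
  obtain ⟨C₂, L₂, hC₂, h₂⟩ := exists_norm_mollify_sub_le hw (sc (cutS hφ) 4⁻¹) 2
  have hmain (j : ℤ) (hj : -1 ≤ j) (M : ℝ) (F : 𝓢'(Phase d, ℂ)) (hM : 0 ≤ M) (hF : Bd w M F)
      (z y : Phase d) : ‖mollify (fatS hφ j) F (z + y) - mollify (fatS hφ j) F z‖ ≤
        (C₁ + C₂) * M * (‖dilate (2 ^ j) y‖ * (1 + ‖dilate (2 ^ j) y‖) ^ (L₁ + L₂)) * w z := by
    have hr : (0 : ℝ) < 2 ^ (-j) := by positivity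
    have hr2 : (2 : ℝ) ^ (-j) ≤ 2 := by
      calc (2 : ℝ) ^ (-j) ≤ 2 ^ (1 : ℤ) := zpow_le_zpow_right₀ (by norm_num) (by omega)
        _ = 2 := zpow_one 2
    have e : ((2 : ℝ) ^ (-j))⁻¹ = 2 ^ j := by rw [zpow_neg, inv_inv]
    have hwz := (hw.pos z).le
    have hb : 1 ≤ 1 + ‖dilate (2 ^ j) y‖ := by linarith [norm_nonneg (dilate (2 ^ j) y)]
    unfold fatS fatP
    split_ifs with h0
    · have := h₁ _ hr hr2 M F hM hF z y
      rw [e] at this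
      refine this.trans ?_
      gcongr
      · linarith
      · linarith
    · have := h₂ _ hr hr2 M F hM hF z y
      rw [e] at this
      refine this.trans ?_
      gcongr
      · linarith
      · linarith
  have hα' : 0 < 1 - α := by linarith
  refine ⟨(C₁ + C₂) * (2 ^ (1 - α) - 1)⁻¹, L₁ + L₂ + 1, ?_, fun M F hM hF i z y => ?_⟩
  · have := Real.one_lt_rpow (one_lt_two (α := ℝ)) hα'
    have : 0 < (2 : ℝ) ^ (1 - α) - 1 := by linarith
    positivity
  have hwz := (hw.pos z).le
  set Y := ‖dilate (2 ^ i) y‖ with hY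
  have hY0 : 0 ≤ Y := norm_nonneg _
  rw [lowFn_eq_sum, lowFn_eq_sum, ← Finset.sum_sub_distrib]
  have hterm (j : ℤ) (hj : j ∈ Finset.Ico (-1) (i - 1)) :
      ‖mollify (fatS hφ j) (fm (blockS hφ j) F) (z + y) -
        mollify (fatS hφ j) (fm (blockS hφ j) F) z‖ ≤
      (C₁ + C₂) * M * (1 + Y) ^ (L₁ + L₂ + 1) * w z * 2 ^ (-(i : ℝ)) * 2 ^ ((1 - α) * j) := by
    rw [Finset.mem_Ico] at hj
    have hs : ‖dilate (2 ^ j) y‖ ≤ 2 ^ (j - i) * Y := by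
      have : dilate (2 ^ j) y = dilate (2 ^ (j - i)) (dilate (2 ^ i) y) := by
        rw [dilate_dilate, ← zpow_add₀ two_ne_zero, sub_add_cancel]
      rw [this]
      exact norm_dilate_le_of_le_one (by positivity)
        (zpow_le_one_of_nonpos₀ (by norm_num) (by omega)) _
    have hs1 : ‖dilate (2 ^ j) y‖ ≤ Y := by
      refine hs.trans (mul_le_of_le_one_left hY0 ?_)
      exact zpow_le_one_of_nonpos₀ (by norm_num) (by omega)
    calc _ ≤ (C₁ + C₂) * (M * 2 ^ (-α * j)) *
          (‖dilate (2 ^ j) y‖ * (1 + ‖dilate (2 ^ j) y‖) ^ (L₁ + L₂)) * w z :=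
        hmain j hj.1 _ _ (by positivity) (hF j) z y
      _ ≤ (C₁ + C₂) * (M * 2 ^ (-α * j)) * (2 ^ (j - i) * (1 + Y) * (1 + Y) ^ (L₁ + L₂)) * w z := by
        gcongr
        refine hs.trans ?_
        gcongr
        linarith
      _ = (C₁ + C₂) * M * (1 + Y) ^ (L₁ + L₂ + 1) * w z * (2 ^ (-α * j) * 2 ^ (j - i)) := by ring
      _ = (C₁ + C₂) * M * (1 + Y) ^ (L₁ + L₂ + 1) * w z * (2 ^ (-(i : ℝ)) * 2 ^ ((1 - α) * j)) := by
        congr 1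
        rw [← Real.rpow_intCast, ← Real.rpow_add two_pos, ← Real.rpow_add two_pos]
        push_cast
        ring_nf
      _ = _ := by ring
  refine (norm_sum_le _ _).trans ((Finset.sum_le_sum hterm).trans ?_)
  rw [← Finset.mul_sum]
  have hsum := sum_rpow_le hα' (-1) (i - 1)
  have h2 : (2 : ℝ) ^ ((1 - α) * ((i - 1 : ℤ) : ℝ)) ≤ 2 ^ ((1 - α) * i) := by
    refine Real.rpow_le_rpow_of_exponent_le (by norm_num) ?_
    push_cast
    nlinarith
  have h3 : 0 ≤ ((2 : ℝ) ^ (1 - α) - 1)⁻¹ := by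
    have := Real.one_lt_rpow (one_lt_two (α := ℝ)) hα'
    exact inv_nonneg.2 (by linarith)
  calc _ ≤ (C₁ + C₂) * M * (1 + Y) ^ (L₁ + L₂ + 1) * w z * 2 ^ (-(i : ℝ)) *
        ((2 ^ (1 - α) - 1)⁻¹ * 2 ^ ((1 - α) * i)) := by
        gcongr
        exact hsum.trans (by gcongr)
    _ = (C₁ + C₂) * (2 ^ (1 - α) - 1)⁻¹ * M * (2 ^ (-(i : ℝ)) * 2 ^ ((1 - α) * i)) *
        (1 + Y) ^ (L₁ + L₂ + 1) * w z := by ring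
    _ = _ := by
        rw [← Real.rpow_add two_pos]
        ring_nf

theorem exists_norm_lowFn_le (hφ : IsCutoff φ) {w : Phase d → ℝ} (hw : IsWeight w) :
    ∃ C : ℝ, 0 ≤ C ∧ ∀ M F, 0 ≤ M → Bd w M F → ∀ i z, ‖lowFn hφ i F z‖ ≤ C * M * w z := by
  obtain ⟨C, N, hC, h⟩ := exists_norm_mollify_le hw
  have hk := kernelNorm_nonneg N (cutS hφ)
  refine ⟨C * ((1 + 1) ^ (3 * N) * kernelNorm N (cutS hφ)), by positivity, fun M F hM hF i z => ?_⟩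
  have hwz := (hw.pos z).le
  rcases lt_or_ge (i - 1) 0 with hi | hi
  · rw [lowFn, lowS, if_neg (by omega), mollify_zero, norm_zero]
    positivity
  · refine (h _ M F hM hF z).trans ?_
    rw [lowS, if_pos hi]
    gcongr
    exact kernelNorm_sc_le N _ (by positivity) (zpow_le_one_of_nonpos₀ (by norm_num) (by omega))

theorem Bd.hasTemperateGrowth_lowFn (hφ : IsCutoff φ) {w : Phase d → ℝ} (hw : IsWeight w) {M : ℝ}
    (hM : 0 ≤ M) {F : 𝓢'(Phase d, ℂ)} (h : Bd w M F) (i : ℤ) :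
    (lowFn hφ i F).HasTemperateGrowth := h.hasTemperateGrowth_mollify hw hM _

theorem Bd.isRep_lowFn (hφ : IsCutoff φ) {w : Phase d → ℝ} (hw : IsWeight w) {M : ℝ}
    (hM : 0 ≤ M) {F : 𝓢'(Phase d, ℂ)} (h : Bd w M F) (i : ℤ) :
    IsRep (fm (lowS hφ (i - 1)) F) (lowFn hφ i F) := h.isRep_mollify hw hM _

end lowFunctions

/-! ### Commutators of multipliers and slowly varying functions -/

/-- The product of a function of temperate growth and a distribution. -/
abbrev mulD (a : Phase d → ℂ) : 𝓢'(Phase d, ℂ) →L[ℂ] 𝓢'(Phase d, ℂ) :=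
  TemperedDistribution.smulLeftCLM ℂ a

theorem mulD_apply (a : Phase d → ℂ) (G : 𝓢'(Phase d, ℂ)) (ψ : 𝓢(Phase d, ℂ)) :
    mulD a G ψ = G (SchwartzMap.smulLeftCLM ℂ a ψ) := rfl

theorem one_add_norm_dilate_le {r : ℝ} (hr : 0 ≤ r) (y : Phase d) :
    1 + ‖dilate r y‖ ≤ (1 + r) ^ 3 * (1 + ‖y‖) := by
  have h1 := norm_dilate_le hr y
  have h2 : (1 : ℝ) ≤ (1 + r) ^ 3 := one_le_pow₀ (by linarith)
  linarith

/-- On the dual side the commutator has the kernel `K(y) (a(z) - a(z + y))`. Slow variation bounds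
the increment by a power of `1 + |2^i y|`, and since `K` lives at the scale `r` its integral
produces the power of `1 + r 2^i`. -/
theorem exists_bd_commutator {w v : Phase d → ℝ} (hw : IsWeight w) (hv : IsWeight v)
    (σ : 𝓢(Phase d, ℂ)) (R : ℝ) (L : ℕ) :
    ∃ C : ℝ, 0 ≤ C ∧ ∀ r, 0 < r → r ≤ R → ∀ (i : ℤ) A M a G, 0 ≤ A → 0 ≤ M →
      a.HasTemperateGrowth → IsSlow w A i L a → Bd v M G →
      Bd (fun z => w z * v z) (C * (A * M) * (1 + r * 2 ^ i) ^ (3 * L))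
        (fm (sc σ r) (mulD a G) - mulD a (fm (sc σ r) G)) := by
  obtain ⟨C, N, hC, h⟩ := young hv hw
  have hk := kernelNorm_nonneg (N + L) σ
  refine ⟨C * ((1 + |R|) ^ (3 * N) * kernelNorm (N + L) σ), by positivity,
    fun r hr hrR i A M a G hA hM ha hs hG ψ => ?_⟩
  set K : 𝓢(Phase d, ℂ) := 𝓕⁻ (sc σ r) with hK
  set χ : 𝓢(Phase d, ℂ) := SchwartzMap.smulLeftCLM ℂ a (dm (sc σ r) ψ) -
    dm (sc σ r) (SchwartzMap.smulLeftCLM ℂ a ψ) with hχ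
  have e : (fm (sc σ r) (mulD a G) - mulD a (fm (sc σ r) G)) ψ = G χ := by
    rw [hχ, map_sub]; rfl
  have hKint (χ : 𝓢(Phase d, ℂ)) (z : Phase d) :
      Integrable (fun y => K y * χ (z + y)) volume := by
    obtain ⟨B, hB, hb⟩ := exists_schwartz_decay χ 0
    refine K.integrable.mul_of_top_left (memLp_top_of_bound (C := B) ?_ (.of_forall fun y => ?_))
    · exact (χ.continuous.comp (continuous_const.add continuous_id)).aestronglyMeasurable
    · simpa using hb (z + y)
  have hki (n : ℕ) : Integrable (fun y => (1 + ‖y‖) ^ n *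
      (A * ((1 + ‖dilate (2 ^ i) y‖) ^ L * ‖K y‖))) volume := by
    refine ((integrable_pow_mul_schwartz K (n + L)).const_mul
      (A * ((1 + 2 ^ i) ^ 3) ^ L)).mono' ?_ (.of_forall fun y => ?_)
    · have h1 : Continuous fun y : Phase d => dilate (2 ^ i) y := (dilateL (2 ^ i)).continuous
      have : Continuous fun y => (1 + ‖y‖) ^ n * (A * ((1 + ‖dilate (2 ^ i) y‖) ^ L * ‖K y‖)) :=
        ((continuous_const.add continuous_norm).pow n).mul
          (continuous_const.mul (((continuous_const.add h1.norm).pow L).mul K.continuous.norm))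
      exact this.aestronglyMeasurable
    · have h1 := one_add_norm_dilate_le (by positivity : (0 : ℝ) ≤ 2 ^ i) y
      rw [Real.norm_of_nonneg (by positivity)]
      calc _ ≤ (1 + ‖y‖) ^ n * (A * (((1 + 2 ^ i) ^ 3 * (1 + ‖y‖)) ^ L * ‖K y‖)) := by gcongr
        _ = _ := by rw [mul_pow, pow_add]; ring
  have hpt (z : Phase d) : ‖χ z‖ ≤
      ∫ y, (A * ((1 + ‖dilate (2 ^ i) y‖) ^ L * ‖K y‖)) * (‖ψ (z + y)‖ * w (z + y)) := by
    have e1 : χ z = ∫ y, K y * ((a z - a (z + y)) * ψ (z + y)) := by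
      change SchwartzMap.smulLeftCLM ℂ a (dm (sc σ r) ψ) z -
        dm (sc σ r) (SchwartzMap.smulLeftCLM ℂ a ψ) z = _
      rw [SchwartzMap.smulLeftCLM_apply_apply ha, dm_schwartz_apply, dm_schwartz_apply,
        smul_eq_mul, ← integral_const_mul, ← integral_sub ((hKint ψ z).const_mul _) (hKint _ z)]
      refine integral_congr_ae (.of_forall fun y => ?_)
      simp only [SchwartzMap.smulLeftCLM_apply_apply ha, smul_eq_mul]
      ring
    rw [e1]
    refine norm_integral_le_of_norm_le ?_ (.of_forall fun y => ?_)
    · obtain ⟨C', N', hC', hN'⟩ := hw.le_pow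
      obtain ⟨B, hB, hb⟩ := exists_schwartz_decay ψ N'
      have h0 := hki 0
      simp only [pow_zero, one_mul] at h0
      refine h0.mul_of_top_left (memLp_top_of_bound (C := C' * B) ?_ (.of_forall fun y => ?_))
      · have : Continuous fun y => ‖ψ (z + y)‖ * w (z + y) :=
          (ψ.continuous.norm.mul hw.cont).comp (continuous_const.add continuous_id)
        exact this.aestronglyMeasurable
      · have h1 := (hw.pos (z + y)).le
        rw [Real.norm_of_nonneg (by positivity)]
        calc _ ≤ ‖ψ (z + y)‖ * (C' * (1 + ‖z + y‖) ^ N') := by gcongr; exact hN' _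
          _ = C' * ((1 + ‖z + y‖) ^ N' * ‖ψ (z + y)‖) := by ring
          _ ≤ _ := by gcongr; exact hb _
    -- The increment is based at `z + y`, so that the weight `w` is evaluated at the same point as
    -- `ψ`.
    · have h1 := hs (z + y) (-y)
      rw [add_neg_cancel_right, ← dilateL_apply, map_neg, norm_neg, dilateL_apply] at h1
      rw [norm_mul, norm_mul]
      calc _ ≤ ‖K y‖ * (A * (1 + ‖dilate (2 ^ i) y‖) ^ L * w (z + y) * ‖ψ (z + y)‖) := by gcongr
        _ = _ := by ring
  have hmain := h (fun y => A * ((1 + ‖dilate (2 ^ i) y‖) ^ L * ‖K y‖)) ?_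
    (fun y => by positivity) (hki N) ψ χ χ.continuous hpt
  · rw [e]
    have hI : ∫ y, (1 + ‖y‖) ^ N * (A * ((1 + ‖dilate (2 ^ i) y‖) ^ L * ‖K y‖)) ≤
        A * ((1 + |R|) ^ (3 * N) * (1 + r * 2 ^ i) ^ (3 * L) * kernelNorm (N + L) σ) := by
      have e2 : ∫ y, (1 + ‖y‖) ^ N * (A * ((1 + ‖dilate (2 ^ i) y‖) ^ L * ‖K y‖)) =
          ∫ y, (A * ((1 + ‖y‖) ^ N * (1 + ‖dilate (2 ^ i) y‖) ^ L)) * ‖K y‖ := by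
        refine integral_congr_ae (.of_forall fun y => ?_)
        ring
      rw [e2, integral_fourierInv_sc (E := ℝ) σ hr, kernelNorm, ← mul_assoc, ← integral_const_mul]
      refine integral_mono_of_nonneg (.of_forall fun y => ?_)
        ((integrable_pow_mul_schwartz _ _).const_mul _) (.of_forall fun y => ?_)
      · simp only [Pi.zero_apply]; positivity
      · have h1 := one_add_norm_dilate_le hr.le y
        have h2 := one_add_norm_dilate_le (by positivity : 0 ≤ 2 ^ i * r) y
        rw [mul_comm (2 ^ i) r] at h2
        simp only
        rw [dilate_dilate, mul_comm (2 ^ i) r]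
        calc _ ≤ A * (((1 + |R|) ^ 3 * (1 + ‖y‖)) ^ N * ((1 + r * 2 ^ i) ^ 3 * (1 + ‖y‖)) ^ L) *
              ‖𝓕⁻ σ y‖ := by
              gcongr
              refine h1.trans ?_
              gcongr
              exact hrR.trans (le_abs_self R)
          _ = _ := by rw [mul_pow, mul_pow, ← pow_mul, ← pow_mul, pow_add]; ring
    have hwv := wnorm_nonneg (hw.mul hv) ψ
    calc _ ≤ M * wnorm v χ := hG χ
      _ ≤ M * (C * (A * ((1 + |R|) ^ (3 * N) * (1 + r * 2 ^ i) ^ (3 * L) * kernelNorm (N + L) σ)) *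
          wnorm (fun z => w z * v z) ψ) := by
          refine mul_le_mul_of_nonneg_left (hmain.trans ?_) hM
          gcongr
      _ = _ := by ring
  · have : Continuous fun y => A * ((1 + ‖dilate (2 ^ i) y‖) ^ L * ‖K y‖) := by
      have h1 : Continuous fun y : Phase d => dilate (2 ^ i) y := (dilateL (2 ^ i)).continuous
      exact continuous_const.mul (((continuous_const.add h1.norm).pow L).mul K.continuous.norm)
    exact this.measurable

/-! ### Frequencies of products and the paraproduct -/

/-- The product of a test function and the character `z ↦ exp (2πi ⟨z, η⟩)`. -/
def modulate (η : Phase d) (χ : 𝓢(Phase d, ℂ)) : 𝓢(Phase d, ℂ) :=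
  𝓕 (compSubConstCLM ℂ (-η) (𝓕⁻ χ))

theorem modulate_apply (η : Phase d) (χ : 𝓢(Phase d, ℂ)) (z : Phase d) :
    modulate η χ z = Complex.exp (((2 * Real.pi * inner ℝ z η : ℝ) : ℂ) * Complex.I) * χ z := by
  rw [modulate, fourier_eq_fourierInv_neg, fourierInv_translate, ← fourier_eq_fourierInv_neg,
    FourierTransform.fourier_fourierInv_eq, inner_neg_left]
  congr 4
  ring

theorem fourierInv_modulate (η : Phase d) (χ : 𝓢(Phase d, ℂ)) (ξ : Phase d) :
    𝓕⁻ (modulate η χ) ξ = 𝓕⁻ χ (ξ + η) := by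
  rw [modulate, FourierTransform.fourierInv_fourier_eq, compSubConstCLM_apply, sub_neg_eq_add]

/-- The value at `η` is the pairing of `fm σ F` with `χ` times a character, and modulation
translates the Fourier side of `χ`. This replaces the convolution theorem for distributions. -/
theorem Bd.fourierInv_mollify_mul_eq_zero {w : Phase d → ℝ} (hw : IsWeight w) {M : ℝ} (hM : 0 ≤ M)
    {F : 𝓢'(Phase d, ℂ)} (h : Bd w M F) {σ χ : 𝓢(Phase d, ℂ)} {η : Phase d}
    (h0 : ∀ ξ, σ ξ * 𝓕⁻ χ (ξ + η) = 0) :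
    𝓕⁻ (SchwartzMap.smulLeftCLM ℂ (mollify σ F) χ) η = 0 := by
  have ht := h.hasTemperateGrowth_mollify hw hM σ
  have hr := h.isRep_mollify hw hM σ
  have e : 𝓕⁻ (SchwartzMap.smulLeftCLM ℂ (mollify σ F) χ) η = fm σ F (modulate η χ) := by
    rw [(hr.2 _).2, SchwartzMap.fourierInv_coe, Real.fourierInv_eq']
    refine integral_congr_ae (.of_forall fun z => ?_)
    simp only [SchwartzMap.smulLeftCLM_apply_apply ht, modulate_apply, smul_eq_mul]
    ring
  have e2 : dm σ (modulate η χ) = 0 := by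
    apply ext_fourierInv
    intro ξ
    rw [fourierInv_dm σ.hasTemperateGrowth, fourierInv_modulate, h0]
    simp
  rw [e, fm_apply, e2, map_zero]

/-- The dual form of the rule that the spectrum of a product lies in the sum of the spectra. -/
theorem Bd.dm_mollify_mul_eq_zero {w : Phase d → ℝ} (hw : IsWeight w) {M : ℝ} (hM : 0 ≤ M)
    {F : 𝓢'(Phase d, ℂ)} (h : Bd w M F) {σ τ χ : 𝓢(Phase d, ℂ)}
    (h0 : ∀ ξ η, σ ξ ≠ 0 → τ η ≠ 0 → 𝓕⁻ χ (ξ + η) = 0) :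
    dm τ (SchwartzMap.smulLeftCLM ℂ (mollify σ F) χ) = 0 := by
  apply ext_fourierInv
  intro η
  rw [fourierInv_dm τ.hasTemperateGrowth]
  have : (𝓕⁻ (0 : 𝓢(Phase d, ℂ)) : 𝓢(Phase d, ℂ)) η = 0 := by simp
  rw [this]
  by_cases hη : τ η = 0
  · rw [hη, zero_mul]
  · rw [h.fourierInv_mollify_mul_eq_zero hw hM, mul_zero]
    intro ξ
    by_cases hξ : σ ξ = 0
    · rw [hξ, zero_mul]
    · rw [h0 ξ η hξ hη, mul_zero]

theorem Bd.fm_mulD_eq_self {w : Phase d → ℝ} (hw : IsWeight w) {M : ℝ} (hM : 0 ≤ M)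
    {F : 𝓢'(Phase d, ℂ)} (h : Bd w M F) {σ τ ρ : 𝓢(Phase d, ℂ)}
    (h0 : ∀ ξ η, σ ξ ≠ 0 → τ η ≠ 0 → ρ (ξ + η) = 1) (G : 𝓢'(Phase d, ℂ)) :
    fm ρ (mulD (mollify σ F) (fm τ G)) = mulD (mollify σ F) (fm τ G) := by
  ext ψ
  -- The function `dm ρ ψ - ψ` has no frequencies in the sum of the two spectra, because `ρ = 1`
  -- there.
  have key : dm τ (SchwartzMap.smulLeftCLM ℂ (mollify σ F) (dm ρ ψ - ψ)) = 0 := by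
    refine h.dm_mollify_mul_eq_zero hw hM fun ξ η hξ hη => ?_
    have h1 := FourierTransform.fourierInv_add (dm ρ ψ - ψ) ψ
    rw [sub_add_cancel] at h1
    have h2 : 𝓕⁻ (dm ρ ψ) (ξ + η) = 𝓕⁻ (dm ρ ψ - ψ) (ξ + η) + 𝓕⁻ ψ (ξ + η) := by rw [h1]; rfl
    rw [fourierInv_dm ρ.hasTemperateGrowth, h0 ξ η hξ hη, one_mul] at h2
    exact left_eq_add.1 (h2.trans (add_comm _ _))
  rw [map_sub, map_sub, sub_eq_zero] at key
  rw [fm_apply, mulD_apply, mulD_apply, fm_apply, fm_apply, key]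

theorem Bd.fm_mulD_eq_zero {w : Phase d → ℝ} (hw : IsWeight w) {M : ℝ} (hM : 0 ≤ M)
    {F : 𝓢'(Phase d, ℂ)} (h : Bd w M F) {σ τ ρ : 𝓢(Phase d, ℂ)}
    (h0 : ∀ ξ η, σ ξ ≠ 0 → τ η ≠ 0 → ρ (ξ + η) = 0) (G : 𝓢'(Phase d, ℂ)) :
    fm ρ (mulD (mollify σ F) (fm τ G)) = 0 := by
  ext ψ
  have key : dm τ (SchwartzMap.smulLeftCLM ℂ (mollify σ F) (dm ρ ψ)) = 0 := by
    refine h.dm_mollify_mul_eq_zero hw hM fun ξ η hξ hη => ?_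
    rw [fourierInv_dm ρ.hasTemperateGrowth, h0 ξ η hξ hη, zero_mul]
  rw [fm_apply, mulD_apply, fm_apply, key, map_zero]
  rfl

section paraproduct

variable {φ : Phase d → ℝ}

/-- The terms of the paraproduct. -/
def paraTerm (hφ : IsCutoff φ) (F G : 𝓢'(Phase d, ℂ)) (k : ℤ) : 𝓢'(Phase d, ℂ) :=
  mulD (lowFn hφ k F) (fm (blockS hφ k) G)

theorem Bd.fm_fatS_paraTerm (hφ : IsCutoff φ) {w : Phase d → ℝ} (hw : IsWeight w) {M : ℝ}
    (hM : 0 ≤ M) {F : 𝓢'(Phase d, ℂ)} (h : Bd w M F) (G : 𝓢'(Phase d, ℂ)) (k : ℤ) :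
    fm (fatS hφ k) (paraTerm hφ F G k) = paraTerm hφ F G k :=
  h.fm_mulD_eq_self hw hM (fun _ _ h1 h2 => fatS_add_eq_one hφ h1 h2) G

theorem Bd.fm_blockS_mulD_eq_zero (hφ : IsCutoff φ) {w : Phase d → ℝ} (hw : IsWeight w) {M : ℝ}
    (hM : 0 ≤ M) {F : 𝓢'(Phase d, ℂ)} (h : Bd w M F) (G : 𝓢'(Phase d, ℂ)) {j k : ℤ}
    (hj : -1 ≤ j) (hjk : 2 < |j - k|) : fm (blockS hφ j) (paraTerm hφ F G k) = 0 := by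
  refine h.fm_mulD_eq_zero hw hM (fun ξ η h1 h2 => ?_) G
  by_contra h3
  exact absurd (abs_sub_le_two_of_ne_zero hφ hj h1 h2 h3) (by omega)

theorem exists_isDecomp_paraTerm (hφ : IsCutoff φ) {w v : Phase d → ℝ} (hw : IsWeight w)
    (hv : IsWeight v) :
    ∃ C : ℝ, 0 ≤ C ∧ ∀ M F, 0 ≤ M → Bd w M F → ∀ M' b G, 0 ≤ M' → BlockBd hφ v M' b G →
      IsDecomp hφ (fun z => w z * v z) (C * M * M') b (paraTerm hφ F G) := by
  obtain ⟨C, hC, h⟩ := exists_norm_lowFn_le hφ hw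
  refine ⟨C, hC, fun M F hM hF M' b G hM' hG => ⟨fun k => hF.fm_fatS_paraTerm hφ hw hM G k,
    fun k => ?_, fun k hk => ?_⟩⟩
  · rw [mul_assoc]
    exact Bd.smulLeft hw hv (hF.hasTemperateGrowth_lowFn hφ hw hM k)
      (.of_forall fun z => h M F hM hF k z) (by positivity) (hG k)
  · rw [paraTerm, fm_blockS_of_lt hφ hk, map_zero]

theorem IsRep.mulD {F : 𝓢'(Phase d, ℂ)} {a v : Phase d → ℂ} (ha : a.HasTemperateGrowth)
    (hv : IsRep F v) : IsRep (mulD a F) (fun z => a z * v z) := by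
  refine ⟨ha.1.continuous.aestronglyMeasurable.mul hv.1, fun ψ => ?_⟩
  have h := hv.2 (SchwartzMap.smulLeftCLM ℂ a ψ)
  have e (z : Phase d) : SchwartzMap.smulLeftCLM ℂ a ψ z * v z = ψ z * (a z * v z) := by
    rw [SchwartzMap.smulLeftCLM_apply_apply ha, smul_eq_mul]; ring
  simp_rw [e] at h
  exact h

theorem BlockBd.isProduct_paraTerm (hφ : IsCutoff φ) {w v : Phase d → ℝ} (hw : IsWeight w)
    (hv : IsWeight v) {M M' b : ℝ} (hM : 0 ≤ M) (hM' : 0 ≤ M') {F G : 𝓢'(Phase d, ℂ)}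
    (hF : Bd w M F) (hG : BlockBd hφ v M' b G) (k : ℤ) :
    IsProduct (lowFreq φ (k - 1) F) (block φ k G) (paraTerm hφ F G k) := by
  obtain ⟨g, hg, -⟩ := (hG k).exists_rep hv (by positivity)
  rw [lowFreq_eq_fm hφ, block_eq_fm hφ]
  exact ⟨_, g, hF.isRep_lowFn hφ hw hM k, hg,
    IsRep.mulD (hF.hasTemperateGrowth_lowFn hφ hw hM k) hg⟩

theorem IsProduct.unique {F G H H' : 𝓢'(Phase d, ℂ)} (h : IsProduct F G H)
    (h' : IsProduct F G H') : H = H' := by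
  obtain ⟨u, v, hu, hv, hH⟩ := h
  obtain ⟨u', v', hu', hv', hH'⟩ := h'
  ext ψ
  rw [(hH.2 ψ).2, (hH'.2 ψ).2]
  refine integral_congr_ae ?_
  filter_upwards [hu.ae_eq hu', hv.ae_eq hv'] with z h1 h2
  rw [h1, h2]

theorem hasSum_distribution_unique {ι : Type*} {G : ι → 𝓢'(Phase d, ℂ)} {H H' : 𝓢'(Phase d, ℂ)}
    (h : HasSum G H) (h' : HasSum G H') : H = H' := by
  ext ψ
  exact (hasSum_distribution_iff.1 h ψ).unique (hasSum_distribution_iff.1 h' ψ)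

/-- Pointwise products are unique as distributions, so whatever series the choice in `paraproduct`
refers to has the terms `paraTerm`. -/
theorem BlockBd.hasSum_paraproduct (hφ : IsCutoff φ) {w v : Phase d → ℝ} (hw : IsWeight w)
    (hv : IsWeight v) {M M' b : ℝ} (hM : 0 ≤ M) (hM' : 0 ≤ M') {F G : 𝓢'(Phase d, ℂ)}
    (hF : Bd w M F) (hG : BlockBd hφ v M' b G) :
    (∃ H, HasParaproduct φ F G H) ∧ HasSum (paraTerm hφ F G) (paraproduct φ F G) := by
  obtain ⟨C, hC, h⟩ := exists_isDecomp_paraTerm hφ hw hv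
  obtain ⟨m, C', hC', h'⟩ := exists_decomp_hasSum hφ (hw.mul hv) b
  obtain ⟨-, -, H, hH⟩ := h' _ _ (by positivity) (h M F hM hF M' b G hM' hG)
  have hp : ∃ H, HasParaproduct φ F G H :=
    ⟨H, paraTerm hφ F G, BlockBd.isProduct_paraTerm hφ hw hv hM hM' hF hG, hH⟩
  refine ⟨hp, ?_⟩
  have e : paraproduct φ F G = hp.choose := by rw [paraproduct, dif_pos hp]
  obtain ⟨p, h1, h2⟩ := hp.choose_spec
  have hpp : p = paraTerm hφ F G := funext fun k =>
    (h1 k).unique (BlockBd.isProduct_paraTerm hφ hw hv hM hM' hF hG k)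
  rw [e, ← hpp]
  exact h2

end paraproduct

/-! ### The kinetic heat kernel -/

theorem heatExponent_dilate {u : ℝ} (hu : 0 < u) (z : Phase d) :
    heatExponent u z = heatExponent 1 (dilate (√u)⁻¹ z) := by
  obtain ⟨s, hs, rfl⟩ : ∃ s : ℝ, 0 < s ∧ u = s ^ 2 :=
    ⟨√u, Real.sqrt_pos.2 hu, (Real.sq_sqrt hu.le).symm⟩
  rw [Real.sqrt_sq hs.le]
  unfold heatExponent dilate
  simp only [WithLp.toLp_fst, WithLp.toLp_snd]
  have e1 : (3 : ℝ) • (s⁻¹ ^ 3 • z.fst) - (2 * 1 : ℝ) • (s⁻¹ • z.snd) =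
      (s⁻¹ ^ 3) • ((3 : ℝ) • z.fst - (2 * s ^ 2) • z.snd) := by
    rw [smul_sub, smul_smul, smul_smul, smul_smul, smul_smul]
    congr 2
    · ring
    · field_simp
  rw [e1, norm_smul, norm_smul, Real.norm_of_nonneg (by positivity)]
  field_simp

theorem jac_dilateE {r : ℝ} (hr : 0 < r) : jac (dilateE (d := d) r hr.ne') = (r ^ (4 * d))⁻¹ := by
  have h1 : LinearMap.det (dilateE (d := d) r hr.ne' : Phase d →ₗ[ℝ] Phase d) = r ^ (4 * d) := by
    let e := (WithLp.linearEquiv 2 ℝ (EuclideanSpace ℝ (Fin d) × EuclideanSpace ℝ (Fin d)))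
    let f : EuclideanSpace ℝ (Fin d) × EuclideanSpace ℝ (Fin d) →ₗ[ℝ]
        EuclideanSpace ℝ (Fin d) × EuclideanSpace ℝ (Fin d) :=
      LinearMap.prodMap (r ^ 3 • LinearMap.id) (r • LinearMap.id)
    have h2 : (dilateE (d := d) r hr.ne' : Phase d →ₗ[ℝ] Phase d) =
        (e.symm : _ →ₗ[ℝ] _) ∘ₗ f ∘ₗ (e.symm.symm : _ →ₗ[ℝ] _) := rfl
    rw [h2, LinearMap.det_conj, LinearMap.det_prodMap, LinearMap.det_smul, LinearMap.det_smul,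
      LinearMap.det_id, finrank_euclideanSpace, Fintype.card_fin, ← pow_mul, mul_one, mul_one,
      ← pow_add]
    congr 1
    ring
  rw [jac, h1, abs_of_pos (by positivity)]

variable (d) in
/-- The Fourier transform of the kinetic heat kernel at time `1`. -/
def heatS : 𝓢(Phase d, ℂ) := 𝓕 (heatKernelS 1 one_pos)

/-- The kernel is self-similar, `p_u(z) = u^{-2d} p_1(u^{-a/2} z)`, where `4d` is the homogeneous
dimension. All times are thus reached by dilating one Schwartz function, and its Fourier transform
need not be computed. -/
theorem fourier_heatKernelS {u : ℝ} (hu : 0 < u) :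
    𝓕 (heatKernelS (d := d) u hu) = sc (heatS d) √u := by
  have hs : 0 < √u := Real.sqrt_pos.2 hu
  have h2 : √u ^ 2 = u := Real.sq_sqrt hu.le
  set s := √u with hsdef
  have hsi : 0 < s⁻¹ := inv_pos.2 hs
  have e0 : (4 * Real.pi ^ 2 * u ^ 4 / 3) ^ (-(d : ℝ) / 2) =
      (s ^ (4 * d))⁻¹ * (4 * Real.pi ^ 2 * 1 ^ 4 / 3) ^ (-(d : ℝ) / 2) := by
    have : 4 * Real.pi ^ 2 * u ^ 4 / 3 = s ^ 8 * (4 * Real.pi ^ 2 * 1 ^ 4 / 3) := by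
      rw [← h2]; ring
    rw [this, Real.mul_rpow (by positivity) (by positivity)]
    congr 1
    rw [← Real.rpow_natCast s 8, ← Real.rpow_mul hs.le, ← Real.rpow_natCast s (4 * d),
      ← Real.rpow_neg hs.le]
    congr 1
    push_cast
    ring
  have e1 : heatKernelS (d := d) u hu =
      (((s ^ (4 * d))⁻¹ : ℝ) : ℂ) • compE (dilateE s⁻¹ hsi.ne') (heatKernelS 1 one_pos) := by
    ext z
    change ((heatKernel u z : ℝ) : ℂ) = _ * ((heatKernel 1 (dilate s⁻¹ z) : ℝ) : ℂ)
    rw [← Complex.ofReal_mul]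
    congr 1
    unfold heatKernel
    rw [heatExponent_dilate hu, e0, mul_assoc]
  ext ξ
  obtain ⟨η, rfl⟩ := (dilateE (d := d) s⁻¹ hsi.ne').surjective ξ
  rw [e1, FourierTransform.fourier_smul]
  change _ * 𝓕 (compE _ _) _ = _
  rw [fourier_compE (isAdj_dilateE _ hsi.ne'), jac_dilateE hsi, sc_apply _ hs, dilateE_apply,
    dilate_dilate, mul_inv_cancel₀ hs.ne', dilate_one, heatS, ← mul_assoc, ← Complex.ofReal_mul,
    inv_pow, inv_inv, inv_mul_cancel₀ (by positivity), Complex.ofReal_one, one_mul]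

theorem kineticSemigroup_eq {u : ℝ} (hu : 0 < u) (F : 𝓢'(Phase d, ℂ)) :
    kineticSemigroup u F = transportD u (fm (sc (heatS d) √u) F) := by
  rw [kineticSemigroup, dif_pos hu]
  change transportD u (convolve _ F) = _
  rw [convolve, fourier_heatKernelS hu]

/-! ### Gradients -/

/-- The symbols `ℓ 0`, `ℓ 1` describe the behaviour of the symbol `ℓ 0` of a homogeneous
operator of order `k` under dilations and transport. -/
structure IsHomSymbol (k : ℕ) (ℓ : Fin 2 → Phase d → ℂ) : Prop where
  temperate : ∀ l, (ℓ l).HasTemperateGrowth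
  dilate : ∀ l r ξ, ℓ l (dilate r ξ) = ((r ^ (k + 2 * (l : ℕ)) : ℝ) : ℂ) * ℓ l ξ
  cotransport : ∀ u ξ, ℓ 0 (cotransport u ξ) = ℓ 0 ξ + (u : ℂ) * ℓ 1 ξ

theorem isHomSymbol_one : IsHomSymbol (d := d) 0 ![fun _ => 1, fun _ => 0] where
  temperate l := by
    fin_cases l
    · exact Function.HasTemperateGrowth.const _
    · exact Function.HasTemperateGrowth.const _
  dilate l r ξ := by fin_cases l <;> simp
  cotransport u ξ := by simp

theorem hasTemperateGrowth_inner (c : ℂ) (e : Phase d) :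
    Function.HasTemperateGrowth fun ξ : Phase d => c * ((inner ℝ ξ e : ℝ) : ℂ) := by
  fun_prop

/-- For `k = 1` the symbol is a component of `2πi ξ_v`, and the shear adds `u` times the same
component of `2πi ξ_x`, which has degree `3 = k + 2`. For `k = 0` the symbol is constant and nothing
is added. -/
theorem exists_gradV_eq {k : ℕ} (hk : k ≤ 1) (m : Fin k → Fin d) :
    ∃ ℓ : Fin 2 → Phase d → ℂ, IsHomSymbol k ℓ ∧ ∀ F, gradV m F = fm (ℓ 0) F := by
  obtain rfl | rfl : k = 0 ∨ k = 1 := by omega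
  · refine ⟨_, isHomSymbol_one, fun F => ?_⟩
    rw [gradV, LineDeriv.iteratedLineDerivOp_fin_zero]
    ext ψ
    rw [fm_apply]
    exact congrArg F (dm_one ψ).symm
  · set c : ℂ := 2 * Real.pi * Complex.I
    set e : EuclideanSpace ℝ (Fin d) := EuclideanSpace.single (m 0) 1
    refine ⟨![fun ξ => c * ((inner ℝ ξ (WithLp.toLp 2 (0, e) : Phase d) : ℝ) : ℂ),
      fun ξ => c * ((inner ℝ ξ (WithLp.toLp 2 (e, 0) : Phase d) : ℝ) : ℂ)], ⟨fun l => ?_, ?_, ?_⟩, ?_⟩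
    · fin_cases l
      · exact hasTemperateGrowth_inner c _
      · exact hasTemperateGrowth_inner c _
    · intro l r ξ
      fin_cases l
      · simp [WithLp.prod_inner_apply, Kinetic.dilate, inner_smul_left]
        ring
      · simp [WithLp.prod_inner_apply, Kinetic.dilate, inner_smul_left]
        ring
    · intro u ξ
      simp [WithLp.prod_inner_apply, cotransport_apply, inner_add_left, inner_smul_left]
      ring
    · intro F
      rw [gradV, LineDeriv.iteratedLineDerivOp_one,
        TemperedDistribution.lineDeriv_eq_fourierMultiplierCLM]
      have := TemperedDistribution.fourierMultiplierCLM_smul (F := ℂ) (g := fun ξ : Phase d =>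
        ((inner ℝ ξ (WithLp.toLp 2 (0, e) : Phase d) : ℝ) : ℂ)) (by fun_prop) c
      exact (congrArg (fun X : 𝓢'(Phase d, ℂ) →L[ℂ] 𝓢'(Phase d, ℂ) => X F) this).symm

/-- The symbol of `ℓ₀(D) P_u` before the transport by `Γ_u`. -/
def esym (ℓ : Fin 2 → Phase d → ℂ) (u : ℝ) (ξ : Phase d) : ℂ :=
  (ℓ 0 ξ + (u : ℂ) * ℓ 1 ξ) * sc (heatS d) √u ξ

theorem IsHomSymbol.esym_temperate {k : ℕ} {ℓ : Fin 2 → Phase d → ℂ} (hℓ : IsHomSymbol k ℓ)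
    (u : ℝ) : (esym ℓ u).HasTemperateGrowth :=
  ((hℓ.temperate 0).add ((Function.HasTemperateGrowth.const (u : ℂ)).mul (hℓ.temperate 1))).mul
    (sc (heatS d) √u).hasTemperateGrowth

theorem IsHomSymbol.fm_kineticSemigroup {k : ℕ} {ℓ : Fin 2 → Phase d → ℂ} (hℓ : IsHomSymbol k ℓ)
    {u : ℝ} (hu : 0 < u) (F : 𝓢'(Phase d, ℂ)) :
    fm (ℓ 0) (kineticSemigroup u F) = transportD u (fm (esym ℓ u) F) := by
  have h : (fun ξ => ℓ 0 (Kinetic.cotransport u ξ)).HasTemperateGrowth :=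
    (hℓ.temperate 0).comp (Kinetic.cotransport u).hasTemperateGrowth
  rw [kineticSemigroup_eq hu, fm_transportD u (hℓ.temperate 0), fm_fm h
    (sc (heatS d) √u).hasTemperateGrowth]
  congr 2
  refine congrArg fm (funext fun ξ => ?_)
  rw [hℓ.cotransport, esym]

/-- The product of a Schwartz function by a temperate function. -/
def mulS (ℓ : Phase d → ℂ) (A : 𝓢(Phase d, ℂ)) : 𝓢(Phase d, ℂ) := SchwartzMap.smulLeftCLM ℂ ℓ A

theorem sc_mulS {ℓ : Phase d → ℂ} (hℓ : ℓ.HasTemperateGrowth) {n : ℕ}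
    (h : ∀ r ξ, ℓ (dilate r ξ) = ((r ^ n : ℝ) : ℂ) * ℓ ξ) (A : 𝓢(Phase d, ℂ)) {r : ℝ} (hr : 0 < r)
    (ξ : Phase d) : sc (mulS ℓ A) r ξ = ((r ^ n : ℝ) : ℂ) * ℓ ξ * sc A r ξ := by
  rw [sc_apply _ hr, sc_apply _ hr, mulS, SchwartzMap.smulLeftCLM_apply_apply hℓ, h, smul_eq_mul]

theorem hom_pow_dilate (n : ℕ) (r : ℝ) (ξ : Phase d) :
    hom (dilate r ξ) ^ n = ((r ^ (6 * n) : ℝ) : ℂ) * hom ξ ^ n := by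
  rw [hom_dilate, mul_pow, ← Complex.ofReal_pow, ← pow_mul]

/-- On an enlarged block the symbol of `ℓ₀(D) P_u` is a combination of products of dilated
Schwartz functions, with coefficients that decay in `u 2^{2i}`. -/
theorem IsHomSymbol.exists_esym_mul_fatS {φ : Phase d → ℝ} (hφ : IsCutoff φ) {k : ℕ}
    {ℓ : Fin 2 → Phase d → ℂ} (hℓ : IsHomSymbol k ℓ) (n : ℕ) (T : ℝ) :
    ∃ C : ℝ, 0 ≤ C ∧ ∃ A B : Fin 3 → Fin 2 → 𝓢(Phase d, ℂ), ∀ i : ℤ, -1 ≤ i → ∀ u : ℝ, 0 < u →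
      u ≤ T → ∃ q, ∃ c : Fin 2 → ℂ,
        (∀ l, ‖c l‖ ≤ C * ((2 ^ i) ^ k * (wt u i ^ n)⁻¹)) ∧
        ∀ ξ, esym ℓ u ξ * fatS hφ i ξ =
          ∑ l, c l * (sc (A q l) (2 ^ (-i)) ξ * sc (B q l) √u ξ) := by
  -- One power more than `n`, because the term with `l = 1` carries a factor `r = u 2^{2i}` that
  -- must be absorbed too, even for `n = 0`.
  obtain ⟨τ, hτ⟩ := exists_fatAnn_eq hφ (n + 1)
  refine ⟨2 ^ n + (2 + |T|) ^ (n + 1), by positivity,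
    ![fun l => mulS (ℓ l) (fatAnn hφ), fun l => mulS (ℓ l) (sc (cutS hφ) 4⁻¹),
      fun l => mulS (ℓ l) τ],
    ![fun _ => heatS d, fun _ => heatS d, fun _ => mulS (fun ξ => hom ξ ^ (n + 1)) (heatS d)],
    fun i hi u hu huT => ?_⟩
  have hs : 0 < √u := Real.sqrt_pos.2 hu
  have hs2 : √u ^ 2 = u := Real.sq_sqrt hu.le
  have h2i : (0 : ℝ) < 2 ^ i := by positivity
  have e1 : (2 : ℝ) ^ (-i) = (2 ^ i)⁻¹ := zpow_neg 2 i
  have e2 : (2 : ℝ) ^ (2 * i) = (2 ^ i) ^ 2 := by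
    rw [mul_comm, zpow_mul]; rfl
  set r : ℝ := u * (2 ^ i) ^ 2 with hr
  have hr0 : 0 < r := by positivity
  have hw : wt u i = 1 + r := by rw [wt, e2]
  have hw1 : 1 ≤ wt u i := one_le_wt hu.le i
  have hT0 : 0 < T := hu.trans_le huT
  have hfat (ξ : Phase d) : fatS hφ i ξ = sc (fatP hφ i) (2 ^ (-i)) ξ := rfl
  have hl (l : Fin 2) : r ^ (l : ℕ) ≤ 1 + r := by
    fin_cases l
    · simp; linarith
    · simp
  have hR (A : 𝓢(Phase d, ℂ)) (l : Fin 2) (ξ : Phase d) : ((u ^ (l : ℕ) : ℝ) : ℂ) * (ℓ l ξ * sc A (2 ^ (-i)) ξ) =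
      (((2 ^ i) ^ k * r ^ (l : ℕ) : ℝ) : ℂ) * sc (mulS (ℓ l) A) (2 ^ (-i)) ξ := by
    rw [sc_mulS (hℓ.temperate l) (hℓ.dilate l) _ (by positivity), ← mul_assoc, ← mul_assoc,
      ← mul_assoc, ← Complex.ofReal_mul]
    congr 3
    rw [e1, hr, pow_add, pow_mul, mul_pow, inv_pow, inv_pow, inv_pow]
    field_simp
  have hE (ξ : Phase d) : esym ℓ u ξ * fatS hφ i ξ = ∑ l : Fin 2, ((u ^ (l : ℕ) : ℝ) : ℂ) *
      (ℓ l ξ * sc (fatP hφ i) (2 ^ (-i)) ξ) * sc (heatS d) √u ξ := by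
    rw [esym, hfat, Fin.sum_univ_two]
    simp
    ring
  -- If `r` is bounded, so is the parabolic weight, and no decay has to be extracted: the profile of
  -- the enlarged block and the heat kernel are used as they are.
  by_cases hrT : r ≤ 1 + T
  · obtain ⟨q, hq, hB⟩ : ∃ q : Fin 3, (∀ l, ![fun l => mulS (ℓ l) (fatAnn hφ),
        fun l => mulS (ℓ l) (sc (cutS hφ) 4⁻¹), fun l => mulS (ℓ l) τ] q l =
          mulS (ℓ l) (fatP hφ i)) ∧ ∀ l : Fin 2, ![fun _ : Fin 2 => heatS d, fun _ => heatS d,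
          fun _ => mulS (fun ξ => hom ξ ^ (n + 1)) (heatS d)] q l = heatS d := by
      by_cases hi0 : 0 ≤ i
      · exact ⟨0, fun l => by simp [fatP, hi0], fun l => rfl⟩
      · exact ⟨1, fun l => by simp [fatP, hi0], fun l => rfl⟩
    refine ⟨q, fun l => (((2 ^ i) ^ k * r ^ (l : ℕ) : ℝ) : ℂ), fun l => ?_, fun ξ => ?_⟩
    · rw [Complex.norm_real, Real.norm_of_nonneg (by positivity), mul_left_comm]
      refine mul_le_mul_of_nonneg_left ?_ (by positivity)
      rw [← div_eq_mul_inv, le_div_iff₀ (by positivity)]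
      calc r ^ (l : ℕ) * wt u i ^ n ≤ (1 + r) * (1 + r) ^ n := by
            rw [hw]
            gcongr
            exact hl l
        _ = (1 + r) ^ (n + 1) := by ring
        _ ≤ (2 + |T|) ^ (n + 1) :=
            pow_le_pow_left₀ (by positivity) (by linarith [le_abs_self T]) _
        _ ≤ _ := le_add_of_nonneg_left (by positivity)
    · rw [hE]
      refine Finset.sum_congr rfl fun l _ => ?_
      rw [hR, hq, hB, mul_assoc]
  -- A large `r` excludes `i = -1`, for which `r = u / 4 ≤ T`. So the profile is an annulus and is
  -- divisible by `hom^{n+1}`; the homogeneous factor is handed over to the heat kernel, and the two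
  -- scales `2^{-i}` and `√u` leave the coefficient `r^{-3(n+1)}`.
  · have hi0 : 0 ≤ i := by
      by_contra hi1
      obtain rfl : i = -1 := by omega
      apply hrT
      rw [hr]
      norm_num
      linarith
    have hr1 : 1 ≤ r := by linarith
    refine ⟨2, fun l => (((2 ^ i) ^ k * r ^ (l : ℕ) * (r ^ (3 * (n + 1)))⁻¹ : ℝ) : ℂ), fun l => ?_,
      fun ξ => ?_⟩
    · rw [Complex.norm_real, Real.norm_of_nonneg (by positivity), mul_left_comm, mul_assoc]
      refine mul_le_mul_of_nonneg_left ?_ (by positivity)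
      rw [← div_eq_mul_inv, ← div_eq_mul_inv, div_le_div_iff₀ (by positivity) (by positivity)]
      calc r ^ (l : ℕ) * wt u i ^ n ≤ r * (r + r) ^ n := by
            rw [hw]
            gcongr
            fin_cases l
            · simpa using hr1
            · simp
        _ = 2 ^ n * r ^ (n + 1) := by rw [← two_mul, mul_pow]; ring
        _ ≤ 2 ^ n * r ^ (3 * (n + 1)) := by
            exact mul_le_mul_of_nonneg_left (pow_le_pow_right₀ hr1 (by omega)) (by positivity)
        _ ≤ _ := by
            gcongr
            exact le_add_of_nonneg_right (by positivity)
    · rw [hE]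
      refine Finset.sum_congr rfl fun l _ => ?_
      rw [hR]
      have h3 : fatP hφ i = mulS (fun ξ => hom ξ ^ (n + 1)) τ := by
        ext ξ
        rw [fatP, if_pos hi0, hτ, mulS,
          SchwartzMap.smulLeftCLM_apply_apply (hasTemperateGrowth_hom_pow _), smul_eq_mul]
      change _ = _ * (sc (mulS (ℓ l) τ) (2 ^ (-i)) ξ *
        sc (mulS (fun ξ => hom ξ ^ (n + 1)) (heatS d)) √u ξ)
      rw [sc_mulS (hℓ.temperate l) (hℓ.dilate l) _ (by positivity),
        sc_mulS (hℓ.temperate l) (hℓ.dilate l) _ (by positivity),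
        sc_mulS (hasTemperateGrowth_hom_pow (n + 1)) (hom_pow_dilate (n + 1)) _ hs, h3,
        sc_mulS (hasTemperateGrowth_hom_pow (n + 1)) (hom_pow_dilate (n + 1)) _ (by positivity)]
      have h4 : ((2 : ℝ) ^ (-i)) ^ (6 * (n + 1)) = (r ^ (3 * (n + 1)))⁻¹ * √u ^ (6 * (n + 1)) := by
        have : √u ^ (6 * (n + 1)) = u ^ (3 * (n + 1)) := by
          rw [show 6 * (n + 1) = 2 * (3 * (n + 1)) by ring, pow_mul, hs2]
        rw [this, e1, hr, mul_pow, ← pow_mul, show 2 * (3 * (n + 1)) = 6 * (n + 1) by ring, inv_pow]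
        field_simp
      rw [h4]
      push_cast
      ring

/-! ### Bounds for the semigroup on enlarged blocks -/

theorem fm_eq_sum {ι : Type*} [Fintype ι] {σ : Phase d → ℂ} {c : ι → ℂ} {τ τ' : ι → 𝓢(Phase d, ℂ)}
    (h : ∀ ξ, σ ξ = ∑ l, c l * (τ l ξ * τ' l ξ)) (G : 𝓢'(Phase d, ℂ)) :
    fm σ G = ∑ l, c l • fm (τ l) (fm (τ' l) G) := by
  have h1 (l : ι) : (fun ξ => τ l ξ * τ' l ξ).HasTemperateGrowth :=
    (τ l).hasTemperateGrowth.mul (τ' l).hasTemperateGrowth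
  have h2 (l : ι) : (c l • fun ξ => τ l ξ * τ' l ξ).HasTemperateGrowth :=
    (Function.HasTemperateGrowth.const (c l)).mul (h1 l)
  have h3 := TemperedDistribution.fourierMultiplierCLM_sum ℂ (s := Finset.univ)
    (g := fun l => c l • fun ξ => τ l ξ * τ' l ξ) (fun l _ => h2 l)
  have h4 : fm σ = ∑ l, fm (c l • fun ξ => τ l ξ * τ' l ξ) := by
    rw [← h3]
    exact congrArg fm (funext h)
  rw [h4, sum_apply]
  refine Finset.sum_congr rfl fun l _ => ?_
  rw [fm_fm (τ l).hasTemperateGrowth (τ' l).hasTemperateGrowth]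
  exact congrArg (fun X : 𝓢'(Phase d, ℂ) →L[ℂ] 𝓢'(Phase d, ℂ) => X G)
    (TemperedDistribution.fourierMultiplierCLM_smul (F := ℂ) (h1 l) (c l))

theorem exists_bd_fm_sc_sc {w : Phase d → ℝ} (hw : IsWeight w) (A B : 𝓢(Phase d, ℂ)) (R : ℝ) :
    ∃ C : ℝ, 0 ≤ C ∧ ∀ r r', 0 < r → r ≤ R → 0 < r' → r' ≤ R → ∀ M F, 0 ≤ M → Bd w M F →
      Bd w (C * M) (fm (sc A r) (fm (sc B r') F)) := by
  obtain ⟨C, hC, h⟩ := exists_bd_fm_sc hw A R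
  obtain ⟨C', hC', h'⟩ := exists_bd_fm_sc hw B R
  refine ⟨C * C', by positivity, fun r r' hr hrR hr' hrR' M F hM hF => ?_⟩
  rw [mul_assoc]
  exact (h r hr hrR).2 _ _ (by positivity) ((h' r' hr' hrR').2 M F hM hF)

/-- The derivation rule `[A B, a] = A [B, a] + [A, a] B`, with one commutator at each of the two
scales. -/
theorem exists_bd_commutator_sc_sc {w v : Phase d → ℝ} (hw : IsWeight w) (hv : IsWeight v)
    (A B : 𝓢(Phase d, ℂ)) (R : ℝ) (L : ℕ) :
    ∃ C : ℝ, 0 ≤ C ∧ ∀ r r', 0 < r → r ≤ R → 0 < r' → r' ≤ R → ∀ (i : ℤ) N M a G, 0 ≤ N → 0 ≤ M →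
      a.HasTemperateGrowth → IsSlow w N i L a → Bd v M G →
      Bd (fun z => w z * v z)
        (C * (N * M) * ((1 + r * 2 ^ i) ^ (3 * L) + (1 + r' * 2 ^ i) ^ (3 * L)))
        (fm (sc A r) (fm (sc B r') (mulD a G)) - mulD a (fm (sc A r) (fm (sc B r') G))) := by
  have hwv := hw.mul hv
  obtain ⟨C₁, hC₁, h₁⟩ := exists_bd_fm_sc hwv A R
  obtain ⟨C₂, hC₂, h₂⟩ := exists_bd_fm_sc hv B R
  obtain ⟨C₃, hC₃, h₃⟩ := Kinetic.exists_bd_commutator hw hv A R L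
  obtain ⟨C₄, hC₄, h₄⟩ := Kinetic.exists_bd_commutator hw hv B R L
  refine ⟨C₁ * C₄ + C₃ * C₂, by positivity, fun r r' hr hrR hr' hrR' i N M a G hN hM ha hs hG => ?_⟩
  have e : fm (sc A r) (fm (sc B r') (mulD a G)) - mulD a (fm (sc A r) (fm (sc B r') G)) =
      fm (sc A r) (fm (sc B r') (mulD a G) - mulD a (fm (sc B r') G)) +
        (fm (sc A r) (mulD a (fm (sc B r') G)) - mulD a (fm (sc A r) (fm (sc B r') G))) := by
    rw [map_sub]
    abel
  rw [e]
  have b1 := (h₁ r hr hrR).2 _ _ (by positivity) (h₄ r' hr' hrR' i N M a G hN hM ha hs hG)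
  have b2 := h₃ r hr hrR i N (C₂ * M) a _ hN (by positivity) ha hs ((h₂ r' hr' hrR').2 M G hM hG)
  refine (b1.add b2).mono hwv ?_
  have x1 : (0 : ℝ) ≤ (1 + r * 2 ^ i) ^ (3 * L) := by positivity
  have x2 : (0 : ℝ) ≤ (1 + r' * 2 ^ i) ^ (3 * L) := by positivity
  have y1 : 0 ≤ C₁ * C₄ * (N * M) := by positivity
  have y2 : 0 ≤ C₃ * C₂ * (N * M) := by positivity
  calc _ = C₁ * C₄ * (N * M) * (1 + r' * 2 ^ i) ^ (3 * L) +
        C₃ * C₂ * (N * M) * (1 + r * 2 ^ i) ^ (3 * L) := by ring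
    _ ≤ C₁ * C₄ * (N * M) * ((1 + r * 2 ^ i) ^ (3 * L) + (1 + r' * 2 ^ i) ^ (3 * L)) +
        C₃ * C₂ * (N * M) * ((1 + r * 2 ^ i) ^ (3 * L) + (1 + r' * 2 ^ i) ^ (3 * L)) := by
      gcongr
      · exact le_add_of_nonneg_left x1
      · exact le_add_of_nonneg_right x2
    _ = _ := by ring

theorem two_zpow_neg_le_two {i : ℤ} (hi : -1 ≤ i) : (2 : ℝ) ^ (-i) ≤ 2 :=
  (zpow_le_zpow_right₀ (by norm_num) (by omega : -i ≤ 1)).trans_eq (zpow_one _)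

section heatBlocks

variable {φ : Phase d → ℝ} {k : ℕ} {ℓ : Fin 2 → Phase d → ℂ}

theorem IsHomSymbol.exists_bd (hℓ : IsHomSymbol k ℓ) (hφ : IsCutoff φ) {w : Phase d → ℝ}
    (hw : IsWeight w) (n : ℕ) (T : ℝ) :
    ∃ C : ℝ, 0 ≤ C ∧ ∀ i : ℤ, -1 ≤ i → ∀ u, 0 < u → u ≤ T → ∀ M G, 0 ≤ M → Bd w M G →
      Bd w (C * ((2 ^ i) ^ k * (wt u i ^ n)⁻¹) * M) (fm (esym ℓ u) (fm (fatS hφ i) G)) := by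
  obtain ⟨C, hC, A, B, h⟩ := hℓ.exists_esym_mul_fatS hφ n T
  choose D hD hDb using fun q l => exists_bd_fm_sc_sc hw (A q l) (B q l) (2 + √T)
  -- The index `q` of the profile depends on `i` and `u`; summing over all of its values makes the
  -- constant uniform.
  refine ⟨C * ∑ q, ∑ l, D q l, mul_nonneg hC (Finset.sum_nonneg fun q _ =>
    Finset.sum_nonneg fun l _ => hD q l), fun i hi u hu huT M G hM hG => ?_⟩
  obtain ⟨q, c, hc, he⟩ := h i hi u hu huT
  rw [fm_fm (hℓ.esym_temperate u) (fatS hφ i).hasTemperateGrowth, fm_eq_sum he]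
  have hw0 : 0 < wt u i := zero_lt_one.trans_le (one_le_wt hu.le i)
  have hr : (2 : ℝ) ^ (-i) ≤ 2 + √T := (two_zpow_neg_le_two hi).trans
    (le_add_of_nonneg_right (Real.sqrt_nonneg _))
  have hr' : √u ≤ 2 + √T := (Real.sqrt_le_sqrt huT).trans (le_add_of_nonneg_left (by norm_num))
  refine (Bd.sum fun l _ => (hDb q l _ _ (by positivity) hr (Real.sqrt_pos.2 hu) hr' M G hM
    hG).smul (c l)).mono hw ?_
  calc ∑ l, ‖c l‖ * (D q l * M)
      ≤ ∑ l, (C * ((2 ^ i) ^ k * (wt u i ^ n)⁻¹)) * (D q l * M) := by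
        refine Finset.sum_le_sum fun l _ => mul_le_mul_of_nonneg_right (hc l) ?_
        exact mul_nonneg (hD q l) hM
    _ = (C * ((2 ^ i) ^ k * (wt u i ^ n)⁻¹)) * M * ∑ l, D q l := by
        rw [Finset.mul_sum]
        exact Finset.sum_congr rfl fun l _ => by ring
    _ ≤ (C * ((2 ^ i) ^ k * (wt u i ^ n)⁻¹)) * M * ∑ q, ∑ l, D q l := by
        refine mul_le_mul_of_nonneg_left ?_ (by positivity)
        exact Finset.single_le_sum (f := fun q => ∑ l, D q l)
          (fun q _ => Finset.sum_nonneg fun l _ => hD q l) (Finset.mem_univ q)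
    _ = _ := by ring

theorem one_add_sqrt_mul_le {u : ℝ} (hu : 0 ≤ u) (i : ℤ) : 1 + √u * 2 ^ i ≤ 2 * wt u i := by
  have h2 : √u ^ 2 = u := Real.sq_sqrt hu
  have e2 : (2 : ℝ) ^ (2 * i) = (2 ^ i) ^ 2 := by
    rw [mul_comm, zpow_mul]; rfl
  rw [wt, e2]
  nlinarith [sq_nonneg (√u * 2 ^ i - 1)]

theorem IsHomSymbol.exists_bd_commutator (hℓ : IsHomSymbol k ℓ) (hφ : IsCutoff φ)
    {w v : Phase d → ℝ} (hw : IsWeight w) (hv : IsWeight v) (n : ℕ) (T : ℝ) (L : ℕ) :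
    ∃ C : ℝ, 0 ≤ C ∧ ∀ i : ℤ, -1 ≤ i → ∀ u, 0 < u → u ≤ T → ∀ N M a G, 0 ≤ N → 0 ≤ M →
      a.HasTemperateGrowth → IsSlow w N i L a → Bd v M G →
      Bd (fun z => w z * v z) (C * ((2 ^ i) ^ k * (wt u i ^ n)⁻¹) * (N * M))
        (fm (esym ℓ u) (fm (fatS hφ i) (mulD a G)) - mulD a (fm (esym ℓ u) (fm (fatS hφ i) G))) := by
  -- The commutators lose powers `3L` of `1 + √u 2^i`, which is at most twice the parabolic weight;
  -- the surplus decay compensates them.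
  obtain ⟨C, hC, A, B, h⟩ := hℓ.exists_esym_mul_fatS hφ (n + 3 * L) T
  choose D hD hDb using fun q l => exists_bd_commutator_sc_sc hw hv (A q l) (B q l) (2 + √T) L
  refine ⟨2 * 2 ^ (3 * L) * C * ∑ q, ∑ l, D q l, mul_nonneg (by positivity)
    (Finset.sum_nonneg fun q _ => Finset.sum_nonneg fun l _ => hD q l),
    fun i hi u hu huT N M a G hN hM ha hs hG => ?_⟩
  obtain ⟨q, c, hc, he⟩ := h i hi u hu huT
  have hw1 : 1 ≤ wt u i := one_le_wt hu.le i
  have hw0 : 0 < wt u i := zero_lt_one.trans_le hw1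
  have hr : (2 : ℝ) ^ (-i) ≤ 2 + √T := (two_zpow_neg_le_two hi).trans
    (le_add_of_nonneg_right (Real.sqrt_nonneg _))
  have hr' : √u ≤ 2 + √T := (Real.sqrt_le_sqrt huT).trans (le_add_of_nonneg_left (by norm_num))
  have e1 : fm (esym ℓ u) (fm (fatS hφ i) (mulD a G)) -
      mulD a (fm (esym ℓ u) (fm (fatS hφ i) G)) =
      ∑ l, c l • (fm (sc (A q l) (2 ^ (-i))) (fm (sc (B q l) √u) (mulD a G)) -
        mulD a (fm (sc (A q l) (2 ^ (-i))) (fm (sc (B q l) √u) G))) := by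
    rw [fm_fm (hℓ.esym_temperate u) (fatS hφ i).hasTemperateGrowth, fm_eq_sum he, fm_fm
      (hℓ.esym_temperate u) (fatS hφ i).hasTemperateGrowth, fm_eq_sum he, map_sum,
      ← Finset.sum_sub_distrib]
    refine Finset.sum_congr rfl fun l _ => ?_
    rw [smul_sub, map_smul]
  rw [e1]
  refine (Bd.sum fun l _ => (hDb q l _ _ (by positivity) hr (Real.sqrt_pos.2 hu) hr' i N M a G hN hM
    ha hs hG).smul (c l)).mono (hw.mul hv) ?_
  set X : ℝ := (1 + 2 ^ (-i) * 2 ^ i) ^ (3 * L) + (1 + √u * 2 ^ i) ^ (3 * L)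
  have hX : X ≤ 2 * 2 ^ (3 * L) * wt u i ^ (3 * L) := by
    have x1 : (1 + (2 : ℝ) ^ (-i) * 2 ^ i) ^ (3 * L) ≤ (2 * wt u i) ^ (3 * L) := by
      refine pow_le_pow_left₀ (by positivity) ?_ _
      rw [zpow_neg, inv_mul_cancel₀ (by positivity)]
      linarith
    have x2 : (1 + √u * (2 : ℝ) ^ i) ^ (3 * L) ≤ (2 * wt u i) ^ (3 * L) :=
      pow_le_pow_left₀ (by positivity) (one_add_sqrt_mul_le hu.le i) _
    rw [mul_pow] at x1 x2
    calc X ≤ _ := add_le_add x1 x2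
      _ = _ := by ring
  calc ∑ l, ‖c l‖ * (D q l * (N * M) * X)
      ≤ ∑ l, (C * ((2 ^ i) ^ k * (wt u i ^ (n + 3 * L))⁻¹)) *
          (D q l * (N * M) * (2 * 2 ^ (3 * L) * wt u i ^ (3 * L))) := by
        refine Finset.sum_le_sum fun l _ => ?_
        have := hD q l
        have h0 : 0 ≤ X := by positivity
        exact mul_le_mul (hc l) (mul_le_mul_of_nonneg_left hX (by positivity)) (by positivity)
          (by positivity)
    _ = 2 * 2 ^ (3 * L) * (C * ((2 ^ i) ^ k * (wt u i ^ n)⁻¹)) * (N * M) * ∑ l, D q l := by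
        rw [Finset.mul_sum]
        refine Finset.sum_congr rfl fun l _ => ?_
        rw [pow_add]
        field_simp
    _ ≤ 2 * 2 ^ (3 * L) * (C * ((2 ^ i) ^ k * (wt u i ^ n)⁻¹)) * (N * M) * ∑ q, ∑ l, D q l := by
        refine mul_le_mul_of_nonneg_left ?_ (by positivity)
        exact Finset.single_le_sum (f := fun q => ∑ l, D q l)
          (fun q _ => Finset.sum_nonneg fun l _ => hD q l) (Finset.mem_univ q)
    _ = _ := by ring

/-- A block of a transported distribution vanishes if the frequencies do not match. -/
theorem fm_blockS_transportD_eq_zero (hφ : IsCutoff φ) {i j : ℤ} (hi : -1 ≤ i) (hj : -1 ≤ j) {u : ℝ}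
    (hu : 0 ≤ u) (h : 2 ^ 10 * wt u i < (2 : ℝ) ^ |j - i|) {σ : Phase d → ℂ}
    (hσ : σ.HasTemperateGrowth) {G : 𝓢'(Phase d, ℂ)} (hG : fm (fatS hφ i) G = G) :
    fm (blockS hφ j) (transportD u (fm σ G)) = 0 := by
  have h1 : (fun ξ => blockS hφ j (cotransport u ξ)).HasTemperateGrowth :=
    (blockS hφ j).hasTemperateGrowth.comp (cotransport u).hasTemperateGrowth
  have h2 : (fun ξ => σ ξ * fatS hφ i ξ).HasTemperateGrowth :=
    hσ.mul (fatS hφ i).hasTemperateGrowth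
  rw [fm_transportD u (blockS hφ j).hasTemperateGrowth, ← hG, fm_fm hσ
    (fatS hφ i).hasTemperateGrowth, fm_fm h1 h2]
  have e : (fun ξ => blockS hφ j (cotransport u ξ) * (σ ξ * fatS hφ i ξ)) = fun _ => 0 := by
    funext ξ
    by_contra hne
    have h2 : blockS hφ j (cotransport u ξ) ≠ 0 := fun h2 => hne (by rw [h2, zero_mul])
    have h3 : fatS hφ i ξ ≠ 0 := fun h3 => hne (by rw [h3, mul_zero, mul_zero])
    exact absurd (two_zpow_abs_le_of_ne_zero hφ hi hj hu h3 h2) (not_le.2 h)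
  rw [e, fm_zero, map_zero]

end heatBlocks

/-! ### Smoothing by the semigroup -/

theorem exists_bd_blockS {φ : Phase d → ℝ} (hφ : IsCutoff φ) {w : Phase d → ℝ} (hw : IsWeight w) :
    ∃ C : ℝ, 0 ≤ C ∧ ∀ j M F, 0 ≤ M → Bd w M F → Bd w (C * M) (fm (blockS hφ j) F) := by
  obtain ⟨C₁, hC₁, h₁⟩ := exists_bd_fm_sc hw (annS hφ) 1
  obtain ⟨C₂, hC₂, h₂⟩ := exists_bd_fm_sc hw (cutS hφ) 1
  refine ⟨C₁ + C₂, by positivity, fun j M F hM hF => ?_⟩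
  rcases le_or_gt 0 j with hj | hj
  · rw [blockS, if_pos hj]
    refine ((h₁ _ (by positivity) ?_).2 M F hM hF).mono hw (by nlinarith)
    exact zpow_le_one_of_nonpos₀ (by norm_num) (by omega)
  · rcases eq_or_ne j (-1) with rfl | hj'
    · have := (h₂ 1 one_pos le_rfl).2 M F hM hF
      rw [sc_one] at this
      rw [blockS, if_neg (by omega), if_pos rfl]
      exact this.mono hw (by nlinarith)
    · rw [fm_blockS_of_lt hφ (by omega)]
      exact (bd_zero w).mono hw (by positivity)

theorem geo_eq (j : ℤ) : geo j = ((2 : ℝ) ^ |j|)⁻¹ := by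
  rw [geo, one_div, inv_pow, Int.abs_eq_natAbs, zpow_natCast]

theorem rpow_mul_int_le (b : ℝ) (i j : ℤ) :
    (2 : ℝ) ^ (-b * i) ≤ 2 ^ (-b * j) * ((2 : ℝ) ^ |j - i|) ^ ⌈|b|⌉₊ := by
  rw [← zpow_natCast, ← zpow_mul, ← Real.rpow_intCast, ← Real.rpow_add two_pos]
  refine Real.rpow_le_rpow_of_exponent_le (by norm_num) ?_
  push_cast
  have h1 : |b| ≤ (⌈|b|⌉₊ : ℝ) := Nat.le_ceil _
  have h2 : b * ((j : ℝ) - i) ≤ |b| * |(j : ℝ) - i| := by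
    rw [← abs_mul]; exact le_abs_self _
  have h3 : |b| * |(j : ℝ) - i| ≤ |(j : ℝ) - i| * ⌈|b|⌉₊ := by
    rw [mul_comm]; gcongr
  linarith

theorem wt_le_mul {u : ℝ} (hu : 0 ≤ u) (i j : ℤ) : wt u j ≤ wt u i * ((2 : ℝ) ^ |j - i|) ^ 2 := by
  have h1 : (1 : ℝ) ≤ (2 : ℝ) ^ |j - i| := one_le_zpow₀ (by norm_num) (abs_nonneg _)
  have h2 : (2 : ℝ) ^ (2 * j) ≤ 2 ^ (2 * i) * ((2 : ℝ) ^ |j - i|) ^ 2 := by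
    rw [← zpow_natCast, ← zpow_mul, ← zpow_add₀ two_ne_zero]
    refine zpow_le_zpow_right₀ (by norm_num) ?_
    have := le_abs_self (j - i)
    push_cast
    linarith
  have h3 : (1 : ℝ) ≤ ((2 : ℝ) ^ |j - i|) ^ 2 := one_le_pow₀ h1
  unfold wt
  calc 1 + u * (2 : ℝ) ^ (2 * j) ≤ 1 * ((2 : ℝ) ^ |j - i|) ^ 2 +
        u * (2 ^ (2 * i) * ((2 : ℝ) ^ |j - i|) ^ 2) := by
        rw [one_mul]; gcongr
    _ = _ := by ring

/-- The decay in `u 2^{2i}` compensates the distance between the frequencies. -/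
theorem exists_wt_bound (b : ℝ) {D : ℝ} (hD : 0 ≤ D) :
    ∃ n : ℕ, ∃ C : ℝ, 0 ≤ C ∧ ∀ u, 0 ≤ u → ∀ i j : ℤ, (2 : ℝ) ^ |j - i| ≤ D * wt u i →
      (2 : ℝ) ^ (-b * i) * (wt u i ^ n)⁻¹ ≤
        C * (2 ^ (-b * j) * (wt u j ^ 2)⁻¹ * geo (i - j)) := by
  set m := ⌈|b|⌉₊ with hm
  -- With `p = 2^{|j-i|}`: the change of the index in `2^{-bi}` costs `p^m`, replacing the squared
  -- weight at `i` by that at `j` costs `p^4`, and the summable factor costs `p`. Each of the `m +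
  -- 5` powers is at most `D W`, and `W²` is left over from the squared weight.
  refine ⟨m + 7, D ^ (m + 5), by positivity, fun u hu i j h => ?_⟩
  rw [← geo_neg, neg_sub, geo_eq]
  have h1 := rpow_mul_int_le b i j
  have h2 := wt_le_mul hu i j
  rw [← hm] at h1
  set p : ℝ := (2 : ℝ) ^ |j - i|
  have hp : 0 < p := by positivity
  have hi : 0 < wt u i := zero_lt_one.trans_le (one_le_wt hu i)
  have hj : 0 < wt u j := zero_lt_one.trans_le (one_le_wt hu j)
  set W := wt u i
  set V := wt u j
  have h3 : p ^ (m + 5) * W ^ 2 ≤ D ^ (m + 5) * W ^ (m + 7) := by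
    calc p ^ (m + 5) * W ^ 2 ≤ (D * W) ^ (m + 5) * W ^ 2 := by gcongr
      _ = _ := by ring
  have h4 : p ^ m * V ^ 2 * p ≤ D ^ (m + 5) * W ^ (m + 7) := by
    calc p ^ m * V ^ 2 * p ≤ p ^ m * (W * p ^ 2) ^ 2 * p := by gcongr
      _ = p ^ (m + 5) * W ^ 2 := by ring
      _ ≤ _ := h3
  calc (2 : ℝ) ^ (-b * i) * (W ^ (m + 7))⁻¹ ≤ 2 ^ (-b * j) * p ^ m * (W ^ (m + 7))⁻¹ := by gcongr
    _ = 2 ^ (-b * j) * (p ^ m * (W ^ (m + 7))⁻¹) := by ring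
    _ ≤ 2 ^ (-b * j) * (D ^ (m + 5) * ((V ^ 2)⁻¹ * p⁻¹)) := by
        refine mul_le_mul_of_nonneg_left ?_ (by positivity)
        rw [← mul_inv, ← div_eq_mul_inv, ← div_eq_mul_inv,
          div_le_div_iff₀ (by positivity) (by positivity)]
        linarith
    _ = _ := by ring

theorem zpow_pow_mul_rpow (b : ℝ) (k : ℕ) (i : ℤ) :
    ((2 : ℝ) ^ i) ^ k * 2 ^ (-b * i) = 2 ^ (-(b - k) * i) := by
  rw [← zpow_natCast, ← zpow_mul, ← Real.rpow_intCast, ← Real.rpow_add two_pos]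
  congr 1
  push_cast
  ring

theorem Bd.of_hasSum {w : Phase d → ℝ} {M : ℝ} {G : ℤ → 𝓢'(Phase d, ℂ)} {H : 𝓢'(Phase d, ℂ)} {j : ℤ}
    (h : ∀ i, Bd w (M * geo (i - j)) (G i)) (hH : HasSum G H) : Bd w (3 * M) H := fun ψ => by
  have h1 := hasSum_distribution_iff.1 hH ψ
  have h2 : HasSum (fun i => M * wnorm w ψ * geo (i - j)) (M * wnorm w ψ * 3) :=
    (hasSum_geo_sub j).mul_left _
  calc _ ≤ M * wnorm w ψ * 3 := h1.norm_le_of_bounded h2 fun i => (h i ψ).trans_eq (by ring)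
    _ = _ := by ring

section smoothing

variable {φ : Phase d → ℝ} {k : ℕ} {ℓ : Fin 2 → Phase d → ℂ}

/-- The operator `ℓ₀(D) P_u`. -/
def smoothing (ℓ : Fin 2 → Phase d → ℂ) (u : ℝ) : 𝓢'(Phase d, ℂ) →L[ℂ] 𝓢'(Phase d, ℂ) :=
  fm (ℓ 0) ∘L kineticSemigroup u

theorem IsHomSymbol.smoothing_eq (hℓ : IsHomSymbol k ℓ) {u : ℝ} (hu : 0 < u)
    (F : 𝓢'(Phase d, ℂ)) : smoothing ℓ u F = transportD u (fm (esym ℓ u) F) :=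
  hℓ.fm_kineticSemigroup hu F

theorem IsHomSymbol.exists_bd_smoothing (hℓ : IsHomSymbol k ℓ) (hφ : IsCutoff φ) {w : Phase d → ℝ}
    (hw : IsWeight w) (n : ℕ) (T : ℝ) :
    ∃ C : ℝ, 0 ≤ C ∧ ∀ i : ℤ, -1 ≤ i → ∀ u, 0 < u → u ≤ T → ∀ M G, 0 ≤ M → Bd w M G →
      fm (fatS hφ i) G = G → Bd w (C * ((2 ^ i) ^ k * (wt u i ^ n)⁻¹) * M) (smoothing ℓ u G) := by
  obtain ⟨C₁, hC₁, h₁⟩ := hℓ.exists_bd hφ hw n T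
  obtain ⟨C₂, hC₂, h₂⟩ := exists_bd_transportD hw T
  refine ⟨C₂ * C₁, by positivity, fun i hi u hu huT M G hM hG hf => ?_⟩
  have h3 := h₁ i hi u hu huT M G hM hG
  have hw0 : 0 < wt u i := zero_lt_one.trans_le (one_le_wt hu.le i)
  rw [hf] at h3
  rw [hℓ.smoothing_eq hu]
  have h4 := h₂ u (by rwa [abs_of_pos hu]) _ _ (by positivity) h3
  refine h4.mono hw (le_of_eq (by ring))

/-- The blocks of `ℓ₀(D) P_u G_i` for the terms of a decomposition of regularity `b`. -/
theorem IsHomSymbol.exists_bd_blockS_smoothing_term (hℓ : IsHomSymbol k ℓ) (hφ : IsCutoff φ)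
    {w : Phase d → ℝ} (hw : IsWeight w) (b T : ℝ) :
    ∃ C : ℝ, 0 ≤ C ∧ ∀ u, 0 < u → u ≤ T → ∀ M G, 0 ≤ M → IsDecomp hφ w M b G → ∀ i j : ℤ,
      Bd w (C * M * (2 ^ (-(b - k) * j) * (wt u j ^ 2)⁻¹) * geo (i - j))
        (fm (blockS hφ j) (smoothing ℓ u (G i))) := by
  obtain ⟨n, C₁, hC₁, h₁⟩ := exists_wt_bound (b - k) (D := 2 ^ 10) (by positivity)
  obtain ⟨C₂, hC₂, h₂⟩ := hℓ.exists_bd_smoothing hφ hw n T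
  obtain ⟨C₃, hC₃, h₃⟩ := exists_bd_blockS hφ hw
  refine ⟨C₃ * C₂ * C₁, by positivity, fun u hu huT M G hM hG i j => ?_⟩
  have hwj : 0 < wt u j := zero_lt_one.trans_le (one_le_wt hu.le j)
  have h0 : Bd w (C₃ * C₂ * C₁ * M * (2 ^ (-(b - k) * j) * (wt u j ^ 2)⁻¹) * geo (i - j))
      (0 : 𝓢'(Phase d, ℂ)) := by
    have := geo_nonneg (i - j)
    exact (bd_zero w).mono hw (by positivity)
  rcases lt_or_ge i (-1) with hi | hi
  · rw [hG.zero i hi, map_zero, map_zero]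
    exact h0
  rcases lt_or_ge j (-1) with hj | hj
  · rw [fm_blockS_of_lt hφ hj]
    exact h0
  -- Either the mismatch of frequencies is paid for by the decay, or the block vanishes.
  by_cases hc : (2 : ℝ) ^ |j - i| ≤ 2 ^ 10 * wt u i
  · have hwi : 0 < wt u i := zero_lt_one.trans_le (one_le_wt hu.le i)
    have h4 := h₂ i hi u hu huT _ _ (by positivity) (hG.bd i) (hG.fat i)
    refine (h₃ j _ _ (by positivity) h4).mono hw ?_
    calc _ = C₃ * C₂ * M * ((2 ^ i) ^ k * 2 ^ (-b * i) * (wt u i ^ n)⁻¹) := by ring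
      _ ≤ C₃ * C₂ * M * (C₁ * (2 ^ (-(b - k) * j) * (wt u j ^ 2)⁻¹ * geo (i - j))) := by
          rw [zpow_pow_mul_rpow]
          exact mul_le_mul_of_nonneg_left (h₁ u hu.le i j hc) (by positivity)
      _ = _ := by ring
  · rw [hℓ.smoothing_eq hu, fm_blockS_transportD_eq_zero hφ hi hj hu.le (not_le.1 hc)
      (hℓ.esym_temperate u) (hG.fat i)]
    exact h0

/-- The blocks of `ℓ₀(D) P_u H` for a distribution `H` of regularity `b`. -/
theorem IsHomSymbol.exists_bd_blockS_smoothing (hℓ : IsHomSymbol k ℓ) (hφ : IsCutoff φ)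
    {w : Phase d → ℝ} (hw : IsWeight w) (b T : ℝ) :
    ∃ C : ℝ, 0 ≤ C ∧ ∀ u, 0 < u → u ≤ T → ∀ M G H, 0 ≤ M → IsDecomp hφ w M b G → HasSum G H →
      ∀ j : ℤ, Bd w (C * M * (2 ^ (-(b - k) * j) * (wt u j ^ 2)⁻¹))
        (fm (blockS hφ j) (smoothing ℓ u H)) := by
  obtain ⟨C, hC, h⟩ := hℓ.exists_bd_blockS_smoothing_term hφ hw b T
  refine ⟨3 * C, by positivity, fun u hu huT M G H hM hG hH j => ?_⟩
  have hs := ((fm (blockS hφ j)) ∘L smoothing ℓ u).hasSum hH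
  exact (Bd.of_hasSum (fun i => h u hu huT M G hM hG i j) hs).mono hw (le_of_eq (by ring))

theorem IsHomSymbol.exists_blockBd_smoothing (hℓ : IsHomSymbol k ℓ) (hφ : IsCutoff φ)
    {w : Phase d → ℝ} (hw : IsWeight w) (b T : ℝ) :
    ∃ C : ℝ, 0 ≤ C ∧ ∀ u, 0 < u → u ≤ T → ∀ M G H, 0 ≤ M → IsDecomp hφ w M b G → HasSum G H →
      BlockBd hφ w (C * M) (b - k) (smoothing ℓ u H) := by
  obtain ⟨C, hC, h⟩ := hℓ.exists_bd_blockS_smoothing hφ hw b T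
  refine ⟨C, hC, fun u hu huT M G H hM hG hH j => (h u hu huT M G H hM hG hH j).mono hw ?_⟩
  have h1 : 1 ≤ wt u j ^ 2 := one_le_pow₀ (one_le_wt hu.le j)
  refine mul_le_mul_of_nonneg_left ?_ (by positivity)
  exact mul_le_of_le_one_right (by positivity) (inv_le_one_of_one_le₀ h1)

end smoothing

/-! ### Differences of low frequency functions -/

theorem measurePreserving_transport (u : ℝ) :
    MeasurePreserving (transport (d := d) u) volume volume := by
  refine ⟨(transport u).continuous.measurable, ?_⟩
  have h := Measure.map_linearMap_addHaar_eq_smul_addHaar (volume : Measure (Phase d))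
    (f := (transport (d := d) u : Phase d →ₗ[ℝ] Phase d))
    (transport u).toLinearEquiv.isUnit_det'.ne_zero
  have h3 : Measure.map (transport u) (volume : Measure (Phase d)) =
    ENNReal.ofReal (jac (transport (d := d) u)) • volume := h
  rw [h3, jac_transport, ENNReal.ofReal_one, one_smul]

theorem IsRep.transportD {F : 𝓢'(Phase d, ℂ)} {a : Phase d → ℂ} (h : IsRep F a) (u : ℝ) :
    IsRep (transportD u F) (fun z => a (transport u z)) := by
  have hm := measurePreserving_transport (d := d) u
  have he : MeasurableEmbedding (transport (d := d) u) :=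
    (transport u).toHomeomorph.measurableEmbedding
  refine ⟨h.1.comp_measurePreserving hm, fun ψ => ?_⟩
  obtain ⟨h1, h2⟩ := h.2 (compE (transport (-u)) ψ)
  have e : (fun z => ψ z * a (transport u z)) =
      (fun z => compE (transport (-u)) ψ z * a z) ∘ transport u := by
    funext z
    simp [transport_neg_transport]
  rw [e]
  refine ⟨(hm.integrable_comp_emb he).2 h1, ?_⟩
  rw [transportD_apply', h2]
  exact (hm.integral_comp he _).symm

theorem IsRep.sub {F G : 𝓢'(Phase d, ℂ)} {a b : Phase d → ℂ} (hF : IsRep F a) (hG : IsRep G b) :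
    IsRep (F - G) (fun z => a z - b z) := by
  refine ⟨hF.1.sub hG.1, fun ψ => ?_⟩
  obtain ⟨h1, h2⟩ := hF.2 ψ
  obtain ⟨h3, h4⟩ := hG.2 ψ
  simp only [mul_sub]
  refine ⟨h1.sub h3, ?_⟩
  rw [integral_sub h1 h3, ← h2, ← h4]
  rfl

section difference

variable {φ : Phase d → ℝ}

theorem BlockBd.sub_lowS_sub_one {hφ : IsCutoff φ} {w : Phase d → ℝ} (hw : IsWeight w) {M b : ℝ}
    (hM : 0 ≤ M) (hb : 0 < b) {F : 𝓢'(Phase d, ℂ)} (h : BlockBd hφ w M b F) {k : ℤ}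
    (hk : -1 ≤ k) :
    Bd w ((1 - 2 ^ (-b))⁻¹ * M * (2 ^ b * 2 ^ (-b * k))) (F - fm (lowS hφ (k - 1)) F) := by
  have hq : (2 : ℝ) ^ (-b) < 1 := Real.rpow_lt_one_of_one_lt_of_neg (by norm_num) (by linarith)
  have hq1 : 0 ≤ (1 - (2 : ℝ) ^ (-b))⁻¹ := inv_nonneg.2 (by linarith)
  rcases eq_or_lt_of_le hk with rfl | hk'
  · have e : lowS hφ (-1 - 1) = lowS hφ (-1) := by
      rw [lowS, lowS, if_neg (by norm_num), if_neg (by norm_num)]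
    rw [e]
    refine (h.sub_lowS hw hM hb le_rfl).mono hw ?_
    refine mul_le_mul_of_nonneg_left ?_ (by positivity)
    exact le_mul_of_one_le_left (by positivity) (Real.one_le_rpow (by norm_num) hb.le)
  · refine (h.sub_lowS hw hM hb (by omega)).mono hw (le_of_eq ?_)
    rw [← Real.rpow_add two_pos]
    congr 2
    push_cast
    ring

/-- The difference of a transported low frequency part at one time and of a low frequency part
at another time. -/
theorem exists_norm_lowFn_sub_le (hφ : IsCutoff φ) {w : Phase d → ℝ} (hw : IsWeight w) {α : ℝ}
    (hα : 0 < α) (T : ℝ) :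
    ∃ C : ℝ, 0 ≤ C ∧ ∀ u, 0 ≤ u → u ≤ T → ∀ M F F', 0 ≤ M → Bd w M F → Bd w M F' →
      BlockBd hφ w M α F → BlockBd hφ w M α F' →
      Bd w (M * u ^ (α / 2)) (F' - transportD u F) → ∀ i k : ℤ, -1 ≤ i → -1 ≤ k →
      ∀ᵐ z, ‖lowFn hφ i F (transport u z) - lowFn hφ k F' z‖ ≤
        C * M * (2 ^ (-α * i) + u ^ (α / 2) + 2 ^ (-α * k)) * w z := by
  obtain ⟨C, hC, h⟩ := exists_bd_transportD hw T
  have hq : (2 : ℝ) ^ (-α) < 1 := Real.rpow_lt_one_of_one_lt_of_neg (by norm_num) (by linarith)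
  have hq1 : 0 ≤ (1 - (2 : ℝ) ^ (-α))⁻¹ := inv_nonneg.2 (by linarith)
  set K : ℝ := (1 - (2 : ℝ) ^ (-α))⁻¹ * 2 ^ α with hK
  have hK0 : 0 ≤ K := by positivity
  refine ⟨C * K + 1 + K, by positivity, fun u hu huT M F F' hM hF hF' hB hB' hd i k hi hk => ?_⟩
  have hu0 : (0 : ℝ) ≤ u ^ (α / 2) := by positivity
  have r1 := ((hF.isRep_lowFn hφ hw hM i).transportD u).sub (hF'.isRep_lowFn hφ hw hM k)
  refine r1.ae_le_of_bd hw (by positivity) ?_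
  -- Three errors: the transported high frequencies of `F`, the kinetic increment from `F` to `F'`,
  -- and the high frequencies of `F'`.
  have e : transportD u (fm (lowS hφ (i - 1)) F) - fm (lowS hφ (k - 1)) F' =
      -transportD u (F - fm (lowS hφ (i - 1)) F) + -(F' - transportD u F) +
        (F' - fm (lowS hφ (k - 1)) F') := by
    rw [map_sub]; abel
  rw [e]
  have b1 := h u (by rwa [abs_of_nonneg hu]) _ _ (by positivity) (hB.sub_lowS_sub_one hw hM hα hi)
  have b3 := hB'.sub_lowS_sub_one hw hM hα hk
  refine ((b1.neg.add hd.neg).add b3).mono hw ?_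
  set x : ℝ := 2 ^ (-α * i)
  set y : ℝ := 2 ^ (-α * k)
  set t : ℝ := u ^ (α / 2)
  have hx : 0 ≤ x := by positivity
  have hy : 0 ≤ y := by positivity
  have e1 : C * ((1 - (2 : ℝ) ^ (-α))⁻¹ * M * (2 ^ α * x)) + M * t +
      (1 - (2 : ℝ) ^ (-α))⁻¹ * M * (2 ^ α * y) = M * ((C * K) * x + 1 * t + K * y) := by
    rw [hK]; ring
  rw [e1]
  have hCK : 0 ≤ C * K := by positivity
  calc M * ((C * K) * x + 1 * t + K * y) ≤ M * ((C * K + 1 + K) * x + (C * K + 1 + K) * t +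
        (C * K + 1 + K) * y) := by
        gcongr <;> linarith
    _ = _ := by ring

end difference

/-! ### The commutator at a fixed time -/

section fixedTime

variable {φ : Phase d → ℝ} {k : ℕ} {ℓ : Fin 2 → Phase d → ℂ}

/-- Only the terms with `|j - k| ≤ 2` survive. The point is finiteness: a block of a paraproduct can
then be exchanged with time integrals and with series in `G` at no cost. -/
theorem BlockBd.fm_blockS_paraproduct (hφ : IsCutoff φ) {w v : Phase d → ℝ} (hw : IsWeight w)
    (hv : IsWeight v) {M M' b : ℝ} (hM : 0 ≤ M) (hM' : 0 ≤ M') {F G : 𝓢'(Phase d, ℂ)}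
    (hF : Bd w M F) (hG : BlockBd hφ v M' b G) {j : ℤ} (hj : -1 ≤ j) :
    fm (blockS hφ j) (paraproduct φ F G) =
      ∑ k ∈ Finset.Ico (-1) (j + 3), fm (blockS hφ j) (paraTerm hφ F G k) := by
  have h1 := (fm (blockS hφ j)).hasSum (BlockBd.hasSum_paraproduct hφ hw hv hM hM' hF hG).2
  refine hasSum_distribution_unique h1 (hasSum_sum_of_ne_finset_zero fun k hk => ?_)
  rw [Finset.mem_Ico, not_and_or] at hk
  rcases hk with hk | hk
  · rw [paraTerm, fm_blockS_of_lt hφ (lt_of_not_ge hk), map_zero, map_zero]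
  · refine hF.fm_blockS_mulD_eq_zero hφ hw hM G hj ?_
    rw [lt_abs]
    right
    omega

theorem fm_lowS_eq_self {hφ : IsCutoff φ} {F : 𝓢'(Phase d, ℂ)} {N : ℤ} (hN : -1 ≤ N)
    (h : ∀ k, N ≤ k → fm (blockS hφ k) F = 0) : fm (lowS hφ N) F = F := by
  have h1 (n : ℤ) (hn : N ≤ n) : fm (lowS hφ n) F = fm (lowS hφ N) F := by
    rw [← sum_fm_blockS, ← sum_fm_blockS]
    refine (Finset.sum_subset (Finset.Ico_subset_Ico_right hn) fun k hk hk' => h k ?_).symm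
    rw [Finset.mem_Ico] at hk hk'
    omega
  ext ψ
  refine tendsto_nhds_unique (tendsto_const_nhds.congr' ?_) (tendsto_fm_lowS hφ F ψ)
  filter_upwards [Filter.eventually_ge_atTop N.toNat] with n hn
  rw [h1 n (by omega)]

/-- Since `u ≤ (1 + u 2^{2i}) 2^{-2i}`, taking the power `α/2 ≤ 1` converts regularity in time into
regularity at the frequency `2^i`, at the price of one parabolic weight. -/
theorem rpow_half_le {u α : ℝ} (hu : 0 ≤ u) (hα : 0 < α) (hα1 : α < 1) (i : ℤ) :
    u ^ (α / 2) ≤ wt u i * 2 ^ (-α * i) := by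
  have h1 : u ≤ wt u i * 2 ^ (-(2 * (i : ℝ))) := by
    have e : (2 : ℝ) ^ (-(2 * (i : ℝ))) = (2 ^ (2 * i))⁻¹ := by
      rw [← zpow_neg, ← Real.rpow_intCast]
      congr 1
      push_cast
      ring
    rw [e, wt, ← div_eq_mul_inv, le_div_iff₀ (by positivity)]
    linarith
  have hw1 := one_le_wt hu i
  have hw0 : 0 ≤ wt u i := by linarith
  calc u ^ (α / 2) ≤ (wt u i * 2 ^ (-(2 * (i : ℝ)))) ^ (α / 2) :=
        Real.rpow_le_rpow hu h1 (by positivity)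
    _ = wt u i ^ (α / 2) * 2 ^ (-α * i) := by
        rw [Real.mul_rpow hw0 (by positivity), ← Real.rpow_mul two_pos.le]
        congr 2
        ring
    _ ≤ wt u i * 2 ^ (-α * i) := by
        refine mul_le_mul_of_nonneg_right ?_ (by positivity)
        exact Real.rpow_le_self_of_one_le hw1 (by linarith)

/-- As `0 < α < 1`, the change of the index costs at most one power of `2^{|k-i|}`. -/
theorem rpow_le_of_compat {α D W : ℝ} (hα : 0 < α) (hα1 : α < 1) {i k : ℤ}
    (h : (2 : ℝ) ^ |k - i| ≤ D * W) : (2 : ℝ) ^ (-α * k) ≤ D * W * 2 ^ (-α * i) := by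
  have h1 := rpow_mul_int_le α k i
  have h2 : ⌈|α|⌉₊ = 1 := by
    rw [abs_of_pos hα, Nat.ceil_eq_iff one_ne_zero]
    simp
    constructor <;> linarith
  rw [h2, pow_one, abs_sub_comm] at h1
  calc _ ≤ _ := h1
    _ ≤ 2 ^ (-α * i) * (D * W) := by gcongr
    _ = _ := by ring

/-- The contribution of the frequencies of size `2^i` to the commutator. -/
def commTerm (hφ : IsCutoff φ) (ℓ : Fin 2 → Phase d → ℂ) (u : ℝ) (F F' G : 𝓢'(Phase d, ℂ))
    (N i : ℤ) : 𝓢'(Phase d, ℂ) :=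
  smoothing ℓ u (paraTerm hφ F G i) -
    ∑ k ∈ Finset.Ico (-1) N, paraTerm hφ F' (smoothing ℓ u (fm (blockS hφ i) G)) k

theorem IsHomSymbol.fm_blockS_smoothing_eq_zero (hℓ : IsHomSymbol k ℓ) (hφ : IsCutoff φ) {i j : ℤ}
    (hi : -1 ≤ i) {u : ℝ} (hu : 0 < u) (h : 2 ^ 10 * wt u i < (2 : ℝ) ^ |j - i|)
    {G : 𝓢'(Phase d, ℂ)} (hG : fm (fatS hφ i) G = G) :
    fm (blockS hφ j) (smoothing ℓ u G) = 0 := by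
  rcases lt_or_ge j (-1) with hj | hj
  · exact fm_blockS_of_lt hφ hj _
  · rw [hℓ.smoothing_eq hu]
    exact fm_blockS_transportD_eq_zero hφ hi hj hu.le h (hℓ.esym_temperate u) hG

/-- The heart of the estimate: the gain `2^{-αi}` comes from the slow variation of `S_{i-1} F` in
the commutator with the multiplier, and from the kinetic Hölder bound in the exchange of `F` for
`F'`. Truncation at `N` loses nothing of the smoothed block, since all of its blocks from `N` on
vanish. -/
theorem IsHomSymbol.exists_bd_commTerm (hℓ : IsHomSymbol k ℓ) (hφ : IsCutoff φ)
    {w v : Phase d → ℝ} (hw : IsWeight w) (hv : IsWeight v) {α : ℝ} (hα : 0 < α) (hα1 : α < 1)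
    (b T : ℝ) (n : ℕ) :
    ∃ C : ℝ, 0 ≤ C ∧ ∀ u, 0 < u → u ≤ T → ∀ M M' F F' G, 0 ≤ M → 0 ≤ M' →
      Bd w M F → Bd w M F' → BlockBd hφ w M α F → BlockBd hφ w M α F' →
      Bd w (M * u ^ (α / 2)) (F' - transportD u F) → BlockBd hφ v M' b G → ∀ i N : ℤ, -1 ≤ i →
      -1 ≤ N → (∀ k, N ≤ k → fm (blockS hφ k) (smoothing ℓ u (fm (blockS hφ i) G)) = 0) →
      Bd (fun z => w z * v z) (C * (M * M') * (2 ^ (-(α + b - k) * i) * (wt u i ^ n)⁻¹))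
        (commTerm hφ ℓ u F F' G N i) := by
  have hwv := hw.mul hv
  obtain ⟨C₁, L, hC₁, h₁⟩ := exists_isSlow_lowFn hφ hw hα1
  obtain ⟨C₂, hC₂, h₂⟩ := hℓ.exists_bd_commutator hφ hw hv n T L
  obtain ⟨C₃, hC₃, h₃⟩ := exists_bd_transportD hwv T
  obtain ⟨C₄, hC₄, h₄⟩ := exists_norm_lowFn_sub_le hφ hw hα T
  obtain ⟨C₅, hC₅, h₅⟩ := hℓ.exists_bd_smoothing hφ hv (n + 2) T
  obtain ⟨C₆, hC₆, h₆⟩ := exists_bd_blockS hφ hv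
  refine ⟨C₃ * C₂ * C₁ + C₄ * 2 ^ 11 * (C₆ * C₅) * 2 ^ 10 * 3, by positivity,
    fun u hu huT M M' F F' G hM hM' hF hF' hB hB' hd hG i N hi hN hz => ?_⟩
  have hW1 : 1 ≤ wt u i := one_le_wt hu.le i
  set W := wt u i with hWdef
  have hW0 : 0 < W := by linarith
  set a := lowFn hφ i F with ha_def
  set g := fm (blockS hφ i) G with hg_def
  have ha : a.HasTemperateGrowth := hF.hasTemperateGrowth_lowFn hφ hw hM i
  have hau : (fun z => a (transport u z)).HasTemperateGrowth :=
    ha.comp (transport u).hasTemperateGrowth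
  have hgf : fm (fatS hφ i) g = g := fm_fatS_blockS hφ i G
  have hpf : fm (fatS hφ i) (mulD a g) = mulD a g := hF.fm_fatS_paraTerm hφ hw hM G i
  set Y := smoothing ℓ u g with hY
  have hYe : Y = transportD u (fm (esym ℓ u) g) := hℓ.smoothing_eq hu g
  set K : 𝓢'(Phase d, ℂ) := fm (esym ℓ u) (mulD a g) - mulD a (fm (esym ℓ u) g) with hK
  set c : ℤ → Phase d → ℂ := fun k z => a (transport u z) - lowFn hφ k F' z with hc
  have hct (k : ℤ) : (lowFn hφ k F').HasTemperateGrowth := hF'.hasTemperateGrowth_lowFn hφ hw hM k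
  -- Transport is multiplicative: `Γ_u (a e_u(D) g) = (Γ_u a) Y`. Decomposing `Y` into its finitely
  -- many blocks allows the comparison with the paraproduct term by term.
  have e1 : commTerm hφ ℓ u F F' G N i = transportD u K +
      ∑ k ∈ Finset.Ico (-1) N, mulD (c k) (fm (blockS hφ k) Y) := by
    have s1 : ∑ k ∈ Finset.Ico (-1) N, mulD (c k) (fm (blockS hφ k) Y) =
        mulD (fun z => a (transport u z)) Y - ∑ k ∈ Finset.Ico (-1) N, paraTerm hφ F' Y k := by
      have : mulD (fun z => a (transport u z)) Y =
          ∑ k ∈ Finset.Ico (-1) N, mulD (fun z => a (transport u z)) (fm (blockS hφ k) Y) := by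
        rw [← map_sum, sum_fm_blockS, fm_lowS_eq_self hN hz]
      rw [this, ← Finset.sum_sub_distrib]
      refine Finset.sum_congr rfl fun k _ => ?_
      have h := TemperedDistribution.smulLeftCLM_sub (F := ℂ) hau (hct k)
      exact congrArg (fun X : 𝓢'(Phase d, ℂ) →L[ℂ] 𝓢'(Phase d, ℂ) => X (fm (blockS hφ k) Y)) h
    have s2 : transportD u (mulD a (fm (esym ℓ u) g)) = mulD (fun z => a (transport u z)) Y := by
      rw [hYe]
      exact transportD_smulLeft u ha _
    rw [s1, hK, map_sub, s2, commTerm]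
    change smoothing ℓ u (mulD a g) - _ = _
    rw [hℓ.smoothing_eq hu]
    abel
  have b1 : Bd (fun z => w z * v z) (C₃ * (C₂ * ((2 ^ i) ^ k * (W ^ n)⁻¹) *
      (C₁ * M * 2 ^ (-α * i) * (M' * 2 ^ (-b * i))))) (transportD u K) := by
    have h := h₂ i hi u hu huT _ _ a g (by positivity) (by positivity) ha (h₁ M F hM hB i) (hG i)
    rw [hpf, hgf] at h
    exact h₃ u (by rwa [abs_of_pos hu]) _ _ (by positivity) h
  -- The decay of `Y` is requested with the power `n + 2`: one factor `W` is spent on the bound of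
  -- `c q`, the other on inserting `geo (q - i)`, which makes the sum over `q` bounded uniformly in
  -- `N`. The constant `2^11` covers `1 + 1 + 2^10`.
  have b2 (q : ℤ) (hq : q ∈ Finset.Ico (-1) N) : Bd (fun z => w z * v z)
      (C₄ * M * (2 ^ 11 * W * 2 ^ (-α * i)) * (C₆ * (C₅ * ((2 ^ i) ^ k * (W ^ (n + 2))⁻¹) *
        (M' * 2 ^ (-b * i)))) * (2 ^ 10 * W * geo (q - i))) (mulD (c q) (fm (blockS hφ q) Y)) := by
    have hgeo := geo_nonneg (q - i)
    by_cases hcomp : (2 : ℝ) ^ |q - i| ≤ 2 ^ 10 * W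
    · have h := h₆ q _ _ (by positivity) (h₅ i hi u hu huT _ g (by positivity) (hG i) hgf)
      have hbd : ∀ᵐ z, ‖c q z‖ ≤ C₄ * M * (2 ^ 11 * W * 2 ^ (-α * i)) * w z := by
        filter_upwards [h₄ u hu.le huT M F F' hM hF hF' hB hB' hd i q hi (Finset.mem_Ico.1 hq).1]
          with z hzz
        refine hzz.trans (mul_le_mul_of_nonneg_right ?_ (hw.pos z).le)
        refine mul_le_mul_of_nonneg_left ?_ (by positivity)
        have t1 := rpow_half_le hu.le hα hα1 i
        have t2 := rpow_le_of_compat hα hα1 hcomp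
        have t3 : (0 : ℝ) < 2 ^ (-α * i) := by positivity
        rw [← hWdef] at t1
        have t4 : (2 : ℝ) ^ (-α * i) ≤ W * 2 ^ (-α * i) := le_mul_of_one_le_left t3.le hW1
        have t5 : 0 < W * (2 : ℝ) ^ (-α * i) := by positivity
        calc _ ≤ W * 2 ^ (-α * i) + W * 2 ^ (-α * i) + 2 ^ 10 * W * 2 ^ (-α * i) :=
              add_le_add (add_le_add t4 t1) t2
          _ ≤ _ := by nlinarith
      refine (Bd.smulLeft hw hv (hau.sub (hct q)) hbd (by positivity) h).mono hwv ?_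
      refine le_mul_of_one_le_right (by positivity) ?_
      rw [geo_eq, ← div_eq_mul_inv, one_le_div (by positivity)]
      exact hcomp
    · have h0 : fm (blockS hφ q) Y = 0 :=
        hℓ.fm_blockS_smoothing_eq_zero hφ hi hu (not_le.1 hcomp) hgf
      rw [h0, map_zero]
      exact (bd_zero _).mono hwv (by positivity)
  have hsum : ∑ q ∈ Finset.Ico (-1) N, geo (q - i) ≤ 3 :=
    sum_le_hasSum _ (fun q _ => geo_nonneg _) (hasSum_geo_sub i)
  rw [e1]
  refine (b1.add (Bd.sum b2)).mono hwv ?_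
  have e2 : (2 : ℝ) ^ (-(α + b - k) * i) = (2 ^ i) ^ k * (2 ^ (-α * i) * 2 ^ (-b * i)) := by
    rw [← zpow_pow_mul_rpow, ← Real.rpow_add two_pos]
    congr 2
    ring
  rw [e2, ← Finset.mul_sum, ← Finset.mul_sum]
  set x : ℝ := 2 ^ (-α * i)
  set y : ℝ := 2 ^ (-b * i)
  set p : ℝ := (2 ^ i) ^ k
  have e3 : (W ^ (n + 2))⁻¹ = (W ^ n)⁻¹ * (W * W)⁻¹ := by
    rw [pow_add, mul_inv, pow_two]
  calc _ ≤ C₃ * (C₂ * (p * (W ^ n)⁻¹) * (C₁ * M * x * (M' * y))) +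
        C₄ * M * (2 ^ 11 * W * x) * (C₆ * (C₅ * (p * (W ^ (n + 2))⁻¹) * (M' * y))) *
          (2 ^ 10 * W * 3) := by gcongr
    _ = _ := by
        rw [e3]
        field_simp

/-- The commutator at a fixed time. -/
theorem IsHomSymbol.exists_bd_comm (hℓ : IsHomSymbol k ℓ) (hφ : IsCutoff φ)
    {w v : Phase d → ℝ} (hw : IsWeight w) (hv : IsWeight v) {α : ℝ} (hα : 0 < α) (hα1 : α < 1)
    (b T : ℝ) :
    ∃ C : ℝ, 0 ≤ C ∧ ∀ u, 0 < u → u ≤ T → ∀ M M' F F' G, 0 ≤ M → 0 ≤ M' →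
      Bd w M F → Bd w M F' → BlockBd hφ w M α F → BlockBd hφ w M α F' →
      Bd w (M * u ^ (α / 2)) (F' - transportD u F) → BlockBd hφ v M' b G → ∀ j : ℤ,
      Bd (fun z => w z * v z) (C * (M * M') * (2 ^ (-(α + b - k) * j) * (wt u j ^ 2)⁻¹))
        (fm (blockS hφ j) (smoothing ℓ u (paraproduct φ F G)) -
          fm (blockS hφ j) (paraproduct φ F' (smoothing ℓ u G))) := by
  have hwv := hw.mul hv
  -- The threshold is `2^13` instead of `2^10` since the paraproduct shifts frequencies by up to two
  -- blocks: beyond it, every `q` with `|j - q| ≤ 2` still has `2^{|q-i|} > 2^10 wt u i`, so both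
  -- parts of the term vanish.
  obtain ⟨n, C₁, hC₁, h₁⟩ := exists_wt_bound (α + b - k) (D := 2 ^ 13) (by positivity)
  obtain ⟨C₂, hC₂, h₂⟩ := hℓ.exists_bd_commTerm hφ hw hv hα hα1 b T n
  obtain ⟨C₃, hC₃, h₃⟩ := exists_bd_blockS hφ hwv
  obtain ⟨C₄, hC₄, h₄⟩ := hℓ.exists_blockBd_smoothing hφ hv b T
  refine ⟨3 * (C₃ * C₂ * C₁), by positivity,
    fun u hu huT M M' F F' G hM hM' hF hF' hB hB' hd hG j => ?_⟩
  have hwj : 0 < wt u j := zero_lt_one.trans_le (one_le_wt hu.le j)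
  rcases lt_or_ge j (-1) with hj | hj
  · rw [fm_blockS_of_lt hφ hj, fm_blockS_of_lt hφ hj, sub_zero]
    exact (bd_zero _).mono hwv (by positivity)
  have hYG : BlockBd hφ v (C₄ * M') (b - k) (smoothing ℓ u G) :=
    h₄ u hu huT M' _ G hM' hG.isDecomp (BlockBd.hasSum hv hM' hG)
  rw [BlockBd.fm_blockS_paraproduct hφ hw hv hM (by positivity) hF' hYG hj]
  set X : ℤ → 𝓢'(Phase d, ℂ) := fun i => fm (blockS hφ j) (smoothing ℓ u (paraTerm hφ F G i)) -
    ∑ q ∈ Finset.Ico (-1) (j + 3), fm (blockS hφ j)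
      (paraTerm hφ F' (smoothing ℓ u (fm (blockS hφ i) G)) q) with hX
  have s1 : HasSum (fun i => fm (blockS hφ j) (smoothing ℓ u (paraTerm hφ F G i)))
      (fm (blockS hφ j) (smoothing ℓ u (paraproduct φ F G))) :=
    (fm (blockS hφ j) ∘L smoothing ℓ u).hasSum
      (BlockBd.hasSum_paraproduct hφ hw hv hM hM' hF hG).2
  have s2 (q : ℤ) : HasSum (fun i => fm (blockS hφ j)
      (paraTerm hφ F' (smoothing ℓ u (fm (blockS hφ i) G)) q))
      (fm (blockS hφ j) (paraTerm hφ F' (smoothing ℓ u G) q)) :=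
    (fm (blockS hφ j) ∘L mulD (lowFn hφ q F') ∘L fm (blockS hφ q) ∘L smoothing ℓ u).hasSum
      (BlockBd.hasSum hv hM' hG)
  have s3 := s1.sub (hasSum_sum (s := Finset.Ico (-1) (j + 3)) fun q _ => s2 q)
  have key (i : ℤ) : Bd (fun z => w z * v z) (C₃ * C₂ * C₁ * (M * M') *
      (2 ^ (-(α + b - k) * j) * (wt u j ^ 2)⁻¹) * geo (i - j)) (X i) := by
    have h0 : Bd (fun z => w z * v z) (C₃ * C₂ * C₁ * (M * M') *
        (2 ^ (-(α + b - k) * j) * (wt u j ^ 2)⁻¹) * geo (i - j)) (0 : 𝓢'(Phase d, ℂ)) := by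
      have := geo_nonneg (i - j)
      exact (bd_zero _).mono hwv (by positivity)
    rcases lt_or_ge i (-1) with hi | hi
    · have e : X i = 0 := by
        simp only [hX, paraTerm, fm_blockS_of_lt hφ hi, map_zero, Finset.sum_const_zero, sub_zero]
      rw [e]
      exact h0
    have hwi : 0 < wt u i := zero_lt_one.trans_le (one_le_wt hu.le i)
    have hgf := fm_fatS_blockS hφ i G
    by_cases hcomp : (2 : ℝ) ^ |j - i| ≤ 2 ^ 13 * wt u i
    · obtain ⟨m, hm⟩ := pow_unbounded_of_one_lt (2 ^ 10 * wt u i) (one_lt_two (α := ℝ))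
      -- Beyond `i + m` the smoothed block `i` has no frequencies, and the terms from `j + 3` on do
      -- not meet block `j`; so the truncated commutator has the required block.
      set N : ℤ := max (j + 3) (i + m) with hN
      have hz (q : ℤ) (hq : N ≤ q) :
          fm (blockS hφ q) (smoothing ℓ u (fm (blockS hφ i) G)) = 0 := by
        refine hℓ.fm_blockS_smoothing_eq_zero hφ hi hu (hm.trans_le ?_) hgf
        rw [← zpow_natCast]
        refine zpow_le_zpow_right₀ (by norm_num) ?_
        have := (le_max_right _ _).trans hq
        have := le_abs_self (q - i)
        omega
      have hjN : j + 3 ≤ N := le_max_left _ _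
      have e : X i = fm (blockS hφ j) (commTerm hφ ℓ u F F' G N i) := by
        simp only [hX]
        rw [commTerm, map_sub, map_sum]
        congr 1
        refine Finset.sum_subset (Finset.Ico_subset_Ico_right hjN) fun q hq hq' => ?_
        refine hF'.fm_blockS_mulD_eq_zero hφ hw hM _ hj ?_
        rw [Finset.mem_Ico] at hq hq'
        rw [lt_abs]
        right
        omega
      rw [e]
      have h := h₂ u hu huT M M' F F' G hM hM' hF hF' hB hB' hd hG i N hi (by omega) hz
      refine (h₃ j _ _ (by positivity) h).mono hwv ?_
      calc _ = C₃ * C₂ * (M * M') * (2 ^ (-(α + b - k) * i) * (wt u i ^ n)⁻¹) := by ring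
        _ ≤ C₃ * C₂ * (M * M') *
            (C₁ * (2 ^ (-(α + b - k) * j) * (wt u j ^ 2)⁻¹ * geo (i - j))) :=
          mul_le_mul_of_nonneg_left (h₁ u hu.le i j hcomp) (by positivity)
        _ = _ := by ring
    · have hcomp' : 2 ^ 13 * wt u i < (2 : ℝ) ^ |j - i| := not_le.1 hcomp
      have e : X i = 0 := by
        have x1 : fm (blockS hφ j) (smoothing ℓ u (paraTerm hφ F G i)) = 0 :=
          hℓ.fm_blockS_smoothing_eq_zero hφ hi hu (by linarith) (hF.fm_fatS_paraTerm hφ hw hM G i)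
        simp only [hX]
        rw [x1, Finset.sum_eq_zero, sub_zero]
        intro q hq
        by_cases hqj : 2 < |j - q|
        · exact hF'.fm_blockS_mulD_eq_zero hφ hw hM _ hj hqj
        · have x2 : fm (blockS hφ q) (smoothing ℓ u (fm (blockS hφ i) G)) = 0 := by
            refine hℓ.fm_blockS_smoothing_eq_zero hφ hi hu ?_ hgf
            have x3 : |j - i| ≤ |q - i| + 2 := by
              have := abs_sub_le j q i
              omega
            have x4 : (2 : ℝ) ^ |j - i| ≤ 2 ^ |q - i| * 2 ^ 2 := by
              calc (2 : ℝ) ^ |j - i| ≤ 2 ^ (|q - i| + 2) := zpow_le_zpow_right₀ (by norm_num) x3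
                _ = _ := by rw [zpow_add₀ two_ne_zero]; rfl
            nlinarith
          rw [paraTerm, x2, map_zero, map_zero]
      rw [e]
      exact h0
  exact (Bd.of_hasSum key s3).mono hwv (le_of_eq (by ring))

end fixedTime

/-! ### Measurability and continuity in time -/

/-- The first variable is replaced by `⌊s (n+1)⌋ / (n+1)`, which takes countably many values, so
measurable versions can be chosen outside one common null set. Continuity in that variable gives the
limit `n → ∞`. -/
theorem aemeasurable_diag_of_forall {H : ℝ → ℝ → ℂ} {μ : Measure ℝ} (hm : ∀ r, AEMeasurable (H r) μ)
    (hc : ∀ᵐ s ∂μ, ContinuousAt (fun r => H r s) s) : AEMeasurable (fun s => H s s) μ := by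
  have hq : ∀ᵐ s ∂μ, ∀ (n : ℕ) (q : ℤ), H (q / (n + 1)) s = (hm (q / (n + 1))).mk _ s := by
    rw [ae_all_iff]
    intro n
    rw [ae_all_iff]
    exact fun q => (hm _).ae_eq_mk
  have hn (n : ℕ) : AEMeasurable (fun s : ℝ => H ((⌊s * (n + 1)⌋ : ℤ) / ((n : ℝ) + 1)) s) μ := by
    have h1 : Measurable fun p : ℝ × ℤ => (hm (p.2 / (n + 1))).mk _ p.1 :=
      measurable_from_prod_countable_left fun q => (hm ((q : ℝ) / ((n : ℝ) + 1))).measurable_mk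
    have h2 : Measurable fun s : ℝ => (s, ⌊s * (n + 1)⌋) :=
      measurable_id.prodMk (Int.measurable_floor.comp (measurable_id.mul_const _))
    refine ⟨_, h1.comp h2, ?_⟩
    filter_upwards [hq] with s hs
    exact hs n _
  refine aemeasurable_of_tendsto_metrizable_ae' hn ?_
  filter_upwards [hc] with s hs
  refine hs.tendsto.comp ?_
  have h3 : Filter.Tendsto (fun n : ℕ => s - 1 / ((n : ℝ) + 1)) Filter.atTop (nhds s) := by
    simpa using tendsto_const_nhds.sub (tendsto_one_div_add_atTop_nhds_zero_nat (𝕜 := ℝ))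
  refine tendsto_of_tendsto_of_tendsto_of_le_of_le h3 tendsto_const_nhds (fun n => ?_) fun n => ?_
  · have hn : (0 : ℝ) < n + 1 := by positivity
    simp only
    rw [le_div_iff₀ hn, sub_mul, one_div, inv_mul_cancel₀ hn.ne']
    exact (Int.sub_one_lt_floor _).le
  · have hn : (0 : ℝ) < n + 1 := by positivity
    simp only
    rw [div_le_iff₀ hn]
    exact Int.floor_le _

/-- A function of two times which is measurable in one of them and continuous in the other is
measurable on the diagonal. -/
theorem aemeasurable_diag {H : ℝ → ℝ → ℂ} {a b : ℝ}
    (hm : ∀ r ∈ Ioo a b, AEMeasurable (H r) (volume.restrict (Ioo a b)))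
    (hc : ∀ s ∈ Ioo a b, ContinuousAt (fun r => H r s) s) :
    AEMeasurable (fun s => H s s) (volume.restrict (Ioo a b)) := by
  classical
  -- The discretized times may leave the interval, where nothing is assumed; there the function is
  -- replaced by zero.
  set H' : ℝ → ℝ → ℂ := fun r s => if r ∈ Ioo a b then H r s else 0
  have h1 : AEMeasurable (fun s => H' s s) (volume.restrict (Ioo a b)) := by
    refine aemeasurable_diag_of_forall (fun r => ?_) ?_
    · by_cases hr : r ∈ Ioo a b
      · simpa only [H', if_pos hr] using hm r hr
      · simpa only [H', if_neg hr] using aemeasurable_const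
    · filter_upwards [ae_restrict_mem measurableSet_Ioo] with s hs
      refine (hc s hs).congr ?_
      filter_upwards [Ioo_mem_nhds hs.1 hs.2] with r hr
      simp only [H', if_pos hr]
  refine h1.congr ?_
  filter_upwards [ae_restrict_mem measurableSet_Ioo] with s hs
  simp only [H', if_pos hs]

/-- Dominated convergence: pointwise convergence and uniform polynomial decay suffice, with no
control of derivatives. This is all that is needed to test against distributions which are
functions. -/
theorem tendsto_wnorm_sub {w : Phase d → ℝ} (hw : IsWeight w) {ι : Type*} {l : Filter ι}
    [l.IsCountablyGenerated] {χ : ι → 𝓢(Phase d, ℂ)} {χ₀ : 𝓢(Phase d, ℂ)}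
    (hp : ∀ z, Filter.Tendsto (fun i => χ i z) l (nhds (χ₀ z)))
    (hb : ∀ L : ℕ, ∃ B : ℝ, ∀ᶠ i in l, ∀ z, (1 + ‖z‖) ^ L * ‖χ i z‖ ≤ B) :
    Filter.Tendsto (fun i => wnorm w (χ i - χ₀)) l (nhds 0) := by
  obtain ⟨C, N, hC, hwN⟩ := hw.le_pow
  obtain ⟨n, hn⟩ := exists_integrable_pow (Phase d)
  obtain ⟨B, hB⟩ := hb (N + n)
  obtain ⟨B₀, hB₀, h₀⟩ := exists_schwartz_decay χ₀ (N + n)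
  have h := tendsto_integral_filter_of_dominated_convergence (μ := (volume : Measure (Phase d)))
    (l := l) (F := fun i z => ‖(χ i - χ₀) z‖ * w z) (f := fun _ => 0)
    (fun z => (B + B₀) * C * ((1 + ‖z‖) ^ n)⁻¹) ?_ ?_ (hn.const_mul _) ?_
  · simpa [wnorm] using h
  · exact .of_forall fun i => ((χ i - χ₀).continuous.norm.mul hw.cont).aestronglyMeasurable
  · filter_upwards [hB] with i hi
    refine .of_forall fun z => ?_
    rw [Real.norm_of_nonneg (mul_nonneg (norm_nonneg _) (hw.pos z).le)]
    have h1 : (1 + ‖z‖) ^ (N + n) * ‖(χ i - χ₀) z‖ ≤ B + B₀ := by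
      have : ‖(χ i - χ₀) z‖ ≤ ‖χ i z‖ + ‖χ₀ z‖ := norm_sub_le _ _
      calc _ ≤ (1 + ‖z‖) ^ (N + n) * (‖χ i z‖ + ‖χ₀ z‖) := by gcongr
        _ ≤ _ := by rw [mul_add]; exact add_le_add (hi z) (h₀ z)
    rw [← div_eq_mul_inv, le_div_iff₀ (by positivity)]
    calc ‖(χ i - χ₀) z‖ * w z * (1 + ‖z‖) ^ n
        ≤ ‖(χ i - χ₀) z‖ * (C * (1 + ‖z‖) ^ N) * (1 + ‖z‖) ^ n := by
          gcongr
          exact hwN z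
      _ = (1 + ‖z‖) ^ (N + n) * ‖(χ i - χ₀) z‖ * C := by ring
      _ ≤ (B + B₀) * C := by gcongr
  · refine .of_forall fun z => ?_
    have : Filter.Tendsto (fun i => ‖χ i z - χ₀ z‖ * w z) l (nhds (‖χ₀ z - χ₀ z‖ * w z)) :=
      (((hp z).sub_const _).norm).mul_const _
    simpa using this

theorem Bd.tendsto_apply {w : Phase d → ℝ} {M : ℝ} {F : 𝓢'(Phase d, ℂ)}
    (h : Bd w M F) {ι : Type*} {l : Filter ι} {χ : ι → 𝓢(Phase d, ℂ)} {χ₀ : 𝓢(Phase d, ℂ)}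
    (hχ : Filter.Tendsto (fun i => wnorm w (χ i - χ₀)) l (nhds 0)) :
    Filter.Tendsto (fun i => F (χ i)) l (nhds (F χ₀)) := by
  rw [tendsto_iff_norm_sub_tendsto_zero]
  refine squeeze_zero (fun _ => norm_nonneg _) (fun i => ?_) (by simpa using hχ.const_mul M)
  rw [← map_sub]
  exact h _

/-! ### Continuity in time of the semigroup -/

theorem dm_sc_apply (σ ψ : 𝓢(Phase d, ℂ)) {r : ℝ} (hr : 0 < r) (z : Phase d) :
    dm (sc σ r) ψ z = ∫ y, 𝓕⁻ σ y * ψ (z + dilate r y) := by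
  have hj := jac_pos (dilateE (d := d) r hr.ne')
  have h := integral_comp_linearEquiv (dilateE r hr.ne') fun y => 𝓕⁻ (sc σ r) y * ψ (z + y)
  have h2 (y : Phase d) : 𝓕⁻ (sc σ r) (dilateE r hr.ne' y) =
      (jac (dilateE (d := d) r hr.ne') : ℂ) * 𝓕⁻ σ y := by
    rw [sc, dif_pos hr.ne', fourierInv_compE (isAdj_dilateE r hr.ne')]
  simp only [h2, mul_assoc] at h
  rw [integral_const_mul, Complex.real_smul] at h
  rw [dm_schwartz_apply]
  exact (mul_left_cancel₀ (Complex.ofReal_ne_zero.2 hj.ne') h).symm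

/-- The dual of the semigroup. -/
def heatDual (u : ℝ) (ψ : 𝓢(Phase d, ℂ)) : 𝓢(Phase d, ℂ) :=
  dm (sc (heatS d) √u) (compE (transport (-u)) ψ)

theorem kineticSemigroup_apply {u : ℝ} (hu : 0 < u) (F : 𝓢'(Phase d, ℂ)) (ψ : 𝓢(Phase d, ℂ)) :
    kineticSemigroup u F ψ = F (heatDual u ψ) := by
  rw [kineticSemigroup_eq hu]; rfl

theorem continuous_dilate (z : Phase d) : Continuous fun r : ℝ => dilate r z := by
  unfold dilate
  fun_prop

theorem continuous_transport_apply {a : ℝ → ℝ} {b : ℝ → Phase d} (ha : Continuous a)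
    (hb : Continuous b) : Continuous fun x => transport (a x) (b x) := by
  simp only [transport_apply]
  fun_prop

theorem one_add_norm_transport_le (u : ℝ) (z : Phase d) :
    1 + ‖transport u z‖ ≤ (2 + |u|) * (1 + ‖z‖) := by
  have h1 : transport u z = z + u • WithLp.toLp 2 (z.snd, 0) := by
    rw [transport_apply]
    exact WithLp.ofLp_injective 2 (Prod.ext rfl (by simp))
  have h2 : ‖(WithLp.toLp 2 (z.snd, 0) : Phase d)‖ ≤ ‖z‖ := by
    refine (sq_le_sq₀ (norm_nonneg _) (norm_nonneg _)).1 ?_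
    rw [WithLp.prod_norm_sq_eq_of_L2, WithLp.prod_norm_sq_eq_of_L2]
    simp
  have h3 : ‖transport u z‖ ≤ ‖z‖ + |u| * ‖z‖ := by
    rw [h1]
    refine (norm_add_le _ _).trans ?_
    rw [norm_smul, Real.norm_eq_abs]
    gcongr
  nlinarith [norm_nonneg z, abs_nonneg u]

theorem exists_compE_transport_le (ψ : 𝓢(Phase d, ℂ)) (L : ℕ) (R : ℝ) :
    ∃ B : ℝ, 0 ≤ B ∧ ∀ u, |u| ≤ R → ∀ z, (1 + ‖z‖) ^ L * ‖ψ (transport u z)‖ ≤ B := by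
  obtain ⟨B, hB, h⟩ := exists_schwartz_decay ψ L
  refine ⟨(2 + |R|) ^ L * B, by positivity, fun u hu z => ?_⟩
  have h1 : 1 + ‖z‖ ≤ (2 + |R|) * (1 + ‖transport u z‖) := by
    have := one_add_norm_transport_le (-u) (transport u z)
    rw [transport_neg_transport, abs_neg] at this
    refine this.trans ?_
    have h2 : |u| ≤ |R| := hu.trans (le_abs_self R)
    gcongr
  calc _ ≤ ((2 + |R|) * (1 + ‖transport u z‖)) ^ L * ‖ψ (transport u z)‖ := by gcongr
    _ = (2 + |R|) ^ L * ((1 + ‖transport u z‖) ^ L * ‖ψ (transport u z)‖) := by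
        rw [mul_pow, mul_assoc]
    _ ≤ _ := by
        gcongr
        exact h _

theorem tendsto_wnorm_compE_transport {w : Phase d → ℝ} (hw : IsWeight w) (ψ : 𝓢(Phase d, ℂ)) :
    Filter.Tendsto (fun u => wnorm w (compE (transport u) ψ - ψ)) (nhds 0) (nhds 0) := by
  refine tendsto_wnorm_sub hw (fun z => ?_) fun L => ?_
  · have h : Continuous fun u : ℝ => transport u z :=
      continuous_transport_apply continuous_id continuous_const
    have e : transport 0 z = z := by
      rw [transport_apply, zero_smul, add_zero]
      rfl
    have h2 := (ψ.continuous.tendsto (transport 0 z)).comp (h.tendsto 0)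
    rw [e] at h2
    exact h2
  · obtain ⟨B, -, h⟩ := exists_compE_transport_le ψ L 1
    refine ⟨B, ?_⟩
    filter_upwards [Metric.ball_mem_nhds (0 : ℝ) one_pos] with u hu z
    rw [mem_ball_zero_iff, Real.norm_eq_abs] at hu
    exact h u hu.le z

theorem heatDual_apply {u : ℝ} (hu : 0 < u) (ψ : 𝓢(Phase d, ℂ)) (z : Phase d) :
    heatDual u ψ z = ∫ y, 𝓕⁻ (heatS d) y * ψ (transport (-u) (z + dilate √u y)) := by
  rw [heatDual, dm_sc_apply _ _ (Real.sqrt_pos.2 hu)]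
  rfl

theorem exists_heatDual_le (ψ : 𝓢(Phase d, ℂ)) (L : ℕ) (R : ℝ) :
    ∃ B : ℝ, 0 ≤ B ∧ ∀ u, 0 < u → u ≤ R → ∀ z, (1 + ‖z‖) ^ L * ‖heatDual u ψ z‖ ≤ B := by
  obtain ⟨B, hB, h⟩ := exists_compE_transport_le ψ L R
  have hi := integrable_pow_mul_schwartz (𝓕⁻ (heatS d)) L
  refine ⟨B * (1 + √R) ^ (3 * L) * ∫ y, (1 + ‖y‖) ^ L * ‖𝓕⁻ (heatS d) y‖,
    mul_nonneg (by positivity) (integral_nonneg fun y => by simp only [Pi.zero_apply]; positivity),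
    fun u hu huR z => ?_⟩
  have h0 : ‖heatDual u ψ z‖ ≤ ∫ y, B * (1 + √R) ^ (3 * L) * ((1 + ‖z‖) ^ L)⁻¹ *
      ((1 + ‖y‖) ^ L * ‖𝓕⁻ (heatS d) y‖) := by
    rw [heatDual_apply hu]
    refine norm_integral_le_of_norm_le (hi.const_mul _) (.of_forall fun y => ?_)
    rw [norm_mul]
    have h1 := h (-u) (by rwa [abs_neg, abs_of_pos hu]) (z + dilate √u y)
    have h2 := norm_dilate_le (Real.sqrt_nonneg u) y
    have h3 : 1 + ‖dilate √u y‖ ≤ (1 + √R) ^ 3 * (1 + ‖y‖) := by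
      have h4 : (1 + √u) ^ 3 ≤ (1 + √R) ^ 3 := by gcongr
      have h5 : 1 ≤ (1 + √R) ^ 3 := one_le_pow₀ (by linarith [Real.sqrt_nonneg R])
      nlinarith [norm_nonneg y]
    have h6 : 1 + ‖z‖ ≤ (1 + ‖z + dilate √u y‖) * ((1 + √R) ^ 3 * (1 + ‖y‖)) :=
      (one_add_norm_le_mul z (dilate √u y)).trans (by gcongr)
    have h7 : ‖ψ (transport (-u) (z + dilate √u y))‖ * (1 + ‖z‖) ^ L ≤
        B * ((1 + √R) ^ (3 * L) * (1 + ‖y‖) ^ L) := by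
      set p := ‖ψ (transport (-u) (z + dilate √u y))‖
      calc p * (1 + ‖z‖) ^ L
          ≤ p * ((1 + ‖z + dilate √u y‖) * ((1 + √R) ^ 3 * (1 + ‖y‖))) ^ L := by gcongr
        _ = (1 + ‖z + dilate √u y‖) ^ L * p * ((1 + √R) ^ (3 * L) * (1 + ‖y‖) ^ L) := by
            rw [mul_pow, mul_pow, pow_mul]; ring
        _ ≤ _ := by gcongr
    calc ‖𝓕⁻ (heatS d) y‖ * ‖ψ (transport (-u) (z + dilate √u y))‖
        ≤ ‖𝓕⁻ (heatS d) y‖ * (B * ((1 + √R) ^ (3 * L) * (1 + ‖y‖) ^ L) * ((1 + ‖z‖) ^ L)⁻¹) := by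
          refine mul_le_mul_of_nonneg_left ?_ (norm_nonneg _)
          rw [← div_eq_mul_inv, le_div_iff₀ (by positivity)]
          exact h7
      _ = _ := by ring
  rw [integral_const_mul] at h0
  calc _ ≤ _ := mul_le_mul_of_nonneg_left h0 (by positivity)
    _ = _ := by field_simp

/-- After rescaling, the kernel no longer depends on `u`; only the argument of `ψ` moves,
continuously. -/
theorem tendsto_wnorm_heatDual {w : Phase d → ℝ} (hw : IsWeight w) (ψ : 𝓢(Phase d, ℂ)) {u₀ : ℝ}
    (hu₀ : 0 < u₀) :
    Filter.Tendsto (fun u => wnorm w (heatDual u ψ - heatDual u₀ ψ)) (nhds u₀) (nhds 0) := by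
  have hpos : ∀ᶠ u in nhds u₀, 0 < u := lt_mem_nhds hu₀
  refine tendsto_wnorm_sub hw (fun z => ?_) fun L => ?_
  · obtain ⟨B, -, hB⟩ := exists_schwartz_decay ψ 0
    rw [heatDual_apply hu₀]
    have h := tendsto_integral_filter_of_dominated_convergence (μ := (volume : Measure (Phase d)))
      (l := nhds u₀) (F := fun u y => 𝓕⁻ (heatS d) y * ψ (transport (-u) (z + dilate √u y)))
      (f := fun y => 𝓕⁻ (heatS d) y * ψ (transport (-u₀) (z + dilate √u₀ y)))
      (fun y => B * ‖𝓕⁻ (heatS d) y‖) ?_ ?_ ((𝓕⁻ (heatS d)).integrable.norm.const_mul B) ?_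
    · refine h.congr' ?_
      filter_upwards [hpos] with u hu
      rw [heatDual_apply hu]
    · refine .of_forall fun u => Continuous.aestronglyMeasurable ?_
      refine (𝓕⁻ (heatS d)).continuous.mul (ψ.continuous.comp ((transport (-u)).continuous.comp ?_))
      exact continuous_const.add (dilateL √u).continuous
    · refine .of_forall fun u => .of_forall fun y => ?_
      have := hB (transport (-u) (z + dilate √u y))
      rw [pow_zero, one_mul] at this
      rw [norm_mul, mul_comm]
      gcongr
    · refine .of_forall fun y => ?_
      have h1 : Continuous fun u : ℝ => transport (-u) (z + dilate √u y) := by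
        refine continuous_transport_apply continuous_neg ?_
        exact continuous_const.add ((continuous_dilate y).comp Real.continuous_sqrt)
      exact ((ψ.continuous.tendsto _).comp (h1.tendsto u₀)).const_mul _
  · obtain ⟨B, -, h⟩ := exists_heatDual_le ψ L (u₀ + 1)
    refine ⟨B, ?_⟩
    filter_upwards [hpos, eventually_le_nhds (lt_add_one u₀)] with u hu hu1
    exact h u hu hu1

theorem smoothing_one (u : ℝ) (F : 𝓢'(Phase d, ℂ)) :
    smoothing ![fun _ => 1, fun _ => 0] u F = kineticSemigroup u F := by
  ext ψ
  exact congrArg (kineticSemigroup u F) (dm_one ψ)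

theorem exists_semigroup_le {φ : Phase d → ℝ} (hφ : IsCutoff φ) {w : Phase d → ℝ}
    (hw : IsWeight w) (b T : ℝ) :
    ∃ m : ℕ, ∃ C : ℝ, 0 ≤ C ∧ ∀ M G H, 0 ≤ M → IsDecomp hφ w M b G → HasSum G H →
      ∀ u, 0 < u → u ≤ T → ∀ ψ : 𝓢(Phase d, ℂ),
        (∀ j, ‖fm (blockS hφ j) (kineticSemigroup u H) ψ‖ ≤ C * M * testNorm m w ψ * geo j) ∧
        HasSum (fun j => fm (blockS hφ j) (kineticSemigroup u H) ψ) (kineticSemigroup u H ψ) ∧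
        ‖kineticSemigroup u H ψ‖ ≤ C * M * testNorm m w ψ := by
  obtain ⟨C, hC, h⟩ := isHomSymbol_one.exists_blockBd_smoothing hφ hw b T
  obtain ⟨m, C', hC', h'⟩ := exists_decomp_hasSum hφ hw (b - (0 : ℕ))
  refine ⟨m, 3 * (C' * C), by positivity, fun M G H hM hG hH u hu huT ψ => ?_⟩
  have hB := h u hu huT M G H hM hG hH
  rw [smoothing_one] at hB
  have hs := BlockBd.hasSum hw (by positivity) hB
  obtain ⟨h1, h2, -⟩ := h' _ _ (by positivity) hB.isDecomp
  have ht := testNorm_nonneg m hw ψ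
  refine ⟨fun j => (h1 j ψ).trans ?_, hasSum_distribution_iff.1 hs ψ,
    (h2 _ hs ψ).trans (le_of_eq (by ring))⟩
  have := geo_nonneg j
  have h3 : 0 ≤ C' * C * M * testNorm m w ψ * geo j := by positivity
  linarith

/-- A distribution of low regularity is not a function, so the continuity is taken from its pieces.
The blocks of `P_u H` are summed over `j`, and each of them over the pieces `G i`; both series have
geometric majorants that are uniform for `u` near `u₀`. -/
theorem continuousAt_kineticSemigroup {φ : Phase d → ℝ} {hφ : IsCutoff φ} {w : Phase d → ℝ}
    (hw : IsWeight w) {M b : ℝ} (hM : 0 ≤ M) {G : ℤ → 𝓢'(Phase d, ℂ)} {H : 𝓢'(Phase d, ℂ)}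
    (hG : IsDecomp hφ w M b G) (hH : HasSum G H) (ψ : 𝓢(Phase d, ℂ)) {u₀ : ℝ} (hu₀ : 0 < u₀) :
    ContinuousAt (fun u => kineticSemigroup u H ψ) u₀ := by
  have hpos : ∀ᶠ u in nhds u₀, 0 < u ∧ u ≤ u₀ + 1 :=
    (lt_mem_nhds hu₀).and (eventually_le_nhds (lt_add_one u₀))
  obtain ⟨m, C, hC, h⟩ := exists_semigroup_le hφ hw b (u₀ + 1)
  obtain ⟨C', hC', h'⟩ := isHomSymbol_one.exists_bd_blockS_smoothing_term hφ hw b (u₀ + 1)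
  simp only [smoothing_one] at h'
  have hi (i : ℤ) (χ : 𝓢(Phase d, ℂ)) :
      Filter.Tendsto (fun u => kineticSemigroup u (G i) χ) (nhds u₀)
        (nhds (kineticSemigroup u₀ (G i) χ)) := by
    rw [kineticSemigroup_apply hu₀]
    refine ((hG.bd i).tendsto_apply (tendsto_wnorm_heatDual hw χ hu₀)).congr' ?_
    filter_upwards [hpos] with u hu
    rw [kineticSemigroup_apply hu.1]
  have hj (j : ℤ) : Filter.Tendsto (fun u => fm (blockS hφ j) (kineticSemigroup u H) ψ) (nhds u₀)
      (nhds (fm (blockS hφ j) (kineticSemigroup u₀ H) ψ)) := by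
    have hs (u : ℝ) := (hasSum_distribution_iff.1
      (((fm (blockS hφ j)) ∘L kineticSemigroup u).hasSum hH) ψ).tsum_eq
    have ht : Filter.Tendsto (fun u => ∑' i, fm (blockS hφ j) (kineticSemigroup u (G i)) ψ)
        (nhds u₀) (nhds (∑' i, fm (blockS hφ j) (kineticSemigroup u₀ (G i)) ψ)) := by
      refine tendsto_tsum_of_dominated_convergence
        (bound := fun i => C' * M * 2 ^ (-(b - (0 : ℕ)) * j) * wnorm w ψ * geo (i - j))
        ((hasSum_geo_sub j).mul_left _).summable (fun i => hi i _) ?_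
      filter_upwards [hpos] with u hu i
      have h1 : 1 ≤ wt u j ^ 2 := one_le_pow₀ (one_le_wt hu.1.le j)
      refine (h' u hu.1 hu.2 M G hM hG i j ψ).trans ?_
      have h2 : (2 : ℝ) ^ (-(b - (0 : ℕ)) * j) * (wt u j ^ 2)⁻¹ ≤ 2 ^ (-(b - (0 : ℕ)) * j) :=
        mul_le_of_le_one_right (by positivity) (inv_le_one_of_one_le₀ h1)
      have h3 := geo_nonneg (i - j)
      have h4 := wnorm_nonneg hw ψ
      calc _ ≤ C' * M * 2 ^ (-(b - (0 : ℕ)) * j) * geo (i - j) * wnorm w ψ := by gcongr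
        _ = _ := by ring
    have e := hs u₀
    simp only [ContinuousLinearMap.comp_apply] at hs e
    rw [e] at ht
    exact ht.congr hs
  have hs (u : ℝ) (hu : 0 < u ∧ u ≤ u₀ + 1) := (h M G H hM hG hH u hu.1 hu.2 ψ).2.1.tsum_eq
  have ht : Filter.Tendsto (fun u => ∑' j, fm (blockS hφ j) (kineticSemigroup u H) ψ)
      (nhds u₀) (nhds (∑' j, fm (blockS hφ j) (kineticSemigroup u₀ H) ψ)) := by
    refine tendsto_tsum_of_dominated_convergence (bound := fun j => C * M * testNorm m w ψ * geo j)
      (hasSum_geo.mul_left _).summable hj ?_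
    filter_upwards [hpos] with u hu j
    exact (h M G H hM hG hH u hu.1 hu.2 ψ).1 j
  rw [hs u₀ hpos.self_of_nhds] at ht
  refine ht.congr' ?_
  filter_upwards [hpos] with u hu
  exact hs u hu

/-! ### The Duhamel operator -/

section duhamel

variable {φ : Phase d → ℝ}

/-- Weakly measurable functions of time with values in distributions of regularity `b`. -/
structure IsTimeDecomp (hφ : IsCutoff φ) (w : Phase d → ℝ) (M b T : ℝ)
    (G : ℝ → 𝓢'(Phase d, ℂ)) : Prop where
  meas : ∀ ψ : 𝓢(Phase d, ℂ), AEMeasurable (fun s => G s ψ) (volume.restrict (Ioo 0 T))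
  decomp : ∀ s ∈ Icc 0 T, ∃ G', IsDecomp hφ w M b G' ∧ HasSum G' (G s)

/-- The integrand of the Duhamel operator. -/
def duhamelIntegrand (lam : ℝ) (G : ℝ → 𝓢'(Phase d, ℂ)) (t : ℝ) (ψ : 𝓢(Phase d, ℂ)) (s : ℝ) : ℂ :=
  (Real.exp (-lam * (t - s)) : ℂ) * kineticSemigroup (t - s) (G s) ψ

theorem norm_exp_le_one {lam x : ℝ} (hlam : 0 ≤ lam) (hx : 0 ≤ x) :
    ‖((Real.exp (-lam * x) : ℝ) : ℂ)‖ ≤ 1 := by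
  rw [Complex.norm_real, Real.norm_of_nonneg (Real.exp_pos _).le, Real.exp_le_one_iff]
  nlinarith

variable {hφ : IsCutoff φ} {w : Phase d → ℝ} {M b T : ℝ} {G : ℝ → 𝓢'(Phase d, ℂ)}

theorem IsTimeDecomp.continuousAt_integrand (hw : IsWeight w) (hM : 0 ≤ M)
    (hG : IsTimeDecomp hφ w M b T G) (lam : ℝ) (ψ : 𝓢(Phase d, ℂ)) {s t : ℝ} (hs : s ∈ Icc 0 T)
    (hst : s < t) :
    ContinuousAt (fun t => (Real.exp (-lam * (t - s)) : ℂ) * kineticSemigroup (t - s) (G s) ψ) t := by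
  obtain ⟨G', hG', hH⟩ := hG.decomp s hs
  have h1 := continuousAt_kineticSemigroup hw hM hG' hH ψ (sub_pos.2 hst)
  refine ContinuousAt.mul (by fun_prop) ?_
  exact ContinuousAt.comp (f := fun t => t - s) (x := t)
    (g := fun u => kineticSemigroup u (G s) ψ) h1 (by fun_prop)

/-- The elapsed time and the time of the source are separated: for fixed `r` the function `s ↦
P_{t-r} G(s)` is weakly measurable, and for fixed `s` it is continuous in `r < t`. -/
theorem IsTimeDecomp.aemeasurable_integrand (hw : IsWeight w) (hM : 0 ≤ M)
    (hG : IsTimeDecomp hφ w M b T G) (lam : ℝ) (ψ : 𝓢(Phase d, ℂ)) {t : ℝ} (ht : t ≤ T) :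
    AEMeasurable (duhamelIntegrand lam G t ψ) (volume.restrict (Ioo 0 t)) := by
  refine aemeasurable_diag (H := fun r s => (Real.exp (-lam * (t - r)) : ℂ) *
    kineticSemigroup (t - r) (G s) ψ) (fun r hr => ?_) fun s hs => ?_
  · simp only [kineticSemigroup_apply (sub_pos.2 hr.2)]
    exact ((hG.meas _).mono_measure (Measure.restrict_mono (Ioo_subset_Ioo_right ht) le_rfl)).const_mul _
  · obtain ⟨G', hG', hH⟩ := hG.decomp s ⟨hs.1.le, hs.2.le.trans ht⟩
    have h1 := continuousAt_kineticSemigroup hw hM hG' hH ψ (sub_pos.2 hs.2)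
    refine ContinuousAt.mul (by fun_prop) ?_
    exact ContinuousAt.comp (f := fun r => t - r) (x := s)
      (g := fun u => kineticSemigroup u (G s) ψ) h1 (by fun_prop)

theorem exists_integrand_le (hφ : IsCutoff φ) {w : Phase d → ℝ} (hw : IsWeight w) (b T : ℝ) :
    ∃ m : ℕ, ∃ C : ℝ, 0 ≤ C ∧ ∀ M G, 0 ≤ M → IsTimeDecomp hφ w M b T G → ∀ lam, 0 ≤ lam →
      ∀ t ≤ T, ∀ ψ, ∀ s ∈ Ioo 0 t, ‖duhamelIntegrand lam G t ψ s‖ ≤ C * M * testNorm m w ψ := by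
  obtain ⟨m, C, hC, h⟩ := exists_semigroup_le hφ hw b T
  refine ⟨m, C, hC, fun M G hM hG lam hlam t ht ψ s hs => ?_⟩
  obtain ⟨G', hG', hH⟩ := hG.decomp s ⟨hs.1.le, hs.2.le.trans ht⟩
  have h1 := (h M G' (G s) hM hG' hH (t - s) (sub_pos.2 hs.2) (by linarith [hs.1]) ψ).2.2
  rw [duhamelIntegrand, norm_mul]
  have h2 := norm_exp_le_one hlam (sub_pos.2 hs.2).le
  have h3 := (norm_nonneg _).trans h1
  exact (mul_le_mul h2 h1 (norm_nonneg _) zero_le_one).trans_eq (one_mul _)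

theorem IsTimeDecomp.integrableOn (hw : IsWeight w) (hM : 0 ≤ M)
    (hG : IsTimeDecomp hφ w M b T G) {lam : ℝ} (hlam : 0 ≤ lam) (ψ : 𝓢(Phase d, ℂ)) {t : ℝ}
    (ht : t ≤ T) : IntegrableOn (duhamelIntegrand lam G t ψ) (Ioo 0 t) := by
  obtain ⟨m, C, hC, h⟩ := exists_integrand_le hφ hw b T
  refine Integrable.of_bound (hG.aemeasurable_integrand hw hM lam ψ ht).aestronglyMeasurable
    (C * M * testNorm m w ψ) ?_
  filter_upwards [ae_restrict_mem measurableSet_Ioo] with s hs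
  exact h M G hM hG lam hlam t ht ψ s hs

theorem setIntegral_eq_intervalIntegral (f : ℝ → ℂ) {t : ℝ} (ht : 0 ≤ t) :
    ∫ s in Ioo 0 t, f s = ∫ s in (0 : ℝ)..t, f s := by
  rw [intervalIntegral.integral_of_le ht, integral_Ioc_eq_integral_Ioo]

theorem IsTimeDecomp.exists_hasDuhamel (hw : IsWeight w) (hM : 0 ≤ M)
    (hG : IsTimeDecomp hφ w M b T G) {lam : ℝ} (hlam : 0 ≤ lam) {t : ℝ} (ht : t ∈ Icc 0 T) :
    ∃ H, HasDuhamel lam G t H := by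
  obtain ⟨m, C, hC, h⟩ := exists_integrand_le hφ hw b T
  have hi (ψ : 𝓢(Phase d, ℂ)) := hG.integrableOn hw hM hlam ψ ht.2
  let f : 𝓢(Phase d, ℂ) →ₗ[ℂ] ℂ :=
    { toFun ψ := ∫ s in Ioo 0 t, duhamelIntegrand lam G t ψ s
      map_add' ψ χ := by
        rw [← integral_add (hi ψ) (hi χ)]
        refine integral_congr_ae (.of_forall fun s => ?_)
        simp only [duhamelIntegrand, map_add, mul_add]
      map_smul' c ψ := by
        rw [RingHom.id_apply, smul_eq_mul, ← integral_const_mul]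
        refine integral_congr_ae (.of_forall fun s => ?_)
        simp only [duhamelIntegrand, map_smul, smul_eq_mul]
        ring }
  obtain ⟨H, hH⟩ := exists_distribution_of_le (C := C * M * t) hw f (m := m) fun ψ => by
    have h1 := norm_setIntegral_le_of_norm_le_const (μ := volume) (measure_Ioo_lt_top (a := 0) (b := t))
      (h M G hM hG lam hlam t ht.2 ψ)
    rw [measureReal_def, Real.volume_Ioo, ENNReal.toReal_ofReal (by linarith [ht.1]), sub_zero] at h1
    exact h1.trans_eq (by ring)
  refine ⟨H, fun ψ => ⟨?_, ?_⟩⟩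
  · rw [intervalIntegrable_iff_integrableOn_Ioo_of_le ht.1]
    exact hi ψ
  · rw [hH, ← setIntegral_eq_intervalIntegral _ ht.1]
    rfl

theorem IsTimeDecomp.duhamel_apply (hw : IsWeight w) (hM : 0 ≤ M)
    (hG : IsTimeDecomp hφ w M b T G) {lam : ℝ} (hlam : 0 ≤ lam) {t : ℝ} (ht : t ∈ Icc 0 T)
    (ψ : 𝓢(Phase d, ℂ)) :
    duhamel lam G t ψ = ∫ s in Ioo 0 t, duhamelIntegrand lam G t ψ s := by
  have h := hG.exists_hasDuhamel hw hM hlam ht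
  rw [duhamel, dif_pos h, (h.choose_spec ψ).2, setIntegral_eq_intervalIntegral _ ht.1]
  rfl

/-- Measurability is obtained from continuity in `t`. The integral is extended by an indicator to
the fixed interval `(0, T)`; the indicator jumps only at `s = t₀`, a null set. -/
theorem IsTimeDecomp.aemeasurable_duhamel (hw : IsWeight w) (hM : 0 ≤ M)
    (hG : IsTimeDecomp hφ w M b T G) {lam : ℝ} (hlam : 0 ≤ lam) (ψ : 𝓢(Phase d, ℂ)) :
    AEMeasurable (fun t => duhamel lam G t ψ) (volume.restrict (Ioo 0 T)) := by
  refine ContinuousOn.aemeasurable (fun t₀ ht₀ => ContinuousAt.continuousWithinAt ?_)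
    measurableSet_Ioo
  obtain ⟨m, C, hC, h⟩ := exists_integrand_le hφ hw b T
  have hnear : ∀ᶠ t in nhds t₀, t ∈ Ioo 0 T := Ioo_mem_nhds ht₀.1 ht₀.2
  have hK : 0 ≤ C * M * testNorm m w ψ :=
    mul_nonneg (mul_nonneg hC hM) (testNorm_nonneg m hw ψ)
  have e (t : ℝ) (ht : t ∈ Ioo 0 T) : duhamel lam G t ψ =
      ∫ s in Ioo 0 T, (Ioo 0 t).indicator (duhamelIntegrand lam G t ψ) s := by
    rw [hG.duhamel_apply hw hM hlam ⟨ht.1.le, ht.2.le⟩, setIntegral_indicator measurableSet_Ioo,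
      inter_eq_right.2 (Ioo_subset_Ioo_right ht.2.le)]
  have hc : ContinuousAt (fun t => ∫ s in Ioo 0 T,
      (Ioo 0 t).indicator (duhamelIntegrand lam G t ψ) s) t₀ := by
    refine continuousAt_of_dominated (bound := fun _ => C * M * testNorm m w ψ) ?_ ?_ ?_ ?_
    · filter_upwards [hnear] with t ht
      refine AEMeasurable.aestronglyMeasurable ?_
      rw [aemeasurable_indicator_iff measurableSet_Ioo, Measure.restrict_restrict measurableSet_Ioo,
        inter_eq_left.2 (Ioo_subset_Ioo_right ht.2.le)]
      exact hG.aemeasurable_integrand hw hM lam ψ ht.2.le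
    · filter_upwards [hnear] with t ht
      refine .of_forall fun s => ?_
      by_cases hs : s ∈ Ioo 0 t
      · rw [indicator_of_mem hs]
        exact h M G hM hG lam hlam t ht.2.le ψ s hs
      · rw [indicator_of_notMem hs, norm_zero]
        exact hK
    · exact integrable_const _
    · have hne : ∀ᵐ s ∂(volume.restrict (Ioo 0 T)), s ≠ t₀ := by
        refine ae_restrict_of_ae ?_
        simp [ae_iff, measure_singleton]
      filter_upwards [hne, ae_restrict_mem measurableSet_Ioo] with s hs hsT
      rcases lt_or_gt_of_ne hs with hlt | hgt
      · refine (hG.continuousAt_integrand hw hM lam ψ ⟨hsT.1.le, hsT.2.le⟩ hlt).congr ?_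
        filter_upwards [lt_mem_nhds hlt] with t ht
        have hst : s ∈ Ioo 0 t := ⟨hsT.1, ht⟩
        rw [indicator_of_mem hst]
        rfl
      · refine (continuousAt_const (y := (0 : ℂ))).congr ?_
        filter_upwards [gt_mem_nhds hgt] with t ht
        rw [indicator_of_notMem]
        exact fun hs' => absurd hs'.2 (not_lt.2 ht.le)
  refine hc.congr ?_
  filter_upwards [hnear] with t ht
  exact (e t ht).symm

end duhamel

/-! ### Products with functions which are continuous in time -/

section time

variable {φ : Phase d → ℝ}

/-- Functions of time with values in a kinetic Hölder space. -/
structure IsKinetic (hφ : IsCutoff φ) (w : Phase d → ℝ) (M α T : ℝ)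
    (f : ℝ → 𝓢'(Phase d, ℂ)) : Prop where
  bd : ∀ t ∈ Icc 0 T, Bd w M (f t)
  block : ∀ t ∈ Icc 0 T, BlockBd hφ w M α (f t)
  holder : ∀ s ∈ Icc 0 T, ∀ t ∈ Icc 0 T,
    Bd w (M * |t - s| ^ (α / 2)) (f t - transportD (t - s) (f s))

variable {hφ : IsCutoff φ} {w v : Phase d → ℝ} {M M' α b T : ℝ} {f G : ℝ → 𝓢'(Phase d, ℂ)}

/-- The Hölder bound compares `f(t)` with the transport of `f(t₀)`, not with `f(t₀)`; the transport
is in turn weakly continuous at time zero. -/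
theorem IsKinetic.continuousAt (hw : IsWeight w) (hα : 0 < α)
    (hf : IsKinetic hφ w M α T f) (ψ : 𝓢(Phase d, ℂ)) {t₀ : ℝ} (ht₀ : t₀ ∈ Ioo 0 T) :
    ContinuousAt (fun t => f t ψ) t₀ := by
  have ht₀' : t₀ ∈ Icc 0 T := ⟨ht₀.1.le, ht₀.2.le⟩
  have h1 : Filter.Tendsto (fun t => f t₀ (compE (transport (-(t - t₀))) ψ)) (nhds t₀)
      (nhds (f t₀ ψ)) := by
    refine (hf.bd t₀ ht₀').tendsto_apply ((tendsto_wnorm_compE_transport hw ψ).comp ?_)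
    have : Continuous fun t : ℝ => -(t - t₀) := by fun_prop
    simpa using this.tendsto t₀
  have h2 : Filter.Tendsto (fun t => (f t - transportD (t - t₀) (f t₀)) ψ) (nhds t₀) (nhds 0) := by
    refine squeeze_zero_norm' (a := fun t => M * |t - t₀| ^ (α / 2) * wnorm w ψ) ?_ ?_
    · filter_upwards [Ioo_mem_nhds ht₀.1 ht₀.2] with t ht
      exact hf.holder t₀ ht₀' t ⟨ht.1.le, ht.2.le⟩ ψ
    · have : Continuous fun t : ℝ => M * |t - t₀| ^ (α / 2) * wnorm w ψ := by
        refine (continuous_const.mul ?_).mul continuous_const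
        exact (continuous_id.sub continuous_const).abs.rpow_const fun _ => Or.inr (by positivity)
      have h3 := this.tendsto t₀
      rwa [sub_self, abs_zero, Real.zero_rpow (by positivity), mul_zero, zero_mul] at h3
  have h4 := h2.add h1
  rw [zero_add] at h4
  refine h4.congr fun t => ?_
  change f t ψ - transportD (t - t₀) (f t₀) ψ + _ = _
  rw [transportD_apply', sub_add_cancel]

/-- The product is the diagonal of `S_{i-1} f(r) R_i G(s)`, measurable in `s` and continuous in `r`
because `f` is weakly continuous and its low frequencies are bounded by the weight uniformly in
time. -/
theorem IsKinetic.aemeasurable_paraTerm (hw : IsWeight w) (hv : IsWeight v) (hM : 0 ≤ M)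
    (hα : 0 < α) (hf : IsKinetic hφ w M α T f)
    (hm : ∀ ψ : 𝓢(Phase d, ℂ), AEMeasurable (fun s => G s ψ) (volume.restrict (Ioo 0 T)))
    (hG : ∀ s ∈ Icc 0 T, BlockBd hφ v M' b (G s)) (i : ℤ) (ψ : 𝓢(Phase d, ℂ)) :
    AEMeasurable (fun s => paraTerm hφ (f s) (G s) i ψ) (volume.restrict (Ioo 0 T)) := by
  refine aemeasurable_diag (H := fun r s => fm (blockS hφ i) (G s)
    (SchwartzMap.smulLeftCLM ℂ (lowFn hφ i (f r)) ψ)) (fun r hr => hm _) fun s hs => ?_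
  have hs' : s ∈ Icc 0 T := ⟨hs.1.le, hs.2.le⟩
  refine (hG s hs' i).tendsto_apply (tendsto_wnorm_sub hv (fun z => ?_) fun L => ?_)
  · have h1 : Filter.Tendsto (fun r => lowFn hφ i (f r) z * ψ z) (nhds s)
        (nhds (lowFn hφ i (f s) z * ψ z)) := (hf.continuousAt hw hα _ hs).mul_const _
    rw [SchwartzMap.smulLeftCLM_apply_apply ((hf.bd s hs').hasTemperateGrowth_lowFn hφ hw hM i)]
    refine h1.congr' ?_
    filter_upwards [Ioo_mem_nhds hs.1 hs.2] with r hr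
    rw [SchwartzMap.smulLeftCLM_apply_apply
      ((hf.bd r ⟨hr.1.le, hr.2.le⟩).hasTemperateGrowth_lowFn hφ hw hM i)]
    rfl
  · obtain ⟨C, hC, h⟩ := exists_norm_lowFn_le hφ hw
    obtain ⟨C', N, hC', hN⟩ := hw.le_pow
    obtain ⟨B, hB, hBd⟩ := exists_schwartz_decay ψ (L + N)
    refine ⟨C * M * C' * B, ?_⟩
    filter_upwards [Ioo_mem_nhds hs.1 hs.2] with r hr z
    have hr' : r ∈ Icc 0 T := ⟨hr.1.le, hr.2.le⟩
    rw [SchwartzMap.smulLeftCLM_apply_apply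
      ((hf.bd r hr').hasTemperateGrowth_lowFn hφ hw hM i), norm_smul]
    calc (1 + ‖z‖) ^ L * (‖lowFn hφ i (f r) z‖ * ‖ψ z‖)
        ≤ (1 + ‖z‖) ^ L * (C * M * (C' * (1 + ‖z‖) ^ N) * ‖ψ z‖) := by
          gcongr
          refine (h M _ hM (hf.bd r hr') i z).trans ?_
          gcongr
          exact hN z
      _ = C * M * C' * ((1 + ‖z‖) ^ (L + N) * ‖ψ z‖) := by ring
      _ ≤ _ := by
          gcongr
          exact hBd z

theorem IsKinetic.aemeasurable_paraproduct (hw : IsWeight w) (hv : IsWeight v) (hM : 0 ≤ M)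
    (hM' : 0 ≤ M') (hα : 0 < α) (hf : IsKinetic hφ w M α T f)
    (hm : ∀ ψ : 𝓢(Phase d, ℂ), AEMeasurable (fun s => G s ψ) (volume.restrict (Ioo 0 T)))
    (hG : ∀ s ∈ Icc 0 T, BlockBd hφ v M' b (G s)) (ψ : 𝓢(Phase d, ℂ)) :
    AEMeasurable (fun s => paraproduct φ (f s) (G s) ψ) (volume.restrict (Ioo 0 T)) := by
  refine aemeasurable_of_tendsto_metrizable_ae (Filter.atTop : Filter (Finset ℤ))
    (f := fun S s => ∑ i ∈ S, paraTerm hφ (f s) (G s) i ψ) (fun S => ?_) ?_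
  · exact Finset.aemeasurable_fun_sum S fun i _ =>
      hf.aemeasurable_paraTerm hw hv hM hα hm hG i ψ
  · filter_upwards [ae_restrict_mem measurableSet_Ioo] with s hs
    have hs' : s ∈ Icc 0 T := ⟨hs.1.le, hs.2.le⟩
    exact hasSum_distribution_iff.1
      (BlockBd.hasSum_paraproduct hφ hw hv hM hM' (hf.bd s hs') (hG s hs')).2 ψ

theorem exists_isTimeDecomp_paraproduct (hφ : IsCutoff φ) (hw : IsWeight w) (hv : IsWeight v) :
    ∃ C : ℝ, 0 ≤ C ∧ ∀ (M M' α b T : ℝ) (f G : ℝ → 𝓢'(Phase d, ℂ)), 0 ≤ M → 0 ≤ M' → 0 < α → IsKinetic hφ w M α T f →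
      (∀ ψ : 𝓢(Phase d, ℂ), AEMeasurable (fun s => G s ψ) (volume.restrict (Ioo 0 T))) →
      (∀ s ∈ Icc 0 T, BlockBd hφ v M' b (G s)) →
      IsTimeDecomp hφ (fun z => w z * v z) (C * M * M') b T
        (fun s => paraproduct φ (f s) (G s)) := by
  obtain ⟨C, hC, h⟩ := exists_isDecomp_paraTerm hφ hw hv
  refine ⟨C, hC, fun M M' α b T f G hM hM' hα hf hm hG => ⟨fun ψ =>
    hf.aemeasurable_paraproduct hw hv hM hM' hα hm hG ψ, fun s hs => ⟨_,
      h M _ hM (hf.bd s hs) M' b _ hM' (hG s hs),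
      (BlockBd.hasSum_paraproduct hφ hw hv hM hM' (hf.bd s hs) (hG s hs)).2⟩⟩⟩

end time

/-! ### The commutator with the Duhamel operator -/

/-- Dropping the exponential leaves an explicit integral, at most `2^{-2j}`; dropping the weight
leaves at most `T` or `1/λ`, according to whether `λ ≤ 1`. The exponent `θ` interpolates between the
two. -/
theorem integral_exp_mul_wt_le {T θ lam t : ℝ} (hT : 0 < T) (hθ : θ ∈ Icc (0 : ℝ) 2) (hlam : 0 ≤ lam)
    (ht : t ∈ Icc 0 T) (j : ℤ) :
    IntegrableOn (fun s => Real.exp (-lam * (t - s)) * (wt (t - s) j ^ 2)⁻¹) (Ioo 0 t) ∧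
    ∫ s in Ioo 0 t, Real.exp (-lam * (t - s)) * (wt (t - s) j ^ 2)⁻¹ ≤
      (1 + T) * (max lam 1) ^ ((θ - 2) / 2) * 2 ^ (-θ * j) := by
  set a : ℝ := 2 ^ (2 * j) with ha
  have ha0 : 0 < a := by positivity
  set μ : ℝ := max lam 1 with hμ
  have hμ0 : 0 < μ := lt_max_of_lt_right one_pos
  have hpos {s : ℝ} (hs : s ∈ Icc 0 t) : 1 ≤ wt (t - s) j := one_le_wt (sub_nonneg.2 hs.2) j
  have hwtc : Continuous fun s => wt (t - s) j := by
    unfold wt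
    fun_prop
  have hc2 : ContinuousOn (fun s => (wt (t - s) j ^ 2)⁻¹) (Icc 0 t) :=
    (hwtc.pow 2).continuousOn.inv₀ fun s hs => (pow_pos (zero_lt_one.trans_le (hpos hs)) 2).ne'
  have hc1 : Continuous fun s => Real.exp (-lam * (t - s)) := by fun_prop
  have i2 : IntegrableOn (fun s => (wt (t - s) j ^ 2)⁻¹) (Ioo 0 t) :=
    hc2.integrableOn_Icc.mono_set Ioo_subset_Icc_self
  have i1 : IntegrableOn (fun s => Real.exp (-lam * (t - s))) (Ioo 0 t) :=
    hc1.continuousOn.integrableOn_Icc.mono_set Ioo_subset_Icc_self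
  have i3 : IntegrableOn (fun s => Real.exp (-lam * (t - s)) * (wt (t - s) j ^ 2)⁻¹) (Ioo 0 t) :=
    (hc1.continuousOn.mul hc2).integrableOn_Icc.mono_set Ioo_subset_Icc_self
  refine ⟨i3, ?_⟩
  set I := ∫ s in Ioo 0 t, Real.exp (-lam * (t - s)) * (wt (t - s) j ^ 2)⁻¹
  have hI0 : 0 ≤ I := setIntegral_nonneg measurableSet_Ioo fun s _ => by positivity
  have hexp {s : ℝ} (hs : s ∈ Ioo 0 t) : Real.exp (-lam * (t - s)) ≤ 1 := by
    rw [Real.exp_le_one_iff]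
    nlinarith [hs.2]
  have b2 : I ≤ a⁻¹ := by
    calc I ≤ ∫ s in Ioo 0 t, (wt (t - s) j ^ 2)⁻¹ := by
          refine setIntegral_mono_on i3 i2 measurableSet_Ioo fun s hs => ?_
          exact mul_le_of_le_one_left (by positivity) (hexp hs)
      _ = ∫ s in (0 : ℝ)..t, (wt (t - s) j ^ 2)⁻¹ := by
          rw [intervalIntegral.integral_of_le ht.1, integral_Ioc_eq_integral_Ioo]
      _ = a⁻¹ * (wt (t - t) j)⁻¹ - a⁻¹ * (wt (t - 0) j)⁻¹ := by
          refine intervalIntegral.integral_eq_sub_of_hasDerivAt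
            (f := fun s => a⁻¹ * (wt (t - s) j)⁻¹) (fun s hs => ?_) ?_
          · rw [uIcc_of_le ht.1] at hs
            have h1 : HasDerivAt (fun s => wt (t - s) j) (-1 * a) s := by
              unfold wt
              exact (((hasDerivAt_id s).const_sub t).mul_const a).const_add 1
            have h2 := (h1.inv (zero_lt_one.trans_le (hpos hs)).ne').const_mul a⁻¹
            refine h2.congr_deriv ?_
            field_simp
          · exact (ContinuousOn.intervalIntegrable (by rwa [uIcc_of_le ht.1]))
      _ ≤ a⁻¹ := by
          have h1 : 0 ≤ a⁻¹ * (wt (t - 0) j)⁻¹ :=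
            mul_nonneg (by positivity) (inv_nonneg.2 (zero_le_one.trans (hpos ⟨le_rfl, ht.1⟩)))
          have h2 : wt (t - t) j = 1 := by simp [wt]
          rw [h2]
          linarith
  have b1 : I ≤ (1 + T) * μ⁻¹ := by
    have h0 : I ≤ ∫ s in Ioo 0 t, Real.exp (-lam * (t - s)) := by
      refine setIntegral_mono_on i3 i1 measurableSet_Ioo fun s hs => ?_
      exact mul_le_of_le_one_right (Real.exp_pos _).le (inv_le_one_of_one_le₀
        (one_le_pow₀ (hpos ⟨hs.1.le, hs.2.le⟩)))
    rcases le_or_gt lam 1 with h1 | h1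
    · have hμ1 : μ = 1 := max_eq_right h1
      rw [hμ1, inv_one, mul_one]
      calc I ≤ _ := h0
        _ ≤ ∫ s in Ioo 0 t, (1 : ℝ) :=
            setIntegral_mono_on i1 (integrable_const _) measurableSet_Ioo fun s hs => hexp hs
        _ = t := by simp [ht.1]
        _ ≤ 1 + T := by linarith [ht.2]
    · have hμ1 : μ = lam := max_eq_left h1.le
      have hl0 : 0 < lam := by linarith
      rw [hμ1]
      calc I ≤ _ := h0
        _ = ∫ s in (0 : ℝ)..t, Real.exp (-lam * (t - s)) := by
            rw [intervalIntegral.integral_of_le ht.1, integral_Ioc_eq_integral_Ioo]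
        _ = lam⁻¹ * Real.exp (-lam * (t - t)) - lam⁻¹ * Real.exp (-lam * (t - 0)) := by
            refine intervalIntegral.integral_eq_sub_of_hasDerivAt
              (f := fun s => lam⁻¹ * Real.exp (-lam * (t - s))) (fun s hs => ?_)
              (hc1.intervalIntegrable _ _)
            have h2 : HasDerivAt (fun s => -lam * (t - s)) (-lam * (-1)) s :=
              ((hasDerivAt_id s).const_sub t).const_mul (-lam)
            refine (h2.exp.const_mul lam⁻¹).congr_deriv ?_
            field_simp
        _ ≤ lam⁻¹ := by
            rw [sub_self, mul_zero, Real.exp_zero]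
            have : 0 ≤ lam⁻¹ * Real.exp (-lam * (t - 0)) := by positivity
            linarith
        _ ≤ (1 + T) * lam⁻¹ := le_mul_of_one_le_left (by positivity) (by linarith)
  have hθ0 := hθ.1
  have hθ2 : 0 ≤ 1 - θ / 2 := by linarith [hθ.2]
  -- Splitting the power needs only nonnegative exponents, so `I = 0` and the endpoints `θ = 0` and
  -- `θ = 2` are included.
  calc I = I ^ (1 - θ / 2) * I ^ (θ / 2) := by
        rw [← Real.rpow_add_of_nonneg hI0 hθ2 (by positivity), sub_add_cancel, Real.rpow_one]
    _ ≤ ((1 + T) * μ⁻¹) ^ (1 - θ / 2) * (a⁻¹) ^ (θ / 2) := by gcongr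
    _ = (1 + T) ^ (1 - θ / 2) * μ ^ ((θ - 2) / 2) * 2 ^ (-θ * j) := by
        rw [Real.mul_rpow (by positivity) (by positivity), Real.inv_rpow hμ0.le,
          ← Real.rpow_neg hμ0.le, Real.inv_rpow ha0.le, ← Real.rpow_neg ha0.le, ha,
          ← Real.rpow_intCast, ← Real.rpow_mul two_pos.le]
        congr 2
        · congr 1
          ring
        · push_cast
          ring
    _ ≤ _ := by
        gcongr
        exact Real.rpow_le_self_of_one_le (by linarith) (by linarith)

section main

variable {φ : Phase d → ℝ} {k : ℕ} {ℓ : Fin 2 → Phase d → ℂ} {hφ : IsCutoff φ}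

theorem IsTimeDecomp.fm_duhamel_apply {w : Phase d → ℝ} {M b T : ℝ}
    {G : ℝ → 𝓢'(Phase d, ℂ)} (hw : IsWeight w) (hM : 0 ≤ M)
    (hG : IsTimeDecomp hφ w M b T G) {lam : ℝ} (hlam : 0 ≤ lam) {t : ℝ} (ht : t ∈ Icc 0 T)
    (ℓ : Fin 2 → Phase d → ℂ) (ψ : 𝓢(Phase d, ℂ)) :
    IntegrableOn (fun s => (Real.exp (-lam * (t - s)) : ℂ) * smoothing ℓ (t - s) (G s) ψ)
      (Ioo 0 t) ∧ fm (ℓ 0) (duhamel lam G t) ψ =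
        ∫ s in Ioo 0 t, (Real.exp (-lam * (t - s)) : ℂ) * smoothing ℓ (t - s) (G s) ψ :=
  ⟨hG.integrableOn hw hM hlam (dm (ℓ 0) ψ) ht.2, hG.duhamel_apply hw hM hlam ht (dm (ℓ 0) ψ)⟩

theorem isTimeDecomp_of_blockBd {v : Phase d → ℝ} (hv : IsWeight v) {M b T : ℝ} (hM : 0 ≤ M)
    {g : ℝ → 𝓢'(Phase d, ℂ)}
    (hm : ∀ ψ : 𝓢(Phase d, ℂ), AEMeasurable (fun s => g s ψ) (volume.restrict (Ioo 0 T)))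
    (hg : ∀ s ∈ Icc 0 T, BlockBd hφ v M b (g s)) : IsTimeDecomp hφ v M b T g :=
  ⟨hm, fun s hs => ⟨_, (hg s hs).isDecomp, BlockBd.hasSum hv hM (hg s hs)⟩⟩

theorem IsHomSymbol.exists_blockBd_duhamel (hℓ : IsHomSymbol k ℓ) (hφ : IsCutoff φ)
    {v : Phase d → ℝ} (hv : IsWeight v) (b : ℝ) {T : ℝ} (hT : 0 < T) :
    ∃ C : ℝ, 0 ≤ C ∧ ∀ (M : ℝ) (g : ℝ → 𝓢'(Phase d, ℂ)), 0 ≤ M →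
      (∀ ψ : 𝓢(Phase d, ℂ), AEMeasurable (fun s => g s ψ) (volume.restrict (Ioo 0 T))) →
      (∀ s ∈ Icc 0 T, BlockBd hφ v M b (g s)) → ∀ lam, 0 ≤ lam → ∀ t ∈ Icc 0 T,
        BlockBd hφ v (C * M) (b - k) (fm (ℓ 0) (duhamel lam g t)) := by
  obtain ⟨C, hC, h⟩ := hℓ.exists_blockBd_smoothing hφ hv b T
  refine ⟨T * C, by positivity, fun M g hM hm hg lam hlam t ht j ψ => ?_⟩
  have hG := isTimeDecomp_of_blockBd hv hM hm hg
  rw [fm_apply, (hG.fm_duhamel_apply hv hM hlam ht ℓ _).2]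
  have h1 := norm_setIntegral_le_of_norm_le_const (μ := volume)
    (f := fun s => (Real.exp (-lam * (t - s)) : ℂ) * smoothing ℓ (t - s) (g s)
      (dm (blockS hφ j) ψ)) (C := C * M * 2 ^ (-(b - k) * j) * wnorm v ψ)
    (measure_Ioo_lt_top (a := 0) (b := t)) fun s hs => by
      have hs' : s ∈ Icc 0 T := ⟨hs.1.le, hs.2.le.trans ht.2⟩
      have h2 := h (t - s) (sub_pos.2 hs.2) (by linarith [hs.1, ht.2]) M _ (g s) hM
        (hg s hs').isDecomp (BlockBd.hasSum hv hM (hg s hs')) j ψ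
      rw [norm_mul]
      exact (mul_le_mul (norm_exp_le_one hlam (sub_pos.2 hs.2).le) h2 (norm_nonneg _)
        zero_le_one).trans_eq (one_mul _)
  rw [measureReal_def, Real.volume_Ioo, ENNReal.toReal_ofReal (by linarith [ht.1]), sub_zero] at h1
  refine h1.trans ?_
  have h3 : 0 ≤ C * M * 2 ^ (-(b - k) * j) * wnorm v ψ :=
    mul_nonneg (by positivity) (wnorm_nonneg hv ψ)
  calc _ ≤ C * M * 2 ^ (-(b - k) * j) * wnorm v ψ * T := mul_le_mul_of_nonneg_left ht.2 h3
    _ = _ := by ring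

/-- The blocks of the commutator of the Duhamel operator with a paraproduct. -/
theorem IsHomSymbol.exists_bd_duhamel_comm (hℓ : IsHomSymbol k ℓ) (hφ : IsCutoff φ)
    {w v : Phase d → ℝ} (hw : IsWeight w) (hv : IsWeight v) {α : ℝ} (hα : 0 < α) (hα1 : α < 1)
    (b : ℝ) {T : ℝ} (hT : 0 < T) {θ : ℝ} (hθ : θ ∈ Icc (0 : ℝ) 2) :
    ∃ C : ℝ, 0 ≤ C ∧ ∀ (M M' : ℝ) (f g : ℝ → 𝓢'(Phase d, ℂ)), 0 ≤ M → 0 ≤ M' →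
      IsKinetic hφ w M α T f →
      (∀ ψ : 𝓢(Phase d, ℂ), AEMeasurable (fun s => g s ψ) (volume.restrict (Ioo 0 T))) →
      (∀ s ∈ Icc 0 T, BlockBd hφ v M' b (g s)) → ∀ lam, 0 ≤ lam → ∀ t ∈ Icc 0 T, ∀ j : ℤ,
        Bd (fun z => w z * v z)
          (C * (max lam 1) ^ ((θ - 2) / 2) * (M * M') * 2 ^ (-(α + b + θ - k) * j))
          (fm (blockS hφ j) (fm (ℓ 0) (duhamel lam (fun s => paraproduct φ (f s) (g s)) t) -
            paraproduct φ (f t) (fm (ℓ 0) (duhamel lam g t)))) := by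
  have hwv := hw.mul hv
  obtain ⟨C₁, hC₁, h₁⟩ := hℓ.exists_bd_comm hφ hw hv hα hα1 b T
  obtain ⟨C₂, hC₂, h₂⟩ := exists_isTimeDecomp_paraproduct hφ hw hv
  obtain ⟨C₃, hC₃, h₃⟩ := hℓ.exists_blockBd_duhamel hφ hv b hT
  obtain ⟨C₄, hC₄, h₄⟩ := hℓ.exists_blockBd_smoothing hφ hv b T
  refine ⟨C₁ * (1 + T), by positivity, fun M M' f g hM hM' hf hm hg lam hlam t ht j ψ => ?_⟩
  have hμ : 0 < max lam 1 := lt_max_of_lt_right one_pos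
  rcases lt_or_ge j (-1) with hj | hj
  · rw [fm_blockS_of_lt hφ hj]
    exact (bd_zero _).mono hwv (by positivity) ψ
  have hG := isTimeDecomp_of_blockBd hv hM' hm hg
  have hP := h₂ M M' α b T f g hM hM' hα hf hm hg
  have hV := h₃ M' g hM' hm hg lam hlam t ht
  set X : ℝ → 𝓢'(Phase d, ℂ) := fun s =>
    fm (blockS hφ j) (smoothing ℓ (t - s) (paraproduct φ (f s) (g s))) -
      fm (blockS hφ j) (paraproduct φ (f t) (smoothing ℓ (t - s) (g s))) with hX
  have hsm (s : ℝ) (hs : s ∈ Ioo 0 t) : BlockBd hφ v (C₄ * M') (b - k) (smoothing ℓ (t - s) (g s)) := by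
    have hs' : s ∈ Icc 0 T := ⟨hs.1.le, hs.2.le.trans ht.2⟩
    exact h₄ (t - s) (sub_pos.2 hs.2) (by linarith [hs.1, ht.2]) M' _ (g s) hM'
      (hg s hs').isDecomp (BlockBd.hasSum hv hM' (hg s hs'))
  obtain ⟨p1, p2⟩ := hP.fm_duhamel_apply hwv (by positivity) hlam ht ℓ (dm (blockS hφ j) ψ)
  -- The multiplication by `S_{q-1} f(t)` is put on the test function. It does not depend on `s`, so
  -- the time integral passes through the paraproduct with `f(t)`, a finite sum on block `j`.
  set χ : ℤ → 𝓢(Phase d, ℂ) := fun q => dm (blockS hφ q)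
    (SchwartzMap.smulLeftCLM ℂ (lowFn hφ q (f t)) (dm (blockS hφ j) ψ)) with hχ
  have q (n : ℤ) := hG.fm_duhamel_apply hv hM' hlam ht ℓ (χ n)
  have e1 : fm (blockS hφ j) (paraproduct φ (f t) (fm (ℓ 0) (duhamel lam g t))) ψ =
      ∑ n ∈ Finset.Ico (-1) (j + 3), fm (ℓ 0) (duhamel lam g t) (χ n) := by
    rw [BlockBd.fm_blockS_paraproduct hφ hw hv hM (by positivity) (hf.bd t ht) hV hj]
    exact sum_apply _ _ _
  have e2 (s : ℝ) (hs : s ∈ Ioo 0 t) :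
      fm (blockS hφ j) (paraproduct φ (f t) (smoothing ℓ (t - s) (g s))) ψ =
      ∑ n ∈ Finset.Ico (-1) (j + 3), smoothing ℓ (t - s) (g s) (χ n) := by
    rw [BlockBd.fm_blockS_paraproduct hφ hw hv hM (by positivity) (hf.bd t ht) (hsm s hs) hj]
    exact sum_apply _ _ _
  have e3 : fm (blockS hφ j) (fm (ℓ 0) (duhamel lam (fun s => paraproduct φ (f s) (g s)) t) -
      paraproduct φ (f t) (fm (ℓ 0) (duhamel lam g t))) ψ =
      ∫ s in Ioo 0 t, (Real.exp (-lam * (t - s)) : ℂ) * X s ψ := by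
    rw [map_sub]
    change fm (ℓ 0) _ (dm (blockS hφ j) ψ) - fm (blockS hφ j) _ ψ = _
    rw [p2, e1, Finset.sum_congr rfl fun n _ => (q n).2, ← integral_finsetSum _ fun n _ => (q n).1,
      ← integral_sub p1 (integrable_finsetSum _ fun n _ => (q n).1)]
    refine setIntegral_congr_fun measurableSet_Ioo fun s hs => ?_
    change _ = _ * (fm (blockS hφ j) _ ψ - fm (blockS hφ j) _ ψ)
    rw [e2 s hs, ← Finset.mul_sum]
    exact (mul_sub _ _ _).symm
  obtain ⟨i1, i2⟩ := integral_exp_mul_wt_le hT hθ hlam ht j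
  rw [e3]
  set K : ℝ := C₁ * (M * M') * 2 ^ (-(α + b - k) * j) * wnorm (fun z => w z * v z) ψ with hK
  have hK0 : 0 ≤ K := mul_nonneg (by positivity) (wnorm_nonneg hwv ψ)
  calc ‖∫ s in Ioo 0 t, (Real.exp (-lam * (t - s)) : ℂ) * X s ψ‖
      ≤ ∫ s in Ioo 0 t, K * (Real.exp (-lam * (t - s)) * (wt (t - s) j ^ 2)⁻¹) := by
        refine norm_integral_le_of_norm_le (i1.const_mul K) ?_
        filter_upwards [ae_restrict_mem measurableSet_Ioo] with s hs
        have hs' : s ∈ Icc 0 T := ⟨hs.1.le, hs.2.le.trans ht.2⟩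
        have hd := hf.holder s hs' t ht
        rw [abs_of_pos (sub_pos.2 hs.2)] at hd
        have hb := h₁ (t - s) (sub_pos.2 hs.2) (by linarith [hs.1, ht.2]) M M' (f s) (f t) (g s) hM
          hM' (hf.bd s hs') (hf.bd t ht) (hf.block s hs') (hf.block t ht) hd (hg s hs') j ψ
        rw [norm_mul, Complex.norm_real, Real.norm_of_nonneg (Real.exp_pos _).le]
        calc _ ≤ Real.exp (-lam * (t - s)) * _ :=
              mul_le_mul_of_nonneg_left hb (Real.exp_pos _).le
          _ = _ := by rw [hK]; ring
    _ = K * ∫ s in Ioo 0 t, Real.exp (-lam * (t - s)) * (wt (t - s) j ^ 2)⁻¹ :=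
        integral_const_mul _ _
    _ ≤ K * ((1 + T) * (max lam 1) ^ ((θ - 2) / 2) * 2 ^ (-θ * j)) :=
        mul_le_mul_of_nonneg_left i2 hK0
    _ = _ := by
        have : (2 : ℝ) ^ (-(α + b + θ - k) * j) = 2 ^ (-(α + b - k) * j) * 2 ^ (-θ * j) := by
          rw [← Real.rpow_add two_pos]
          congr 1
          ring
        rw [hK, this]
        ring

end main

/-! ### The norms -/

section norms

variable {φ : Phase d → ℝ} {hφ : IsCutoff φ} {ρ : Phase d → ℝ}

theorem two_rpow_eq_ofReal (x : ℝ) : (2 : ℝ≥0∞) ^ x = ENNReal.ofReal (2 ^ x) := by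
  rw [← ENNReal.ofReal_rpow_of_pos two_pos, ENNReal.ofReal_ofNat]

theorem blockBd_of_besovNorm_le (hφ : IsCutoff φ) (hρ : IsWeight ρ) {s M : ℝ} (hM : 0 ≤ M)
    {F : 𝓢'(Phase d, ℂ)} (h : besovNorm φ s ρ F ≤ ENNReal.ofReal M) :
    BlockBd hφ (fun z => (ρ z)⁻¹) M s F := fun j => by
  rcases lt_or_ge j (-1) with hj | hj
  · rw [fm_blockS_of_lt hφ hj]
    exact (bd_zero _).mono hρ.inv (by positivity)
  · refine Bd.of_supNorm_le hρ (by positivity) ?_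
    have h1 := (le_iSup₂ (f := fun (j : ℤ) (_ : -1 ≤ j) =>
      (2 : ℝ≥0∞) ^ (s * (j : ℝ)) * supNorm ρ (block φ j F)) j hj).trans h
    rw [block_eq_fm hφ, two_rpow_eq_ofReal, mul_comm, ← ENNReal.le_div_iff_mul_le
      (Or.inl (by simp; positivity)) (Or.inl ENNReal.ofReal_ne_top),
      ← ENNReal.ofReal_div_of_pos (by positivity)] at h1
    rwa [neg_mul, Real.rpow_neg two_pos.le, ← div_eq_mul_inv]

theorem besovNorm_le_of_bd (hφ : IsCutoff φ) (hρ : IsWeight ρ) {s M : ℝ} (hM : 0 ≤ M)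
    {F : 𝓢'(Phase d, ℂ)}
    (h : ∀ j : ℤ, Bd (fun z => (ρ z)⁻¹) (M * 2 ^ (-s * j)) (fm (blockS hφ j) F)) :
    besovNorm φ s ρ F ≤ ENNReal.ofReal M := by
  refine iSup₂_le fun j _ => ?_
  have h1 := Bd.supNorm_le hρ (by positivity) (h j)
  rw [block_eq_fm hφ, two_rpow_eq_ofReal]
  calc _ ≤ ENNReal.ofReal (2 ^ (s * j)) * ENNReal.ofReal (M * 2 ^ (-s * j)) := by gcongr
    _ = ENNReal.ofReal M := by
        rw [← ENNReal.ofReal_mul (by positivity), mul_left_comm, ← Real.rpow_add two_pos]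
        simp

theorem transportD_zero (F : 𝓢'(Phase d, ℂ)) : transportD 0 F = F := by
  ext ψ
  rw [transportD_apply']
  congr 1
  ext z
  rw [compE_apply, neg_zero, transport_apply, zero_smul, add_zero]
  rfl

theorem isKinetic_of_kineticNorm_lt_top (hφ : IsCutoff φ) (hρ : IsWeight ρ) {T α : ℝ} (hα : 0 < α)
    {f : ℝ → 𝓢'(Phase d, ℂ)} (h : kineticNorm φ T α ρ f < ⊤) :
    IsKinetic hφ (fun z => (ρ z)⁻¹) (kineticNorm φ T α ρ f).toReal α T f := by
  have hM : 0 ≤ (kineticNorm φ T α ρ f).toReal := ENNReal.toReal_nonneg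
  have e : ENNReal.ofReal (kineticNorm φ T α ρ f).toReal = kineticNorm φ T α ρ f :=
    ENNReal.ofReal_toReal h.ne
  have h1 : besovNormT φ T α ρ f ≤ kineticNorm φ T α ρ f := le_self_add
  have h2 : transportHolderNorm T (α / 2) ρ f ≤ kineticNorm φ T α ρ f := le_add_self
  refine ⟨fun t ht => ?_, fun t ht => ?_, fun s hs t ht => ?_⟩
  · refine Bd.of_supNorm_le hρ hM ?_
    rw [e]
    exact ((le_iSup₂ (f := fun (t : ℝ) (_ : t ∈ Icc (0 : ℝ) T) => supNorm ρ (f t)) t ht).trans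
      le_self_add).trans h2
  · refine blockBd_of_besovNorm_le hφ hρ hM ?_
    rw [e]
    exact (le_iSup₂ (f := fun (t : ℝ) (_ : t ∈ Icc (0 : ℝ) T) => besovNorm φ α ρ (f t)) t ht).trans h1
  -- The Hölder quotient is taken over `s ≠ t` only; on the diagonal the increment is zero.
  · rcases eq_or_ne s t with rfl | hst
    · rw [sub_self, transportD_zero, sub_self, abs_zero, Real.zero_rpow (by positivity), mul_zero]
      exact bd_zero _
    · have hpos : 0 < |t - s| ^ (α / 2) := Real.rpow_pos_of_pos (abs_pos.2 (sub_ne_zero.2 hst.symm)) _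
      refine Bd.of_supNorm_le hρ (by positivity) ?_
      rw [ENNReal.ofReal_mul hM, e]
      have h3 : supNorm ρ (f t - transportD (t - s) (f s)) / ENNReal.ofReal (|t - s| ^ (α / 2)) ≤
          kineticNorm φ T α ρ f := by
        refine le_trans ?_ (le_add_self.trans h2)
        refine le_trans ?_ (le_iSup₂ (f := fun (s : ℝ) (_ : s ∈ Icc (0 : ℝ) T) =>
          ⨆ (t ∈ Icc (0 : ℝ) T) (_ : s ≠ t), supNorm ρ (f t - transportD (t - s) (f s)) /
            ENNReal.ofReal (|t - s| ^ (α / 2))) s hs)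
        refine le_trans ?_ (le_iSup₂ (f := fun (t : ℝ) (_ : t ∈ Icc (0 : ℝ) T) =>
          ⨆ (_ : s ≠ t), supNorm ρ (f t - transportD (t - s) (f s)) /
            ENNReal.ofReal (|t - s| ^ (α / 2))) t ht)
        exact le_iSup (fun _ : s ≠ t => supNorm ρ (f t - transportD (t - s) (f s)) /
            ENNReal.ofReal (|t - s| ^ (α / 2))) hst
      rwa [ENNReal.div_le_iff (by simpa using hpos) ENNReal.ofReal_ne_top] at h3

theorem MemBesovT.aemeasurable {T s : ℝ} {F : ℝ → 𝓢'(Phase d, ℂ)} (h : MemBesovT φ T s ρ F)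
    (ψ : 𝓢(Phase d, ℂ)) : AEMeasurable (fun t => F t ψ) (volume.restrict (Ioo 0 T)) :=
  (h.meas ψ).mono_measure (Measure.restrict_mono Ioo_subset_Icc_self le_rfl)

theorem MemBesovT.blockBd (hφ : IsCutoff φ) (hρ : IsWeight ρ) {T s : ℝ} {F : ℝ → 𝓢'(Phase d, ℂ)}
    (h : MemBesovT φ T s ρ F) (t : ℝ) (ht : t ∈ Icc 0 T) :
    BlockBd hφ (fun z => (ρ z)⁻¹) (besovNormT φ T s ρ F).toReal s (F t) := by
  refine blockBd_of_besovNorm_le hφ hρ ENNReal.toReal_nonneg ?_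
  rw [ENNReal.ofReal_toReal h.finite.ne]
  exact le_iSup₂ (f := fun (t : ℝ) (_ : t ∈ Icc (0 : ℝ) T) => besovNorm φ s ρ (F t)) t ht

/-- The commutator estimate for one component of the gradient. -/
theorem exists_commutator_le (hφ : IsCutoff φ) {ρ₁ ρ₂ : Phase d → ℝ} (hρ₁ : IsWeight ρ₁)
    (hρ₂ : IsWeight ρ₂) {α : ℝ} (hα : α ∈ Ioo (0 : ℝ) 1) (β : ℝ) {k : ℕ} (hk : k ≤ 1) {T : ℝ}
    (hT : 0 < T) {θ : ℝ} (hθ : θ ∈ Icc (0 : ℝ) 2) (m : Fin k → Fin d) :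
    ∃ C : ℝ, 0 ≤ C ∧ ∀ lam : ℝ, 0 ≤ lam → ∀ f g : ℝ → 𝓢'(Phase d, ℂ),
      kineticNorm φ T α ρ₁ f < ⊤ → MemBesovT φ T β ρ₂ g →
      CommutatorDefined φ T lam f g m ∧
      (∀ ψ : 𝓢(Phase d, ℂ), AEMeasurable (fun t => commutator φ lam f g m t ψ)
        (volume.restrict (Icc 0 T))) ∧
      besovNormT φ T (α + β + θ - k) (fun z => ρ₁ z * ρ₂ z) (commutator φ lam f g m) ≤
        ENNReal.ofReal (C * (max lam 1) ^ ((θ - 2) / 2)) *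
          kineticNorm φ T α ρ₁ f * besovNormT φ T β ρ₂ g := by
  obtain ⟨ℓ, hℓ, hgrad⟩ := exists_gradV_eq hk m
  have hw := hρ₁.inv
  have hv := hρ₂.inv
  obtain ⟨C, hC, h⟩ := hℓ.exists_bd_duhamel_comm hφ hw hv hα.1 hα.2 β hT hθ
  obtain ⟨C₂, hC₂, h₂⟩ := exists_isTimeDecomp_paraproduct hφ hw hv
  obtain ⟨C₃, hC₃, h₃⟩ := hℓ.exists_blockBd_duhamel hφ hv β hT
  refine ⟨C, hC, fun lam hlam f g hf hg => ?_⟩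
  have hK := isKinetic_of_kineticNorm_lt_top hφ hρ₁ hα.1 hf
  have hB := hg.blockBd hφ hρ₂
  have hm := hg.aemeasurable
  set M := (kineticNorm φ T α ρ₁ f).toReal
  set M' := (besovNormT φ T β ρ₂ g).toReal
  have hM : 0 ≤ M := ENNReal.toReal_nonneg
  have hM' : 0 ≤ M' := ENNReal.toReal_nonneg
  have hG := isTimeDecomp_of_blockBd hv hM' hm hB
  have hP := h₂ M M' α β T f g hM hM' hα.1 hK hm hB
  have hV := h₃ M' g hM' hm hB lam hlam
  have hμ : 0 < max lam 1 := lt_max_of_lt_right one_pos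
  -- The iterated derivative is the multiplier with the symbol `ℓ 0`, and the rest of the argument
  -- treats `k = 0` and `k = 1` together.
  have ecomm (t : ℝ) : commutator φ lam f g m t =
      fm (ℓ 0) (duhamel lam (fun s => paraproduct φ (f s) (g s)) t) -
        paraproduct φ (f t) (fm (ℓ 0) (duhamel lam g t)) := by
    rw [commutator, hgrad, hgrad]
  refine ⟨⟨fun t ht => ?_, fun t ht => ?_, fun t ht => ?_, fun t ht => ?_⟩, fun ψ => ?_, ?_⟩
  · exact (BlockBd.hasSum_paraproduct hφ hw hv hM hM' (hK.bd t ht) (hB t ht)).1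
  · exact hP.exists_hasDuhamel (hw.mul hv) (by positivity) hlam ht
  · exact hG.exists_hasDuhamel hv hM' hlam ht
  · rw [hgrad]
    exact (BlockBd.hasSum_paraproduct hφ hw hv hM (by positivity) (hK.bd t ht) (hV t ht)).1
  · rw [← Measure.restrict_congr_set Ioo_ae_eq_Icc]
    simp only [ecomm]
    exact (hP.aemeasurable_duhamel (hw.mul hv) (by positivity) hlam (dm (ℓ 0) ψ)).sub
      (hK.aemeasurable_paraproduct hw hv hM (by positivity) hα.1
        (fun χ => hG.aemeasurable_duhamel hv hM' hlam (dm (ℓ 0) χ)) hV ψ)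
  · have e1 : ENNReal.ofReal (C * (max lam 1) ^ ((θ - 2) / 2)) * kineticNorm φ T α ρ₁ f *
        besovNormT φ T β ρ₂ g =
        ENNReal.ofReal (C * (max lam 1) ^ ((θ - 2) / 2) * (M * M')) := by
      rw [ENNReal.ofReal_mul (p := C * (max lam 1) ^ ((θ - 2) / 2)) (q := M * M') (by positivity),
        ENNReal.ofReal_mul hM,
        ENNReal.ofReal_toReal hf.ne, ENNReal.ofReal_toReal hg.finite.ne, mul_assoc]
    rw [e1]
    refine iSup₂_le fun t ht => besovNorm_le_of_bd hφ (hρ₁.mul hρ₂) (by positivity) fun j => ?_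
    rw [ecomm]
    have h4 := h M M' f g hM hM' hK hm hB lam hlam t ht j
    have e2 : (fun z => (ρ₁ z * ρ₂ z)⁻¹) = fun z => (ρ₁ z)⁻¹ * (ρ₂ z)⁻¹ :=
      funext fun z => mul_inv _ _
    rw [e2]
    exact h4

end norms

end Kinetic

end

/-! ### Assembly over the components of the gradient -/

theorem lemma3p12 (d : ℕ) (hd : 1 ≤ d) (φ : Kinetic.Phase d → ℝ) (hφ : Kinetic.IsCutoff φ)
    (ρ₁ ρ₂ : Kinetic.Phase d → ℝ) (hρ₁ : ρ₁ ∈ Kinetic.polyWeights d)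
    (hρ₂ : ρ₂ ∈ Kinetic.polyWeights d) (α β : ℝ) (hα : α ∈ Set.Ioo (0 : ℝ) 1)
    (k : ℕ) (hk : k ≤ 1) (T : ℝ) (hT : 0 < T) (θ : ℝ) (hθ : θ ∈ Set.Icc (0 : ℝ) 2) :
    ∃ C : ℝ, 0 < C ∧ ∀ lam : ℝ, 0 ≤ lam → ∀ f g : ℝ → 𝓢'(Kinetic.Phase d, ℂ),
      Kinetic.kineticNorm φ T α ρ₁ f < ⊤ → Kinetic.MemBesovT φ T β ρ₂ g →
      (∀ m : Fin k → Fin d,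
        Kinetic.CommutatorDefined φ T lam f g m ∧
        Kinetic.MemBesovT φ T (α + β + θ - k) (fun z => ρ₁ z * ρ₂ z)
          (Kinetic.commutator φ lam f g m)) ∧
      ⨆ m : Fin k → Fin d,
        Kinetic.besovNormT φ T (α + β + θ - k) (fun z => ρ₁ z * ρ₂ z)
          (Kinetic.commutator φ lam f g m) ≤
        ENNReal.ofReal (C * (max lam 1) ^ ((θ - 2) / 2)) *
          Kinetic.kineticNorm φ T α ρ₁ f * Kinetic.besovNormT φ T β ρ₂ g := by
  choose C hC h using fun m : Fin k → Fin d => Kinetic.exists_commutator_le hφ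
    (Kinetic.isWeight_of_mem_polyWeights hρ₁) (Kinetic.isWeight_of_mem_polyWeights hρ₂) hα β hk hT
    hθ m
  have hsum : 0 ≤ ∑ m, C m := Finset.sum_nonneg fun m _ => hC m
  -- There are finitely many components, so the sum of their constants serves all of them; the
  -- summand `1` makes it positive.
  refine ⟨∑ m, C m + 1, by positivity, fun lam hlam f g hf hg => ?_⟩
  have hle (m : Fin k → Fin d) :
      Kinetic.besovNormT φ T (α + β + θ - k) (fun z => ρ₁ z * ρ₂ z)
          (Kinetic.commutator φ lam f g m) ≤
        ENNReal.ofReal ((∑ m, C m + 1) * (max lam 1) ^ ((θ - 2) / 2)) *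
          Kinetic.kineticNorm φ T α ρ₁ f * Kinetic.besovNormT φ T β ρ₂ g := by
    refine (h m lam hlam f g hf hg).2.2.trans ?_
    have h1 : C m ≤ ∑ m, C m + 1 :=
      (Finset.single_le_sum (fun m _ => hC m) (Finset.mem_univ m)).trans (by linarith)
    gcongr
  exact ⟨fun m => ⟨(h m lam hlam f g hf hg).1, (h m lam hlam f g hf hg).2.1,
    (hle m).trans_lt (ENNReal.mul_lt_top (ENNReal.mul_lt_top ENNReal.ofReal_lt_top hf) hg.finite)⟩,
    iSup_le hle⟩
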